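/- **Setting.** Let $\mathcal H=L^2(\mathbb R^d)$, let $\mathcal H_X=\mathcal H^{\otimes |X|}$ be the space of the particles with labels in a finite set $X$, $\mathcal H_n=\mathcal H_{\{1,\dots,n\}}$, and let $\mathfrak L^1(\mathcal H_n)$ be the space of the trace class operators on $\mathcal H_n$ that are invariant under permutations of the particles, with the norm $\|f\|_{\mathfrak L^1}=\mathrm{Tr}\,|f|$. For a sequence $f=(f_n)$ let $f_{|X|}(X)$ be the operator $f_{|X|}$ acting on the particles in $X$. Let $\mathfrak L^1_0$ be the set of the finite sequences $(f_n)$ (that is, $f_n=0$ for all large $n$) of degenerate operators (operators with kernels $\sum_{k=1}^m a_k(q)\overline{b_k(q')}$) with $a_k,b_k\in C_c^\infty$. Let $\Phi$ be a bounded measurable real two-body interaction potential with $\Phi(q,q')=\Phi(q',q)$, let $\epsilon>0$, and $H_X=-\frac12\sum_{i\in X}\Delta_{q_i}+\epsilon\sum_{i<j}\Phi(q_i,q_j)$. Put $\mathcal G^*_X(t)f=e^{-itH_X}fe^{itH_X}$, let $\mathcal N^*_X$ be the infinitesimal generator of this group in the trace norm ($\mathcal N^*_Xf=-i(H_Xf-fH_X)$),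 $\mathcal N^*_s=\mathcal N^*_{\{1,\dots,s\}}$, and $\mathcal N^*_{\rm int}(i,j)f=-i(\Phi(q_i,q_j)f-f\Phi(q_i,q_j))$. **Nonlinear groups and cumulants.** For families $F=(F(W))_W$ of operators on the spaces $\mathcal H_W$ and a finite set $X$ of particles define the family $\mathcal G(t;X\mid F)$ by $$\mathcal G(t;X\mid F)(W)=\sum_{Q}\ \sum_{R}(-1)^{|R|-1}(|R|-1)!\prod_{Z\in R}\mathcal G^*_{\theta(Z)\cap X}(t)\prod_{B\in Q}F(B),$$ where $Q$ runs over the partitions of $W$ into non-empty blocks, $R$ over the partitions of the set $Q$, and $\theta(Z)=\bigcup_{B\in Z}B$. (For $W=X$ and $F(B)=f_{|B|}(B)$ this is the nonlinear group of the von Neumann hierarchy for correlation operators; for $W\supset X$ only the particles in $X$ move.) With $Y=\{1,\dots,s\}$ let $$\mathfrak A_{1+n}(t;\{Y\},s+1,\dots,s+n\mid f)=\sum_{P}(-1)^{|P|-1}(|P|-1)!\;\mathcal G\big(t;\theta(X_1)\mid\dots\,\mathcal G(t;\theta(X_{|P|})\mid f)\dots\big)(\{1,\dots,s+n\}),$$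 where $P=\{X_1,\dots,X_{|P|}\}$ runs over the partitions of the set of the $1+n$ clusters $Y,\{s+1\},\dots,\{s+n\}$. **Theorem.** Let $G^{0}_n\in\mathfrak L^1(\mathcal H_n)$, $n\ge1$, with $\sup_{n\ge1}\|G_n^{0}\|_{\mathfrak L^1(\mathcal H_n)}<(2e^3)^{-1}$. Then for all $s\ge1$ and $t\in\mathbb R$ the series $$G_s(t)=\sum_{n=0}^\infty\frac1{n!}\,\mathrm{Tr}_{s+1,\dots,s+n}\,\mathfrak A_{1+n}(t;\{Y\},s+1,\dots,s+n\mid G^{0})$$ converges in trace norm, $G_s(t)\in\mathfrak L^1(\mathcal H_s)$, and the sequence $G(t)=(G_s(t))_{s\ge1}$ is a solution of the Cauchy problem of the nonlinear quantum BBGKY hierarchy $$\frac{\partial}{\partial t}G_s(t)=\mathcal N^*_sG_s(t)+I_s(G(t)),\qquad G_s(0)=G_s^{0},\qquad s\ge1,$$ $$I_s(G)=\epsilon\!\!\sum_{Y=X_1\sqcup X_2}\ \sum_{i_1\in X_1,\,i_2\in X_2}\!\!\mathcal N^*_{\rm int}(i_1,i_2)G_{|X_1|}(X_1)G_{|X_2|}(X_2)+\epsilon\,\mathrm{Tr}_{s+1}\sum_{i\in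 Y}\mathcal N^*_{\rm int}(i,s+1)\Big(G_{s+1}+\!\!\sum_{\substack{Y\cup\{s+1\}=X_1\sqcup X_2\\ i\in X_1,\ s+1\in X_2}}\!\!G_{|X_1|}(X_1)G_{|X_2|}(X_2)\Big),$$ where the sums run over unordered partitions into two non-empty sets. * It is always a weak solution: for every $s\ge1$ and every degenerate operator $\varphi$ on $\mathcal H_s$ with kernel $\sum_{k=1}^m a_k(q)\overline{b_k(q')}$, $a_k,b_k\in C_c^\infty$, one has $\varphi\in D(\mathcal N^*_s)$, and for all $t\in\mathbb R$ the function $t\mapsto\mathrm{Tr}\,\varphi G_s(t)$ is differentiable with derivative $-\mathrm{Tr}\,(\mathcal N^*_s\varphi)G_s(t)+\mathrm{Tr}\,\varphi I_s(G(t))$. * If $(G^{0}_n)_{n\ge1}\in\mathfrak L^1_0$, then it is a strong solution: for all $s\ge1$ and $t\in\mathbb R$, $G_s(t)\in D(\mathcal N^*_s)$, and $G_s$ is differentiable at $t$ in the trace norm with derivative $\mathcal N^*_sG_s(t)+I_s(G(t))$. -/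

import Mathlib

open MeasureTheory Filter Topology
open scoped ENNReal ContDiff FourierTransform InnerProductSpace

noncomputable section

namespace QBBGKY

/-! Particles carry labels in `ℕ`; the first `n` particles are those of `Finset.range n`. -/

/-- Position space of one particle. -/
abbrev Pos (d : ℕ) : Type := EuclideanSpace ℝ (Fin d)

/-- Configurations `(q_i)_{i ∈ X}` of the particles with labels in `X`. -/
abbrev Conf (d : ℕ) (X : Finset ℕ) : Type := EuclideanSpace ℝ (X × Fin d)

/-- The Hilbert space of the particles in `X`: the `|X|`-fold tensor power of `L²(ℝᵈ)`, realized as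
the space of square integrable functions of `(q_i)_{i ∈ X}`. -/
abbrev L2 (d : ℕ) (X : Finset ℕ) : Type := Lp (α := Conf d X) ℂ 2 volume

/-- Bounded operators on the Hilbert space of the particles in `X`. -/
abbrev Op (d : ℕ) (X : Finset ℕ) : Type := L2 d X →L[ℂ] L2 d X

/-- A sequence `f = (f₀, f₁, f₂, …)` of operators on the `n`-particle spaces. -/
abbrev OpSeq (d : ℕ) : Type := ∀ n : ℕ, Op d (Finset.range n)

/-- A family of operators, one for every finite set of particles. -/
abbrev OpFam (d : ℕ) : Type := ∀ W : Finset ℕ, Op d W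

variable {d : ℕ}

/-! ### Trace and trace norm -/

section Trace

variable {H : Type} [NormedAddCommGroup H] [InnerProductSpace ℂ H] [CompleteSpace H]

variable (H) in
/-- The index set of a Hilbert basis of `H`. -/
def basisIndex : Set H := (exists_hilbertBasis ℂ H).choose

variable (H) in
/-- A Hilbert basis of `H`. -/
def basis : HilbertBasis (basisIndex H) ℂ H := (exists_hilbertBasis ℂ H).choose_spec.choose

/-- The trace norm `Tr |T|`, with `|T| = (T⋆ T)^{1/2}`. -/
def traceNorm (T : H →L[ℂ] H) : ℝ≥0∞ :=
  ∑' j, ENNReal.ofReal (RCLike.re ⟪basis H j, CFC.abs T (basis H j)⟫_ℂ)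

/-- Trace class operators. -/
def IsTraceClass (T : H →L[ℂ] H) : Prop := traceNorm T < ⊤

/-- The trace of a (trace class) operator. -/
def trace (T : H →L[ℂ] H) : ℂ := ∑' j, ⟪basis H j, T (basis H j)⟫_ℂ

/-- `F` is differentiable at `t` with derivative `D` in the sense of the trace norm. -/
def HasTraceDerivAt (F : ℝ → H →L[ℂ] H) (D : H →L[ℂ] H) (t : ℝ) : Prop :=
  Tendsto (fun h : ℝ => traceNorm (((h : ℂ)⁻¹) • (F (t + h) - F t) - D)) (𝓝[≠] 0) (𝓝 0)

end Trace

/-! ### Relabelling of particles -/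

/-- The map of configurations that gives the coordinates of particle `i` to particle `e i`. -/
def relabelConf {X X' : Finset ℕ} (e : X ≃ X') : Conf d X ≃ₗᵢ[ℝ] Conf d X' :=
  LinearIsometryEquiv.piLpCongrLeft 2 ℝ ℝ (e.prodCongr (Equiv.refl (Fin d)))

/-- Transport of wave functions along a relabelling of particles. -/
def relabelVec {X X' : Finset ℕ} (e : X ≃ X') : L2 d X →L[ℂ] L2 d X' :=
  (Lp.compMeasurePreservingₗᵢ ℂ (relabelConf (d := d) e).symm
    (relabelConf (d := d) e).symm.measurePreserving).toContinuousLinearMap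

/-- Transport of operators along a relabelling of particles. -/
def relabelOp {X X' : Finset ℕ} (e : X ≃ X') (A : Op d X) : Op d X' :=
  relabelVec e ∘L A ∘L (relabelVec e).adjoint

/-- The increasing enumeration of the particles in `X`. -/
def enum (X : Finset ℕ) : Finset.range X.card ≃ X :=
  (((Finset.range X.card).orderIsoOfFin (Finset.card_range _)).symm.trans
    (X.orderIsoOfFin rfl)).toEquiv

/-- The operator `f_{|X|}(X)`: the member `f_{|X|}` of the sequence `f`, acting on the
particles in `X`. -/
def at_ (f : OpSeq d) : OpFam d := fun X => relabelOp (enum X) (f X.card)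

/-- Symmetry with respect to permutations of the particles. -/
def IsSymm {X : Finset ℕ} (A : Op d X) : Prop := ∀ σ : Equiv.Perm X, relabelOp σ A = A

/-- The space `𝔏¹(ℋ_n)` of symmetric trace class operators. -/
def MemL1 {X : Finset ℕ} (A : Op d X) : Prop := IsTraceClass A ∧ IsSymm A

/-! ### Tensor products and partial traces -/

/-- The part `(q_i)_{i ∈ X}` of a configuration `(q_i)_{i ∈ W}`. -/
def restr {X W : Finset ℕ} (h : X ⊆ W) (q : Conf d W) : Conf d X :=
  WithLp.toLp 2 fun p => q (⟨p.1, h p.1.2⟩, p.2)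

theorem measurePreserving_restr {X W : Finset ℕ} (h : X ⊆ W) :
    MeasurePreserving
      (fun q : Conf d W => (restr h q, restr (Finset.sdiff_subset (s := W) (t := X)) q))
      volume (volume.prod volume) := by
  let e₀ : X ⊕ (W \ X : Finset ℕ) ≃ W :=
    { toFun := Sum.elim (fun x => ⟨x, h x.2⟩) (fun x => ⟨x, Finset.sdiff_subset x.2⟩)
      invFun := fun w => if hw : (w : ℕ) ∈ X then Sum.inl ⟨w, hw⟩
        else Sum.inr ⟨w, Finset.mem_sdiff.2 ⟨w.2, hw⟩⟩
      left_inv := by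
        rintro (x | x)
        · simp
        · have := (Finset.mem_sdiff.1 x.2).2
          simp [this]
      right_inv := by
        intro w
        by_cases hw : (w : ℕ) ∈ X <;> simp [hw] }
  let e : (X × Fin d) ⊕ ((W \ X : Finset ℕ) × Fin d) ≃ W × Fin d :=
    (Equiv.sumProdDistrib _ _ _).symm.trans (e₀.prodCongr (Equiv.refl _))
  have h1 := PiLp.volume_preserving_ofLp (ι := W × Fin d)
  have h2 := (volume_measurePreserving_piCongrLeft (fun _ : W × Fin d => ℝ) e).symm
  have h3 := volume_measurePreserving_sumPiEquivProdPi
    (fun _ : (X × Fin d) ⊕ ((W \ X : Finset ℕ) × Fin d) => ℝ)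
  have h4 := (PiLp.volume_preserving_toLp (ι := X × Fin d)).prod
    (PiLp.volume_preserving_toLp (ι := (W \ X : Finset ℕ) × Fin d))
  have := h4.comp (h3.comp (h2.comp h1))
  exact this

theorem memLp_tensor {X W : Finset ℕ} (h : X ⊆ W) (u : L2 d X) (w : L2 d (W \ X)) :
    MemLp (fun q : Conf d W => u (restr h q) * w (restr Finset.sdiff_subset q)) 2 volume := by
  have h2 : MemLp (fun p : Conf d X × Conf d (W \ X) => u p.1 * w p.2) 2
      (volume.prod volume) := by
    have hm : AEStronglyMeasurable (fun p : Conf d X × Conf d (W \ X) => u p.1 * w p.2)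
        (volume.prod volume) :=
      (Lp.aestronglyMeasurable u).comp_fst.mul (Lp.aestronglyMeasurable w).comp_snd
    rw [memLp_two_iff_integrable_sq_norm hm]
    have hu := (memLp_two_iff_integrable_sq_norm (Lp.aestronglyMeasurable u)).1 (Lp.memLp u)
    have hw := (memLp_two_iff_integrable_sq_norm (Lp.aestronglyMeasurable w)).1 (Lp.memLp w)
    have := hu.mul_prod hw
    refine this.congr (Eventually.of_forall fun p => ?_)
    simp [mul_pow]
  exact h2.comp_measurePreserving (measurePreserving_restr h)

/-- The tensor product `u ⊗ w` of a wave function of the particles in `X` and one of the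
particles in `W \ X`. -/
def tensorVec {X W : Finset ℕ} (h : X ⊆ W) (u : L2 d X) (w : L2 d (W \ X)) : L2 d W :=
  (memLp_tensor h u w).toLp _

theorem norm_tensorVec {X W : Finset ℕ} (h : X ⊆ W) (u : L2 d X) (w : L2 d (W \ X)) :
    ‖tensorVec h u w‖ = ‖w‖ * ‖u‖ := by
  have key : ∀ (α : Type) [MeasurableSpace α] (μ : Measure α) (f : α → ℂ),
      eLpNorm f 2 μ = (∫⁻ x, ‖f x‖ₑ ^ (2 : ℝ) ∂μ) ^ (1 / (2 : ℝ)) := by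
    intro α _ μ f
    rw [eLpNorm_eq_lintegral_rpow_enorm_toReal (by norm_num) (by norm_num)]
    simp
  have hm : AEStronglyMeasurable (fun p : Conf d X × Conf d (W \ X) => u p.1 * w p.2)
      (volume.prod volume) :=
    (Lp.aestronglyMeasurable u).comp_fst.mul (Lp.aestronglyMeasurable w).comp_snd
  have h1 : eLpNorm (fun q : Conf d W => u (restr h q) * w (restr Finset.sdiff_subset q)) 2 volume
      = eLpNorm w 2 volume * eLpNorm u 2 volume := by
    have := eLpNorm_comp_measurePreserving (p := 2) hm (measurePreserving_restr (d := d) h)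
    refine Eq.trans this ?_
    rw [key, key, key, ← ENNReal.mul_rpow_of_nonneg _ _ (by norm_num)]
    congr 1
    rw [mul_comm, ← lintegral_prod_mul]
    · refine lintegral_congr fun p => ?_
      rw [enorm_mul, ENNReal.mul_rpow_of_nonneg _ _ (by norm_num)]
    · exact (Lp.aestronglyMeasurable u).enorm.pow_const _
    · exact (Lp.aestronglyMeasurable w).enorm.pow_const _
  rw [tensorVec, Lp.norm_toLp, h1, ENNReal.toReal_mul, Lp.norm_def, Lp.norm_def]

theorem coeFn_tensorVec {X W : Finset ℕ} (h : X ⊆ W) (u : L2 d X) (w : L2 d (W \ X)) :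
    tensorVec h u w =ᵐ[volume]
      fun q => u (restr h q) * w (restr Finset.sdiff_subset q) :=
  MemLp.coeFn_toLp _

/-- The bounded operator `u ↦ u ⊗ w`. -/
def tensorRight {X W : Finset ℕ} (h : X ⊆ W) (w : L2 d (W \ X)) : L2 d X →L[ℂ] L2 d W :=
  LinearMap.mkContinuous
    { toFun := fun u => tensorVec h u w
      map_add' := by
        intro u v
        refine Lp.ext ?_
        have hq : Measure.QuasiMeasurePreserving (restr (d := d) h) volume volume :=
          Measure.quasiMeasurePreserving_fst.comp (measurePreserving_restr h).quasiMeasurePreserving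
        filter_upwards [coeFn_tensorVec h (u + v) w, coeFn_tensorVec h u w, coeFn_tensorVec h v w,
          Lp.coeFn_add (tensorVec h u w) (tensorVec h v w), hq.ae (Lp.coeFn_add u v)]
          with q h1 h2 h3 h4 h5
        rw [h1, h4, Pi.add_apply, h2, h3, h5, Pi.add_apply, add_mul]
      map_smul' := by
        intro c u
        refine Lp.ext ?_
        have hq : Measure.QuasiMeasurePreserving (restr (d := d) h) volume volume :=
          Measure.quasiMeasurePreserving_fst.comp (measurePreserving_restr h).quasiMeasurePreserving
        filter_upwards [coeFn_tensorVec h (c • u) w, coeFn_tensorVec h u w,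
          Lp.coeFn_smul c (tensorVec h u w), hq.ae (Lp.coeFn_smul c u)] with q h1 h2 h3 h4
        rw [h1, RingHom.id_apply, h3, Pi.smul_apply, h2, h4, Pi.smul_apply, smul_eq_mul,
          smul_eq_mul, mul_assoc] }
    ‖w‖ (fun u => (norm_tensorVec h u w).le)

open Classical in
/-- The operator `A` of the particles in `X` as an operator `A ⊗ 1` of the particles in `W ⊇ X`:
the unique bounded operator `B` with `B (u ⊗ w) = (A u) ⊗ w`. -/
def ampl {X : Finset ℕ} (W : Finset ℕ) (A : Op d X) : Op d W :=
  if h : ∃ (hX : X ⊆ W) (B : Op d W), ∀ u w, B (tensorVec hX u w) = tensorVec hX (A u) w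
  then h.choose_spec.choose else 0

open Classical in
/-- The partial trace of a (trace class) operator of the particles in `W` over the particles in
`W \ X`: the sum over a Hilbert basis `(e_j)` of the matrix elements `⟨e_j| T |e_j⟩`. -/
def ptrace (X : Finset ℕ) {W : Finset ℕ} (T : Op d W) : Op d X :=
  if hX : X ⊆ W then
    ∑' j, (tensorRight hX (basis (L2 d (W \ X)) j)).adjoint ∘L T ∘L
      tensorRight hX (basis (L2 d (W \ X)) j)
  else 0

/-! ### Dynamics of finitely many particles -/

/-- The position `q_i` of particle `i` in the configuration `q` (for `i ∈ W`). -/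
def pos {W : Finset ℕ} (i : ℕ) (q : Conf d W) : Pos d :=
  WithLp.toLp 2 fun k => if h : i ∈ W then q (⟨i, h⟩, k) else 0

open Classical in
/-- The operator of multiplication by the (essentially bounded) function `v`. -/
def mulOp {W : Finset ℕ} (v : Conf d W → ℝ) : Op d W :=
  if hv : MemLp (fun q => (v q : ℂ)) ∞ (volume : Measure (Conf d W)) then
    (ContinuousLinearMap.mul ℂ ℂ).holderL volume ∞ 2 2 (hv.toLp _)
  else 0

/-- The interaction energy `Φ(i, j)` of the particles `i` and `j`. -/
def pairOp (Φ : Pos d → Pos d → ℝ) (W : Finset ℕ) (i j : ℕ) : Op d W :=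
  mulOp fun q => Φ (pos i q) (pos j q)

/-- The pairs of particles in `X`. -/
def pairs (X : Finset ℕ) : Finset (ℕ × ℕ) := (X ×ˢ X).filter fun p => p.1 < p.2

/-- `χ = ∑_{i ∈ X} K(i) ψ`, with `K = -Δ/2` on its domain, the Sobolev space `H²`, by means of
the Fourier transform `(𝓕 ψ)(ξ) = ∫ e^{-2πi⟨ξ, q⟩} ψ(q) dq`. -/
def IsKinetic {X : Finset ℕ} (ψ χ : L2 d X) : Prop :=
  (𝓕 χ : L2 d X) =ᵐ[volume]
    fun ξ => ((2 * Real.pi ^ 2 * ‖ξ‖ ^ 2 : ℝ) : ℂ) * (𝓕 ψ : L2 d X) ξ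

/-- `χ = H ψ`, where `H = ∑_i K(i) + ε ∑_{i<j} Φ(i, j)` is the Hamiltonian of the particles
in `X`. -/
def IsHamiltonian (Φ : Pos d → Pos d → ℝ) (ε : ℝ) {X : Finset ℕ} (ψ χ : L2 d X) : Prop :=
  ∃ κ : L2 d X, IsKinetic ψ κ ∧
    χ = κ + (ε : ℂ) • ∑ p ∈ pairs X, pairOp Φ X p.1 p.2 ψ

/-- `U` is the strongly continuous unitary group with infinitesimal generator `-i H`. -/
structure IsUnitaryGroup (Φ : Pos d → Pos d → ℝ) (ε : ℝ) (X : Finset ℕ) (U : ℝ → Op d X) :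
    Prop where
  unitary : ∀ t, U t ∈ unitary (Op d X)
  zero : U 0 = 1
  add : ∀ t τ, U (t + τ) = U t * U τ
  continuous : ∀ ψ, Continuous fun t => U t ψ
  generator : ∀ ψ χ, IsHamiltonian Φ ε ψ χ →
    HasDerivAt (fun t => U t ψ) (-Complex.I • χ) 0

open Classical in
/-- The unitary group `e^{-itH}` of the particles in `X`. -/
def evol (Φ : Pos d → Pos d → ℝ) (ε : ℝ) (X : Finset ℕ) (t : ℝ) : Op d X :=
  if h : ∃ U, IsUnitaryGroup Φ ε X U then h.choose t else 1

/-- The group `𝒢*(t) f = e^{-itH} f e^{itH}`. -/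
def vonNeumann (Φ : Pos d → Pos d → ℝ) (ε : ℝ) {X : Finset ℕ} (t : ℝ) (f : Op d X) : Op d X :=
  evol Φ ε X t * f * evol Φ ε X (-t)

/-- `f` belongs to the domain of the infinitesimal generator `𝒩*` of the group `𝒢*`, in the sense
of the trace norm, and `D = 𝒩* f` (that is, `D = -i (H f - f H)`). -/
def IsGenerator (Φ : Pos d → Pos d → ℝ) (ε : ℝ) {X : Finset ℕ} (f D : Op d X) : Prop :=
  HasTraceDerivAt (fun t => vonNeumann Φ ε t f) D 0

/-- `𝒩*_int(i, j) f = -i (Φ(i, j) f - f Φ(i, j))`. -/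
def Nint (Φ : Pos d → Pos d → ℝ) {W : Finset ℕ} (i j : ℕ) (f : Op d W) : Op d W :=
  -Complex.I • (pairOp Φ W i j * f - f * pairOp Φ W i j)

/-! ### The nonlinear groups and their cumulants -/

/-- The product `∏_B f_{|B|}(B)` over the blocks `B` of a partition of `W`. (The factors act on
different particles, so they commute.) -/
def clusterProd {W : Finset ℕ} (P : Finpartition W) (F : OpFam d) : Op d W :=
  (P.parts.toList.map fun B => ampl W (F B)).prod

/-- Declusterization: the set of the particles that occur in the clusters of `Z`. -/
def declust (Z : Finset (Finset ℕ)) : Finset ℕ := Z.sup id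

/-- The weight `(-1)^{n-1} (n-1)!`. -/
def cumulantWeight (n : ℕ) : ℂ := (-1) ^ (n - 1) * ((n - 1).factorial : ℂ)

/-- The product over the blocks `Z` of `R` of the operators `e^{-itH}` of the particles of `θ(Z)`
that lie in `X`, as an operator of the particles in `W`. -/
def evolProd (Φ : Pos d → Pos d → ℝ) (ε : ℝ) (X W : Finset ℕ) {𝒬 : Finset (Finset ℕ)}
    (R : Finpartition 𝒬) (t : ℝ) : Op d W :=
  (R.parts.toList.map fun Z => ampl W (evol Φ ε (declust Z ∩ X) t)).prod

/-- The cumulant of order `|Q|` of the groups `𝒢*`, applied to `f`: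
`∑_R (-1)^{|R|-1} (|R|-1)! ∏_{Z ∈ R} 𝒢*(t, θ(Z)) f`, where `R` runs over the partitions of the set
of clusters `Q`, and where only the particles in `X` move. -/
def cumulant (Φ : Pos d → Pos d → ℝ) (ε t : ℝ) (X : Finset ℕ) {W : Finset ℕ}
    (Q : Finpartition W) (f : Op d W) : Op d W :=
  ∑ R : Finpartition Q.parts, cumulantWeight R.parts.card •
    (evolProd Φ ε X W R t * f * evolProd Φ ε X W R (-t))

/-- The nonlinear mapping `𝒢(t; X ∣ F)`, as a family of operators: the correlations of the
particles in `W` evolve while only the particles in `X` move. For `W = X` this is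
`∑_Q 𝔄_{|Q|}(t, Q) ∏_{B ∈ Q} F(B)`, the sum over the partitions `Q` of `X`. -/
def nonlinearGroup (Φ : Pos d → Pos d → ℝ) (ε t : ℝ) (X : Finset ℕ) (F : OpFam d) : OpFam d :=
  fun _ => ∑ Q, cumulant Φ ε t X Q (clusterProd Q F)

/-- The clusters `{Y}, s+1, …, s+n`, with `Y` the set of the first `s` particles. -/
def clusters (s n : ℕ) : Finset (Finset ℕ) :=
  insert (Finset.range s) ((Finset.Ico s (s + n)).image fun i => {i})

/-- The composition `𝒢(t; θ(X₁) ∣ … 𝒢(t; θ(X_{|P|}) ∣ F) …)` over the blocks of `P`. (The groups of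
particles `θ(X_k)` are disjoint, so the mappings commute.) -/
def compGroup (Φ : Pos d → Pos d → ℝ) (ε t : ℝ) {𝒬 : Finset (Finset ℕ)} (P : Finpartition 𝒬)
    (F : OpFam d) : OpFam d :=
  (P.parts.toList.map declust).foldr (fun X F' => nonlinearGroup Φ ε t X F') F

/-- The cumulant `𝔄_{1+n}(t; {Y}, s+1, …, s+n ∣ f)` of the nonlinear groups. -/
def nonlinearCumulant (Φ : Pos d → Pos d → ℝ) (ε t : ℝ) (s n : ℕ) (f : OpSeq d) :
    Op d (Finset.range (s + n)) :=
  ∑ P : Finpartition (clusters s n), cumulantWeight P.parts.card •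
    compGroup Φ ε t P (at_ f) (Finset.range (s + n))

/-- The `n`-th term `(1/n!) Tr_{s+1,…,s+n} 𝔄_{1+n}(t; {Y}, s+1, …, s+n ∣ f)`. -/
def seriesTerm (Φ : Pos d → Pos d → ℝ) (ε t : ℝ) (f : OpSeq d) (s n : ℕ) :
    Op d (Finset.range s) :=
  ((n.factorial : ℂ)⁻¹) • ptrace (Finset.range s) (nonlinearCumulant Φ ε t s n f)

/-- The marginal correlation operators, given by the series. -/
def marginal (Φ : Pos d → Pos d → ℝ) (ε : ℝ) (f : OpSeq d) (t : ℝ) : OpSeq d :=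
  fun s => ∑' n, seriesTerm Φ ε t f s n

/-! ### The nonlinear BBGKY hierarchy -/

/-- `∑_{P : W = X₁ ∪ X₂, i ∈ X₁, j ∈ X₂} G(X₁) G(X₂)`. -/
def pairSum (G : OpSeq d) (W : Finset ℕ) (i j : ℕ) : Op d W :=
  ∑ P : Finpartition W with P.parts.card = 2 ∧ P.part i ≠ P.part j, clusterProd P (at_ G)

/-- The right-hand side of the hierarchy without the linear term `𝒩*_s G_s`:
`ε ∑_{P : Y = X₁ ∪ X₂} ∑_{i₁ ∈ X₁} ∑_{i₂ ∈ X₂} 𝒩*_int(i₁, i₂) G(X₁) G(X₂)`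
`+ ε Tr_{s+1} ∑_{i ∈ Y} 𝒩*_int(i, s+1) (G_{s+1}(Y, s+1) + ∑_{P, i ∈ X₁, s+1 ∈ X₂} G(X₁) G(X₂))`.
(The first sum is arranged by the pairs `i₁ < i₂`; here `s` is the label of particle number
`s + 1`.) -/
def interaction (Φ : Pos d → Pos d → ℝ) (ε : ℝ) (G : OpSeq d) (s : ℕ) : Op d (Finset.range s) :=
  (ε : ℂ) • ∑ p ∈ pairs (Finset.range s), Nint Φ p.1 p.2 (pairSum G (Finset.range s) p.1 p.2) +
  (ε : ℂ) • ptrace (Finset.range s) (∑ i ∈ Finset.range s,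
    Nint Φ i s (G (s + 1) + pairSum G (Finset.range (s + 1)) i s))

/-- `a` is (the class of) an infinitely differentiable function with compact support. -/
def IsTest {X : Finset ℕ} (a : L2 d X) : Prop :=
  ∃ g : Conf d X → ℂ, ContDiff ℝ ∞ g ∧ HasCompactSupport g ∧ a =ᵐ[volume] g

/-- Degenerate operators with infinitely differentiable compactly supported kernels
`∑_k a_k(q) \overline{b_k(q')}`. -/
def IsDegenerate {X : Finset ℕ} (A : Op d X) : Prop :=
  ∃ (m : ℕ) (a b : Fin m → L2 d X), (∀ k, IsTest (a k) ∧ IsTest (b k)) ∧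
    ∀ ψ, A ψ = ∑ k, ⟪b k, ψ⟫_ℂ • a k

/-- Finite sequences of degenerate operators with infinitely differentiable compactly supported
kernels. -/
def MemL10 (f : OpSeq d) : Prop :=
  (∃ N, ∀ n, N ≤ n → f n = 0) ∧ ∀ n, 1 ≤ n → IsDegenerate (f n)

/-- `G` is a strong solution of the Cauchy problem of the hierarchy, with initial data `G0`: for
all `t`, `G_s(t)` belongs to the domain of `𝒩*_s`, and the equation holds in the sense of the
trace norm. -/
def IsStrongSolution (Φ : Pos d → Pos d → ℝ) (ε : ℝ) (G0 : OpSeq d) (G : ℝ → OpSeq d) : Prop :=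
  ∀ s, 1 ≤ s → G 0 s = G0 s ∧ ∀ t, MemL1 (G t s) ∧
    ∃ D, IsGenerator Φ ε (G t s) D ∧
      HasTraceDerivAt (fun τ => G τ s) (D + interaction Φ ε (G t) s) t

/-- `G` is a weak solution of the Cauchy problem of the hierarchy, with initial data `G0`: for
every degenerate test operator `φ` the functional `t ↦ Tr φ G_s(t)` is differentiable and satisfies
the equation, in which the generator `𝒩*_s` is carried over to `φ` as `-𝒩*_s`. -/
def IsWeakSolution (Φ : Pos d → Pos d → ℝ) (ε : ℝ) (G0 : OpSeq d) (G : ℝ → OpSeq d) : Prop :=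
  ∀ s, 1 ≤ s → G 0 s = G0 s ∧ ∀ t, MemL1 (G t s) ∧
    ∀ φ : Op d (Finset.range s), IsDegenerate φ →
      ∃ D, IsGenerator Φ ε φ D ∧
        HasDerivAt (fun τ => trace (φ * G τ s))
          (-trace (D * G t s) + trace (φ * interaction Φ ε (G t) s)) t

end QBBGKY

end

open QBBGKY

open scoped ENNReal ContDiff FourierTransform InnerProductSpace
set_option autoImplicit false

noncomputable section

namespace QBBGKY

/-! The nonlinear group is a linear evolution seen through a logarithm. A family F of correlations
generates the densities `expFam F`, whose value on V is the sum over the partitions Q of V of the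
products of the F(B). Operators of disjoint sets of particles commute, so these sums behave like an
exponential in the commutative convolution algebra of set functions, and the cumulant weights
(-1)^(n-1) (n-1)! are those of the logarithm. Resumming the double sum over Q and R shows that the
nonlinear group is: exponentiate, let the particles of X move by the linear von Neumann group, take
the logarithm (`ampl_nonlinearGroup`, `expFam_nonlinearGroup`). A composition of nonlinear groups is
therefore a succession of linear evolutions of densities.

By cyclicity, the partial trace does not see the motion of traced particles that is decoupled from
Y. Of all blocks of P only the one containing Y survives (`IsTCFam.ptd_compGroup`), and the weights
of the remaining blocks add up to a sign (`sum_cumulantWeight_part`). The n-th term becomes 1/n!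
times the alternating sum, over the sets A of traced particles, of the traced correlations in which
Y ∪ A moves (`IsTCFam.ptrace_nonlinearCumulant`).

Convergence. If the members of F have trace norm at most c, the correlations of V are bounded by the
sum over Q and R of (|R|-1)! c^|Q|, which is at most |V|! 3^(-|V|) when 2c(e³-1) ≤ 1
(`sum_sum_factorial_le`); c < 1/(2e³) gives this with room to spare. After conceding a factor
(6/5)^|V| for the control of derivatives, and 2^n for the choice of A, the n-th term is at most
s!(2/5)^s binom(n+s,s) (4/5)^n (`summable_termBd`).

The equation. The kinetic energy is unbounded, so derivatives are first taken in the interaction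
picture: freeG(-τ) x(τ) is differentiable for every trace class datum, because the interacting group
is a bounded perturbation of the free one (`isPert_evolG`). The free group factors over tensor
products and is compatible with partial traces, so this differentiability passes from densities to
correlations (`IsTCFam.hasDerivAt_freeG_corrT`), to their marginals, and to the sum of the series
(`IsAdmissible.hasDerivAt_freeG_corr`). A pair potential between i and j acts on a product of
correlations inside one block, or it joins two blocks; this yields f(V) plus the sum of the f(X₁)
f(X₂) with i in X₁ and j in X₂ (`eq_sum_link`). Under the trace, pairs of traced particles
disappear, pairs in Y give the first part of the right-hand side, and the pairs of Y with each of
the n traced particles give n equal contributions; n/n! = 1/(n-1)! turns them into the trace over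
one additional particle (`IsAdmissible.margD_extend`).

For the weak equation the free motion is transferred to the test operator. For data in 𝔏¹₀ the same
majorant is used with the norm ‖u‖ + θ‖u'‖, which is submultiplicative for tensor products; a small
θ > 0 fits into the gap between 1/(2e³) and 1/(2(e³-1)). Then the marginals themselves are
differentiable, and comparison with the interaction picture puts them into the domain of the
generator. -/

variable {d : ℕ}


/-! ### Trace class operators as a Banach space -/

section TraceClass

open InnerProductSpace ContinuousLinearMap

variable {H : Type} [NormedAddCommGroup H] [InnerProductSpace ℂ H] [CompleteSpace H]

/-- The operator `z ↦ ⟪y, z⟫ x`. -/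
abbrev ketbra (x y : H) : H →L[ℂ] H := rankOne ℂ x y

omit [CompleteSpace H] in
theorem op_mul_apply (A B : H →L[ℂ] H) (x : H) : (A * B) x = A (B x) := rfl

omit [CompleteSpace H] in
theorem op_one_apply (x : H) : (1 : H →L[ℂ] H) x = x := rfl

theorem adjoint_one_eq : adjoint (1 : H →L[ℂ] H) = 1 := by
  rw [← ContinuousLinearMap.star_eq_adjoint, star_one]

/-- Since ‖T x‖ = ‖ |T| x ‖, the map |T| x ↦ T x is well defined and isometric, and extends to the
closure of the range of |T|. U is this isometry preceded by the orthogonal projection onto that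
closure. -/
theorem exists_polar (T : H →L[ℂ] H) :
    ∃ U : H →L[ℂ] H, ‖U‖ ≤ 1 ∧ U * CFC.abs T = T ∧ adjoint U * T = CFC.abs T := by
  set P := CFC.abs T with hP
  have hPsa : adjoint P = P := by
    have := (CFC.abs_nonneg T).isSelfAdjoint
    exact this
  have hPP : P * P = adjoint T * T := CFC.abs_mul_abs T
  have hinner : ∀ x y, ⟪P x, P y⟫_ℂ = ⟪T x, T y⟫_ℂ := by
    intro x y
    have h1 : ⟪P x, P y⟫_ℂ = ⟪x, (P * P) y⟫_ℂ := by
      have h0 := adjoint_inner_left P (P y) x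
      rwa [hPsa] at h0
    rw [h1, hPP, op_mul_apply, adjoint_inner_right]
  have hnorm : ∀ x, ‖T x‖ = ‖P x‖ := by
    intro x
    have := hinner x x
    rw [inner_self_eq_norm_sq_to_K, inner_self_eq_norm_sq_to_K] at this
    have h2 : ‖P x‖ ^ 2 = ‖T x‖ ^ 2 := by exact_mod_cast this
    exact ((sq_eq_sq₀ (norm_nonneg _) (norm_nonneg _)).1 h2).symm
  set K : Submodule ℂ H := (LinearMap.range P.toLinearMap).topologicalClosure with hK
  have : CompleteSpace K := (Submodule.isClosed_topologicalClosure _).completeSpace_coe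
  let e : H →ₗ[ℂ] K := P.toLinearMap.codRestrict K
    (fun x => Submodule.le_topologicalClosure _ ⟨x, rfl⟩)
  have hdense : DenseRange e := by
    intro k
    rw [closure_subtype]
    have hk : (k : H) ∈ closure (Set.range P) := k.2
    convert hk using 2
    ext z
    constructor
    · rintro ⟨_, ⟨x, rfl⟩, rfl⟩
      exact ⟨x, rfl⟩
    · rintro ⟨x, rfl⟩
      exact ⟨e x, ⟨x, rfl⟩, rfl⟩
  have hbd : ∀ x, ‖T.toLinearMap x‖ ≤ 1 * ‖e x‖ := fun x => by
    rw [one_mul]; exact (hnorm x).le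
  set V : K →L[ℂ] H := T.toLinearMap.extendOfNorm e with hV
  have hVe : ∀ x, V (e x) = T x := LinearMap.extendOfNorm_eq hdense ⟨1, hbd⟩
  have hVnorm : ∀ k, ‖V k‖ = ‖k‖ := by
    intro k
    refine hdense.induction_on (p := fun k => ‖V k‖ = ‖k‖) k
      (isClosed_eq V.continuous.norm continuous_norm) ?_
    intro x
    rw [hVe]
    exact hnorm x
  have hVinner : ∀ k l, ⟪V k, V l⟫_ℂ = ⟪k, l⟫_ℂ :=
    (LinearMap.norm_map_iff_inner_map_map (𝕜 := ℂ) V).1 hVnorm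
  refine ⟨V ∘L K.orthogonalProjectionOnto, ?_, ?_, ?_⟩
  · refine opNorm_le_bound _ zero_le_one fun x => ?_
    rw [comp_apply, hVnorm, one_mul]
    exact Submodule.norm_orthogonalProjectionOnto_apply_le K x
  · ext x
    have : K.orthogonalProjectionOnto (P x) = e x :=
      Submodule.orthogonalProjectionOnto_mem_subspace_eq_self (K := K) (e x)
    rw [op_mul_apply, comp_apply, this, hVe]
  · ext x
    refine ext_inner_right ℂ fun y => ?_
    rw [op_mul_apply, adjoint_inner_left, comp_apply, ← hVe x, hVinner]
    rw [Submodule.coe_inner]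
    rw [← Submodule.coe_inner]
    exact Submodule.inner_orthogonalProjectionOnto_eq_of_mem_left (e x) y

-- Cauchy–Schwarz on finite subsets, followed by Bessel's inequality for each of the two vectors.
omit [CompleteSpace H] in
theorem sum_enorm_inner_mul_le {ι : Type*} {b : ι → H} (hb : Orthonormal ℂ b) (y z : H) :
    ∑' j, ‖⟪y, b j⟫_ℂ‖ₑ * ‖⟪b j, z⟫_ℂ‖ₑ ≤ ‖y‖ₑ * ‖z‖ₑ := by
  rw [ENNReal.tsum_eq_iSup_sum]
  refine iSup_le fun s => ?_
  have h1 : ∑ j ∈ s, ‖⟪y, b j⟫_ℂ‖ * ‖⟪b j, z⟫_ℂ‖ ≤ ‖y‖ * ‖z‖ := by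
    have hc := Finset.sum_mul_sq_le_sq_mul_sq s (fun j => ‖⟪y, b j⟫_ℂ‖) (fun j => ‖⟪b j, z⟫_ℂ‖)
    have h2 : ∑ j ∈ s, ‖⟪y, b j⟫_ℂ‖ ^ 2 ≤ ‖y‖ ^ 2 := by
      simp_rw [norm_inner_symm y]
      exact hb.sum_inner_products_le y
    have h3 : ∑ j ∈ s, ‖⟪b j, z⟫_ℂ‖ ^ 2 ≤ ‖z‖ ^ 2 := hb.sum_inner_products_le z
    refine abs_le_of_sq_le_sq' ?_ (by positivity) |>.2
    calc _ ≤ _ := hc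
      _ ≤ ‖y‖ ^ 2 * ‖z‖ ^ 2 := by gcongr
      _ = _ := by ring
  calc ∑ j ∈ s, ‖⟪y, b j⟫_ℂ‖ₑ * ‖⟪b j, z⟫_ℂ‖ₑ
      = ENNReal.ofReal (∑ j ∈ s, ‖⟪y, b j⟫_ℂ‖ * ‖⟪b j, z⟫_ℂ‖) := by
        rw [ENNReal.ofReal_sum_of_nonneg (fun _ _ => by positivity)]
        refine Finset.sum_congr rfl fun j _ => ?_
        rw [ENNReal.ofReal_mul (norm_nonneg _), ofReal_norm, ofReal_norm]
    _ ≤ ENNReal.ofReal (‖y‖ * ‖z‖) := ENNReal.ofReal_le_ofReal h1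
    _ = _ := by rw [ENNReal.ofReal_mul (norm_nonneg _), ofReal_norm, ofReal_norm]

/-- By the polar decomposition |T| = U⋆T, so any expansion of T into rank one operators gives the
diagonal elements of |T| term by term, and Bessel's inequality sums them over the basis. With
`exists_nuclear` this identifies the trace norm with the least value of ∑ ‖x_i‖ ‖y_i‖ over such
expansions, and all further norm estimates are read off from expansions. -/
theorem traceNorm_le_tsum {ι : Type*} {x y : ι → H} {T : H →L[ℂ] H}
    (hT : HasSum (fun i => ketbra (x i) (y i)) T) :
    traceNorm T ≤ ∑' i, ‖x i‖ₑ * ‖y i‖ₑ := by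
  obtain ⟨U, hU, -, hUT⟩ := exists_polar T
  have key : ∀ j, ENNReal.ofReal (RCLike.re ⟪basis H j, CFC.abs T (basis H j)⟫_ℂ) ≤
      ∑' i, ‖⟪y i, basis H j⟫_ℂ‖ₑ * ‖⟪basis H j, adjoint U (x i)⟫_ℂ‖ₑ := by
    intro j
    set e := basis H j
    have h1 : HasSum (fun i => ⟪y i, e⟫_ℂ * ⟪e, adjoint U (x i)⟫_ℂ) ⟪e, CFC.abs T e⟫_ℂ := by
      rw [← hUT, op_mul_apply]
      have h2 := ((innerSL ℂ e) ∘L (adjoint U) ∘L (ContinuousLinearMap.apply ℂ H e)).hasSum hT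
      convert! h2 using 1
      ext i
      simp
    calc _ ≤ ‖⟪e, CFC.abs T e⟫_ℂ‖ₑ := by
          rw [← ofReal_norm]
          exact ENNReal.ofReal_le_ofReal (RCLike.re_le_norm _)
      _ ≤ _ := by
          rw [← h1.tsum_eq]
          refine enorm_tsum_le_tsum_enorm.trans (le_of_eq ?_)
          simp_rw [enorm_mul]
  calc traceNorm T ≤ ∑' j, ∑' i, ‖⟪y i, basis H j⟫_ℂ‖ₑ * ‖⟪basis H j, adjoint U (x i)⟫_ℂ‖ₑ :=
        ENNReal.tsum_le_tsum key
    _ = ∑' i, ∑' j, ‖⟪y i, basis H j⟫_ℂ‖ₑ * ‖⟪basis H j, adjoint U (x i)⟫_ℂ‖ₑ := ENNReal.tsum_comm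
    _ ≤ ∑' i, ‖x i‖ₑ * ‖y i‖ₑ := by
        refine ENNReal.tsum_le_tsum fun i => ?_
        refine (sum_enorm_inner_mul_le (basis H).orthonormal _ _).trans ?_
        rw [mul_comm]
        gcongr
        rw [← ofReal_norm, ← ofReal_norm]
        refine ENNReal.ofReal_le_ofReal ?_
        refine ((adjoint U).le_opNorm _).trans ?_
        have : ‖adjoint U‖ ≤ 1 := by rw [LinearIsometryEquiv.norm_map]; exact hU
        nlinarith [norm_nonneg (x i)]

/-- An optimal expansion: with S = |T|^{1/2} and the fixed basis (e_j), T = U S S = ∑ |U S e_j⟩⟨S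
e_j|, and ∑ ‖S e_j‖² = Tr |T|. -/
theorem exists_nuclear {T : H →L[ℂ] H} (hT : IsTraceClass T) :
    ∃ x y : basisIndex H → H, HasSum (fun i => ketbra (x i) (y i)) T ∧
      Summable (fun i => ‖x i‖ * ‖y i‖) ∧ ∑' i, ‖x i‖ₑ * ‖y i‖ₑ = traceNorm T := by
  obtain ⟨U, hU, hUT, -⟩ := exists_polar T
  set P := CFC.abs T with hP
  set S := CFC.sqrt P
  have hSS : S * S = P := CFC.sqrt_mul_sqrt_self P (CFC.abs_nonneg T)
  have hSsa : adjoint S = S := (CFC.sqrt_nonneg P).isSelfAdjoint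
  set e := basis H
  have hre : ∀ j, RCLike.re ⟪e j, P (e j)⟫_ℂ = ‖S (e j)‖ ^ 2 := by
    intro j
    rw [← hSS, op_mul_apply, ← adjoint_inner_left, hSsa, inner_self_eq_norm_sq]
  have htn : traceNorm T = ∑' j, ‖S (e j)‖ₑ * ‖S (e j)‖ₑ := by
    refine tsum_congr fun j => ?_
    rw [← hP, hre, sq, ENNReal.ofReal_mul (norm_nonneg _), ofReal_norm]
  have hle : ∀ j, ‖U (S (e j))‖ ≤ ‖S (e j)‖ := fun j => by
    refine (U.le_opNorm _).trans ?_
    nlinarith [norm_nonneg (S (e j))]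
  have hsum0 : Summable fun j => ‖S (e j)‖ * ‖S (e j)‖ := by
    have : (∑' j, ‖S (e j)‖ₑ * ‖S (e j)‖ₑ) ≠ ⊤ := by rw [← htn]; exact hT.ne
    have h2 := ENNReal.summable_toReal this
    refine h2.congr fun j => ?_
    simp
  have hsum : Summable fun j => ‖U (S (e j))‖ * ‖S (e j)‖ :=
    hsum0.of_nonneg_of_le (fun _ => by positivity)
      (fun j => mul_le_mul_of_nonneg_right (hle j) (norm_nonneg _))
  have hHS : HasSum (fun j => ketbra (U (S (e j))) (S (e j))) T := by
    have hs : Summable fun j => ketbra (U (S (e j))) (S (e j)) := by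
      refine Summable.of_norm ?_
      simpa [ketbra, norm_rankOne] using hsum
    convert! hs.hasSum
    ext z
    have h1 := (ContinuousLinearMap.apply ℂ H z).hasSum hs.hasSum
    have h2 := (U ∘L S).hasSum (e.hasSum_repr (S z))
    refine HasSum.unique (?_ : HasSum (fun j => ketbra (U (S (e j))) (S (e j)) z) (T z)) ?_
    · convert! h2 using 1
      · ext j
        simp only [rankOne_apply, map_smul, comp_apply]
        rw [HilbertBasis.repr_apply_apply, ← adjoint_inner_left S, hSsa]
      · rw [← hUT, ← hSS]; rfl
    · exact h1
  refine ⟨_, _, hHS, hsum, le_antisymm ?_ (traceNorm_le_tsum hHS)⟩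
  rw [htn]
  refine ENNReal.tsum_le_tsum fun j => ?_
  gcongr
  rw [← ofReal_norm, ← ofReal_norm]
  exact ENNReal.ofReal_le_ofReal (hle j)

/-- The optimal expansions of all summands together form an expansion of the sum. Only convergence
in the operator norm is assumed; this is what makes the completeness of `TC H` work. -/
theorem traceNorm_le_tsum_traceNorm {κ : Type*} {T : κ → H →L[ℂ] H} {S : H →L[ℂ] H}
    (hS : HasSum T S) : traceNorm S ≤ ∑' k, traceNorm (T k) := by
  by_cases htop : ∑' k, traceNorm (T k) = ⊤
  · rw [htop]; exact le_top
  have hT : ∀ k, IsTraceClass (T k) := fun k => (ENNReal.ne_top_of_tsum_ne_top htop k).lt_top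
  choose x y hxy hsum htn using fun k => exists_nuclear (hT k)
  have hsum2 : Summable fun p : κ × basisIndex H => ketbra (x p.1 p.2) (y p.1 p.2) := by
    refine Summable.of_norm ?_
    have : (∑' p : κ × basisIndex H, ‖x p.1 p.2‖ₑ * ‖y p.1 p.2‖ₑ) ≠ ⊤ := by
      rw [ENNReal.tsum_prod (f := fun k i => ‖x k i‖ₑ * ‖y k i‖ₑ)]
      simp_rw [htn]
      exact htop
    refine (ENNReal.summable_toReal this).congr fun p => ?_
    simp [ketbra, norm_rankOne]
  have h2 : HasSum (fun p : κ × basisIndex H => ketbra (x p.1 p.2) (y p.1 p.2)) S := by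
    have := hsum2.hasSum.prod_fiberwise hxy
    rw [hS.unique this]
    exact hsum2.hasSum
  refine (traceNorm_le_tsum h2).trans (le_of_eq ?_)
  rw [ENNReal.tsum_prod (f := fun k i => ‖x k i‖ₑ * ‖y k i‖ₑ)]
  simp_rw [htn]

theorem traceNorm_zero : traceNorm (0 : H →L[ℂ] H) = 0 := by
  simpa using traceNorm_le_tsum (H := H) (ι := Empty) (x := fun _ => 0) (y := fun _ => 0)
    (T := 0) hasSum_empty

theorem traceNorm_add_le (S T : H →L[ℂ] H) : traceNorm (S + T) ≤ traceNorm S + traceNorm T := by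
  have := traceNorm_le_tsum_traceNorm (hasSum_fintype (fun b : Bool => cond b S T))
  simpa [tsum_fintype] using this

theorem enorm_le_traceNorm (T : H →L[ℂ] H) : ‖T‖ₑ ≤ traceNorm T := by
  by_cases hT : IsTraceClass T
  · obtain ⟨x, y, h, -, h2⟩ := exists_nuclear hT
    rw [← h2, ← h.tsum_eq]
    refine enorm_tsum_le_tsum_enorm.trans (le_of_eq (tsum_congr fun j => ?_))
    rw [← ofReal_norm, norm_rankOne, ENNReal.ofReal_mul (norm_nonneg _), ofReal_norm, ofReal_norm]
  · rw [IsTraceClass, not_lt_top_iff] at hT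
    rw [hT]; exact le_top

variable {H' : Type} [NormedAddCommGroup H'] [InnerProductSpace ℂ H'] [CompleteSpace H']

theorem traceNorm_sandwich_le (A : H →L[ℂ] H') (B : H' →L[ℂ] H) {T : H →L[ℂ] H}
    (hT : IsTraceClass T) : traceNorm (A ∘L T ∘L B) ≤ ‖A‖ₑ * traceNorm T * ‖B‖ₑ := by
  obtain ⟨x, y, h, -, h2⟩ := exists_nuclear hT
  have h3 : HasSum (fun i => ketbra (A (x i)) (adjoint B (y i))) (A ∘L T ∘L B) := by
    have := ((compL ℂ H' H H').flip B ∘L (compL ℂ H H H') A).hasSum h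
    convert! this using 1
    ext i z
    simp [adjoint_inner_left]
  refine (traceNorm_le_tsum h3).trans ?_
  rw [← h2, ← ENNReal.tsum_mul_left, ← ENNReal.tsum_mul_right]
  refine ENNReal.tsum_le_tsum fun i => ?_
  have e1 : ‖A (x i)‖ₑ ≤ ‖A‖ₑ * ‖x i‖ₑ := A.le_opENorm _
  have e2 : ‖adjoint B (y i)‖ₑ ≤ ‖B‖ₑ * ‖y i‖ₑ := by
    refine ((adjoint B).le_opENorm _).trans (le_of_eq ?_)
    rw [← ofReal_norm, LinearIsometryEquiv.norm_map, ofReal_norm]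
  calc _ ≤ (‖A‖ₑ * ‖x i‖ₑ) * (‖B‖ₑ * ‖y i‖ₑ) := by gcongr
    _ = _ := by ring

theorem traceNorm_ketbra_le (x y : H) : traceNorm (ketbra x y) ≤ ‖x‖ₑ * ‖y‖ₑ := by
  have := traceNorm_le_tsum (hasSum_fintype (fun _ : Unit => ketbra x y))
  simpa [tsum_fintype] using this

theorem traceNorm_smul_le (c : ℂ) {T : H →L[ℂ] H} (hT : IsTraceClass T) :
    traceNorm (c • T) ≤ ‖c‖ₑ * traceNorm T := by
  have := traceNorm_sandwich_le (c • ContinuousLinearMap.id ℂ H) (ContinuousLinearMap.id ℂ H) hT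
  rw [ContinuousLinearMap.comp_id] at this
  have h1 : (c • ContinuousLinearMap.id ℂ H) ∘L T = c • T := by ext; simp
  rw [h1] at this
  refine this.trans ?_
  have e1 : ‖ContinuousLinearMap.id ℂ H‖ₑ ≤ 1 := by
    rw [← ofReal_norm]; exact ENNReal.ofReal_le_one.2 norm_id_le
  have e2 : ‖c • ContinuousLinearMap.id ℂ H‖ₑ ≤ ‖c‖ₑ := by
    rw [enorm_smul]; exact mul_le_of_le_one_right' e1
  calc _ ≤ ‖c‖ₑ * traceNorm T * 1 := by gcongr
    _ = _ := mul_one _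

variable (H) in
/-- The subspace of trace class operators. -/
def tcSubmodule : Submodule ℂ (H →L[ℂ] H) where
  carrier := {T | IsTraceClass T}
  add_mem' {S T} hS hT := (traceNorm_add_le S T).trans_lt (ENNReal.add_lt_top.2 ⟨hS, hT⟩)
  zero_mem' := by simp [IsTraceClass, traceNorm_zero]
  smul_mem' c T hT := (traceNorm_smul_le c hT).trans_lt
    (ENNReal.mul_lt_top (by simp) hT)

variable (H) in
/-- The space of trace class operators with the trace norm. -/
def TC : Type := tcSubmodule H

namespace TC

instance : AddCommGroup (TC H) := inferInstanceAs (AddCommGroup (tcSubmodule H))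
instance : Module ℂ (TC H) := inferInstanceAs (Module ℂ (tcSubmodule H))

variable (H) in
/-- The underlying bounded operator, as a linear map. -/
def opₗ : TC H →ₗ[ℂ] (H →L[ℂ] H) := (tcSubmodule H).subtype

theorem opₗ_injective : Function.Injective (opₗ H) := Subtype.val_injective

theorem isTraceClass (T : TC H) : IsTraceClass (opₗ H T) := T.2

instance : NormedAddCommGroup (TC H) := AddGroupNorm.toNormedAddCommGroup
  { toFun := fun T => (traceNorm (opₗ H T)).toReal
    map_zero' := by simp [traceNorm_zero]
    add_le' := fun S T => by
      rw [← ENNReal.toReal_add S.isTraceClass.ne T.isTraceClass.ne, map_add]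
      exact ENNReal.toReal_mono (ENNReal.add_lt_top.2 ⟨S.isTraceClass, T.isTraceClass⟩).ne
        (traceNorm_add_le _ _)
    neg' := fun T => by
      have h : ∀ S : TC H, (traceNorm (opₗ H (-S))).toReal ≤ (traceNorm (opₗ H S)).toReal := by
        intro S
        refine ENNReal.toReal_mono S.isTraceClass.ne ?_
        have := traceNorm_smul_le (-1) S.isTraceClass
        simpa using this
      exact le_antisymm (h T) (by simpa using h (-T))
    eq_zero_of_map_eq_zero' := fun T hT => by
      rw [ENNReal.toReal_eq_zero_iff] at hT
      have h0 := hT.resolve_right T.isTraceClass.ne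
      have := enorm_le_traceNorm (opₗ H T)
      rw [h0, nonpos_iff_eq_zero, enorm_eq_zero] at this
      exact opₗ_injective (by rw [this, map_zero]) }

theorem norm_def (T : TC H) : ‖T‖ = (traceNorm (opₗ H T)).toReal := rfl

theorem traceNorm_opₗ (T : TC H) : traceNorm (opₗ H T) = ENNReal.ofReal ‖T‖ := by
  rw [norm_def, ENNReal.ofReal_toReal T.isTraceClass.ne]

instance : NormedSpace ℂ (TC H) where
  norm_smul_le c T := by
    rw [norm_def, norm_def, map_smul]
    have := traceNorm_smul_le c T.isTraceClass
    have h2 := ENNReal.toReal_mono (ENNReal.mul_lt_top (by simp) T.isTraceClass).ne this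
    simpa using h2

theorem norm_opₗ_le (T : TC H) : ‖opₗ H T‖ ≤ ‖T‖ := by
  have := ENNReal.toReal_mono T.isTraceClass.ne (enorm_le_traceNorm (opₗ H T))
  rwa [toReal_enorm] at this

variable (H) in
/-- The underlying bounded operator. -/
def op : TC H →L[ℂ] (H →L[ℂ] H) :=
  (opₗ H).mkContinuous 1 fun T => by rw [one_mul]; exact norm_opₗ_le T

theorem op_injective : Function.Injective (op H) := Subtype.val_injective

theorem norm_op_le (T : TC H) : ‖op H T‖ ≤ ‖T‖ := norm_opₗ_le T

theorem traceNorm_op (T : TC H) : traceNorm (op H T) = ENNReal.ofReal ‖T‖ := traceNorm_opₗ T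

theorem isTraceClass_op (T : TC H) : IsTraceClass (op H T) := T.isTraceClass

open Classical in
/-- A trace class operator as an element of `TC H` (zero for other operators). -/
def mk (T : H →L[ℂ] H) : TC H :=
  if h : T ∈ tcSubmodule H then (⟨T, h⟩ : tcSubmodule H) else 0

theorem op_mk {T : H →L[ℂ] H} (h : IsTraceClass T) : op H (mk T) = T := by
  have h' : T ∈ tcSubmodule H := h
  have h2 : mk T = (⟨T, h⟩ : tcSubmodule H) := dif_pos h'
  rw [h2]; rfl

theorem norm_mk_le {T : H →L[ℂ] H} {c : ℝ} (hc : 0 ≤ c) (h : traceNorm T ≤ ENNReal.ofReal c) :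
    ‖mk T‖ ≤ c := by
  have hT : IsTraceClass T := h.trans_lt ENNReal.ofReal_lt_top
  have := traceNorm_op (mk T)
  rw [op_mk hT] at this
  rw [this] at h
  exact (ENNReal.ofReal_le_ofReal_iff hc).1 h

-- A series that converges absolutely in the trace norm converges in the operator norm.
-- Subadditivity, applied to the tails, shows that the limit is trace class and that the tails tend
-- to zero in the trace norm.
instance : CompleteSpace (TC H) := by
  refine NormedAddCommGroup.completeSpace_of_summable_imp_tendsto fun u hu => ?_
  have hop : Summable fun k => op H (u k) :=
    Summable.of_norm_bounded (g := fun k => ‖u k‖) hu fun k => norm_op_le (u k)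
  have hbound : ∀ n, traceNorm ((∑' k, op H (u k)) - ∑ k ∈ Finset.range n, op H (u k)) ≤
      ENNReal.ofReal (∑' k, ‖u (k + n)‖) := by
    intro n
    have h1 : HasSum (fun k => op H (u (k + n)))
        ((∑' k, op H (u k)) - ∑ k ∈ Finset.range n, op H (u k)) :=
      (hasSum_nat_add_iff' n).2 hop.hasSum
    refine (traceNorm_le_tsum_traceNorm h1).trans ?_
    simp_rw [traceNorm_op]
    rw [ENNReal.ofReal_tsum_of_nonneg (fun _ => norm_nonneg _) ((summable_nat_add_iff n).2 hu)]
  have htc : IsTraceClass (∑' k, op H (u k)) := by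
    have := hbound 0
    simp only [Finset.range_zero, Finset.sum_empty, sub_zero] at this
    exact this.trans_lt ENNReal.ofReal_lt_top
  refine ⟨mk (∑' k, op H (u k)), ?_⟩
  rw [tendsto_iff_norm_sub_tendsto_zero]
  refine squeeze_zero (fun _ => norm_nonneg _) (fun n => ?_) (tendsto_sum_nat_add fun k => ‖u k‖)
  rw [norm_sub_rev]
  have h2 := hbound n
  have h3 : op H (mk (∑' k, op H (u k)) - ∑ k ∈ Finset.range n, u k) =
      (∑' k, op H (u k)) - ∑ k ∈ Finset.range n, op H (u k) := by
    rw [map_sub, op_mk htc, map_sum]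
  rw [← h3, traceNorm_op] at h2
  exact (ENNReal.ofReal_le_ofReal_iff (tsum_nonneg fun _ => norm_nonneg _)).1 h2

theorem isTraceClass_ketbra (x y : H) : IsTraceClass (ketbra x y) :=
  (traceNorm_ketbra_le x y).trans_lt (ENNReal.mul_lt_top (by simp) (by simp))

/-- The rank one operator `z ↦ ⟪y, z⟫ x` as a trace class operator. -/
def kb (x y : H) : TC H := mk (ketbra x y)

@[simp] theorem op_kb (x y : H) : op H (kb x y) = ketbra x y := op_mk (isTraceClass_ketbra x y)

theorem norm_kb_le (x y : H) : ‖kb x y‖ ≤ ‖x‖ * ‖y‖ := by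
  refine norm_mk_le (by positivity) ?_
  rw [ENNReal.ofReal_mul (norm_nonneg _), ofReal_norm, ofReal_norm]
  exact traceNorm_ketbra_le x y

theorem exists_hasSum (T : TC H) : ∃ x y : basisIndex H → H,
    HasSum (fun i => kb (x i) (y i)) T ∧ Summable (fun i => ‖x i‖ * ‖y i‖) ∧
      ∑' i, ‖x i‖ * ‖y i‖ = ‖T‖ := by
  obtain ⟨x, y, h, hs, h2⟩ := exists_nuclear T.isTraceClass_op
  refine ⟨x, y, ?_, hs, ?_⟩
  · have hs2 : Summable fun i => kb (x i) (y i) :=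
      Summable.of_norm (hs.of_nonneg_of_le (fun _ => norm_nonneg _) fun i => norm_kb_le _ _)
    have h3 := (op H).hasSum hs2.hasSum
    simp only [op_kb] at h3
    have : T = ∑' i, kb (x i) (y i) := op_injective (h.unique h3)
    rw [this]
    exact hs2.hasSum
  · rw [traceNorm_op] at h2
    have h3 := congrArg ENNReal.toReal h2
    rw [ENNReal.toReal_ofReal (norm_nonneg _), ENNReal.tsum_toReal_eq (fun i => by finiteness)] at h3
    rw [← h3]
    simp

/-- Rank one operators are total in the trace norm. Most identities between continuous maps on trace
class operators are verified on them. -/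
theorem clm_ext {E : Type*} [NormedAddCommGroup E] [NormedSpace ℂ E] {f g : TC H →L[ℂ] E}
    (h : ∀ x y, f (kb x y) = g (kb x y)) : f = g := by
  ext T
  obtain ⟨x, y, hs, -⟩ := T.exists_hasSum
  have h1 := f.hasSum hs
  have h2 := g.hasSum hs
  simp only [h] at h1 h2
  exact h1.unique h2

theorem isTraceClass_sandwich (A : H →L[ℂ] H') (B : H' →L[ℂ] H) (T : TC H) :
    IsTraceClass (A ∘L op H T ∘L B) :=
  (traceNorm_sandwich_le A B T.isTraceClass_op).trans_lt
    (ENNReal.mul_lt_top (ENNReal.mul_lt_top (by simp) T.isTraceClass_op) (by simp))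

/-- The map `T ↦ A T B`. -/
def sandwich (A : H →L[ℂ] H') (B : H' →L[ℂ] H) : TC H →L[ℂ] TC H' :=
  LinearMap.mkContinuous
    { toFun := fun T => mk (A ∘L op H T ∘L B)
      map_add' := fun S T => op_injective (by
        rw [op_mk (isTraceClass_sandwich _ _ _), map_add, map_add,
          op_mk (isTraceClass_sandwich _ _ _), op_mk (isTraceClass_sandwich _ _ _)]
        ext; simp)
      map_smul' := fun c T => op_injective (by
        rw [op_mk (isTraceClass_sandwich _ _ _), map_smul, map_smul,
          op_mk (isTraceClass_sandwich _ _ _)]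
        ext; simp) }
    (‖A‖ * ‖B‖) (fun T => by
      refine norm_mk_le (by positivity) ((traceNorm_sandwich_le A B T.isTraceClass_op).trans ?_)
      rw [traceNorm_op, ENNReal.ofReal_mul (by positivity), ENNReal.ofReal_mul (by positivity),
        ofReal_norm A, ofReal_norm B]
      exact le_of_eq (by ring))

theorem op_sandwich (A : H →L[ℂ] H') (B : H' →L[ℂ] H) (T : TC H) :
    op H' (sandwich A B T) = A ∘L op H T ∘L B := op_mk (isTraceClass_sandwich _ _ _)

theorem sandwich_kb (A : H →L[ℂ] H') (B : H' →L[ℂ] H) (x y : H) :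
    sandwich A B (kb x y) = kb (A x) (adjoint B y) := op_injective (by
  rw [op_sandwich, op_kb, op_kb, rankOne_comp, comp_rankOne])

theorem norm_sandwich_le (A : H →L[ℂ] H') (B : H' →L[ℂ] H) (T : TC H) :
    ‖sandwich A B T‖ ≤ ‖A‖ * ‖B‖ * ‖T‖ :=
  (LinearMap.mkContinuous_norm_le _ (by positivity) _ |> (sandwich A B).le_of_opNorm_le <| T)

theorem op_tsum_kb_eq {ι : Type*} {x y : ι → H} {T : TC H} (h : HasSum (fun i => kb (x i) (y i)) T)
    (z : H) : HasSum (fun i => ⟪y i, z⟫_ℂ • x i) (op H T z) := by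
  have := (ContinuousLinearMap.apply ℂ H z ∘L op H).hasSum h
  simpa [Function.comp_def] using this

/-- An optimal expansion and an exchange of the two sums reduce this to Bessel's inequality, so the
series of the trace converges absolutely. -/
theorem summable_trace {ι : Type*} {b : ι → H} (hb : Orthonormal ℂ b) (T : TC H) :
    ∑' j, ‖⟪b j, op H T (b j)⟫_ℂ‖ₑ ≤ ENNReal.ofReal ‖T‖ := by
  obtain ⟨x, y, hs, hs2, hn⟩ := T.exists_hasSum
  calc ∑' j, ‖⟪b j, op H T (b j)⟫_ℂ‖ₑ
      ≤ ∑' j, ∑' i, ‖⟪y i, b j⟫_ℂ‖ₑ * ‖⟪b j, x i⟫_ℂ‖ₑ := by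
        refine ENNReal.tsum_le_tsum fun j => ?_
        have := (innerSL ℂ (b j)).hasSum (op_tsum_kb_eq hs (b j))
        rw [coe_innerSL_apply] at this
        have h2 : HasSum (fun i => ⟪b j, ⟪y i, b j⟫_ℂ • x i⟫_ℂ) ⟪b j, op H T (b j)⟫_ℂ := this
        rw [← h2.tsum_eq]
        refine enorm_tsum_le_tsum_enorm.trans (le_of_eq (tsum_congr fun i => ?_))
        simp
    _ = ∑' i, ∑' j, ‖⟪y i, b j⟫_ℂ‖ₑ * ‖⟪b j, x i⟫_ℂ‖ₑ := ENNReal.tsum_comm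
    _ ≤ ∑' i, ‖y i‖ₑ * ‖x i‖ₑ := ENNReal.tsum_le_tsum fun i => sum_enorm_inner_mul_le hb _ _
    _ = ENNReal.ofReal ‖T‖ := by
        rw [← hn, ENNReal.ofReal_tsum_of_nonneg (fun _ => by positivity) hs2]
        refine tsum_congr fun i => ?_
        rw [ENNReal.ofReal_mul (norm_nonneg _), ofReal_norm, ofReal_norm, mul_comm]

theorem summable_inner {ι : Type*} {b : ι → H} (hb : Orthonormal ℂ b) (T : TC H) :
    Summable fun j => ⟪b j, op H T (b j)⟫_ℂ := by
  refine Summable.of_norm ?_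
  have h := ((summable_trace hb T).trans_lt ENNReal.ofReal_lt_top).ne
  simpa using ENNReal.summable_toReal h

variable (H) in
/-- The trace. -/
def tr : TC H →L[ℂ] ℂ :=
  LinearMap.mkContinuous
    { toFun := fun T => trace (op H T)
      map_add' := fun S T => by
        rw [trace, trace, trace, ← (summable_inner (basis H).orthonormal S).tsum_add
          (summable_inner (basis H).orthonormal T)]
        simp
      map_smul' := fun c T => by
        rw [trace, trace, RingHom.id_apply, smul_eq_mul,
          ← (summable_inner (basis H).orthonormal T).tsum_mul_left]
        simp }
    1 (fun T => by
      have h := summable_trace (basis H).orthonormal T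
      have h2 : ‖trace (op H T)‖ₑ ≤ ENNReal.ofReal ‖T‖ := enorm_tsum_le_tsum_enorm.trans h
      rw [← ofReal_norm, ENNReal.ofReal_le_ofReal_iff (norm_nonneg _)] at h2
      simpa using h2)

theorem tr_apply (T : TC H) : tr H T = trace (op H T) := rfl

@[simp] theorem tr_kb (x y : H) : tr H (kb x y) = ⟪y, x⟫_ℂ := by
  rw [tr_apply, op_kb, trace, ← (basis H).tsum_inner_mul_inner]
  simp

theorem norm_tr_le (T : TC H) : ‖tr H T‖ ≤ ‖T‖ := by
  have := (tr H).le_of_opNorm_le (LinearMap.mkContinuous_norm_le _ zero_le_one _) T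
  simpa using this

/-- Left multiplication by a bounded operator. -/
abbrev lmul (A : H →L[ℂ] H) : TC H →L[ℂ] TC H := sandwich A 1

/-- Right multiplication by a bounded operator. -/
abbrev rmul (A : H →L[ℂ] H) : TC H →L[ℂ] TC H := sandwich 1 A

theorem op_lmul (A : H →L[ℂ] H) (T : TC H) : op H (lmul A T) = A * op H T := op_sandwich _ _ _

theorem op_rmul (A : H →L[ℂ] H) (T : TC H) : op H (rmul A T) = op H T * A := op_sandwich _ _ _

/-- Cyclicity of the trace; on a rank one operator it is the definition of the adjoint. -/
theorem tr_sandwich (A : H →L[ℂ] H') (B : H' →L[ℂ] H) (T : TC H) :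
    tr H' (sandwich A B T) = tr H (lmul (B ∘L A) T) := by
  have : tr H' ∘L sandwich A B = tr H ∘L lmul (B ∘L A) := by
    refine clm_ext fun x y => ?_
    simp [sandwich_kb, adjoint_inner_left]
  exact DFunLike.congr_fun this T

theorem tr_lmul_eq_tr_rmul (A : H →L[ℂ] H) (T : TC H) : tr H (lmul A T) = tr H (rmul A T) := by
  exact (tr_sandwich 1 A T).symm

theorem tr_lmul_kb (x y : H) (T : TC H) : tr H (lmul (ketbra x y) T) = ⟪y, op H T x⟫_ℂ := by
  have : tr H ∘L lmul (ketbra x y) =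
      innerSL ℂ y ∘L ContinuousLinearMap.apply ℂ H x ∘L op H := by
    refine clm_ext fun u v => ?_
    simp [sandwich_kb, mul_comm, adjoint_one_eq]
  exact DFunLike.congr_fun this T

theorem op_ext_inner {S T : TC H} (h : ∀ x y, ⟪y, op H S x⟫_ℂ = ⟪y, op H T x⟫_ℂ) : S = T :=
  op_injective (ContinuousLinearMap.ext fun x => ext_inner_left ℂ fun y => h x y)

end TC

theorem hasTraceDerivAt_of_hasDerivAt {F : ℝ → TC H} {D : TC H} {t : ℝ} (h : HasDerivAt F D t) :
    HasTraceDerivAt (fun τ => TC.op H (F τ)) (TC.op H D) t := by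
  rw [hasDerivAt_iff_tendsto_slope_zero] at h
  rw [tendsto_iff_norm_sub_tendsto_zero] at h
  have h2 := (ENNReal.continuous_ofReal.tendsto 0).comp h
  rw [ENNReal.ofReal_zero] at h2
  refine h2.congr fun τ => ?_
  simp only [Function.comp_def]
  rw [← TC.traceNorm_op, map_sub, ← Complex.coe_smul τ⁻¹ (F (t + τ) - F t)]
  simp

end TraceClass


/-! ### Tensor products of wave functions -/

section Product

/-- Change of variables without any injectivity of the map; almost everywhere strong measurability
of the integrand takes its place. -/
theorem _root_.MeasureTheory.MeasurePreserving.integral_comp_of_aestronglyMeasurable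
    {α β E : Type*} [MeasurableSpace α] [MeasurableSpace β] [NormedAddCommGroup E] [NormedSpace ℝ E]
    {μ : Measure α} {ν : Measure β} {g : α → β} (hg : MeasurePreserving g μ ν) {f : β → E}
    (hf : AEStronglyMeasurable f ν) : ∫ x, f (g x) ∂μ = ∫ y, f y ∂ν := by
  have h := integral_map hg.measurable.aemeasurable (by rw [hg.map_eq]; exact hf)
  rw [hg.map_eq] at h
  exact h.symm

variable {α β : Type*} [MeasurableSpace α] [MeasurableSpace β] {μ : Measure α} {ν : Measure β}
  [SigmaFinite μ] [SigmaFinite ν]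

/-- On a product of two spanning sets of finite measure f is integrable, and the complex measure
with density f vanishes on the rectangles, a π-system generating the product σ-algebra. Countably
many such products cover the space. -/
theorem ae_eq_zero_of_forall_setIntegral_prod_eq_zero {f : α × β → ℂ} (hf : MemLp f 2 (μ.prod ν))
    (h : ∀ s t, MeasurableSet s → MeasurableSet t → μ s < ⊤ → ν t < ⊤ →
      ∫ p in s ×ˢ t, f p ∂(μ.prod ν) = 0) : f =ᵐ[μ.prod ν] 0 := by
  have hS : ∀ n, f =ᵐ[(μ.prod ν).restrict (spanningSets μ n ×ˢ spanningSets ν n)] 0 := by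
    intro n
    set S := spanningSets μ n
    set T := spanningSets ν n
    have hSm : MeasurableSet S := measurableSet_spanningSets μ n
    have hTm : MeasurableSet T := measurableSet_spanningSets ν n
    have hSf : μ S < ⊤ := measure_spanningSets_lt_top μ n
    have hTf : ν T < ⊤ := measure_spanningSets_lt_top ν n
    have : IsFiniteMeasure ((μ.prod ν).restrict (S ×ˢ T)) :=
      ⟨by rw [Measure.restrict_apply_univ, Measure.prod_prod]; exact ENNReal.mul_lt_top hSf hTf⟩
    have hint : Integrable f ((μ.prod ν).restrict (S ×ˢ T)) :=
      (hf.restrict _).integrable one_le_two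
    refine hint.ae_eq_of_withDensityᵥ_eq (integrable_zero _ _ _) ?_
    have key : ∀ s t, MeasurableSet s → MeasurableSet t →
        ∫ p in s ×ˢ t, f p ∂((μ.prod ν).restrict (S ×ˢ T)) = 0 := by
      intro s t hs ht
      rw [Measure.restrict_restrict (hs.prod ht), Set.prod_inter_prod]
      exact h _ _ (hs.inter hSm) (ht.inter hTm) ((measure_mono Set.inter_subset_right).trans_lt hSf)
        ((measure_mono Set.inter_subset_right).trans_lt hTf)
    refine VectorMeasure.ext_of_generateFrom _ ?_ generateFrom_prod.symm isPiSystem_prod ?_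
    · rintro _ ⟨s, hs, t, ht, rfl⟩
      rw [withDensityᵥ_apply hint (hs.prod ht), withDensityᵥ_zero]
      simpa using key s t hs ht
    · rw [withDensityᵥ_apply hint MeasurableSet.univ, withDensityᵥ_zero]
      simpa using key Set.univ Set.univ .univ .univ
  have hU : (⋃ n, spanningSets μ n ×ˢ spanningSets ν n) = Set.univ := by
    refine Set.eq_univ_of_forall fun p => ?_
    obtain ⟨i, hi⟩ := Set.mem_iUnion.1 ((iUnion_spanningSets μ).symm ▸ Set.mem_univ p.1)
    obtain ⟨j, hj⟩ := Set.mem_iUnion.1 ((iUnion_spanningSets ν).symm ▸ Set.mem_univ p.2)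
    exact Set.mem_iUnion.2 ⟨max i j, monotone_spanningSets μ (le_max_left _ _) hi,
      monotone_spanningSets ν (le_max_right _ _) hj⟩
  have h2 : ∀ᵐ p ∂((μ.prod ν).restrict (⋃ n, spanningSets μ n ×ˢ spanningSets ν n)), f p = 0 :=
    (ae_restrict_iUnion_iff _ _).2 hS
  rwa [hU, Measure.restrict_univ] at h2

end Product

/-- `W` is the disjoint union of `X` and `Z`. -/
structure Split (X Z W : Finset ℕ) : Prop where
  left : X ⊆ W
  eq : Z = W \ X

namespace Split

variable {X Z W : Finset ℕ}

theorem right (h : Split X Z W) : Z ⊆ W := h.eq ▸ Finset.sdiff_subset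

theorem disjoint (h : Split X Z W) : Disjoint X Z := h.eq ▸ Finset.disjoint_sdiff

theorem union (h : Split X Z W) : X ∪ Z = W := by
  rw [h.eq, Finset.union_sdiff_of_subset h.left]

theorem symm (h : Split X Z W) : Split Z X W :=
  ⟨h.right, by rw [h.eq, Finset.sdiff_sdiff_eq_self h.left]⟩

theorem of_subset (h : X ⊆ W) : Split X (W \ X) W := ⟨h, rfl⟩

theorem of_disjoint (h : Disjoint X Z) : Split X Z (X ∪ Z) :=
  ⟨Finset.subset_union_left, by rw [Finset.union_sdiff_left, Finset.sdiff_eq_self_of_disjoint h.symm]⟩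

end Split

/-! ### Product vectors and operators acting on one tensor factor. -/

section Tensor

variable {X Z W : Finset ℕ}

theorem measurable_restr (h : X ⊆ W) : Measurable (restr (d := d) h) := by
  have : Continuous (restr (d := d) h) := by unfold restr; fun_prop
  exact this.measurable

theorem measurePreserving_split (h : Split X Z W) :
    MeasurePreserving (fun q : Conf d W => (restr h.left q, restr h.right q))
      volume (volume.prod volume) := by
  obtain ⟨hl, rfl⟩ := h
  exact measurePreserving_restr hl

theorem quasiMeasurePreserving_restr (h : X ⊆ W) :
    Measure.QuasiMeasurePreserving (restr (d := d) h) volume volume :=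
  Measure.quasiMeasurePreserving_fst.comp (measurePreserving_restr h).quasiMeasurePreserving

/-- The configuration of all particles with given configurations of two groups of particles. -/
def glue (X Z W : Finset ℕ) (p : Conf d X × Conf d Z) : Conf d W :=
  WithLp.toLp 2 fun w => if h : (w.1 : ℕ) ∈ X then p.1 (⟨w.1, h⟩, w.2)
    else if h : (w.1 : ℕ) ∈ Z then p.2 (⟨w.1, h⟩, w.2) else 0

theorem measurable_glue (X Z W : Finset ℕ) : Measurable (glue (d := d) X Z W) := by
  have : Continuous (glue (d := d) X Z W) := by
    unfold glue
    refine (PiLp.continuous_toLp 2 _).comp (continuous_pi fun w => ?_)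
    split_ifs <;> fun_prop
  exact this.measurable

theorem glue_restr (h : Split X Z W) (q : Conf d W) :
    glue X Z W (restr h.left q, restr h.right q) = q := by
  ext w
  have hw : (w.1 : ℕ) ∈ X ∪ Z := by rw [h.union]; exact w.1.2
  by_cases h1 : (w.1 : ℕ) ∈ X
  · simp [glue, restr, h1]
  · have h2 := (Finset.mem_union.1 hw).resolve_left h1
    simp [glue, restr, h1, h2]

theorem restr_glue_left (h : Split X Z W) (p : Conf d X × Conf d Z) :
    restr h.left (glue X Z W p) = p.1 := by
  ext w
  simp [glue, restr]

theorem restr_glue_right (h : Split X Z W) (p : Conf d X × Conf d Z) :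
    restr h.right (glue X Z W p) = p.2 := by
  ext w
  have h1 : (w.1 : ℕ) ∉ X := Finset.disjoint_right.1 h.disjoint w.1.2
  simp [glue, restr, h1]

theorem measurePreserving_glue (h : Split X Z W) :
    MeasurePreserving (glue (d := d) X Z W) (volume.prod volume) volume := by
  refine ⟨measurable_glue _ _ _, ?_⟩
  rw [← (measurePreserving_split h).map_eq,
    Measure.map_map (measurable_glue _ _ _) (measurePreserving_split h).measurable]
  have : glue (d := d) X Z W ∘ (fun q => (restr h.left q, restr h.right q)) = id :=
    funext fun q => glue_restr h q
  rw [this, Measure.map_id]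

theorem memLp_tp (h : Split X Z W) (u : L2 d X) (w : L2 d Z) :
    MemLp (fun q : Conf d W => u (restr h.left q) * w (restr h.right q)) 2 volume := by
  obtain ⟨hl, rfl⟩ := h
  exact memLp_tensor hl u w

/-- The tensor product `u ⊗ w`. -/
def tp (h : Split X Z W) (u : L2 d X) (w : L2 d Z) : L2 d W := (memLp_tp h u w).toLp _

theorem coeFn_tp (h : Split X Z W) (u : L2 d X) (w : L2 d Z) :
    tp h u w =ᵐ[volume] fun q => u (restr h.left q) * w (restr h.right q) := MemLp.coeFn_toLp _

theorem tp_comm (h : Split X Z W) (u : L2 d X) (w : L2 d Z) : tp h.symm w u = tp h u w :=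
  MemLp.toLp_congr _ _ (Eventually.of_forall fun _ => mul_comm _ _)

theorem norm_tp (h : Split X Z W) (u : L2 d X) (w : L2 d Z) : ‖tp h u w‖ = ‖u‖ * ‖w‖ := by
  obtain ⟨hl, rfl⟩ := h
  rw [mul_comm]
  exact norm_tensorVec hl u w

theorem tp_add_left (h : Split X Z W) (u v : L2 d X) (w : L2 d Z) :
    tp h (u + v) w = tp h u w + tp h v w := by
  obtain ⟨hl, rfl⟩ := h
  exact (tensorRight hl w).map_add u v

theorem tp_smul_left (h : Split X Z W) (c : ℂ) (u : L2 d X) (w : L2 d Z) :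
    tp h (c • u) w = c • tp h u w := by
  obtain ⟨hl, rfl⟩ := h
  exact (tensorRight hl w).map_smul c u

/-- The tensor product of wave functions as a bilinear map. -/
def tpL (h : Split X Z W) : L2 d X →L[ℂ] L2 d Z →L[ℂ] L2 d W :=
  LinearMap.mkContinuous₂ (LinearMap.mk₂ ℂ (tp h) (tp_add_left h) (tp_smul_left h)
    (fun u v w => by rw [← tp_comm h, tp_add_left, tp_comm h, tp_comm h])
    (fun c u w => by rw [← tp_comm h, tp_smul_left, tp_comm h])) 1
    (fun u w => by rw [one_mul]; exact (norm_tp h u w).le)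

@[simp] theorem tpL_apply (h : Split X Z W) (u : L2 d X) (w : L2 d Z) : tpL h u w = tp h u w := rfl

theorem tensorRight_apply (h : X ⊆ W) (w : L2 d (W \ X)) (u : L2 d X) :
    tensorRight h w u = tp (Split.of_subset h) u w := rfl

theorem inner_tp (h : Split X Z W) (u u' : L2 d X) (w w' : L2 d Z) :
    ⟪tp h u w, tp h u' w'⟫_ℂ = ⟪u, u'⟫_ℂ * ⟪w, w'⟫_ℂ := by
  rw [L2.inner_def, L2.inner_def, L2.inner_def]
  have hm : AEStronglyMeasurable (fun p : Conf d X × Conf d Z => ⟪u p.1, u' p.1⟫_ℂ * ⟪w p.2, w' p.2⟫_ℂ)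
      (volume.prod volume) :=
    (((Lp.aestronglyMeasurable u).inner (Lp.aestronglyMeasurable u')).comp_fst).mul
      (((Lp.aestronglyMeasurable w).inner (Lp.aestronglyMeasurable w')).comp_snd)
  rw [← integral_prod_mul,
    ← (measurePreserving_split (d := d) h).integral_comp_of_aestronglyMeasurable hm]
  refine integral_congr_ae ?_
  filter_upwards [coeFn_tp h u w, coeFn_tp h u' w'] with q h1 h2
  rw [h1, h2]
  simp only [RCLike.inner_apply, map_mul]
  ring

/-- Products of indicator functions of sets of finite measure are product vectors, so every integral
of ψ over a rectangle vanishes. -/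
theorem eq_zero_of_inner_tp (h : Split X Z W) {ψ : L2 d W}
    (hψ : ∀ u w, ⟪tp h u w, ψ⟫_ℂ = 0) : ψ = 0 := by
  have hg := measurePreserving_glue (d := d) h
  have h0 : (ψ ∘ glue X Z W : Conf d X × Conf d Z → ℂ) =ᵐ[volume.prod volume] 0 := by
    refine ae_eq_zero_of_forall_setIntegral_prod_eq_zero ((Lp.memLp ψ).comp_measurePreserving hg) ?_
    intro s t hs ht hμs hμt
    have := hψ (indicatorConstLp 2 hs hμs.ne 1) (indicatorConstLp 2 ht hμt.ne 1)
    rw [L2.inner_def] at this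
    rw [← integral_indicator (hs.prod ht)]
    have hm : AEStronglyMeasurable (fun q : Conf d W =>
        ⟪tp h (indicatorConstLp 2 hs hμs.ne 1) (indicatorConstLp 2 ht hμt.ne 1) q, ψ q⟫_ℂ) volume :=
      (Lp.aestronglyMeasurable _).inner (Lp.aestronglyMeasurable _)
    rw [← hg.integral_comp_of_aestronglyMeasurable hm] at this
    rw [← this]
    refine integral_congr_ae ?_
    filter_upwards [hg.quasiMeasurePreserving.ae (coeFn_tp h (indicatorConstLp 2 hs hμs.ne 1)
        (indicatorConstLp 2 ht hμt.ne 1)),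
      Measure.quasiMeasurePreserving_fst.ae (indicatorConstLp_coeFn (p := 2) (hs := hs)
        (hμs := hμs.ne) (c := (1 : ℂ))),
      Measure.quasiMeasurePreserving_snd.ae (indicatorConstLp_coeFn (p := 2) (hs := ht)
        (hμs := hμt.ne) (c := (1 : ℂ)))] with p h1 h2 h3
    rw [h1, restr_glue_left h, restr_glue_right h, h2, h3]
    by_cases h4 : p.1 ∈ s <;> by_cases h5 : p.2 ∈ t <;> simp [Set.indicator, h4, h5]
  rw [Lp.eq_zero_iff_ae_eq_zero]
  filter_upwards [(measurePreserving_split h).quasiMeasurePreserving.ae h0] with q hq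
  simpa only [Function.comp_apply, glue_restr h, Pi.zero_apply] using hq

theorem dense_span_tp (h : Split X Z W) :
    (Submodule.span ℂ (Set.range fun p : L2 d X × L2 d Z => tp h p.1 p.2)).topologicalClosure = ⊤ := by
  rw [Submodule.topologicalClosure_eq_top_iff, Submodule.eq_bot_iff]
  intro ψ hψ
  exact eq_zero_of_inner_tp h fun u w => hψ _ (Submodule.subset_span ⟨(u, w), rfl⟩)

theorem clm_ext_tp {E : Type*} [NormedAddCommGroup E] [NormedSpace ℂ E] (h : Split X Z W)
    {f g : L2 d W →L[ℂ] E} (hfg : ∀ u w, f (tp h u w) = g (tp h u w)) : f = g := by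
  refine ContinuousLinearMap.ext_on (Submodule.dense_iff_topologicalClosure_eq_top.2
    (dense_span_tp h)) ?_
  rintro _ ⟨p, rfl⟩
  exact hfg _ _

theorem tp_assoc {Y U T : Finset ℕ} (h1 : Split X Y U) (h2 : Split U Z W) (h3 : Split Y Z T)
    (h4 : Split X T W) (u : L2 d X) (v : L2 d Y) (w : L2 d Z) :
    tp h2 (tp h1 u v) w = tp h4 u (tp h3 v w) := by
  refine Lp.ext ?_
  filter_upwards [coeFn_tp h2 (tp h1 u v) w, coeFn_tp h4 u (tp h3 v w),
    (quasiMeasurePreserving_restr h2.left).ae (coeFn_tp h1 u v),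
    (quasiMeasurePreserving_restr h4.right).ae (coeFn_tp h3 v w)] with q e1 e2 e3 e4
  rw [e1, e2, e3, e4, mul_assoc]
  rfl

/-! ### Amplification -/

-- The algebraic tensor product maps isometrically onto a dense subspace of the space of W. There A
-- ⊗ 1 is bounded, hence it extends by continuity.
open scoped TensorProduct in
theorem exists_ampl (h : Split X Z W) (A : Op d X) :
    ∃ B : Op d W, ∀ u w, B (tp h u w) = tp h (A u) w := by
  let e : (L2 d X ⊗[ℂ] L2 d Z) →ₗ[ℂ] L2 d W :=
    TensorProduct.lift ((tpL (d := d) h).toLinearMap₁₂)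
  have he : ∀ u w, e (u ⊗ₜ w) = tp h u w := fun u w => rfl
  have hinner : ∀ x y, ⟪e x, e y⟫_ℂ = ⟪x, y⟫_ℂ := by
    intro x y
    induction x using TensorProduct.induction_on with
    | zero => simp
    | add x x' hx hx' => rw [map_add, inner_add_left, inner_add_left, hx, hx']
    | tmul u w =>
      induction y using TensorProduct.induction_on with
      | zero => simp
      | add x x' hx hx' => rw [map_add, inner_add_right, inner_add_right, hx, hx']
      | tmul u' w' => rw [he, he, inner_tp, TensorProduct.inner_tmul]
  have hnorm : ∀ x, ‖e x‖ = ‖x‖ := fun x => by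
    rw [norm_eq_sqrt_re_inner (𝕜 := ℂ) (e x), hinner]
    exact (norm_eq_sqrt_re_inner (𝕜 := ℂ) x).symm
  have hdense : DenseRange e := by
    have h1 := dense_span_tp (d := d) h
    rw [← Submodule.dense_iff_topologicalClosure_eq_top] at h1
    refine h1.mono ?_
    rw [← LinearMap.coe_range, SetLike.coe_subset_coe, Submodule.span_le]
    rintro _ ⟨p, rfl⟩
    exact ⟨p.1 ⊗ₜ p.2, he _ _⟩
  refine ⟨(e ∘ₗ (A.rTensor (L2 d Z)).toLinearMap).extendOfNorm e, fun u w => ?_⟩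
  rw [← he, LinearMap.extendOfNorm_eq hdense]
  · rfl
  · refine ⟨‖A.rTensor (L2 d Z)‖, fun x => ?_⟩
    rw [LinearMap.comp_apply, hnorm, hnorm]
    exact (A.rTensor (L2 d Z)).le_opNorm x

theorem ampl_tp (h : Split X Z W) (A : Op d X) (u : L2 d X) (w : L2 d Z) :
    ampl W A (tp h u w) = tp h (A u) w := by
  obtain ⟨hl, rfl⟩ := h
  have hex : ∃ (hX : X ⊆ W) (B : Op d W), ∀ u w, B (tensorVec hX u w) = tensorVec hX (A u) w := by
    obtain ⟨B, hB⟩ := exists_ampl (Split.of_subset hl) A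
    exact ⟨hl, B, hB⟩
  rw [ampl, dif_pos hex]
  exact hex.choose_spec.choose_spec u w

theorem ampl_tp_right (h : Split X Z W) (A : Op d Z) (u : L2 d X) (w : L2 d Z) :
    ampl W A (tp h u w) = tp h u (A w) := by
  rw [← tp_comm, ampl_tp, tp_comm]

theorem ampl_unique (h : Split X Z W) {A : Op d X} {B : Op d W}
    (hB : ∀ u w, B (tp h u w) = tp h (A u) w) : ampl W A = B :=
  clm_ext_tp h fun u w => by rw [ampl_tp, hB]

theorem ampl_mul (h : X ⊆ W) (A B : Op d X) : ampl W (A * B) = ampl W A * ampl W B :=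
  ampl_unique (Split.of_subset h) fun u w => by
    rw [op_mul_apply, ampl_tp, ampl_tp, op_mul_apply]

theorem ampl_one (h : X ⊆ W) : ampl W (1 : Op d X) = 1 :=
  ampl_unique (Split.of_subset h) fun _ _ => rfl

theorem ampl_add (h : X ⊆ W) (A B : Op d X) : ampl W (A + B) = ampl W A + ampl W B :=
  ampl_unique (Split.of_subset h) fun u w => by
    rw [add_apply, ampl_tp, ampl_tp, add_apply, tp_add_left]

theorem ampl_smul (h : X ⊆ W) (c : ℂ) (A : Op d X) : ampl W (c • A) = c • ampl W A :=
  ampl_unique (Split.of_subset h) fun u w => by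
    rw [smul_apply, ampl_tp, smul_apply, tp_smul_left]

theorem ampl_zero (h : X ⊆ W) : ampl W (0 : Op d X) = 0 := by
  simpa using ampl_smul h 0 (0 : Op d X)

theorem ampl_sum (h : X ⊆ W) {ι : Type*} (s : Finset ι) (A : ι → Op d X) :
    ampl W (∑ i ∈ s, A i) = ∑ i ∈ s, ampl W (A i) := by
  classical
  induction s using Finset.induction_on with
  | empty => simpa using ampl_zero h
  | insert a s ha ih => rw [Finset.sum_insert ha, Finset.sum_insert ha, ampl_add h, ih]

theorem ampl_adjoint (h : X ⊆ W) (A : Op d X) :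
    ampl W (ContinuousLinearMap.adjoint A) = ContinuousLinearMap.adjoint (ampl W A) := by
  refine ampl_unique (Split.of_subset h) fun u w => ?_
  rw [← sub_eq_zero]
  refine eq_zero_of_inner_tp (Split.of_subset h) fun u' w' => ?_
  rw [inner_sub_right, ContinuousLinearMap.adjoint_inner_right, ampl_tp, inner_tp, inner_tp,
    ContinuousLinearMap.adjoint_inner_right, sub_self]

/-- The remaining set of particles is empty and its configuration space is a point, so tensoring
with w is multiplication by the value of w at that point. -/
theorem ampl_self (A : Op d W) : ampl W A = A := by
  have hs : Split W (W \ W) W := Split.of_subset subset_rfl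
  have he : IsEmpty ((W \ W : Finset ℕ) × Fin d) :=
    ⟨fun p => by have := p.1.2; simp at this⟩
  refine ampl_unique hs fun u w => ?_
  have key : ∀ u : L2 d W, tp hs u w = (w (WithLp.toLp 2 (fun p => he.elim p)) : ℂ) • u := by
    intro u
    refine Lp.ext ?_
    filter_upwards [coeFn_tp hs u w, Lp.coeFn_smul (w (WithLp.toLp 2 (fun p => he.elim p)) : ℂ) u]
      with q h1 h2
    rw [h1, h2, Pi.smul_apply, smul_eq_mul, mul_comm]
    congr 2
    ext p
    exact he.elim p
  rw [key, key, map_smul]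

theorem ampl_ampl {U : Finset ℕ} (hX : X ⊆ U) (hU : U ⊆ W) (A : Op d X) :
    ampl W (ampl U A) = ampl W A := by
  have h1 : Split X (U \ X) U := Split.of_subset hX
  have h2 : Split U (W \ U) W := Split.of_subset hU
  have h4 : Split X (W \ X) W := Split.of_subset (hX.trans hU)
  have h3 : Split (U \ X) (W \ U) (W \ X) := by
    refine ⟨Finset.sdiff_subset_sdiff hU subset_rfl, ?_⟩
    ext a; simp only [Finset.mem_sdiff]
    have := @hX a
    tauto
  refine (ampl_unique h2 fun u w => ?_)
  have : ampl W A ∘L (tpL h2).flip w = (tpL h2).flip w ∘L ampl U A := by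
    refine clm_ext_tp h1 fun v v' => ?_
    simp only [ContinuousLinearMap.comp_apply, ContinuousLinearMap.flip_apply, tpL_apply]
    rw [tp_assoc h1 h2 h3 h4, ampl_tp, ampl_tp, tp_assoc h1 h2 h3 h4]
  exact DFunLike.congr_fun this u

theorem ampl_mul_ampl_tp (h : Split X Z W) (A : Op d X) (B : Op d Z) (u : L2 d X) (w : L2 d Z) :
    (ampl W A * ampl W B) (tp h u w) = tp h (A u) (B w) := by
  rw [op_mul_apply, ampl_tp_right, ampl_tp]

theorem ampl_commute (hX : X ⊆ W) (hZ : Z ⊆ W) (h : Disjoint X Z) (A : Op d X) (B : Op d Z) :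
    Commute (ampl W A) (ampl W B) := by
  have hs := Split.of_disjoint h
  have hU : X ∪ Z ⊆ W := Finset.union_subset hX hZ
  rw [← ampl_ampl hs.left hU, ← ampl_ampl hs.right hU, commute_iff_eq, ← ampl_mul hU,
    ← ampl_mul hU]
  congr 1
  refine clm_ext_tp hs fun u w => ?_
  rw [ampl_mul_ampl_tp, op_mul_apply, ampl_tp, ampl_tp_right]

theorem ampl_mem_unitary (h : X ⊆ W) {A : Op d X} (hA : A ∈ unitary (Op d X)) :
    ampl W A ∈ unitary (Op d W) := by
  rw [Unitary.mem_iff] at hA ⊢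
  rw [ContinuousLinearMap.star_eq_adjoint, ← ampl_adjoint h, ← ampl_mul h, ← ampl_mul h,
    ← ContinuousLinearMap.star_eq_adjoint, hA.1, hA.2, ampl_one h]
  exact ⟨rfl, rfl⟩

end Tensor


theorem ENNReal_tsum_mul_le_of_sq {ι : Type*} {a b : ι → ℝ} {A B : ℝ} (ha : ∀ j, 0 ≤ a j)
    (hb : ∀ j, 0 ≤ b j) (hA : 0 ≤ A) (hB : 0 ≤ B) (h1 : ∀ s : Finset ι, ∑ j ∈ s, a j ^ 2 ≤ A ^ 2)
    (h2 : ∀ s : Finset ι, ∑ j ∈ s, b j ^ 2 ≤ B ^ 2) :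
    ∑' j, ENNReal.ofReal (a j * b j) ≤ ENNReal.ofReal (A * B) := by
  rw [ENNReal.tsum_eq_iSup_sum]
  refine iSup_le fun s => ?_
  rw [← ENNReal.ofReal_sum_of_nonneg (fun j _ => mul_nonneg (ha j) (hb j))]
  refine ENNReal.ofReal_le_ofReal ?_
  have hc := Finset.sum_mul_sq_le_sq_mul_sq s a b
  refine abs_le_of_sq_le_sq' ?_ (by positivity) |>.2
  calc _ ≤ _ := hc
    _ ≤ A ^ 2 * B ^ 2 := mul_le_mul (h1 s) (h2 s) (Finset.sum_nonneg fun _ _ => sq_nonneg _)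
        (sq_nonneg _)
    _ = _ := by ring

/-! ### Tensor products and partial traces of trace class operators -/

/-- Trace class operators of the particles in `X`. -/
abbrev TCV (d : ℕ) (X : Finset ℕ) : Type := TC (L2 d X)

section

variable {H : Type} [NormedAddCommGroup H] [InnerProductSpace ℂ H] [CompleteSpace H]

theorem TC.kb_add_left (x x' y : H) : TC.kb (x + x') y = TC.kb x y + TC.kb x' y :=
  TC.op_injective (by rw [map_add, TC.op_kb, TC.op_kb, TC.op_kb]; ext; simp)

theorem TC.kb_smul_left (c : ℂ) (x y : H) : TC.kb (c • x) y = c • TC.kb x y :=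
  TC.op_injective (by rw [map_smul, TC.op_kb, TC.op_kb]; ext1 z; simp [smul_comm c])

theorem TC.kb_add_right (x y y' : H) : TC.kb x (y + y') = TC.kb x y + TC.kb x y' :=
  TC.op_injective (by rw [map_add, TC.op_kb, TC.op_kb, TC.op_kb]; ext; simp)

theorem TC.kb_smul_right (c : ℂ) (x y : H) : TC.kb x (c • y) = starRingEnd ℂ c • TC.kb x y :=
  TC.op_injective (by rw [map_smul, TC.op_kb, TC.op_kb]; ext; simp)

variable (H) in
/-- The map `(x, y) ↦ |x⟩⟨y|`. -/
def TC.kbL : H →L[ℂ] H →L⋆[ℂ] TC H :=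
  LinearMap.mkContinuous₂ (LinearMap.mk₂'ₛₗ (RingHom.id ℂ) (starRingEnd ℂ) TC.kb TC.kb_add_left
    TC.kb_smul_left TC.kb_add_right TC.kb_smul_right) 1
    (fun x y => by rw [one_mul]; exact TC.norm_kb_le x y)

theorem TC.ext_tr {S T : TC H} (h : ∀ A, TC.tr H (TC.lmul A S) = TC.tr H (TC.lmul A T)) : S = T :=
  TC.op_ext_inner fun x y => by rw [← TC.tr_lmul_kb, ← TC.tr_lmul_kb, h]

end

/-! ### Tensor products of trace class operators. -/

section Tensor

variable {X Z W : Finset ℕ}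

theorem TC.clm_ext_tp {E : Type*} [NormedAddCommGroup E] [NormedSpace ℂ E] (h : Split X Z W)
    {f g : TCV d W →L[ℂ] E}
    (hfg : ∀ u w u' w', f (kb (tp h u w) (tp h u' w')) = g (kb (tp h u w) (tp h u' w'))) :
    f = g := by
  refine TC.clm_ext fun x y => ?_
  have hd := Submodule.dense_iff_topologicalClosure_eq_top.2 (dense_span_tp (d := d) h)
  have h1 : ∀ u w, f ∘SL (kbL (L2 d W) (tp h u w)) = g ∘SL (kbL (L2 d W) (tp h u w)) := by
    intro u w
    refine ContinuousLinearMap.ext_on hd ?_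
    rintro _ ⟨p, rfl⟩
    exact hfg _ _ _ _
  have h2 : f ∘L ((kbL (L2 d W)).flip y) = g ∘L ((kbL (L2 d W)).flip y) :=
    QBBGKY.clm_ext_tp h fun u w => DFunLike.congr_fun (h1 u w) y
  exact DFunLike.congr_fun h2 x

theorem adjoint_tpL_tp (h : Split X Z W) (y u : L2 d X) (w : L2 d Z) :
    ContinuousLinearMap.adjoint (tpL h y) (tp h u w) = ⟪y, u⟫_ℂ • w := by
  refine ext_inner_left ℂ fun v => ?_
  rw [ContinuousLinearMap.adjoint_inner_right, tpL_apply, inner_tp, inner_smul_right]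

/-- For S = ∑ |x_i⟩⟨y_i| each |x_i⟩⟨y_i| ⊗ T is T sandwiched between w ↦ x_i ⊗ w and the adjoint of
w ↦ y_i ⊗ w. Its norm is at most ‖x_i‖ ‖y_i‖ ‖T‖, and an optimal expansion of S gives the bound of
the sum. -/
theorem exists_tens (h : Split X Z W) (S : TCV d X) (T : TCV d Z) :
    ∃ R : TCV d W, TC.op _ R = ampl W (TC.op _ S) * ampl W (TC.op _ T) ∧ ‖R‖ ≤ ‖S‖ * ‖T‖ := by
  obtain ⟨x, y, hs, hs2, hn⟩ := S.exists_hasSum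
  set f : _ → TCV d W := fun i =>
    TC.sandwich (tpL h (x i)) (ContinuousLinearMap.adjoint (tpL h (y i))) T with hf
  have hnL : ∀ u, ‖tpL (d := d) h u‖ ≤ ‖u‖ := fun u =>
    ContinuousLinearMap.opNorm_le_bound _ (norm_nonneg _) fun w => (norm_tp h u w).le
  have hfn : ∀ i, ‖f i‖ ≤ ‖x i‖ * ‖y i‖ * ‖T‖ := by
    intro i
    refine (TC.norm_sandwich_le _ _ _).trans ?_
    rw [LinearIsometryEquiv.norm_map]
    gcongr
    · exact hnL _
    · exact hnL _
  have hsf : Summable f := Summable.of_norm_bounded (hs2.mul_right ‖T‖) hfn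
  refine ⟨∑' i, f i, ?_, ?_⟩
  · refine clm_ext_tp h fun u w => ?_
    have h1 := (ContinuousLinearMap.apply ℂ (L2 d W) (tp h u w) ∘L TC.op _).hasSum hsf.hasSum
    refine h1.unique ?_
    rw [ampl_mul_ampl_tp]
    have h2 := ((tpL h).flip (TC.op _ T w)).hasSum (TC.op_tsum_kb_eq hs u)
    convert! h2 using 1
    ext1 i
    simp only [ContinuousLinearMap.comp_apply,
      ContinuousLinearMap.flip_apply, map_smul, tpL_apply]
    rw [hf]
    change TC.op _ _ _ = _
    rw [TC.op_sandwich, ContinuousLinearMap.comp_apply, ContinuousLinearMap.comp_apply,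
      adjoint_tpL_tp, map_smul, map_smul, tpL_apply]
  · refine (tsum_of_norm_bounded (hs2.mul_right ‖T‖).hasSum hfn).trans ?_
    rw [hs2.tsum_mul_right, hn]

/-- The tensor product of two trace class operators. -/
def tensFun (h : Split X Z W) (S : TCV d X) (T : TCV d Z) : TCV d W := (exists_tens h S T).choose

theorem op_tensFun (h : Split X Z W) (S : TCV d X) (T : TCV d Z) :
    TC.op _ (tensFun h S T) = ampl W (TC.op _ S) * ampl W (TC.op _ T) :=
  (exists_tens h S T).choose_spec.1

theorem tensFun_add_left (h : Split X Z W) (S S' : TCV d X) (T : TCV d Z) :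
    tensFun h (S + S') T = tensFun h S T + tensFun h S' T :=
  TC.op_injective (by simp only [map_add, op_tensFun, ampl_add h.left, add_mul])

theorem tensFun_smul_left (h : Split X Z W) (c : ℂ) (S : TCV d X) (T : TCV d Z) :
    tensFun h (c • S) T = c • tensFun h S T :=
  TC.op_injective (by simp only [map_smul, op_tensFun, ampl_smul h.left, smul_mul_assoc])

theorem tensFun_add_right (h : Split X Z W) (S : TCV d X) (T T' : TCV d Z) :
    tensFun h S (T + T') = tensFun h S T + tensFun h S T' :=
  TC.op_injective (by simp only [map_add, op_tensFun, ampl_add h.right, mul_add])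

theorem tensFun_smul_right (h : Split X Z W) (c : ℂ) (S : TCV d X) (T : TCV d Z) :
    tensFun h S (c • T) = c • tensFun h S T :=
  TC.op_injective (by simp only [map_smul, op_tensFun, ampl_smul h.right, mul_smul_comm])

theorem norm_tensFun_le (h : Split X Z W) (S : TCV d X) (T : TCV d Z) :
    ‖tensFun h S T‖ ≤ 1 * ‖S‖ * ‖T‖ := by
  rw [one_mul]; exact (exists_tens h S T).choose_spec.2

/-- The tensor product of trace class operators as a bilinear map. -/
def tens (h : Split X Z W) : TCV d X →L[ℂ] TCV d Z →L[ℂ] TCV d W :=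
  LinearMap.mkContinuous₂ (LinearMap.mk₂ ℂ (tensFun h) (tensFun_add_left h) (tensFun_smul_left h)
    (tensFun_add_right h) (tensFun_smul_right h)) 1 (norm_tensFun_le h)

theorem op_tens (h : Split X Z W) (S : TCV d X) (T : TCV d Z) :
    TC.op _ (tens h S T) = ampl W (TC.op _ S) * ampl W (TC.op _ T) := op_tensFun h S T

theorem norm_tens_le (h : Split X Z W) (S : TCV d X) (T : TCV d Z) :
    ‖tens h S T‖ ≤ ‖S‖ * ‖T‖ := (exists_tens h S T).choose_spec.2

theorem tens_kb (h : Split X Z W) (u u' : L2 d X) (w w' : L2 d Z) :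
    tens h (TC.kb u u') (TC.kb w w') = TC.kb (tp h u w) (tp h u' w') := by
  refine TC.op_injective (clm_ext_tp h fun v v' => ?_)
  rw [op_tens, ampl_mul_ampl_tp, TC.op_kb, TC.op_kb, TC.op_kb, InnerProductSpace.rankOne_apply,
    InnerProductSpace.rankOne_apply, InnerProductSpace.rankOne_apply, inner_tp, tp_smul_left,
    ← tp_comm h u, tp_smul_left, tp_comm, smul_smul]

theorem tens_comm (h : Split X Z W) (S : TCV d X) (T : TCV d Z) :
    tens h.symm T S = tens h S T :=
  TC.op_injective (by
    rw [op_tens, op_tens, (ampl_commute h.left h.right h.disjoint _ _).eq])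

theorem tens_sandwich (h : Split X Z W) (A A' : Op d X) (B B' : Op d Z) (S : TCV d X)
    (T : TCV d Z) :
    tens h (TC.sandwich A A' S) (TC.sandwich B B' T) =
      TC.sandwich (ampl W A * ampl W B) (ampl W A' * ampl W B') (tens h S T) := by
  refine TC.op_injective (clm_ext_tp h fun v v' => ?_)
  rw [op_tens, ampl_mul_ampl_tp, TC.op_sandwich A, TC.op_sandwich B, TC.op_sandwich, op_tens]
  simp only [ContinuousLinearMap.comp_apply, ampl_mul_ampl_tp]

theorem clm_ext_tens {E : Type*} [NormedAddCommGroup E] [NormedSpace ℂ E] (h : Split X Z W)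
    {f g : TCV d W →L[ℂ] E} (hfg : ∀ S T, f (tens h S T) = g (tens h S T)) : f = g :=
  TC.clm_ext_tp h fun u w u' w' => by rw [← tens_kb, hfg]

/-! #### Partial traces -/

theorem adjoint_tensorRight_tp (h : X ⊆ W) (e w : L2 d (W \ X)) (u : L2 d X) :
    ContinuousLinearMap.adjoint (tensorRight h e) (tp (Split.of_subset h) u w) = ⟪e, w⟫_ℂ • u := by
  refine ext_inner_left ℂ fun v => ?_
  rw [ContinuousLinearMap.adjoint_inner_right, tensorRight_apply, inner_tp, inner_smul_right,
    mul_comm]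

/-- Bessel's inequality for the isometries u ↦ u ⊗ e_j, whose ranges are mutually orthogonal: the
component P of ψ in finitely many ranges satisfies ⟪P, ψ⟫ = ‖P‖². -/
theorem sum_sq_adjoint_tensorRight_le (h : X ⊆ W) {ι : Type*} {e : ι → L2 d (W \ X)}
    (he : Orthonormal ℂ e) (ψ : L2 d W) (s : Finset ι) :
    ∑ j ∈ s, ‖ContinuousLinearMap.adjoint (tensorRight h (e j)) ψ‖ ^ 2 ≤ ‖ψ‖ ^ 2 := by
  classical
  set v : ι → L2 d X := fun j => ContinuousLinearMap.adjoint (tensorRight h (e j)) ψ with hv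
  set P : L2 d W := ∑ j ∈ s, tensorRight h (e j) (v j) with hP
  have h1 : ⟪P, ψ⟫_ℂ = ((∑ j ∈ s, ‖v j‖ ^ 2 : ℝ) : ℂ) := by
    rw [hP, sum_inner]
    push_cast
    refine Finset.sum_congr rfl fun j _ => ?_
    rw [← ContinuousLinearMap.adjoint_inner_right, inner_self_eq_norm_sq_to_K]
    rfl
  have h2 : ⟪P, P⟫_ℂ = ((∑ j ∈ s, ‖v j‖ ^ 2 : ℝ) : ℂ) := by
    rw [hP, sum_inner]
    push_cast
    refine Finset.sum_congr rfl fun j hj => ?_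
    rw [inner_sum, Finset.sum_eq_single_of_mem j hj]
    · rw [tensorRight_apply, inner_tp, inner_self_eq_norm_sq_to_K, inner_self_eq_norm_sq_to_K,
        he.1 j]
      simp
    · intro i _ hij
      rw [tensorRight_apply, tensorRight_apply, inner_tp, he.2 hij.symm, mul_zero]
  have h3 : ‖P‖ ^ 2 = ∑ j ∈ s, ‖v j‖ ^ 2 := by
    rw [← inner_self_eq_norm_sq (𝕜 := ℂ) P, h2]
    exact Complex.ofReal_re _
  have h4 : ‖P‖ ^ 2 ≤ ‖P‖ * ‖ψ‖ := by
    have := norm_inner_le_norm (𝕜 := ℂ) P ψ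
    rw [h1, ← h3] at this
    simpa using this
  rw [← h3]
  have := norm_nonneg P
  have := norm_nonneg ψ
  by_cases h0 : ‖P‖ = 0
  · rw [h0, zero_pow two_ne_zero]; positivity
  · have : 0 < ‖P‖ := lt_of_le_of_ne (norm_nonneg _) (Ne.symm h0)
    have : ‖P‖ ≤ ‖ψ‖ := by nlinarith
    gcongr

/-- The series of the partial trace converges absolutely in the trace norm, with total at most ‖T‖:
expand T optimally, exchange the sums and apply Bessel's inequality to both vectors of each term. -/
theorem tsum_enorm_ptrace_term_le (h : X ⊆ W) (T : TCV d W) :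
    ∑' j, ‖TC.sandwich (ContinuousLinearMap.adjoint (tensorRight h (basis (L2 d (W \ X)) j)))
      (tensorRight h (basis (L2 d (W \ X)) j)) T‖ₑ ≤ ENNReal.ofReal ‖T‖ := by
  obtain ⟨x, y, hs, hs2, hn⟩ := T.exists_hasSum
  set V := fun j => tensorRight h (basis (L2 d (W \ X)) j)
  calc _ ≤ ∑' j, ∑' i, ENNReal.ofReal (‖ContinuousLinearMap.adjoint (V j) (x i)‖ *
          ‖ContinuousLinearMap.adjoint (V j) (y i)‖) := by
        refine ENNReal.tsum_le_tsum fun j => ?_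
        have h1 := (TC.sandwich (ContinuousLinearMap.adjoint (V j)) (V j)).hasSum hs
        rw [← h1.tsum_eq]
        refine enorm_tsum_le_tsum_enorm.trans (ENNReal.tsum_le_tsum fun i => ?_)
        rw [← ofReal_norm]
        refine ENNReal.ofReal_le_ofReal ?_
        rw [TC.sandwich_kb]
        exact TC.norm_kb_le _ _
    _ = ∑' i, ∑' j, ENNReal.ofReal (‖ContinuousLinearMap.adjoint (V j) (x i)‖ *
          ‖ContinuousLinearMap.adjoint (V j) (y i)‖) := ENNReal.tsum_comm
    _ ≤ ∑' i, ENNReal.ofReal (‖x i‖ * ‖y i‖) := by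
        refine ENNReal.tsum_le_tsum fun i => ?_
        exact ENNReal_tsum_mul_le_of_sq (fun _ => norm_nonneg _) (fun _ => norm_nonneg _)
          (norm_nonneg _) (norm_nonneg _)
          (sum_sq_adjoint_tensorRight_le h (basis (L2 d (W \ X))).orthonormal (x i))
          (sum_sq_adjoint_tensorRight_le h (basis (L2 d (W \ X))).orthonormal (y i))
    _ = ENNReal.ofReal ‖T‖ := by
        rw [← hn, ENNReal.ofReal_tsum_of_nonneg (fun _ => by positivity) hs2]

theorem summable_ptrace (h : X ⊆ W) (T : TCV d W) : Summable fun j =>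
    TC.sandwich (ContinuousLinearMap.adjoint (tensorRight h (basis (L2 d (W \ X)) j)))
      (tensorRight h (basis (L2 d (W \ X)) j)) T := by
  refine Summable.of_norm ?_
  have := ((tsum_enorm_ptrace_term_le h T).trans_lt ENNReal.ofReal_lt_top).ne
  simpa using ENNReal.summable_toReal this

/-- The partial trace of trace class operators. -/
def pt (h : X ⊆ W) : TCV d W →L[ℂ] TCV d X :=
  LinearMap.mkContinuous
    { toFun := fun T => ∑' j,
        TC.sandwich (ContinuousLinearMap.adjoint (tensorRight h (basis (L2 d (W \ X)) j)))
          (tensorRight h (basis (L2 d (W \ X)) j)) T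
      map_add' := fun S T => by
        rw [← (summable_ptrace h S).tsum_add (summable_ptrace h T)]
        simp_rw [map_add]
      map_smul' := fun c T => by
        rw [RingHom.id_apply, ← (summable_ptrace h T).tsum_const_smul]
        simp_rw [map_smul] } 1
    (fun T => by
      have h2 := enorm_tsum_le_tsum_enorm.trans (tsum_enorm_ptrace_term_le h T)
      rw [← ofReal_norm, ENNReal.ofReal_le_ofReal_iff (norm_nonneg _)] at h2
      simpa using h2)

theorem op_pt (h : X ⊆ W) (T : TCV d W) : TC.op _ (pt h T) = ptrace X (TC.op _ T) := by
  rw [ptrace, dif_pos h]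
  refine ((TC.op _).map_tsum (summable_ptrace h T)).trans (tsum_congr fun j => ?_)
  rw [TC.op_sandwich]

theorem norm_pt_le (h : X ⊆ W) (T : TCV d W) : ‖pt h T‖ ≤ ‖T‖ := by
  have := (pt (d := d) h).le_of_opNorm_le (LinearMap.mkContinuous_norm_le _ zero_le_one _) T
  simpa using this

theorem pt_kb_tp (h : X ⊆ W) (u u' : L2 d X) (w w' : L2 d (W \ X)) :
    pt h (TC.kb (tp (Split.of_subset h) u w) (tp (Split.of_subset h) u' w')) =
      ⟪w', w⟫_ℂ • TC.kb u u' := by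
  have h1 : ∀ j, TC.sandwich
      (ContinuousLinearMap.adjoint (tensorRight h (basis (L2 d (W \ X)) j)))
      (tensorRight h (basis (L2 d (W \ X)) j))
      (TC.kb (tp (Split.of_subset h) u w) (tp (Split.of_subset h) u' w')) =
      (⟪w', basis (L2 d (W \ X)) j⟫_ℂ * ⟪basis (L2 d (W \ X)) j, w⟫_ℂ) • TC.kb u u' := by
    intro j
    rw [TC.sandwich_kb, adjoint_tensorRight_tp, adjoint_tensorRight_tp, TC.kb_smul_left,
      TC.kb_smul_right, smul_smul, inner_conj_symm, mul_comm]
  have h2 := ((basis (L2 d (W \ X))).hasSum_inner_mul_inner w' w).smul_const (TC.kb u u')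
  rw [← h2.tsum_eq]
  exact tsum_congr h1

theorem pt_tens (h : Split X Z W) (S : TCV d X) (T : TCV d Z) :
    pt h.left (tens h S T) = TC.tr _ T • S := by
  obtain ⟨hl, rfl⟩ := h
  have : ∀ u u', (pt hl) ∘L (tens (Split.of_subset hl) (TC.kb u u')) =
      ((TC.tr (L2 d (W \ X))).smulRight (TC.kb u u')) := fun u u' =>
    TC.clm_ext fun w w' => by
      simp only [ContinuousLinearMap.comp_apply, ContinuousLinearMap.smulRight_apply]
      rw [tens_kb, pt_kb_tp, TC.tr_kb]
  have h2 : (pt hl) ∘L ((tens (Split.of_subset hl)).flip T) =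
      TC.tr _ T • ContinuousLinearMap.id ℂ (TCV d X) :=
    TC.clm_ext fun u u' => DFunLike.congr_fun (this u u') T
  exact DFunLike.congr_fun h2 S

theorem pt_sandwich_ampl (h : X ⊆ W) (A B : Op d X) (T : TCV d W) :
    pt h (TC.sandwich (ampl W A) (ampl W B) T) = TC.sandwich A B (pt h T) := by
  have : pt h ∘L TC.sandwich (ampl W A) (ampl W B) = TC.sandwich A B ∘L pt h := by
    refine TC.clm_ext_tp (Split.of_subset h) fun u w u' w' => ?_
    simp only [ContinuousLinearMap.comp_apply]
    rw [TC.sandwich_kb, ← ampl_adjoint h, ampl_tp, ampl_tp, pt_kb_tp, pt_kb_tp, map_smul,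
      TC.sandwich_kb]
  exact DFunLike.congr_fun this T

/-- Cyclicity of the partial trace for operators of the traced particles. This is why their separate
motion and their mutual interaction leave no mark on the marginals. -/
theorem pt_lmul_eq_rmul (h : X ⊆ W) {Y : Finset ℕ} (hY : Y ⊆ W) (hXY : Disjoint Y X) (C : Op d Y)
    (T : TCV d W) : pt h (TC.lmul (ampl W C) T) = pt h (TC.rmul (ampl W C) T) := by
  have hYZ : Y ⊆ W \ X := Finset.subset_sdiff.2 ⟨hY, hXY⟩
  rw [← ampl_ampl hYZ Finset.sdiff_subset C]
  set C' := ampl (W \ X) C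
  have : pt h ∘L TC.lmul (ampl W C') = pt h ∘L TC.rmul (ampl W C') := by
    refine TC.clm_ext_tp (Split.of_subset h) fun u w u' w' => ?_
    simp only [ContinuousLinearMap.comp_apply]
    rw [TC.lmul, TC.rmul, TC.sandwich_kb, TC.sandwich_kb, ← ampl_adjoint Finset.sdiff_subset,
      adjoint_one_eq, op_one_apply, op_one_apply, ampl_tp_right (Split.of_subset h),
      ampl_tp_right (Split.of_subset h), pt_kb_tp, pt_kb_tp,
      ContinuousLinearMap.adjoint_inner_left]
  exact DFunLike.congr_fun this T

/-- Characterizes the partial trace by duality, without reference to a basis; transitivity and the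
action on tensor products follow by testing. -/
theorem tr_lmul_pt (h : X ⊆ W) (A : Op d X) (T : TCV d W) :
    TC.tr _ (TC.lmul A (pt h T)) = TC.tr _ (TC.lmul (ampl W A) T) := by
  have : TC.tr _ ∘L TC.lmul A ∘L pt h = TC.tr _ ∘L TC.lmul (ampl W A) := by
    refine TC.clm_ext_tp (Split.of_subset h) fun u w u' w' => ?_
    simp only [ContinuousLinearMap.comp_apply]
    rw [pt_kb_tp, map_smul, map_smul, TC.lmul, TC.lmul, TC.sandwich_kb, TC.sandwich_kb,
      adjoint_one_eq, adjoint_one_eq, op_one_apply, op_one_apply, ampl_tp, TC.tr_kb, TC.tr_kb,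
      inner_tp, smul_eq_mul, mul_comm]
  exact DFunLike.congr_fun this T

theorem pt_pt {U : Finset ℕ} (h1 : X ⊆ U) (h2 : U ⊆ W) (T : TCV d W) :
    pt h1 (pt h2 T) = pt (h1.trans h2) T :=
  TC.ext_tr fun A => by rw [tr_lmul_pt, tr_lmul_pt, tr_lmul_pt, ampl_ampl h1 h2]

theorem pt_self (h : W ⊆ W) (T : TCV d W) : pt h T = T :=
  TC.ext_tr fun A => by rw [tr_lmul_pt, ampl_self]

theorem tr_pt (h : X ⊆ W) (T : TCV d W) : TC.tr _ (pt h T) = TC.tr _ T := by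
  have hone : ∀ (V : Finset ℕ) (S : TCV d V), TC.lmul 1 S = S := fun V S =>
    TC.op_injective (by rw [TC.op_lmul, one_mul])
  have := tr_lmul_pt h 1 T
  rwa [ampl_one h, hone, hone] at this

theorem tr_tens (h : Split X Z W) (S : TCV d X) (T : TCV d Z) :
    TC.tr _ (tens h S T) = TC.tr _ S * TC.tr _ T := by
  rw [← tr_pt h.left, pt_tens, map_smul, smul_eq_mul, mul_comm]

theorem lmul_tens (h : Split X Z W) (A : Op d X) (B : Op d Z) (S : TCV d X) (T : TCV d Z) :
    TC.lmul (ampl W A * ampl W B) (tens h S T) = tens h (TC.lmul A S) (TC.lmul B T) := by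
  have := tens_sandwich h A 1 B 1 S T
  rw [ampl_one h.left, ampl_one h.right, mul_one] at this
  exact this.symm

/-- The same product of two trace class operators, regarded once as a multiple of Q and once as a
multiple of B. -/
theorem tr_lmul_op_comm {H : Type} [NormedAddCommGroup H] [InnerProductSpace ℂ H] [CompleteSpace H]
    (B Q : TC H) : TC.tr _ (TC.lmul (TC.op _ B) Q) = TC.tr _ (TC.rmul (TC.op _ Q) B) := by
  congr 1

/-- The functionals B ↦ Tr B Q and B ↦ Tr B Q' are continuous in the trace norm and agree on tensor
products, which are total. Evaluated at rank one operators they give the matrix elements of Q and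
Q'. -/
theorem ext_tr_tens (h : Split X Z W) {Q Q' : TCV d W}
    (hQ : ∀ (A : Op d X) (B : Op d Z), TC.tr _ (TC.lmul (ampl W A * ampl W B) Q) =
      TC.tr _ (TC.lmul (ampl W A * ampl W B) Q')) : Q = Q' := by
  have key : TC.tr _ ∘L TC.rmul (TC.op _ Q) = TC.tr _ ∘L TC.rmul (TC.op _ Q') :=
    clm_ext_tens h fun S T => by
      rw [ContinuousLinearMap.comp_apply, ContinuousLinearMap.comp_apply, ← tr_lmul_op_comm,
        ← tr_lmul_op_comm, op_tens, hQ]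
  refine TC.op_ext_inner fun x y => ?_
  rw [← TC.tr_lmul_kb, ← TC.tr_lmul_kb, ← TC.op_kb, tr_lmul_op_comm, tr_lmul_op_comm]
  exact DFunLike.congr_fun key _

theorem pt_tens_tens {X₁ X₂ W₁ W₂ : Finset ℕ} (hW : Split W₁ W₂ W) (hX : Split X₁ X₂ X)
    (h₁ : X₁ ⊆ W₁) (h₂ : X₂ ⊆ W₂) (h : X ⊆ W) (S : TCV d W₁) (T : TCV d W₂) :
    pt h (tens hW S T) = tens hX (pt h₁ S) (pt h₂ T) := by
  refine ext_tr_tens hX fun A B => ?_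
  rw [lmul_tens, tr_tens, tr_lmul_pt, tr_lmul_pt, tr_lmul_pt, ampl_mul h, ampl_ampl hX.left h,
    ampl_ampl hX.right h, ← ampl_ampl h₁ hW.left, ← ampl_ampl h₂ hW.right, lmul_tens, tr_tens]

end Tensor


/-! ### Sums over partitions -/

section Partitions

variable {ι : Type*} [DecidableEq ι] {M : Type*} [AddCommMonoid M]

/-- The union of partitions of `T` and of `V \ T`. -/
def unionPart {T V : Finset ι} (hT : T ⊆ V) (Q₁ : Finpartition T) (Q₂ : Finpartition (V \ T)) :
    Finpartition V where
  parts := Q₁.parts ∪ Q₂.parts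
  supIndep := by
    rw [Finset.supIndep_iff_pairwiseDisjoint]
    intro B hB B' hB' hne
    have hd : ∀ B ∈ Q₁.parts, ∀ B' ∈ Q₂.parts, Disjoint B B' := fun B hB B' hB' =>
      Finset.disjoint_of_subset_left (Q₁.subset hB)
        (Finset.disjoint_of_subset_right (Q₂.subset hB') Finset.disjoint_sdiff)
    rcases Finset.mem_union.1 hB with h | h <;> rcases Finset.mem_union.1 hB' with h' | h'
    · exact Q₁.disjoint h h' hne
    · exact hd B h B' h'
    · exact (hd B' h' B h).symm
    · exact Q₂.disjoint h h' hne
  sup_parts := by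
    rw [Finset.sup_union, Q₁.sup_parts, Q₂.sup_parts]
    exact Finset.union_sdiff_of_subset hT
  bot_notMem := by
    simp only [Finset.mem_union, not_or]
    exact ⟨Q₁.bot_notMem, Q₂.bot_notMem⟩

theorem disjoint_sup_of_parts {V : Finset ι} (Q : Finpartition V) {Z Z' : Finset (Finset ι)}
    (hZ : Z ⊆ Q.parts) (hZ' : Z' ⊆ Q.parts) (h : Disjoint Z Z') :
    Disjoint (Z.sup id) (Z'.sup id) := by
  rw [Finset.disjoint_sup_left]
  intro B hB
  rw [Finset.disjoint_sup_right]
  intro B' hB'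
  refine Q.disjoint (hZ hB) (hZ' hB') ?_
  rintro rfl
  exact Finset.disjoint_left.1 h hB hB'

theorem sup_sdiff_parts {V : Finset ι} (Q : Finpartition V) {Z : Finset (Finset ι)}
    (hZ : Z ⊆ Q.parts) : (Q.parts \ Z).sup id = V \ Z.sup id := by
  have h1 : (Q.parts \ Z).sup id ⊔ Z.sup id = V := by
    rw [← Finset.sup_union, Finset.sdiff_union_of_subset hZ, Q.sup_parts]
  have h2 := disjoint_sup_of_parts Q Finset.sdiff_subset hZ Finset.sdiff_disjoint
  calc (Q.parts \ Z).sup id = ((Q.parts \ Z).sup id ∪ Z.sup id) \ Z.sup id :=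
        (Finset.union_sdiff_cancel_right h2).symm
    _ = V \ Z.sup id := congrArg (· \ Z.sup id) h1

theorem disjoint_parts_sdiff {T V : Finset ι} (Q₁ : Finpartition T) (Q₂ : Finpartition (V \ T)) :
    Disjoint Q₁.parts Q₂.parts := by
  rw [Finset.disjoint_left]
  intro B h1 h2
  obtain ⟨x, hx⟩ := Q₁.nonempty_of_mem_parts h1
  exact (Finset.mem_sdiff.1 (Q₂.subset h2 hx)).2 (Q₁.subset h1 hx)

/-- Splitting the blocks of a partition into two groups amounts to splitting the set into two
parts and partitioning each of them. -/
theorem sum_finpartition_split (V : Finset ι) (ψ : Finset (Finset ι) → Finset (Finset ι) → M) :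
    ∑ Q : Finpartition V, ∑ Z ∈ Q.parts.powerset, ψ Z (Q.parts \ Z) =
      ∑ T ∈ V.powerset, ∑ Q₁ : Finpartition T, ∑ Q₂ : Finpartition (V \ T),
        ψ Q₁.parts Q₂.parts := by
  symm
  simp_rw [← Fintype.sum_prod_type']
  rw [Finset.sum_sigma', Finset.sum_sigma']
  refine Finset.sum_bij (fun p hp => ⟨unionPart (Finset.mem_powerset.1 (Finset.mem_sigma.1 hp).1)
    p.2.1 p.2.2, p.2.1.parts⟩) ?_ ?_ ?_ ?_
  · rintro ⟨T, Q₁, Q₂⟩ hp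
    exact Finset.mem_sigma.2 ⟨Finset.mem_univ _,
      Finset.mem_powerset.2 Finset.subset_union_left⟩
  · rintro ⟨T, Q₁, Q₂⟩ hp ⟨T', Q₁', Q₂'⟩ hp' h
    simp only [Sigma.mk.injEq, heq_eq_eq] at h
    obtain ⟨h1, h2⟩ := h
    have hT : T = T' := by rw [← Q₁.sup_parts, ← Q₁'.sup_parts, h2]
    subst hT
    obtain rfl : Q₁ = Q₁' := Finpartition.ext h2
    have h3 : Q₁.parts ∪ Q₂.parts = Q₁.parts ∪ Q₂'.parts := congrArg Finpartition.parts h1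
    obtain rfl : Q₂ = Q₂' := by
      refine Finpartition.ext ?_
      rw [← Finset.union_sdiff_cancel_left (disjoint_parts_sdiff Q₁ Q₂), h3,
        Finset.union_sdiff_cancel_left (disjoint_parts_sdiff Q₁ Q₂')]
    rfl
  · rintro ⟨Q, Z⟩ hp
    have hZ : Z ⊆ Q.parts := by simpa using hp
    have hT : Z.sup id ⊆ V := by
      conv_rhs => rw [← Q.sup_parts]
      exact Finset.sup_mono hZ
    refine ⟨⟨Z.sup id, Q.ofSubset hZ rfl, Q.ofSubset Finset.sdiff_subset (sup_sdiff_parts Q hZ)⟩,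
      by simp [hT], ?_⟩
    simp only [Finpartition.ofSubset]
    congr 1
    refine Finpartition.ext ?_
    exact Finset.union_sdiff_of_subset hZ
  · rintro ⟨T, Q₁, Q₂⟩ hp
    simp only [unionPart]
    rw [Finset.union_sdiff_cancel_left (disjoint_parts_sdiff Q₁ Q₂)]

/-- Partitions with a marked block. -/
theorem sum_finpartition_marked (V : Finset ι) (φ : Finset ι → Finset (Finset ι) → M) :
    ∑ P : Finpartition V, ∑ U ∈ P.parts, φ U (P.parts.erase U) =
      ∑ U ∈ V.powerset with U.Nonempty, ∑ P : Finpartition (V \ U), φ U P.parts := by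
  symm
  rw [Finset.sum_sigma', Finset.sum_sigma']
  have hm : ∀ p ∈ (V.powerset.filter fun U => U.Nonempty).sigma
      (fun U => (Finset.univ : Finset (Finpartition (V \ U)))), p.1 ⊆ V ∧ p.1 ≠ ⊥ := by
    rintro p hp
    simp only [Finset.mem_sigma, Finset.mem_filter, Finset.mem_powerset] at hp
    exact ⟨hp.1.1, hp.1.2.ne_empty⟩
  refine Finset.sum_bij (fun p hp => ⟨unionPart (hm p hp).1
    (Finpartition.indiscrete (hm p hp).2) p.2, p.1⟩) ?_ ?_ ?_ ?_
  · rintro ⟨U, P⟩ hp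
    simp [unionPart]
  · rintro ⟨U, P⟩ hp ⟨U', P'⟩ hp' h
    simp only [Sigma.mk.injEq, heq_eq_eq] at h
    obtain ⟨h1, rfl⟩ := h
    have h3 := congrArg Finpartition.parts h1
    simp only [unionPart] at h3
    obtain rfl : P = P' := by
      refine Finpartition.ext ?_
      rw [← Finset.union_sdiff_cancel_left (disjoint_parts_sdiff
        (Finpartition.indiscrete (hm _ hp).2) P), h3,
        Finset.union_sdiff_cancel_left (disjoint_parts_sdiff _ P')]
    rfl
  · rintro ⟨P, U⟩ hp
    have hU : U ∈ P.parts := by simpa using hp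
    have hU' : {U} ⊆ P.parts := Finset.singleton_subset_iff.2 hU
    have hs := sup_sdiff_parts P hU'
    rw [Finset.sup_singleton] at hs
    refine ⟨⟨U, P.ofSubset Finset.sdiff_subset hs⟩,
      by simp [P.subset hU, P.nonempty_of_mem_parts hU], ?_⟩
    simp only [Finpartition.ofSubset]
    congr 1
    refine Finpartition.ext ?_
    exact Finset.union_sdiff_of_subset hU'
  · rintro ⟨U, P⟩ hp
    have h := Finset.union_sdiff_cancel_left (disjoint_parts_sdiff
      (Finpartition.indiscrete (hm _ hp).2) P)
    simp only [unionPart]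
    rw [← Finset.sdiff_singleton_eq_erase]
    simp only [Finpartition.indiscrete_parts] at h ⊢
    rw [h]

theorem sum_finpartition_empty (φ : Finset (Finset ι) → M) :
    ∑ P : Finpartition (∅ : Finset ι), φ P.parts = φ ∅ := by
  have : ∀ P : Finpartition (∅ : Finset ι), P.parts = ∅ := fun P =>
    Finpartition.parts_eq_empty_iff.2 rfl
  have hu : (Finset.univ : Finset (Finpartition (∅ : Finset ι))) =
      {Finpartition.empty (Finset ι)} := by
    refine Finset.eq_singleton_iff_unique_mem.2 ⟨Finset.mem_univ _, fun P _ => ?_⟩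
    exact Finpartition.ext (by rw [this P]; rfl)
  rw [hu, Finset.sum_singleton]
  rfl

theorem sum_powerset_powerset (V : Finset ι) (h : Finset ι → Finset ι → M) :
    ∑ U ∈ V.powerset, ∑ T ∈ U.powerset, h T (U \ T) =
      ∑ T ∈ V.powerset, ∑ U ∈ (V \ T).powerset, h T U := by
  rw [Finset.sum_sigma', Finset.sum_sigma']
  refine Finset.sum_bij' (fun p _ => ⟨p.2, p.1 \ p.2⟩) (fun p _ => ⟨p.1 ∪ p.2, p.1⟩) ?_ ?_ ?_ ?_ ?_
  · rintro ⟨U, T⟩ h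
    simp only [Finset.mem_sigma, Finset.mem_powerset] at h ⊢
    exact ⟨h.2.trans h.1, Finset.sdiff_subset_sdiff h.1 le_rfl⟩
  · rintro ⟨T, U⟩ h
    simp only [Finset.mem_sigma, Finset.mem_powerset] at h ⊢
    exact ⟨Finset.union_subset h.1 (h.2.trans Finset.sdiff_subset), Finset.subset_union_left⟩
  · rintro ⟨U, T⟩ h
    simp only [Finset.mem_sigma, Finset.mem_powerset] at h
    simp [Finset.union_sdiff_of_subset h.2]
  · rintro ⟨T, U⟩ h
    simp only [Finset.mem_sigma, Finset.mem_powerset] at h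
    have : Disjoint T U := (Finset.disjoint_of_subset_left h.2 Finset.sdiff_disjoint).symm
    simp [Finset.union_sdiff_cancel_left this]
  · rintro ⟨U, T⟩ h
    rfl

end Partitions

/-! ### Products of commuting families -/

section Products

variable {β A : Type*} [Ring A]

/-- The product of a family over a finite set (in the order of some enumeration). -/
def lprod (s : Finset β) (f : β → A) : A := (s.toList.map f).prod

@[simp] theorem lprod_empty (f : β → A) : lprod ∅ f = 1 := by simp [lprod]

theorem lprod_congr {s : Finset β} {f g : β → A} (h : ∀ b ∈ s, f b = g b) :
    lprod s f = lprod s g := by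
  rw [lprod, lprod, List.map_congr_left fun b hb => h b (Finset.mem_toList.1 hb)]

theorem commute_lprod {s : Finset β} {f : β → A} {x : A} (h : ∀ b ∈ s, Commute x (f b)) :
    Commute x (lprod s f) := by
  refine Commute.list_prod_right _ _ fun y hy => ?_
  obtain ⟨b, hb, rfl⟩ := List.mem_map.1 hy
  exact h b (Finset.mem_toList.1 hb)

variable [DecidableEq β]

/-- The enumeration of a finite set is arbitrary; commutation of the factors makes the product
independent of it. -/
theorem lprod_insert {s : Finset β} {b : β} {f : β → A} (hb : b ∉ s)
    (h : ∀ x ∈ insert b s, ∀ y ∈ insert b s, x ≠ y → Commute (f x) (f y)) :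
    lprod (insert b s) f = f b * lprod s f := by
  have h1 : ((insert b s).toList.map f).Perm ((b :: s.toList).map f) :=
    (Finset.toList_insert hb).map f
  rw [lprod, h1.prod_eq', List.map_cons, List.prod_cons, lprod]
  rw [List.pairwise_map]
  refine (Finset.nodup_toList _).pairwise_of_forall_ne fun x hx y hy hxy => ?_
  exact h x (Finset.mem_toList.1 hx) y (Finset.mem_toList.1 hy) hxy

theorem lprod_erase {s : Finset β} {b : β} {f : β → A} (hb : b ∈ s)
    (h : ∀ x ∈ s, ∀ y ∈ s, x ≠ y → Commute (f x) (f y)) :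
    f b * lprod (s.erase b) f = lprod s f := by
  rw [← lprod_insert (Finset.notMem_erase b s), Finset.insert_erase hb]
  rwa [Finset.insert_erase hb]

theorem lprod_mul {s : Finset β} {f g : β → A}
    (hf : ∀ x ∈ s, ∀ y ∈ s, x ≠ y → Commute (f x) (f y))
    (hg : ∀ x ∈ s, ∀ y ∈ s, x ≠ y → Commute (g x) (g y))
    (hfg : ∀ x ∈ s, ∀ y ∈ s, x ≠ y → Commute (f x) (g y)) :
    lprod s (fun b => f b * g b) = lprod s f * lprod s g := by
  induction s using Finset.induction_on with
  | empty => simp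
  | insert b s hb ih =>
    have hne : ∀ y ∈ s, b ≠ y := fun y hy h => hb (h ▸ hy)
    rw [lprod_insert hb hf, lprod_insert hb hg, lprod_insert hb, ih]
    · have : Commute (lprod s f) (g b) := (commute_lprod fun y hy =>
        (hfg y (Finset.mem_insert_of_mem hy) b (Finset.mem_insert_self _ _)
          (hne y hy).symm).symm).symm
      rw [mul_assoc, mul_assoc, ← mul_assoc (g b), ← this.eq, mul_assoc]
    · exact fun x hx y hy => hf x (Finset.mem_insert_of_mem hx) y (Finset.mem_insert_of_mem hy)
    · exact fun x hx y hy => hg x (Finset.mem_insert_of_mem hx) y (Finset.mem_insert_of_mem hy)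
    · exact fun x hx y hy => hfg x (Finset.mem_insert_of_mem hx) y (Finset.mem_insert_of_mem hy)
    · intro x hx y hy hxy
      exact ((hf x hx y hy hxy).mul_right (hfg x hx y hy hxy)).mul_left
        ((hfg y hy x hx hxy.symm).symm.mul_right (hg x hx y hy hxy))

theorem lprod_union {s t : Finset β} {f : β → A} (hst : Disjoint s t)
    (h : ∀ x ∈ s ∪ t, ∀ y ∈ s ∪ t, x ≠ y → Commute (f x) (f y)) :
    lprod (s ∪ t) f = lprod s f * lprod t f := by
  induction s using Finset.induction_on with
  | empty => simp
  | insert b s hb ih =>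
    rw [Finset.disjoint_insert_left] at hst
    rw [Finset.insert_union] at h ⊢
    have hb' : b ∉ s ∪ t := by simp [hb, hst.1]
    rw [lprod_insert hb' h, lprod_insert hb, ih hst.2, mul_assoc]
    · exact fun x hx y hy => h x (Finset.mem_insert_of_mem hx) y (Finset.mem_insert_of_mem hy)
    · exact fun x hx y hy => h x (Finset.insert_subset_insert _ Finset.subset_union_left hx) y
        (Finset.insert_subset_insert _ Finset.subset_union_left hy)

theorem lprod_biUnion {s : Finset (Finset β)} {f : β → A}
    (hs : (s : Set (Finset β)).PairwiseDisjoint id)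
    (h : ∀ x ∈ s.biUnion id, ∀ y ∈ s.biUnion id, x ≠ y → Commute (f x) (f y)) :
    lprod (s.biUnion id) f = lprod s fun Z => lprod Z f := by
  induction s using Finset.induction_on with
  | empty => simp
  | insert Z s hZ ih =>
    rw [Finset.biUnion_insert] at h ⊢
    have hd : ∀ x ∈ insert Z s, ∀ y ∈ insert Z s, x ≠ y → Disjoint x y := fun x hx y hy hxy =>
      hs (Finset.mem_coe.2 hx) (Finset.mem_coe.2 hy) hxy
    have hsub : ∀ x ∈ insert Z s, x ⊆ id Z ∪ s.biUnion id := by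
      intro x hx
      rw [← Finset.biUnion_insert]
      exact Finset.subset_biUnion_of_mem id hx
    rw [lprod_union _ h, lprod_insert hZ, ih]
    · rfl
    · exact hs.subset (by simp)
    · exact fun x hx y hy => h x (Finset.mem_union_right _ hx) y (Finset.mem_union_right _ hy)
    · intro x hx y hy hxy
      refine commute_lprod fun a ha => (commute_lprod fun b hb => ?_).symm
      exact h a (hsub y hy ha) b (hsub x hx hb)
        (fun hab => Finset.disjoint_left.1 (hd x hx y hy hxy) (hab ▸ hb) ha)
    · rw [Finset.disjoint_biUnion_right]
      exact fun y hy => hd Z (Finset.mem_insert_self _ _) y (Finset.mem_insert_of_mem hy)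
        (fun h => hZ (h ▸ hy))

end Products

/-! ### Cluster expansions -/

section Expansions

variable {ι A 𝕜 : Type*} [DecidableEq ι] [CommRing 𝕜] [Ring A] [Algebra 𝕜 A]

/-- `∑_P w(|P|) ∏_{B ∈ P} F(B)`, where `P` runs over the partitions of `V`. -/
def expSum (w : ℕ → 𝕜) (F : Finset ι → A) (V : Finset ι) : A :=
  ∑ P : Finpartition V, w P.parts.card • lprod P.parts F

theorem expSum_empty (w : ℕ → 𝕜) (F : Finset ι → A) :
    expSum w F ∅ = w 0 • 1 := by
  have := sum_finpartition_empty (ι := ι) fun P => w P.card • lprod P F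
  rw [expSum, this]
  simp

theorem commute_lprod_parts {V : Finset ι} {F : Finset ι → A}
    (hF : ∀ U ⊆ V, ∀ U' ⊆ V, Disjoint U U' → Commute (F U) (F U')) (P : Finpartition V) :
    ∀ x ∈ P.parts, ∀ y ∈ P.parts, x ≠ y → Commute (F x) (F y) := fun x hx y hy hxy =>
  hF x (P.subset hx) y (P.subset hy) (P.disjoint hx hy hxy)

/-- Isolating the block that contains a given element. -/
theorem expSum_eq_sum_mem {V : Finset ι} (w : ℕ → 𝕜) {F : Finset ι → A}
    (hF : ∀ U ⊆ V, ∀ U' ⊆ V, Disjoint U U' → Commute (F U) (F U')) {a : ι} (ha : a ∈ V) :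
    expSum w F V =
      ∑ U ∈ V.powerset, if a ∈ U then F U * expSum (fun n => w (n + 1)) F (V \ U) else 0 := by
  have h := sum_finpartition_marked V fun U P =>
    if a ∈ U then w (P.card + 1) • (F U * lprod P F) else 0
  have h1 : ∀ P : Finpartition V, (∑ U ∈ P.parts, if a ∈ U then
      w ((P.parts.erase U).card + 1) • (F U * lprod (P.parts.erase U) F) else 0) =
      w P.parts.card • lprod P.parts F := by
    intro P
    rw [Finset.sum_eq_single_of_mem (P.part a) (P.part_mem.2 ha), if_pos (P.mem_part_self.2 ha),
      lprod_erase (P.part_mem.2 ha) (commute_lprod_parts hF P),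
      Finset.card_erase_add_one (P.part_mem.2 ha)]
    intro U hU hne
    rw [if_neg]
    exact fun h => hne (P.part_eq_of_mem hU h).symm
  simp_rw [h1] at h
  rw [expSum, h, Finset.sum_filter]
  refine Finset.sum_congr rfl fun U hU => ?_
  by_cases haU : a ∈ U
  · rw [if_pos ⟨a, haU⟩, if_pos haU]
    simp only [if_pos haU, expSum]
    rw [Finset.mul_sum]
    simp
  · simp [haU]

theorem commute_expSum {V : Finset ι} (w : ℕ → 𝕜) {F : Finset ι → A} {x : A}
    (h : ∀ U ⊆ V, Commute x (F U)) : Commute x (expSum w F V) :=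
  Commute.sum_right _ _ _ fun P _ =>
    (commute_lprod fun _ hb => h _ (P.subset hb)).smul_right _

theorem expSum_congr {V : Finset ι} (w : ℕ → 𝕜) {F F' : Finset ι → A}
    (h : ∀ U ⊆ V, F U = F' U) : expSum w F V = expSum w F' V :=
  Finset.sum_congr rfl fun P _ => by rw [lprod_congr fun b hb => h b (P.subset hb)]

/-- Two-level sums: a partition of the set of the blocks of a partition. -/
theorem sum_expSum_parts (w : ℕ → 𝕜) (K : Finset (Finset ι) → A)
    (hK : ∀ Z Z', Disjoint (Z.sup id) (Z'.sup id) → Commute (K Z) (K Z')) (V : Finset ι) :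
    ∑ Q : Finpartition V, expSum w K Q.parts =
      expSum w (fun T => ∑ Q : Finpartition T, K Q.parts) V := by
  induction V using Finset.strongInduction generalizing w with
  | H V ih =>
    rcases V.eq_empty_or_nonempty with rfl | ⟨a, ha⟩
    · rw [sum_finpartition_empty fun 𝒬 => expSum w K 𝒬, expSum_empty, expSum_empty]
    · rw [expSum_eq_sum_mem w _ ha]
      -- In the inner expansion the block Z of clusters that contains the cluster of a is isolated.
      -- Choosing Q and Z then amounts to choosing T = ⋃ Z together with partitions of T and of V \
      -- T. The shifted weight n ↦ w (n + 1) is the reason for an induction with arbitrary w.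
      · have h1 : ∀ Q : Finpartition V, expSum w K Q.parts = ∑ Z ∈ Q.parts.powerset,
            if a ∈ Z.sup id then K Z * expSum (fun n => w (n + 1)) K (Q.parts \ Z) else 0 := by
          intro Q
          rw [expSum_eq_sum_mem w _ (Q.part_mem.2 ha)]
          · refine Finset.sum_congr rfl fun Z hZ => ?_
            congr 1
            rw [Finset.mem_sup, eq_iff_iff]
            constructor
            · exact fun h => ⟨_, h, Q.mem_part_self.2 ha⟩
            · rintro ⟨B, hB, haB⟩
              rwa [Q.part_eq_of_mem (Finset.mem_powerset.1 hZ hB) haB]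
          · exact fun U hU U' hU' hd => hK _ _ (disjoint_sup_of_parts Q hU hU' hd)
        simp_rw [h1]
        rw [sum_finpartition_split V fun Z Z' =>
          if a ∈ Z.sup id then K Z * expSum (fun n => w (n + 1)) K Z' else 0]
        refine Finset.sum_congr rfl fun T hT => ?_
        rw [Finset.mem_powerset] at hT
        by_cases haT : a ∈ T
        · rw [if_pos haT, ← ih _ (Finset.sdiff_ssubset hT ⟨a, haT⟩), Finset.sum_mul]
          refine Finset.sum_congr rfl fun Q₁ _ => ?_
          rw [Finset.mul_sum]
          refine Finset.sum_congr rfl fun Q₂ _ => ?_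
          rw [if_pos]
          rwa [Q₁.sup_parts]
        · rw [if_neg haT]
          refine Finset.sum_eq_zero fun Q₁ _ => Finset.sum_eq_zero fun Q₂ _ => ?_
          rw [if_neg]
          rwa [Q₁.sup_parts]
      · intro U _ U' _ hd
        refine Commute.sum_left _ _ _ fun Q _ => Commute.sum_right _ _ _ fun Q' _ => hK _ _ ?_
        rwa [Q.sup_parts, Q'.sup_parts]

/-- The weights of the inverse of an exponential. -/
def invWeight (n : ℕ) : ℂ := (-1) ^ n * (n.factorial : ℂ)

theorem cumulantWeight_succ (n : ℕ) : cumulantWeight (n + 1) = invWeight n := rfl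

variable [Algebra ℂ A]

/-- In the convolution algebra of set functions, `expSum invWeight D` is the inverse of D: it is the
series ∑ (-D₊)^n, where D₊ is D on non-empty sets and n! orders the blocks of a partition. For the
proof a block is marked in a partition with n+1 blocks, and (n+1) (-1)^n n! is minus the weight of
n+1. -/
theorem sum_expSum_invWeight_mul {D : Finset ι → A} (hD0 : D ∅ = 1) {S : Finset ι}
    (hS : S.Nonempty)
    (hD : ∀ U ⊆ S, ∀ U' ⊆ S, Disjoint U U' → Commute (D U) (D U')) :
    ∑ U ∈ S.powerset, expSum invWeight D U * D (S \ U) = 0 := by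
  have h1 : ∑ U ∈ S.powerset, expSum invWeight D U * D (S \ U) =
      ∑ U ∈ S.powerset, D U * expSum invWeight D (S \ U) := by
    refine Finset.sum_bij' (fun U _ => S \ U) (fun U _ => S \ U) (fun U _ => by simp)
      (fun U _ => by simp) (fun U hU => ?_) (fun U hU => ?_) (fun U hU => ?_)
    · simp [Finset.sdiff_sdiff_eq_self (Finset.mem_powerset.1 hU)]
    · simp [Finset.sdiff_sdiff_eq_self (Finset.mem_powerset.1 hU)]
    · rw [Finset.sdiff_sdiff_eq_self (Finset.mem_powerset.1 hU)]
      refine (Commute.eq ?_).symm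
      refine commute_expSum _ fun T hT => ?_
      exact hD _ Finset.sdiff_subset _ (hT.trans (Finset.mem_powerset.1 hU))
        (Finset.disjoint_of_subset_right hT Finset.sdiff_disjoint)
  have h2 := sum_finpartition_marked S fun U P => invWeight P.card • (D U * lprod P D)
  have h3 : ∀ P : Finpartition S, ∑ U ∈ P.parts, invWeight (P.parts.erase U).card •
      (D U * lprod (P.parts.erase U) D) = -(invWeight P.parts.card • lprod P.parts D) := by
    intro P
    rw [Finset.sum_congr rfl (g := fun _ => invWeight (P.parts.card - 1) • lprod P.parts D)]
    · rw [Finset.sum_const, ← Nat.cast_smul_eq_nsmul ℂ, smul_smul, ← neg_smul]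
      congr 1
      obtain ⟨n, hn⟩ : ∃ n, P.parts.card = n + 1 :=
        Nat.exists_eq_succ_of_ne_zero (Finset.card_pos.2 (P.parts_nonempty hS.ne_empty)).ne'
      rw [hn, invWeight, invWeight, Nat.add_sub_cancel, Nat.factorial_succ]
      push_cast
      ring
    · intro U hU
      rw [lprod_erase hU (commute_lprod_parts hD P), Finset.card_erase_of_mem hU]
  rw [h1, ← Finset.sum_filter_add_sum_filter_not _ fun U : Finset ι => U.Nonempty]
  have h4 : ∑ U ∈ S.powerset with U.Nonempty, D U * expSum invWeight D (S \ U) =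
      -expSum invWeight D S := by
    simp_rw [h3] at h2
    rw [Finset.sum_neg_distrib] at h2
    rw [expSum, h2]
    refine Finset.sum_congr rfl fun U _ => ?_
    rw [expSum, Finset.mul_sum]
    simp
  have h5 : S.powerset.filter (fun U => ¬U.Nonempty) = {∅} := by
    ext U
    simp only [Finset.mem_filter, Finset.mem_powerset, Finset.not_nonempty_iff_eq_empty,
      Finset.mem_singleton]
    constructor
    · exact fun h => h.2
    · rintro rfl
      simp
  rw [h4, h5, Finset.sum_singleton, hD0, Finset.sdiff_empty, one_mul, neg_add_cancel]

/-- A function is the exponential of its logarithm. -/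
theorem eq_sum_expSum_cumulantWeight_mul {D : Finset ι → A} (hD0 : D ∅ = 1) {V : Finset ι}
    (hD : ∀ U ⊆ V, ∀ U' ⊆ V, Disjoint U U' → Commute (D U) (D U')) {a : ι} (ha : a ∈ V) :
    D V = ∑ U ∈ V.powerset, if a ∈ U then expSum cumulantWeight D U * D (V \ U) else 0 := by
  -- Isolating the block T of a turns the logarithm on U into D(T) times the convolution inverse on
  -- U \ T. Summed over U, the inverse meets D on V \ T, and only T = V remains.
  have h1 : ∀ U ∈ V.powerset, (if a ∈ U then expSum cumulantWeight D U * D (V \ U) else 0) =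
      ∑ T ∈ U.powerset, if a ∈ T then D T * (expSum invWeight D (U \ T) *
        D ((V \ T) \ (U \ T))) else 0 := by
    intro U hU
    rw [Finset.mem_powerset] at hU
    by_cases haU : a ∈ U
    · rw [if_pos haU, expSum_eq_sum_mem _ _ haU, Finset.sum_mul]
      · refine Finset.sum_congr rfl fun T hT => ?_
        rw [Finset.mem_powerset] at hT
        by_cases haT : a ∈ T
        · rw [if_pos haT, if_pos haT, mul_assoc]
          have : (V \ T) \ (U \ T) = V \ U := by
            ext x
            simp only [Finset.mem_sdiff]
            constructor
            · rintro ⟨⟨h1, h2⟩, h3⟩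
              exact ⟨h1, fun h => h3 ⟨h, h2⟩⟩
            · rintro ⟨h1, h2⟩
              exact ⟨⟨h1, fun h => h2 (hT h)⟩, fun h => h2 h.1⟩
          rw [this]
          rfl
        · rw [if_neg haT, if_neg haT, zero_mul]
      · exact fun T hT T' hT' => hD T (hT.trans hU) T' (hT'.trans hU)
    · rw [if_neg haU]
      refine (Finset.sum_eq_zero fun T hT => ?_).symm
      rw [if_neg]
      exact fun h => haU (Finset.mem_powerset.1 hT h)
  rw [Finset.sum_congr rfl h1, sum_powerset_powerset V fun T U =>
    if a ∈ T then D T * (expSum invWeight D U * D ((V \ T) \ U)) else 0]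
  rw [Finset.sum_eq_single_of_mem V (Finset.mem_powerset_self V)]
  · rw [Finset.sdiff_self, Finset.powerset_empty, Finset.sum_singleton, if_pos ha, expSum_empty,
      Finset.sdiff_self, hD0]
    simp [invWeight]
  · intro T hT hne
    rw [Finset.mem_powerset] at hT
    by_cases haT : a ∈ T
    · simp only [if_pos haT]
      rw [← Finset.mul_sum, sum_expSum_invWeight_mul hD0, mul_zero]
      · rw [Finset.sdiff_nonempty]
        exact fun h => hne (hT.antisymm h)
      · exact fun U hU U' hU' => hD U (hU.trans Finset.sdiff_subset) U'
          (hU'.trans Finset.sdiff_subset)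
    · simp [haT]

end Expansions

/-! ### Sums of weights over partitions -/

section Weights

variable {ι : Type*} [DecidableEq ι]

/-- The convolution inverse of the constant function 1 is (-1)^|S|: both have vanishing sums over
the subsets of a non-empty set, and this recursion determines them. -/
theorem sum_invWeight (S : Finset ι) :
    ∑ P : Finpartition S, invWeight P.parts.card = (-1) ^ S.card := by
  have key : ∀ S : Finset ι, expSum invWeight (fun _ => (1 : ℂ)) S = (-1) ^ S.card := by
    intro S
    induction S using Finset.strongInduction with
    | H S ih =>
      rcases S.eq_empty_or_nonempty with rfl | hS
      · rw [expSum_empty]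
        simp [invWeight]
      · have h1 := sum_expSum_invWeight_mul (D := fun _ : Finset ι => (1 : ℂ)) rfl hS
          (fun _ _ _ _ _ => Commute.all _ _)
        have h2 : ∑ U ∈ S.powerset, ((-1 : ℂ)) ^ U.card = 0 := by
          have := Finset.sum_powerset_neg_one_pow_card_of_nonempty hS
          exact_mod_cast this
        simp only [mul_one] at h1
        rw [← Finset.add_sum_erase _ _ (Finset.mem_powerset_self S)] at h1 h2
        rw [Finset.sum_congr rfl fun U hU => ih U ?_] at h1
        · exact add_right_cancel (h1.trans h2.symm)
        · rw [Finset.mem_erase, Finset.mem_powerset] at hU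
          exact hU.2.ssubset_of_ne hU.1
  rw [← key, expSum]
  refine Finset.sum_congr rfl fun P _ => ?_
  simp [lprod]

/-- With the block of a fixed, the weight of n further blocks is `invWeight n`, and `sum_invWeight`
adds these up over the partitions of the rest. This collapses the sum over P in the nonlinear
cumulant as soon as the summands depend only on the block of Y. -/
theorem sum_cumulantWeight_part {M : Type*} [AddCommGroup M] [Module ℂ M] {S : Finset ι} {a : ι}
    (ha : a ∈ S) (h : Finset ι → M) :
    ∑ P : Finpartition S, cumulantWeight P.parts.card • h (P.part a) =
      ∑ U ∈ S.powerset, if a ∈ U then ((-1 : ℂ) ^ (S \ U).card) • h U else 0 := by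
  have h1 := sum_finpartition_marked S fun U P =>
    if a ∈ U then cumulantWeight (P.card + 1) • h U else 0
  have h2 : ∀ P : Finpartition S, (∑ U ∈ P.parts, if a ∈ U then
      cumulantWeight ((P.parts.erase U).card + 1) • h U else 0) =
      cumulantWeight P.parts.card • h (P.part a) := by
    intro P
    rw [Finset.sum_eq_single_of_mem (P.part a) (P.part_mem.2 ha), if_pos (P.mem_part_self.2 ha),
      Finset.card_erase_add_one (P.part_mem.2 ha)]
    intro U hU hne
    rw [if_neg]
    exact fun h => hne (P.part_eq_of_mem hU h).symm
  simp_rw [h2] at h1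
  rw [h1, Finset.sum_filter]
  refine Finset.sum_congr rfl fun U hU => ?_
  by_cases haU : a ∈ U
  · rw [if_pos ⟨a, haU⟩, if_pos haU]
    simp only [if_pos haU]
    rw [← Finset.sum_smul]
    simp_rw [cumulantWeight_succ]
    rw [sum_invWeight]
  · simp [haU]

/-- The exponential generating function of the left-hand sides is 1/(1 - b(e^x - 1)), and the
hypothesis says that y does not exceed its pole. Marking a block gives a recursion in the number of
elements; the induction closes because ∑ y^k/k! over k ≥ 1 is at most e^y - 1. -/
theorem sum_factorial_mul_pow_le {b y : ℝ} (hb : 0 ≤ b) (hy : 0 < y)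
    (h : b * (Real.exp y - 1) ≤ 1) (V : Finset ι) :
    ∑ P : Finpartition V, (P.parts.card.factorial : ℝ) * b ^ P.parts.card ≤
      V.card.factorial * (y⁻¹) ^ V.card := by
  induction V using Finset.strongInduction with
  | H V ih =>
    rcases V.eq_empty_or_nonempty with rfl | hV
    · rw [sum_finpartition_empty fun P => (P.card.factorial : ℝ) * b ^ P.card]
      simp
    · have h1 := sum_finpartition_marked V fun _ P => b * ((P.card.factorial : ℝ) * b ^ P.card)
      have h2 : ∀ P : Finpartition V, ∑ U ∈ P.parts, b * (((P.parts.erase U).card.factorial : ℝ) *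
          b ^ (P.parts.erase U).card) = (P.parts.card.factorial : ℝ) * b ^ P.parts.card := by
        intro P
        obtain ⟨n, hn⟩ : ∃ n, P.parts.card = n + 1 :=
          Nat.exists_eq_succ_of_ne_zero (Finset.card_pos.2 (P.parts_nonempty hV.ne_empty)).ne'
        rw [Finset.sum_congr rfl (g := fun _ => b * ((n.factorial : ℝ) * b ^ n))]
        · rw [Finset.sum_const, hn, Nat.factorial_succ]
          push_cast [nsmul_eq_mul]
          ring
        · intro U hU
          rw [Finset.card_erase_of_mem hU, hn, Nat.add_sub_cancel]
      simp_rw [h2] at h1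
      rw [h1]
      have h3 : ∀ U ∈ V.powerset.filter (fun U => U.Nonempty),
          ∑ P : Finpartition (V \ U), b * ((P.parts.card.factorial : ℝ) * b ^ P.parts.card) ≤
          (fun k => b * (((V.card - k).factorial : ℝ) * (y⁻¹) ^ (V.card - k)) *
            if k = 0 then 0 else 1) U.card := by
        intro U hU
        rw [Finset.mem_filter, Finset.mem_powerset] at hU
        rw [← Finset.mul_sum]
        have := ih _ (Finset.sdiff_ssubset hU.1 hU.2)
        rw [Finset.card_sdiff_of_subset hU.1] at this
        simp only [(Finset.card_pos.2 hU.2).ne', if_false, mul_one]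
        gcongr
      refine (Finset.sum_le_sum h3).trans ?_
      have h4 : ∑ U ∈ V.powerset with U.Nonempty,
          (fun k => b * (((V.card - k).factorial : ℝ) * (y⁻¹) ^ (V.card - k)) *
            if k = 0 then 0 else 1) U.card ≤ ∑ U ∈ V.powerset,
          (fun k => b * (((V.card - k).factorial : ℝ) * (y⁻¹) ^ (V.card - k)) *
            if k = 0 then 0 else 1) U.card := by
        refine Finset.sum_le_sum_of_subset_of_nonneg (Finset.filter_subset _ _) fun U _ _ => ?_
        positivity
      refine h4.trans ?_
      rw [Finset.sum_powerset_apply_card fun k => b * (((V.card - k).factorial : ℝ) *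
        (y⁻¹) ^ (V.card - k)) * if k = 0 then 0 else 1]
      set n := V.card
      have h5 : ∀ k ∈ Finset.range (n + 1), n.choose k • (b * (((n - k).factorial : ℝ) *
          (y⁻¹) ^ (n - k)) * if k = 0 then 0 else 1) =
          (n.factorial * (y⁻¹) ^ n * b) * ((y ^ k / k.factorial) - if k = 0 then 1 else 0) := by
        intro k hk
        have hk' : k ≤ n := Nat.lt_succ_iff.1 (Finset.mem_range.1 hk)
        by_cases hk0 : k = 0
        · simp [hk0]
        · have hc := Nat.choose_mul_factorial_mul_factorial hk'
          have hc' : (n.choose k : ℝ) * k.factorial * (n - k).factorial = n.factorial := by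
            exact_mod_cast hc
          have hp : (y⁻¹) ^ n * y ^ k = (y⁻¹) ^ (n - k) := by
            obtain ⟨m, hm⟩ := Nat.exists_eq_add_of_le hk'
            rw [hm, Nat.add_sub_cancel_left, pow_add, mul_comm ((y⁻¹) ^ k), mul_assoc, ← mul_pow,
              inv_mul_cancel₀ hy.ne', one_pow, mul_one]
          have hkf : (k.factorial : ℝ) ≠ 0 := by positivity
          simp only [hk0, if_false, nsmul_eq_mul, sub_zero, mul_one]
          rw [← hc', ← hp]
          field_simp
      rw [Finset.sum_congr rfl h5, ← Finset.mul_sum, Finset.sum_sub_distrib]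
      have h6 : ∑ k ∈ Finset.range (n + 1), y ^ k / (k.factorial : ℝ) ≤ Real.exp y :=
        Real.sum_le_exp_of_nonneg hy.le _
      have h7 : ∑ k ∈ Finset.range (n + 1), (if k = 0 then (1 : ℝ) else 0) = 1 := by
        simp
      rw [h7]
      calc (n.factorial * (y⁻¹) ^ n * b) * (∑ k ∈ Finset.range (n + 1),
            y ^ k / (k.factorial : ℝ) - 1)
          ≤ (n.factorial * (y⁻¹) ^ n * b) * (Real.exp y - 1) := by gcongr
        _ = (n.factorial * (y⁻¹) ^ n) * (b * (Real.exp y - 1)) := by ring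
        _ ≤ (n.factorial * (y⁻¹) ^ n) * 1 := by gcongr
        _ = _ := mul_one _

/-- The previous bound is used twice: for the partitions R with b = 1, y = 1/2, permitted by √e ≤ 2,
it gives |Q|! 2^|Q|; for the partitions Q with b = 2c, y = 3 it gives the claim. These choices
account for the constant 2e³ of the theorem. -/
theorem sum_sum_factorial_le {c : ℝ} (hc : 0 ≤ c) (h : 2 * c * (Real.exp 3 - 1) ≤ 1)
    (V : Finset ι) :
    ∑ Q : Finpartition V, ∑ R : Finpartition Q.parts,
      ((R.parts.card - 1).factorial : ℝ) * c ^ Q.parts.card ≤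
      V.card.factorial * (3⁻¹) ^ V.card := by
  refine le_trans ?_ (sum_factorial_mul_pow_le (by positivity) (by norm_num) h V)
  refine Finset.sum_le_sum fun Q _ => ?_
  rw [← Finset.sum_mul, mul_pow, ← mul_assoc]
  refine mul_le_mul_of_nonneg_right ?_ (by positivity)
  have h2 : (1 : ℝ) * (Real.exp (2⁻¹) - 1) ≤ 1 := by
    have : Real.exp (2⁻¹) ≤ 2 := by
      rw [← Real.le_log_iff_exp_le (by norm_num)]
      have := Real.log_two_gt_d9
      linarith
    linarith
  have h3 := sum_factorial_mul_pow_le zero_le_one (by norm_num) h2 Q.parts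
  rw [inv_inv] at h3
  refine le_trans (Finset.sum_le_sum fun R _ => ?_) h3
  rw [one_pow, mul_one]
  exact_mod_cast Nat.factorial_le (Nat.sub_le _ _)

end Weights


/-! ### Multiplication operators -/

section Multiplication

variable {X W : Finset ℕ}

open Classical in
/-- Multiplication by an essentially bounded complex function. -/
def multOp (m : Conf d W → ℂ) : Op d W :=
  if hm : MemLp m ⊤ (volume : Measure (Conf d W)) then
    (ContinuousLinearMap.mul ℂ ℂ).holderL volume ⊤ 2 2 (hm.toLp _)
  else 0

/-- Bounded measurable functions. -/
structure IsBdd (m : Conf d W → ℂ) : Prop where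
  meas : Measurable m
  bdd : ∃ C, ∀ q, ‖m q‖ ≤ C

theorem IsBdd.memLp {m : Conf d W → ℂ} (hm : IsBdd m) :
    MemLp m ⊤ (volume : Measure (Conf d W)) := by
  obtain ⟨C, hC⟩ := hm.bdd
  exact memLp_top_of_bound hm.meas.aestronglyMeasurable C (Eventually.of_forall hC)

theorem IsBdd.const (c : ℂ) : IsBdd (fun _ : Conf d W => c) :=
  ⟨measurable_const, ‖c‖, fun _ => le_rfl⟩

theorem IsBdd.mul {m m' : Conf d W → ℂ} (hm : IsBdd m) (hm' : IsBdd m') :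
    IsBdd fun q => m q * m' q := by
  obtain ⟨C, hC⟩ := hm.bdd
  obtain ⟨C', hC'⟩ := hm'.bdd
  refine ⟨hm.meas.mul hm'.meas, C * C', fun q => ?_⟩
  rw [norm_mul]
  exact mul_le_mul (hC q) (hC' q) (norm_nonneg _) ((norm_nonneg _).trans (hC q))

theorem IsBdd.comp {m : Conf d X → ℂ} (hm : IsBdd m) {f : Conf d W → Conf d X}
    (hf : Measurable f) : IsBdd fun q => m (f q) :=
  ⟨hm.meas.comp hf, hm.bdd.imp fun _ hC q => hC (f q)⟩

theorem IsBdd.conj {m : Conf d W → ℂ} (hm : IsBdd m) : IsBdd fun q => starRingEnd ℂ (m q) :=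
  ⟨Complex.continuous_conj.measurable.comp hm.meas, hm.bdd.imp fun _ hC q => by
    simpa using hC q⟩

theorem coeFn_multOp {m : Conf d W → ℂ} (hm : IsBdd m) (u : L2 d W) :
    multOp m u =ᵐ[volume] fun q => m q * u q := by
  rw [multOp, dif_pos hm.memLp, ContinuousLinearMap.holderL_apply_apply]
  filter_upwards [ContinuousLinearMap.coeFn_holder (r := 2) (ContinuousLinearMap.mul ℂ ℂ)
    (hm.memLp.toLp _) u, hm.memLp.coeFn_toLp] with q h1 h2
  rw [h1, h2, ContinuousLinearMap.mul_apply']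

theorem norm_multOp_apply_le {m : Conf d W → ℂ} (hm : IsBdd m) {C : ℝ}
    (h : ∀ q, ‖m q‖ ≤ C) (u : L2 d W) : ‖multOp m u‖ ≤ C * ‖u‖ := by
  refine Lp.norm_le_mul_norm_of_ae_le_mul ?_
  filter_upwards [coeFn_multOp hm u] with q h1
  rw [h1, norm_mul]
  exact mul_le_mul_of_nonneg_right (h q) (norm_nonneg _)

theorem multOp_mul {m m' : Conf d W → ℂ} (hm : IsBdd m) (hm' : IsBdd m') :
    multOp m * multOp m' = multOp fun q => m q * m' q := by
  ext1 u
  refine Lp.ext ?_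
  rw [op_mul_apply]
  filter_upwards [coeFn_multOp hm (multOp m' u), coeFn_multOp hm' u,
    coeFn_multOp (hm.mul hm') u] with q h1 h2 h3
  rw [h1, h2, h3, mul_assoc]

theorem multOp_one : multOp (fun _ : Conf d W => (1 : ℂ)) = 1 := by
  ext1 u
  refine Lp.ext ?_
  filter_upwards [coeFn_multOp (IsBdd.const 1) u] with q h1
  rw [h1, one_mul, op_one_apply]

theorem adjoint_multOp {m : Conf d W → ℂ} (hm : IsBdd m) :
    ContinuousLinearMap.adjoint (multOp m) = multOp fun q => starRingEnd ℂ (m q) := by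
  symm
  rw [ContinuousLinearMap.eq_adjoint_iff]
  intro u v
  rw [L2.inner_def, L2.inner_def]
  refine integral_congr_ae ?_
  filter_upwards [coeFn_multOp hm.conj u, coeFn_multOp hm v] with q h1 h2
  rw [h1, h2]
  simp only [RCLike.inner_apply, map_mul, RingHomCompTriple.comp_apply, RingHom.id_apply]
  ring

theorem ampl_multOp (h : X ⊆ W) {m : Conf d X → ℂ} (hm : IsBdd m) :
    ampl W (multOp m) = multOp fun q => m (restr h q) := by
  refine ampl_unique (Split.of_subset h) fun u w => Lp.ext ?_
  filter_upwards [coeFn_multOp (hm.comp (measurable_restr h)) (tp (Split.of_subset h) u w),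
    coeFn_tp (Split.of_subset h) u w, coeFn_tp (Split.of_subset h) (multOp m u) w,
    (quasiMeasurePreserving_restr h).ae (coeFn_multOp hm u)] with q h1 h2 h3 h4
  rw [h1, h2, h3, h4, mul_assoc]

end Multiplication

/-! ### Pair potentials -/

/-- Bounded symmetric two-body potentials. -/
structure IsPot (Φ : Pos d → Pos d → ℝ) : Prop where
  meas : Measurable (Function.uncurry Φ)
  symm : ∀ q q', Φ q q' = Φ q' q
  bdd : ∃ C, ∀ q q', |Φ q q'| ≤ C

section Potential

variable {Φ : Pos d → Pos d → ℝ} {X W : Finset ℕ}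

theorem measurable_pos (i : ℕ) : Measurable (pos (d := d) (W := W) i) := by
  refine (WithLp.measurable_toLp 2 _).comp (measurable_pi_lambda _ fun k => ?_)
  by_cases h : i ∈ W
  · simp only [h, dif_pos]
    exact (measurable_pi_apply ((⟨i, h⟩, k) : W × Fin d)).comp (WithLp.measurable_ofLp 2 _)
  · simp only [h, dif_neg, not_false_eq_true]
    exact measurable_const

theorem IsPot.isBdd (hΦ : IsPot Φ) (i j : ℕ) :
    IsBdd fun q : Conf d W => ((Φ (pos i q) (pos j q) : ℝ) : ℂ) := by
  refine ⟨Complex.measurable_ofReal.comp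
    (hΦ.meas.comp ((measurable_pos i).prodMk (measurable_pos j))), ?_⟩
  obtain ⟨C, hC⟩ := hΦ.bdd
  exact ⟨C, fun q => by simpa using hC _ _⟩

theorem pairOp_eq (Φ : Pos d → Pos d → ℝ) (W : Finset ℕ) (i j : ℕ) :
    pairOp Φ W i j = multOp fun q => ((Φ (pos i q) (pos j q) : ℝ) : ℂ) := rfl

theorem pairOp_comm (hΦ : IsPot Φ) (W : Finset ℕ) (i j : ℕ) :
    pairOp Φ W i j = pairOp Φ W j i := by
  rw [pairOp_eq, pairOp_eq]
  simp_rw [hΦ.symm]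

theorem adjoint_pairOp (hΦ : IsPot Φ) (i j : ℕ) :
    ContinuousLinearMap.adjoint (pairOp Φ W i j) = pairOp Φ W i j := by
  rw [pairOp_eq, adjoint_multOp (hΦ.isBdd i j)]
  simp

theorem pos_restr (h : X ⊆ W) {i : ℕ} (hi : i ∈ X) (q : Conf d W) :
    pos i (restr h q) = pos i q := by
  simp [pos, restr, hi, h hi]

theorem ampl_pairOp (hΦ : IsPot Φ) (h : X ⊆ W) {i j : ℕ} (hi : i ∈ X) (hj : j ∈ X) :
    ampl W (pairOp Φ X i j) = pairOp Φ W i j := by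
  rw [pairOp_eq, ampl_multOp h (hΦ.isBdd i j)]
  simp_rw [pos_restr h hi, pos_restr h hj]
  rfl

end Potential

/-! ### Relabelling -/

section Relabel

variable {X X' X'' W W' Z Z' : Finset ℕ}

theorem coeFn_relabelVec (e : X ≃ X') (u : L2 d X) :
    relabelVec e u =ᵐ[volume] fun q => u ((relabelConf (d := d) e).symm q) :=
  Lp.coeFn_compMeasurePreserving _ _

theorem relabelConf_symm_apply (e : X ≃ X') (q : Conf d X') (p : X × Fin d) :
    (relabelConf (d := d) e).symm q p = q (e p.1, p.2) := by
  rw [relabelConf, LinearIsometryEquiv.piLpCongrLeft_symm,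
    LinearIsometryEquiv.piLpCongrLeft_apply]
  rfl

theorem relabelVec_trans (e : X ≃ X') (f : X' ≃ X'') (u : L2 d X) :
    relabelVec f (relabelVec e u) = relabelVec (e.trans f) u := by
  refine Lp.ext ?_
  filter_upwards [coeFn_relabelVec f (relabelVec e u), coeFn_relabelVec (e.trans f) u,
    (relabelConf (d := d) f).symm.measurePreserving.quasiMeasurePreserving.ae
      (coeFn_relabelVec e u)] with q h1 h2 h3
  rw [h1, h3, h2]
  congr 1
  ext p
  simp only [relabelConf_symm_apply, Equiv.trans_apply]

theorem relabelVec_refl (u : L2 d X) : relabelVec (Equiv.refl X) u = u := by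
  refine Lp.ext ?_
  filter_upwards [coeFn_relabelVec (Equiv.refl X) u] with q h1
  rw [h1]
  congr 1

theorem relabelVec_symm_apply (e : X ≃ X') (u : L2 d X) :
    relabelVec e.symm (relabelVec e u) = u := by
  rw [relabelVec_trans, Equiv.self_trans_symm, relabelVec_refl]

theorem relabelVec_apply_symm (e : X ≃ X') (u : L2 d X') :
    relabelVec e (relabelVec e.symm u) = u := by
  rw [relabelVec_trans, Equiv.symm_trans_self, relabelVec_refl]

theorem inner_relabelVec (e : X ≃ X') (u v : L2 d X) :
    ⟪relabelVec e u, relabelVec e v⟫_ℂ = ⟪u, v⟫_ℂ :=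
  LinearIsometry.inner_map_map _ u v

theorem norm_relabelVec (e : X ≃ X') (u : L2 d X) : ‖relabelVec e u‖ = ‖u‖ :=
  LinearIsometry.norm_map _ u

theorem adjoint_relabelVec (e : X ≃ X') :
    ContinuousLinearMap.adjoint (relabelVec (d := d) e) = relabelVec e.symm := by
  symm
  rw [ContinuousLinearMap.eq_adjoint_iff]
  intro u v
  rw [← inner_relabelVec e, relabelVec_apply_symm]

theorem relabelOp_apply (e : X ≃ X') (A : Op d X) (u : L2 d X') :
    relabelOp e A u = relabelVec e (A (relabelVec e.symm u)) := by
  rw [relabelOp, adjoint_relabelVec]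
  rfl

theorem relabelOp_apply_relabelVec (e : X ≃ X') (A : Op d X) (u : L2 d X) :
    relabelOp e A (relabelVec e u) = relabelVec e (A u) := by
  rw [relabelOp_apply, relabelVec_symm_apply]

theorem relabelOp_trans (e : X ≃ X') (f : X' ≃ X'') (A : Op d X) :
    relabelOp f (relabelOp e A) = relabelOp (e.trans f) A := by
  ext1 u
  rw [relabelOp_apply, relabelOp_apply, relabelOp_apply, relabelVec_trans, relabelVec_trans]
  rfl

theorem relabelOp_refl (A : Op d X) : relabelOp (Equiv.refl X) A = A := by
  ext1 u
  rw [relabelOp_apply, relabelVec_refl]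
  exact congrArg A (relabelVec_refl u)

theorem relabelOp_mul (e : X ≃ X') (A B : Op d X) :
    relabelOp e (A * B) = relabelOp e A * relabelOp e B := by
  ext1 u
  rw [op_mul_apply, relabelOp_apply, relabelOp_apply, relabelOp_apply, relabelVec_symm_apply,
    op_mul_apply]

theorem relabelOp_one (e : X ≃ X') : relabelOp e (1 : Op d X) = 1 := by
  ext1 u
  rw [relabelOp_apply, op_one_apply, relabelVec_apply_symm, op_one_apply]

theorem relabelOp_add (e : X ≃ X') (A B : Op d X) :
    relabelOp e (A + B) = relabelOp e A + relabelOp e B := by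
  ext1 u
  simp only [add_apply, relabelOp_apply, map_add]

theorem relabelOp_smul (e : X ≃ X') (c : ℂ) (A : Op d X) :
    relabelOp e (c • A) = c • relabelOp e A := by
  ext1 u
  simp only [smul_apply, relabelOp_apply, map_smul]

theorem relabelOp_multOp (e : X ≃ X') {m : Conf d X → ℂ} (hm : IsBdd m) :
    relabelOp e (multOp m) = multOp fun q => m ((relabelConf (d := d) e).symm q) := by
  ext1 u
  refine Lp.ext ?_
  have hq := (relabelConf (d := d) e).symm.measurePreserving.quasiMeasurePreserving
  have hc := coeFn_relabelVec e (relabelVec e.symm u)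
  rw [relabelVec_apply_symm] at hc
  filter_upwards [coeFn_multOp (hm.comp (f := (relabelConf (d := d) e).symm)
      (relabelConf (d := d) e).symm.continuous.measurable) u,
    coeFn_relabelVec e (multOp m (relabelVec e.symm u)),
    hq.ae (coeFn_multOp hm (relabelVec e.symm u)), hc] with q h1 h2 h3 h4
  rw [relabelOp_apply, h1, h2, h3, h4]

/-- The permutation `σ` maps `X` onto `X'`. -/
def Maps (σ : Equiv.Perm ℕ) (X X' : Finset ℕ) : Prop := ∀ a, a ∈ X ↔ σ a ∈ X'

/-- The bijection of `X` with `X'` given by a permutation. -/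
def Maps.equiv {σ : Equiv.Perm ℕ} (h : Maps σ X X') : X ≃ X' := σ.subtypeEquiv h

variable {σ : Equiv.Perm ℕ}

theorem Maps.equiv_apply (h : Maps σ X X') (x : X) : (h.equiv x : ℕ) = σ x := rfl

theorem Maps.symm (h : Maps σ X X') : Maps σ.symm X' X := fun a => by
  rw [h, Equiv.apply_symm_apply]

theorem maps_map (σ : Equiv.Perm ℕ) (X : Finset ℕ) : Maps σ X (X.map σ.toEmbedding) :=
  fun a => by simp

theorem Maps.eq_map (h : Maps σ X X') : X' = X.map σ.toEmbedding := by
  ext a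
  rw [Finset.mem_map_equiv, h, Equiv.apply_symm_apply]

theorem Maps.sdiff (hW : Maps σ W W') (hX : Maps σ X X') : Maps σ (W \ X) (W' \ X') := fun a => by
  rw [Finset.mem_sdiff, Finset.mem_sdiff, hW a, hX a]

theorem Maps.inter (hW : Maps σ W W') (hX : Maps σ X X') : Maps σ (W ∩ X) (W' ∩ X') := fun a => by
  rw [Finset.mem_inter, Finset.mem_inter, hW a, hX a]

theorem Maps.union (hW : Maps σ W W') (hX : Maps σ X X') : Maps σ (W ∪ X) (W' ∪ X') := fun a => by
  rw [Finset.mem_union, Finset.mem_union, hW a, hX a]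

theorem Maps.subset (hW : Maps σ W W') (hX : Maps σ X X') (h : X ⊆ W) : X' ⊆ W' := fun a ha => by
  have := (hX.symm a).1 ha
  have := (hW _).1 (h this)
  rwa [Equiv.apply_symm_apply] at this

theorem Maps.split (hX : Maps σ X X') (hZ : Maps σ Z Z') (hW : Maps σ W W') (h : Split X Z W) :
    Split X' Z' W' := by
  refine ⟨hW.subset hX h.left, ?_⟩
  rw [hX.eq_map, hW.eq_map, hZ.eq_map, h.eq, Finset.map_eq_image, Finset.map_eq_image,
    Finset.map_eq_image]
  exact Finset.image_sdiff _ _ σ.injective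

/-- Finite bijections of labels extend to permutations of ℕ by multiple transitivity. A global
permutation relabels all subsets and supersets coherently. -/
theorem exists_maps (e : X ≃ X') :
    ∃ σ : Equiv.Perm ℕ, ∃ h : Maps σ X X', h.equiv = e := by
  let n := Fintype.card X
  let x : Fin n ↪ ℕ := (Fintype.equivFin X).symm.toEmbedding.trans (Function.Embedding.subtype _)
  let y : Fin n ↪ ℕ := ((Fintype.equivFin X).symm.trans e).toEmbedding.trans
    (Function.Embedding.subtype _)
  obtain ⟨σ, hσ⟩ := (Equiv.Perm.isMultiplyPretransitive ℕ n).exists_smul_eq x y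
  have h1 : ∀ a : X, σ a = e a := by
    intro a
    have := congrArg (fun z : Fin n ↪ ℕ => z (Fintype.equivFin X a)) hσ
    simpa [x, y] using this
  have h2 : Maps σ X X' := by
    intro a
    constructor
    · intro ha
      rw [h1 ⟨a, ha⟩]
      exact (e _).2
    · intro ha
      have h3 := h1 (e.symm ⟨σ a, ha⟩)
      rw [Equiv.apply_symm_apply] at h3
      rw [← σ.injective h3]
      exact (e.symm _).2
  exact ⟨σ, h2, Equiv.ext fun a => Subtype.ext (h1 a)⟩

theorem restr_relabelConf_symm (hX : Maps σ X X') (hW : Maps σ W W') (h : X ⊆ W) (q : Conf d W') :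
    restr h ((relabelConf (d := d) hW.equiv).symm q) =
      (relabelConf (d := d) hX.equiv).symm (restr (hW.subset hX h) q) := by
  ext p
  simp only [relabelConf_symm_apply, restr]
  rfl

theorem relabelVec_tp (hX : Maps σ X X') (hZ : Maps σ Z Z') (hW : Maps σ W W')
    (h : Split X Z W) (u : L2 d X) (w : L2 d Z) :
    relabelVec hW.equiv (tp h u w) =
      tp (hX.split hZ hW h) (relabelVec hX.equiv u) (relabelVec hZ.equiv w) := by
  refine Lp.ext ?_
  have h' := hX.split hZ hW h
  filter_upwards [coeFn_relabelVec hW.equiv (tp h u w),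
    coeFn_tp h' (relabelVec hX.equiv u) (relabelVec hZ.equiv w),
    (relabelConf (d := d) hW.equiv).symm.measurePreserving.quasiMeasurePreserving.ae
      (coeFn_tp h u w),
    (quasiMeasurePreserving_restr h'.left).ae (coeFn_relabelVec hX.equiv u),
    (quasiMeasurePreserving_restr h'.right).ae (coeFn_relabelVec hZ.equiv w)] with q h1 h2 h3 h4 h5
  rw [h1, h2, h3, h4, h5, restr_relabelConf_symm hX hW h.left,
    restr_relabelConf_symm hZ hW h.right]

theorem relabelOp_ampl (hX : Maps σ X X') (hW : Maps σ W W') (h : X ⊆ W) (A : Op d X) :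
    relabelOp hW.equiv (ampl W A) = ampl W' (relabelOp hX.equiv A) := by
  symm
  have hs := Split.of_subset h
  have hZ := hW.sdiff hX
  refine ampl_unique (hX.split hZ hW hs) fun u w => ?_
  rw [relabelOp_apply]
  rw [← relabelVec_apply_symm hX.equiv u, ← relabelVec_apply_symm hZ.equiv w,
    ← relabelVec_tp hX hZ hW hs, relabelVec_symm_apply, ampl_tp, relabelVec_tp hX hZ hW hs,
    relabelOp_apply_relabelVec]

theorem relabelOp_pairOp {Φ : Pos d → Pos d → ℝ} (hΦ : IsPot Φ) (hW : Maps σ W W') (i j : ℕ) :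
    relabelOp hW.equiv (pairOp Φ W i j) = pairOp Φ W' (σ i) (σ j) := by
  rw [pairOp_eq, relabelOp_multOp _ (hΦ.isBdd i j), pairOp_eq]
  have : ∀ (i : ℕ) (q : Conf d W'), pos i ((relabelConf (d := d) hW.equiv).symm q) =
      pos (σ i) q := by
    intro i q
    ext k
    by_cases hi : i ∈ W
    · simp [pos, hi, (hW i).1 hi, relabelConf_symm_apply]
      rfl
    · have : σ i ∉ W' := fun h => hi ((hW i).2 h)
      simp [pos, hi, this]
  simp_rw [this]

/-- Relabelling of trace class operators. -/
def rlT (e : X ≃ X') : TCV d X →L[ℂ] TCV d X' :=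
  TC.sandwich (relabelVec e) (ContinuousLinearMap.adjoint (relabelVec e))

theorem op_rlT (e : X ≃ X') (T : TCV d X) : TC.op _ (rlT e T) = relabelOp e (TC.op _ T) :=
  TC.op_sandwich _ _ _

theorem isTraceClass_relabelOp (e : X ≃ X') {A : Op d X} (hA : IsTraceClass A) :
    IsTraceClass (relabelOp e A) := by
  rw [← TC.op_mk hA, ← op_rlT]
  exact TC.isTraceClass_op _

theorem norm_relabelVec_le (e : X ≃ X') : ‖relabelVec (d := d) e‖ ≤ 1 :=
  ContinuousLinearMap.opNorm_le_bound _ zero_le_one fun u => by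
    rw [one_mul, norm_relabelVec]

theorem norm_rlT_le (e : X ≃ X') (T : TCV d X) : ‖rlT e T‖ ≤ ‖T‖ := by
  refine (TC.norm_sandwich_le _ _ _).trans ?_
  have h1 := norm_relabelVec_le (d := d) e
  have h2 := norm_relabelVec_le (d := d) e.symm
  rw [← adjoint_relabelVec] at h2
  calc _ ≤ 1 * 1 * ‖T‖ := by gcongr
    _ = ‖T‖ := by ring

theorem rlT_refl (T : TCV d X) : rlT (Equiv.refl X) T = T :=
  TC.op_injective (by rw [op_rlT, relabelOp_refl])

theorem rlT_sandwich (e : X ≃ X') (A B : Op d X) (T : TCV d X) :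
    rlT e (TC.sandwich A B T) = TC.sandwich (relabelOp e A) (relabelOp e B) (rlT e T) :=
  TC.op_injective (by
    rw [op_rlT, TC.op_sandwich, TC.op_sandwich, op_rlT]
    exact (relabelOp_mul e A (TC.op _ T * B)).trans (by rw [relabelOp_mul]; rfl))

theorem rlT_tens (hX : Maps σ X X') (hZ : Maps σ Z Z') (hW : Maps σ W W')
    (h : Split X Z W) (S : TCV d X) (T : TCV d Z) :
    rlT hW.equiv (tens h S T) =
      tens (hX.split hZ hW h) (rlT hX.equiv S) (rlT hZ.equiv T) :=
  TC.op_injective (by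
    rw [op_rlT, op_tens, op_tens, relabelOp_mul, relabelOp_ampl hX hW h.left,
      relabelOp_ampl hZ hW h.right, op_rlT, op_rlT])

theorem tr_rlT (e : X ≃ X') (T : TCV d X) : TC.tr _ (rlT e T) = TC.tr _ T := by
  rw [rlT, TC.tr_sandwich]
  refine congrArg _ (TC.op_injective (ContinuousLinearMap.ext fun u => ?_))
  rw [TC.op_lmul, adjoint_relabelVec, op_mul_apply]
  exact relabelVec_symm_apply e (TC.op _ T u)

theorem pt_rlT (hX : Maps σ X X') (hW : Maps σ W W') (h : X ⊆ W) (T : TCV d W) :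
    pt (hW.subset hX h) (rlT hW.equiv T) = rlT hX.equiv (pt h T) := by
  have hs := Split.of_subset h
  have hZ := hW.sdiff hX
  have : pt (hW.subset hX h) ∘L rlT hW.equiv = rlT hX.equiv ∘L pt (d := d) h := by
    refine clm_ext_tens hs fun S T => ?_
    simp only [ContinuousLinearMap.comp_apply]
    rw [rlT_tens hX hZ hW hs, pt_tens (hX.split hZ hW hs), pt_tens hs, tr_rlT, map_smul]
  exact congrArg (fun f => f T) this

/-- The members of a symmetric sequence may be relabelled. -/
theorem relabelOp_at_ {f : OpSeq d} (hf : ∀ n, IsSymm (f n)) (e : X ≃ X') :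
    relabelOp e (at_ f X) = at_ f X' := by
  have key : ∀ (m : ℕ) (_ : m = X'.card) (g : Finset.range m ≃ X'),
      relabelOp g (f m) = at_ f X' := by
    rintro m rfl g
    have h1 : g = (g.trans (enum X').symm).trans (enum X') := by ext; simp
    rw [h1, ← relabelOp_trans]
    exact congrArg _ (hf _ _)
  rw [at_, relabelOp_trans]
  exact key _ (by simpa using Fintype.card_congr e) _

theorem at_range {f : OpSeq d} (hf : ∀ n, IsSymm (f n)) (n : ℕ) :
    at_ f (Finset.range n) = f n := by
  have key : ∀ (m : ℕ) (h : m = n), ∀ g : Finset.range m ≃ Finset.range n,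
      relabelOp g (f m) = f n := by
    rintro m rfl g
    exact hf _ _
  exact key _ (Finset.card_range n) _

end Relabel


/-! ### The Fourier transform of tensor products -/

section Fourier

variable {X X' Z W : Finset ℕ}

/-- The L² transform is compatible with the transform of tempered distributions, so tested with g it
gives ∫ ĝ u. For integrable u this equals the integral of g against the Fourier integral of u, by
Fubini's theorem. -/
theorem coeFn_fourier (u : L2 d W) (hu : Integrable u volume) :
    (𝓕 u : L2 d W) =ᵐ[volume] (𝓕 (u : Conf d W → ℂ) : Conf d W → ℂ) := by
  have hc : Continuous (𝓕 (u : Conf d W → ℂ) : Conf d W → ℂ) :=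
    VectorFourier.fourierIntegral_continuous Real.continuous_fourierChar
      (by exact continuous_inner) hu
  refine ae_eq_of_integral_contDiff_smul_eq
    ((Lp.memLp (𝓕 u : L2 d W)).locallyIntegrable one_le_two) hc.locallyIntegrable ?_
  intro g hg hgs
  have hgs' : HasCompactSupport fun x => (g x : ℂ) :=
    hgs.comp_left (g := Complex.ofReal) Complex.ofReal_zero
  have hg' : ContDiff ℝ ∞ fun x => (g x : ℂ) := Complex.ofRealCLM.contDiff.comp hg
  let G : SchwartzMap (Conf d W) ℂ := hgs'.toSchwartzMap hg'
  have hG : ∀ x, G x = (g x : ℂ) := fun x => rfl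
  have h1 := congrArg (fun T => T G) (Lp.fourier_toTemperedDistribution_eq u)
  simp only [TemperedDistribution.fourier_apply, Lp.toTemperedDistribution_apply] at h1
  have h2 := VectorFourier.integral_fourierIntegral_smul_eq_flip (μ := volume) (ν := volume)
    (e := Real.fourierChar) (L := innerₗ (Conf d W)) (f := (G : Conf d W → ℂ))
    (g := (u : Conf d W → ℂ)) Real.continuous_fourierChar (by exact continuous_inner)
    G.integrable hu
  rw [flip_innerₗ] at h2
  have h3 : ∫ x, (𝓕 G : SchwartzMap (Conf d W) ℂ) x • (u : Conf d W → ℂ) x =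
      ∫ x, G x • (𝓕 (u : Conf d W → ℂ) : Conf d W → ℂ) x := h2
  rw [h3] at h1
  simp only [hG] at h1
  simp only [smul_eq_mul] at h1
  simp only [Complex.real_smul]
  exact h1.symm

/-- The particles of a split as a disjoint union. -/
def Split.equiv (h : Split X Z W) : X ⊕ Z ≃ W where
  toFun := Sum.elim (fun x => ⟨x, h.left x.2⟩) (fun x => ⟨x, h.right x.2⟩)
  invFun w := if hw : (w : ℕ) ∈ X then Sum.inl ⟨w, hw⟩
    else Sum.inr ⟨w, by rw [h.eq]; exact Finset.mem_sdiff.2 ⟨w.2, hw⟩⟩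
  left_inv := by
    rintro (x | x)
    · simp
    · have := Finset.disjoint_right.1 h.disjoint x.2
      simp [this]
  right_inv := by
    intro w
    by_cases hw : (w : ℕ) ∈ X <;> simp [hw]

theorem inner_eq_restr (h : Split X Z W) (p q : Conf d W) :
    ⟪p, q⟫_ℝ = ⟪restr h.left p, restr h.left q⟫_ℝ + ⟪restr h.right p, restr h.right q⟫_ℝ := by
  rw [PiLp.inner_apply, PiLp.inner_apply, PiLp.inner_apply, Fintype.sum_prod_type,
    Fintype.sum_prod_type, Fintype.sum_prod_type, ← h.equiv.sum_comp, Fintype.sum_sum_type]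
  rfl

theorem norm_sq_eq_restr (h : Split X Z W) (q : Conf d W) :
    ‖q‖ ^ 2 = ‖restr h.left q‖ ^ 2 + ‖restr h.right q‖ ^ 2 := by
  rw [← real_inner_self_eq_norm_sq, inner_eq_restr h, real_inner_self_eq_norm_sq,
    real_inner_self_eq_norm_sq]

theorem integrable_tp (h : Split X Z W) {u : L2 d X} {w : L2 d Z} (hu : Integrable u volume)
    (hw : Integrable w volume) : Integrable (tp h u w) volume := by
  refine Integrable.congr ?_ (coeFn_tp h u w).symm
  exact (measurePreserving_split h).integrable_comp_of_integrable (hu.mul_prod hw)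

theorem fourier_tp_apply (h : Split X Z W) (u : L2 d X) (w : L2 d Z) (ξ : Conf d W) :
    (𝓕 (tp h u w : Conf d W → ℂ) : Conf d W → ℂ) ξ =
      (𝓕 (u : Conf d X → ℂ) : Conf d X → ℂ) (restr h.left ξ) *
      (𝓕 (w : Conf d Z → ℂ) : Conf d Z → ℂ) (restr h.right ξ) := by
  rw [Real.fourier_congr_ae (coeFn_tp h u w), Real.fourier_eq, Real.fourier_eq, Real.fourier_eq,
    ← integral_prod_mul (μ := volume) (ν := volume)
      (fun p : Conf d X => Real.fourierChar (-⟪p, restr h.left ξ⟫_ℝ) • u p)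
      (fun p : Conf d Z => Real.fourierChar (-⟪p, restr h.right ξ⟫_ℝ) • w p)]
  have h1 : ∀ q : Conf d W, Real.fourierChar (-⟪q, ξ⟫_ℝ) •
      (u (restr h.left q) * w (restr h.right q)) =
      (fun p : Conf d X × Conf d Z => (Real.fourierChar (-⟪p.1, restr h.left ξ⟫_ℝ) • u p.1) *
        (Real.fourierChar (-⟪p.2, restr h.right ξ⟫_ℝ) • w p.2))
        (restr h.left q, restr h.right q) := by
    intro q
    rw [inner_eq_restr h, neg_add, AddChar.map_add_eq_mul]
    simp only [Circle.smul_def, smul_eq_mul, Circle.coe_mul]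
    ring
  simp_rw [h1]
  refine (measurePreserving_split h).integral_comp_of_aestronglyMeasurable
    (f := fun p : Conf d X × Conf d Z => (Real.fourierChar (-⟪p.1, restr h.left ξ⟫_ℝ) • u p.1) *
      (Real.fourierChar (-⟪p.2, restr h.right ξ⟫_ℝ) • w p.2)) ?_
  have key : ∀ (V : Finset ℕ) (f : L2 d V) (η : Conf d V),
      AEStronglyMeasurable (fun x => Real.fourierChar (-⟪x, η⟫_ℝ) • f x) volume := by
    intro V f η
    refine AEStronglyMeasurable.smul (f := fun x => Real.fourierChar (-⟪x, η⟫_ℝ)) ?_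
      (Lp.aestronglyMeasurable f)
    refine Continuous.aestronglyMeasurable ?_
    exact Real.continuous_fourierChar.comp (continuous_id.inner continuous_const).neg
  exact (key X u _).comp_fst.mul (key Z w _).comp_snd

theorem dense_schwartz (W : Finset ℕ) :
    DenseRange fun f : SchwartzMap (Conf d W) ℂ => (f.toLp 2 volume : L2 d W) :=
  SchwartzMap.denseRange_toLpCLM (F := ℂ) (p := 2) (μ := (volume : Measure (Conf d W)))
    ENNReal.ofNat_ne_top

theorem integrable_schwartz (f : SchwartzMap (Conf d W) ℂ) :
    Integrable (f.toLp 2 volume : L2 d W) volume :=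
  f.integrable.congr (f.coeFn_toLp 2 volume).symm

theorem continuous_fourier_L2 : Continuous fun u : L2 d W => (𝓕 u : L2 d W) :=
  (Lp.fourierTransformₗᵢ (Conf d W) ℂ).continuous

theorem continuous_tp (h : Split X Z W) : Continuous fun p : L2 d X × L2 d Z => tp h p.1 p.2 := by
  have := (tpL (d := d) h).continuous₂
  exact this

/-- On Schwartz functions this is Fubini's theorem for the Fourier integral; both sides are
continuous in (u, w), and Schwartz functions are dense. -/
theorem fourier_tp (h : Split X Z W) (u : L2 d X) (w : L2 d Z) :
    (𝓕 (tp h u w) : L2 d W) = tp h (𝓕 u : L2 d X) (𝓕 w : L2 d Z) := by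
  have hd := (dense_schwartz (d := d) X).prodMap (dense_schwartz (d := d) Z)
  have hc1 : Continuous fun p : L2 d X × L2 d Z => (𝓕 (tp h p.1 p.2) : L2 d W) :=
    continuous_fourier_L2.comp (continuous_tp h)
  have hc2 : Continuous fun p : L2 d X × L2 d Z => tp h (𝓕 p.1 : L2 d X) (𝓕 p.2 : L2 d Z) :=
    (continuous_tp h).comp ((continuous_fourier_L2.comp continuous_fst).prodMk
      (continuous_fourier_L2.comp continuous_snd))
  have := hd.equalizer hc1 hc2 ?_
  · exact congrFun this (u, w)
  · ext1 ⟨f, g⟩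
    simp only [Function.comp_apply, Prod.map_apply]
    refine Lp.ext ?_
    have hf := integrable_schwartz f
    have hg := integrable_schwartz g
    filter_upwards [coeFn_fourier _ (integrable_tp h hf hg),
      coeFn_tp h (𝓕 (f.toLp 2 volume : L2 d X) : L2 d X) (𝓕 (g.toLp 2 volume : L2 d Z) : L2 d Z),
      (quasiMeasurePreserving_restr h.left).ae (coeFn_fourier _ hf),
      (quasiMeasurePreserving_restr h.right).ae (coeFn_fourier _ hg)] with ξ h1 h2 h3 h4
    rw [h1, h2, h3, h4, fourier_tp_apply]

theorem fourier_relabelVec (e : X ≃ X') (u : L2 d X) :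
    (𝓕 (relabelVec e u) : L2 d X') = relabelVec e (𝓕 u : L2 d X) := by
  have hc1 : Continuous fun u : L2 d X => (𝓕 (relabelVec e u) : L2 d X') :=
    continuous_fourier_L2.comp (relabelVec e).continuous
  have hc2 : Continuous fun u : L2 d X => relabelVec e (𝓕 u : L2 d X) :=
    (relabelVec e).continuous.comp continuous_fourier_L2
  refine congrFun ((dense_schwartz (d := d) X).equalizer hc1 hc2 ?_) u
  ext1 f
  simp only [Function.comp_apply]
  refine Lp.ext ?_
  have hf := integrable_schwartz f
  have hi : Integrable (relabelVec e (f.toLp 2 volume : L2 d X)) volume :=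
    Integrable.congr ((relabelConf (d := d) e).symm.measurePreserving.integrable_comp_of_integrable
      hf) (coeFn_relabelVec e _).symm
  filter_upwards [coeFn_fourier _ hi, coeFn_relabelVec e (𝓕 (f.toLp 2 volume : L2 d X) : L2 d X),
    (relabelConf (d := d) e).symm.measurePreserving.quasiMeasurePreserving.ae
      (coeFn_fourier _ hf)] with ξ h1 h2 h3
  rw [h1, h2, h3, Real.fourier_congr_ae (coeFn_relabelVec e _)]
  exact Real.fourier_comp_linearIsometry _ _ _

end Fourier


/-! ### Unitary groups and bounded perturbations -/

section Groups

variable {H : Type} [NormedAddCommGroup H] [InnerProductSpace ℂ H] [CompleteSpace H]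

/-- Strongly continuous one-parameter unitary groups. -/
structure IsUGroup (U : ℝ → H →L[ℂ] H) : Prop where
  unitary : ∀ t, U t ∈ unitary (H →L[ℂ] H)
  zero : U 0 = 1
  add : ∀ t τ, U (t + τ) = U t * U τ
  continuous : ∀ ψ, Continuous fun t => U t ψ

namespace IsUGroup

variable {U : ℝ → H →L[ℂ] H} (hU : IsUGroup U)
include hU

theorem norm_apply (t : ℝ) (x : H) : ‖U t x‖ = ‖x‖ :=
  ContinuousLinearMap.norm_map_of_mem_unitary (hU.unitary t) x

theorem add_apply (t τ : ℝ) (x : H) : U (t + τ) x = U t (U τ x) := by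
  rw [hU.add, op_mul_apply]

theorem zero_apply (x : H) : U 0 x = x := by rw [hU.zero, op_one_apply]

theorem neg_apply_self (t : ℝ) (x : H) : U (-t) (U t x) = x := by
  rw [← hU.add_apply, neg_add_cancel, hU.zero_apply]

theorem apply_neg_self (t : ℝ) (x : H) : U t (U (-t) x) = x := by
  rw [← hU.add_apply, add_neg_cancel, hU.zero_apply]

theorem mul_neg (t : ℝ) : U t * U (-t) = 1 := by rw [← hU.add, add_neg_cancel, hU.zero]

theorem neg_mul (t : ℝ) : U (-t) * U t = 1 := by rw [← hU.add, neg_add_cancel, hU.zero]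

theorem adjoint_eq (t : ℝ) : ContinuousLinearMap.adjoint (U t) = U (-t) := by
  have h1 : star (U t) * U t = 1 := (Unitary.mem_iff.1 (hU.unitary t)).1
  calc ContinuousLinearMap.adjoint (U t) = star (U t) * (U t * U (-t)) := by
        rw [hU.mul_neg, mul_one]; rfl
    _ = U (-t) := by rw [← mul_assoc, h1, one_mul]

theorem inner_left (t : ℝ) (x y : H) : ⟪U t x, y⟫_ℂ = ⟪x, U (-t) y⟫_ℂ := by
  rw [← hU.adjoint_eq, ContinuousLinearMap.adjoint_inner_right]

theorem norm_le (t : ℝ) : ‖U t‖ ≤ 1 :=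
  ContinuousLinearMap.opNorm_le_bound _ zero_le_one fun x => by rw [hU.norm_apply, one_mul]

theorem continuous₂ : Continuous fun p : ℝ × H => U p.1 p.2 := by
  rw [continuous_iff_continuousAt]
  rintro ⟨t, x⟩
  have h1 : Tendsto (fun p : ℝ × H => U p.1 x) (𝓝 (t, x)) (𝓝 (U t x)) :=
    ((hU.continuous x).tendsto t).comp continuous_fst.continuousAt
  have h2 : Tendsto (fun p : ℝ × H => U p.1 (p.2 - x)) (𝓝 (t, x)) (𝓝 0) := by
    rw [tendsto_zero_iff_norm_tendsto_zero]
    simp_rw [hU.norm_apply]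
    have : Tendsto (fun p : ℝ × H => ‖p.2 - x‖) (𝓝 (t, x)) (𝓝 ‖x - x‖) :=
      ((continuous_snd.sub continuous_const).norm).tendsto (t, x)
    rwa [sub_self, norm_zero] at this
  have h3 := h1.add h2
  rw [add_zero] at h3
  refine h3.congr fun p => ?_
  rw [map_sub, add_sub_cancel]

theorem comp_neg : IsUGroup fun t => U (-t) where
  unitary t := hU.unitary _
  zero := by rw [neg_zero, hU.zero]
  add t τ := by rw [neg_add, hU.add]
  continuous ψ := (hU.continuous ψ).comp continuous_neg

/-- Product rule for `U(s) x(s)`. -/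
theorem hasDerivAt_apply {x : ℝ → H} {x' η : H} {t : ℝ} (hx : HasDerivAt x x' t)
    (hη : HasDerivAt (fun s => U s (x t)) η t) :
    HasDerivAt (fun s => U s (x s)) (η + U t x') t := by
  rw [hasDerivAt_iff_tendsto_slope_zero] at hx hη ⊢
  have h1 : Tendsto (fun h : ℝ => U (t + h) (h⁻¹ • (x (t + h) - x t))) (𝓝[≠] 0) (𝓝 (U t x')) := by
    have h2 : Tendsto (fun h : ℝ => t + h) (𝓝[≠] 0) (𝓝 t) := by
      have : Tendsto (fun h : ℝ => t + h) (𝓝 0) (𝓝 (t + 0)) :=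
        (continuous_const.add continuous_id).tendsto 0
      rw [add_zero] at this
      exact this.mono_left nhdsWithin_le_nhds
    exact (hU.continuous₂.tendsto (t, x')).comp (h2.prodMk_nhds hx)
  refine (hη.add h1).congr fun h => ?_
  have h3 : U (t + h) (h⁻¹ • (x (t + h) - x t)) = h⁻¹ • (U (t + h) (x (t + h)) - U (t + h) (x t)) := by
    rw [← map_sub, ← Complex.coe_smul, ← Complex.coe_smul, map_smul]
  rw [h3, ← smul_add]
  congr 1
  abel

theorem hasDerivAt_of_zero {x η : H} (h : HasDerivAt (fun s => U s x) η 0) (t : ℝ) :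
    HasDerivAt (fun s => U s x) (U t η) t := by
  rw [hasDerivAt_iff_tendsto_slope_zero] at h ⊢
  refine (((U t).continuous.tendsto η).comp h).congr fun s => ?_
  simp only [Function.comp_apply]
  rw [← Complex.coe_smul, map_smul, map_sub, zero_add, hU.add_apply t s, hU.zero_apply,
    Complex.coe_smul]

theorem hasDerivAt_zero_apply {x η : H} (h : HasDerivAt (fun s => U s x) η 0) (t : ℝ) :
    HasDerivAt (fun s => U s (U t x)) (U t η) 0 := by
  rw [hasDerivAt_iff_tendsto_slope_zero] at h ⊢
  refine (((U t).continuous.tendsto η).comp h).congr fun s => ?_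
  simp only [Function.comp_apply]
  rw [← Complex.coe_smul, map_smul, map_sub, zero_add, hU.zero_apply, hU.zero_apply,
    Complex.coe_smul, ← hU.add_apply, ← hU.add_apply, add_comm]

end IsUGroup

/-! ### Linear evolution equations -/

theorem norm_le_of_hasDerivAt_le {E : Type*} [NormedAddCommGroup E] [NormedSpace ℝ E] {f f' : ℝ → E}
    {C : ℝ} {n : ℕ} (h0 : f 0 = 0) (hf : ∀ t, HasDerivAt f (f' t) t)
    (hb : ∀ t, ‖f' t‖ ≤ C * |t| ^ n) (t : ℝ) : ‖f t‖ ≤ C * |t| ^ (n + 1) / (n + 1) := by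
  have key : ∀ (f f' : ℝ → E), f 0 = 0 → (∀ t, HasDerivAt f (f' t) t) →
      (∀ t, ‖f' t‖ ≤ C * |t| ^ n) → ∀ t, 0 ≤ t → ‖f t‖ ≤ C * t ^ (n + 1) / (n + 1) := by
    intro f f' h0 hf hb t ht
    have hB : ∀ x : ℝ, HasDerivAt (fun s : ℝ => C * s ^ (n + 1) / (n + 1)) (C * x ^ n) x := by
      intro x
      have := ((hasDerivAt_pow (n + 1) x).const_mul C).div_const ((n : ℝ) + 1)
      convert! this using 1
      have : (n : ℝ) + 1 ≠ 0 := by positivity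
      push_cast
      field_simp
    refine image_norm_le_of_norm_deriv_right_le_deriv_boundary (a := 0) (b := t) (f := f) (f' := f')
      (B := fun s => C * s ^ (n + 1) / (n + 1)) (B' := fun s => C * s ^ n)
      (fun x _ => (hf x).continuousAt.continuousWithinAt) (fun x _ => (hf x).hasDerivWithinAt)
      (by simp [h0]) (fun x => hB x) (fun x hx => ?_) ⟨ht, le_rfl⟩
    have := hb x
    rwa [abs_of_nonneg hx.1] at this
  rcases le_total 0 t with ht | ht
  · rw [abs_of_nonneg ht]
    exact key f f' h0 hf hb t ht
  · rw [abs_of_nonpos ht]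
    have := key (fun s => f (-s)) (fun s => -f' (-s)) (by simpa using h0)
      (fun s => by
        have h1 := (hf (-s)).scomp s (hasDerivAt_neg s)
        rw [neg_one_smul] at h1
        exact h1)
      (fun s => by rw [norm_neg, ← abs_neg s]; exact hb _) (-t) (by linarith)
    simpa using this

variable {A : ℝ → H →L[ℂ] H} {M : ℝ}

/-- The terms of the Dyson series. -/
def dyson (A : ℝ → H →L[ℂ] H) (ψ : H) : ℕ → ℝ → H
  | 0, _ => ψ
  | n + 1, t => ∫ s in (0 : ℝ)..t, A s (dyson A ψ n s)

theorem continuous_dyson (hA : Continuous fun p : ℝ × H => A p.1 p.2) (ψ : H) (n : ℕ) :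
    Continuous (dyson A ψ n) := by
  induction n with
  | zero => exact continuous_const
  | succ n ih =>
    have h : Continuous fun s => A s (dyson A ψ n s) := hA.comp (continuous_id.prodMk ih)
    exact intervalIntegral.continuous_primitive (fun a b => h.intervalIntegrable a b) 0

theorem hasDerivAt_dyson (hA : Continuous fun p : ℝ × H => A p.1 p.2) (ψ : H) (n : ℕ) (t : ℝ) :
    HasDerivAt (dyson A ψ (n + 1)) (A t (dyson A ψ n t)) t := by
  have h : Continuous fun s => A s (dyson A ψ n s) :=
    hA.comp (continuous_id.prodMk (continuous_dyson hA ψ n))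
  exact intervalIntegral.integral_hasDerivAt_right (h.intervalIntegrable _ _)
    h.aestronglyMeasurable.stronglyMeasurableAtFilter h.continuousAt

/-- Each iterated integration of |t|^n contributes a factor 1/(n+1); the factorial makes the Dyson
series converge for all times. -/
theorem norm_dyson_le (hA : Continuous fun p : ℝ × H => A p.1 p.2) (hM0 : 0 ≤ M)
    (hM : ∀ t x, ‖A t x‖ ≤ M * ‖x‖) (ψ : H) (n : ℕ) (t : ℝ) :
    ‖dyson A ψ n t‖ ≤ ‖ψ‖ * M ^ n / n.factorial * |t| ^ n := by
  induction n generalizing t with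
  | zero => simp [dyson]
  | succ n ih =>
    have h := norm_le_of_hasDerivAt_le (C := M * (‖ψ‖ * M ^ n / n.factorial)) (n := n)
      (f := dyson A ψ (n + 1)) (by simp [dyson]) (hasDerivAt_dyson hA ψ n) (fun s => by
        refine (hM _ _).trans ?_
        rw [mul_assoc M]
        exact mul_le_mul_of_nonneg_left (ih s) hM0) t
    refine h.trans_eq ?_
    rw [Nat.factorial_succ]
    push_cast
    field_simp
    ring

theorem exists_solution (hA : Continuous fun p : ℝ × H => A p.1 p.2) (hM0 : 0 ≤ M)
    (hM : ∀ t x, ‖A t x‖ ≤ M * ‖x‖) (ψ : H) :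
    ∃ x : ℝ → H, x 0 = ψ ∧ ∀ t, HasDerivAt x (A t (x t)) t := by
  have hsum : ∀ T : ℝ, Summable fun n : ℕ => ‖ψ‖ * M ^ n / n.factorial * T ^ n := by
    intro T
    have := (Real.summable_pow_div_factorial (M * T)).mul_left ‖ψ‖
    refine this.congr fun n => ?_
    rw [mul_pow]
    ring
  have hs : ∀ t, Summable fun n => dyson A ψ n t := fun t =>
    Summable.of_norm_bounded (hsum |t|) fun n => norm_dyson_le hA hM0 hM ψ n t
  refine ⟨fun t => ∑' n, dyson A ψ n t, ?_, fun t => ?_⟩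
  · change ∑' n, dyson A ψ n 0 = ψ
    rw [tsum_eq_single 0]
    · rfl
    · intro n hn
      obtain ⟨m, rfl⟩ := Nat.exists_eq_succ_of_ne_zero hn
      simp [dyson]
  -- The bounds of the terms are uniform only on bounded time intervals, so differentiation is done
  -- on an interval around 0 that contains t.
  · let T := |t| + 1
    have hD : HasDerivAt (fun t => ∑' n, dyson A ψ (n + 1) t) (∑' n, A t (dyson A ψ n t)) t := by
      refine hasDerivAt_tsum_of_isPreconnected (t := Set.Ioo (-T) T) (y₀ := 0)
        ((hsum T).mul_left M) isOpen_Ioo isPreconnected_Ioo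
        (g := fun n => dyson A ψ (n + 1)) (g' := fun n t => A t (dyson A ψ n t))
        (fun n y _ => hasDerivAt_dyson hA ψ n y) (fun n y hy => ?_) ?_ ?_ ?_
      · refine (hM _ _).trans (mul_le_mul_of_nonneg_left ?_ hM0)
        refine (norm_dyson_le hA hM0 hM ψ n y).trans ?_
        have : |y| ≤ T := abs_le.2 ⟨hy.1.le, hy.2.le⟩
        gcongr
      · simp only [T, Set.mem_Ioo]
        constructor <;> linarith [abs_nonneg t]
      · exact (summable_nat_add_iff (f := fun n => dyson A ψ n 0) 1).2 (hs 0)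
      · simp only [T, Set.mem_Ioo]
        constructor
        · linarith [neg_abs_le t]
        · linarith [le_abs_self t]
    have h1 : (fun t => ∑' n, dyson A ψ n t) = fun t => ψ + ∑' n, dyson A ψ (n + 1) t := by
      ext1 t
      rw [(hs t).tsum_eq_zero_add]
      rfl
    rw [h1]
    have h2 : A t (ψ + ∑' n, dyson A ψ (n + 1) t) = ∑' n, A t (dyson A ψ n t) := by
      rw [← congrFun h1 t, (A t).map_tsum (hs t)]
    have h3 := hD.const_add ψ
    rw [← h2] at h3
    exact h3

theorem inner_eq_of_solution (hs : ∀ t x y, ⟪A t x, y⟫_ℂ + ⟪x, A t y⟫_ℂ = 0) {x y : ℝ → H}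
    (hx : ∀ t, HasDerivAt x (A t (x t)) t) (hy : ∀ t, HasDerivAt y (A t (y t)) t) (t : ℝ) :
    ⟪x t, y t⟫_ℂ = ⟪x 0, y 0⟫_ℂ := by
  have h : ∀ t, HasDerivAt (fun t => ⟪x t, y t⟫_ℂ) 0 t := by
    intro t
    have := (hx t).inner ℂ (hy t)
    rwa [add_comm, hs] at this
  exact is_const_of_deriv_eq_zero (fun t => (h t).differentiableAt) (fun t => (h t).deriv) t 0

/-- For a skew-symmetric A(t) the norm of the difference of two solutions is constant in time. -/
theorem solution_unique (hs : ∀ t x y, ⟪A t x, y⟫_ℂ + ⟪x, A t y⟫_ℂ = 0) {x y : ℝ → H}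
    (hx : ∀ t, HasDerivAt x (A t (x t)) t) (hy : ∀ t, HasDerivAt y (A t (y t)) t)
    (h0 : x 0 = y 0) (t : ℝ) : x t = y t := by
  have h := inner_eq_of_solution hs (x := fun t => x t - y t) (y := fun t => x t - y t)
    (fun t => by rw [map_sub]; exact (hx t).sub (hy t))
    (fun t => by rw [map_sub]; exact (hx t).sub (hy t)) t
  simp only [h0, sub_self, inner_zero_left] at h
  exact sub_eq_zero.1 (inner_self_eq_zero.1 h)

theorem exists_propagator (hA : Continuous fun p : ℝ × H => A p.1 p.2) (hM0 : 0 ≤ M)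
    (hM : ∀ t x, ‖A t x‖ ≤ M * ‖x‖) (hs : ∀ t x y, ⟪A t x, y⟫_ℂ + ⟪x, A t y⟫_ℂ = 0) :
    ∃ W : ℝ → H →L[ℂ] H, W 0 = 1 ∧ (∀ t x, ‖W t x‖ = ‖x‖) ∧
      ∀ x t, HasDerivAt (fun t => W t x) (A t (W t x)) t := by
  choose S h0 hS using exists_solution hA hM0 hM
  have hadd : ∀ t x y, S (x + y) t = S x t + S y t := fun t x y =>
    solution_unique hs (x := S (x + y)) (y := fun t => S x t + S y t) (hS _)
      (fun t => by rw [map_add]; exact (hS x t).add (hS y t))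
      (by simp only [h0]) t
  have hsmul : ∀ t (c : ℂ) x, S (c • x) t = c • S x t := fun t c x =>
    solution_unique hs (x := S (c • x)) (y := fun t => c • S x t) (hS _)
      (fun t => by rw [map_smul]; exact (hS x t).const_smul c)
      (by simp only [h0]) t
  have hnorm : ∀ t x, ‖S x t‖ = ‖x‖ := by
    intro t x
    have := inner_eq_of_solution hs (hS x) (hS x) t
    rw [h0, inner_self_eq_norm_sq_to_K, inner_self_eq_norm_sq_to_K] at this
    have h2 : ‖S x t‖ ^ 2 = ‖x‖ ^ 2 := by exact_mod_cast this
    exact (sq_eq_sq₀ (norm_nonneg _) (norm_nonneg _)).1 h2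
  refine ⟨fun t => LinearMap.mkContinuous ⟨⟨fun x => S x t, hadd t⟩, hsmul t⟩ 1
    fun x => by rw [one_mul]; exact (hnorm t x).le, ?_, hnorm, hS⟩
  ext1 x
  exact h0 x

/-! ### Bounded perturbations of unitary groups -/

/-- `U` is the perturbation of the group `U₀` by the potential `V`. -/
def IsPerturbation (U₀ : ℝ → H →L[ℂ] H) (V : H →L[ℂ] H) (U : ℝ → H →L[ℂ] H) : Prop :=
  ∀ x t, HasDerivAt (fun s => U₀ (-s) (U s x)) (-Complex.I • U₀ (-t) (V (U t x))) t

variable {U₀ U U' : ℝ → H →L[ℂ] H} {V : H →L[ℂ] H}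

theorem inner_interaction (h₀ : IsUGroup U₀) (hV : ContinuousLinearMap.adjoint V = V) (t : ℝ)
    (x y : H) : ⟪(-Complex.I • (U₀ (-t) ∘L V ∘L U₀ t)) x, y⟫_ℂ +
      ⟪x, (-Complex.I • (U₀ (-t) ∘L V ∘L U₀ t)) y⟫_ℂ = 0 := by
  simp only [smul_apply, ContinuousLinearMap.comp_apply, inner_smul_left, inner_smul_right]
  have h1 : ⟪U₀ (-t) (V (U₀ t x)), y⟫_ℂ = ⟪x, U₀ (-t) (V (U₀ t y))⟫_ℂ := by
    rw [h₀.inner_left, neg_neg, ← h₀.inner_left, ← ContinuousLinearMap.adjoint_inner_right, hV]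
  rw [h1]
  simp

/-- In the interaction picture the generator -i U₀(-t) V U₀(t) is bounded and skew-symmetric. It has
a propagator W, and the perturbed group is U₀(t) W(t). -/
theorem exists_perturbation (h₀ : IsUGroup U₀) (hV : ContinuousLinearMap.adjoint V = V) :
    ∃ U, IsUGroup U ∧ IsPerturbation U₀ V U := by
  let A : ℝ → H →L[ℂ] H := fun t => -Complex.I • (U₀ (-t) ∘L V ∘L U₀ t)
  have hAapp : ∀ t x, A t x = -Complex.I • U₀ (-t) (V (U₀ t x)) := fun t x => rfl
  have hs := inner_interaction h₀ hV
  obtain ⟨W, hW0, hWn, hWd⟩ := exists_propagator (A := A) (M := ‖V‖) (by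
      simp only [hAapp]
      exact (h₀.continuous₂.comp (continuous_fst.neg.prodMk
        (V.continuous.comp h₀.continuous₂))).const_smul _) (norm_nonneg _) (by
      intro t x
      rw [hAapp, norm_smul, norm_neg, Complex.norm_I, one_mul, h₀.norm_apply]
      refine (V.le_opNorm _).trans_eq ?_
      rw [h₀.norm_apply]) hs
  have hadd : ∀ t τ, U₀ (t + τ) * W (t + τ) = U₀ t * W t * (U₀ τ * W τ) := by
    intro t τ
    ext1 x
    have key : U₀ τ (W (t + τ) x) = W t (U₀ τ (W τ x)) := by
      refine solution_unique hs (x := fun t => U₀ τ (W (t + τ) x)) ?_ (hWd (U₀ τ (W τ x))) ?_ t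
      · intro t
        have h1 := (hWd x (t + τ)).comp_add_const t τ
        have h2 : HasDerivAt (fun t => U₀ τ (W (t + τ) x)) (U₀ τ (A (t + τ) (W (t + τ) x))) t :=
          ((U₀ τ).restrictScalars ℝ).hasFDerivAt.comp_hasDerivAt t h1
        convert! h2 using 1
        simp only [hAapp, smul_apply, ContinuousLinearMap.comp_apply, map_smul]
        rw [← h₀.add_apply, ← h₀.add_apply]
        congr 3
        ring
      · rw [zero_add, hW0, op_one_apply]
    simp only [op_mul_apply]
    rw [h₀.add_apply, key]
  have hz : U₀ 0 * W 0 = 1 := by rw [h₀.zero, hW0, one_mul]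
  refine ⟨fun t => U₀ t * W t, ⟨fun t => ?_, hz, hadd, fun x => ?_⟩, fun x t => ?_⟩
  · have hiso : star (U₀ t * W t) * (U₀ t * W t) = 1 := by
      refine (ContinuousLinearMap.norm_map_iff_adjoint_comp_self _).1 fun x => ?_
      rw [op_mul_apply, h₀.norm_apply, hWn]
    have hright : (U₀ t * W t) * (U₀ (-t) * W (-t)) = 1 := by
      rw [← hadd, add_neg_cancel, hz]
    refine Unitary.mem_iff.2 ⟨hiso, ?_⟩
    have h1 : U₀ (-t) * W (-t) = star (U₀ t * W t) := by
      calc U₀ (-t) * W (-t) = star (U₀ t * W t) * (U₀ t * W t) * (U₀ (-t) * W (-t)) := by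
            rw [hiso, one_mul]
        _ = star (U₀ t * W t) := by rw [mul_assoc, hright, mul_one]
    rw [← h1, hright]
  · simp only [op_mul_apply]
    refine h₀.continuous₂.comp (continuous_id.prodMk ?_)
    exact continuous_iff_continuousAt.2 fun t => (hWd x t).continuousAt
  · simp only [op_mul_apply, h₀.neg_apply_self]
    exact hWd x t

theorem IsPerturbation.unique (h₀ : IsUGroup U₀) (hV : ContinuousLinearMap.adjoint V = V)
    (hU0 : U 0 = 1) (hU0' : U' 0 = 1) (h : IsPerturbation U₀ V U) (h' : IsPerturbation U₀ V U')
    (t : ℝ) : U t = U' t := by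
  ext1 x
  have key := solution_unique (inner_interaction h₀ hV) (x := fun s => U₀ (-s) (U s x))
    (y := fun s => U₀ (-s) (U' s x)) (fun t => by
      convert! h x t using 1
      simp only [smul_apply, ContinuousLinearMap.comp_apply, h₀.apply_neg_self]) (fun t => by
      convert! h' x t using 1
      simp only [smul_apply, ContinuousLinearMap.comp_apply, h₀.apply_neg_self])
    (by simp only [hU0, hU0']) t
  rw [← h₀.apply_neg_self t (U t x), key, h₀.apply_neg_self]

/-- Write U(s)x as U₀(s) applied to the interaction picture curve U₀(-s)U(s)x, which is
differentiable for every x. Hence x need only lie in the domain of the free generator. The next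
lemma is the converse, so the two domains coincide. -/
theorem IsPerturbation.hasDerivAt (h₀ : IsUGroup U₀) (hU : IsUGroup U)
    (h : IsPerturbation U₀ V U) {x η : H} (hx : HasDerivAt (fun s => U₀ s x) η 0) :
    HasDerivAt (fun s => U s x) (η + -Complex.I • V x) 0 := by
  have h1 := h x 0
  rw [neg_zero, h₀.zero_apply, hU.zero_apply] at h1
  have h2 := h₀.hasDerivAt_apply h1 (η := η) (by
    simpa only [neg_zero, h₀.zero_apply, hU.zero_apply] using hx)
  simpa only [h₀.apply_neg_self, h₀.zero_apply] using h2

theorem IsPerturbation.hasDerivAt_free (h₀ : IsUGroup U₀) (hU : IsUGroup U)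
    (h : IsPerturbation U₀ V U) {x η : H} (hx : HasDerivAt (fun s => U s x) η 0) :
    HasDerivAt (fun s => U₀ s x) (η + Complex.I • V x) 0 := by
  have h1 := (h x 0).sub_const x
  rw [neg_zero, h₀.zero_apply, hU.zero_apply] at h1
  have h2 := h₀.hasDerivAt_apply h1 (η := 0) (by
    simp only [neg_zero, h₀.zero_apply, hU.zero_apply, sub_self, map_zero]
    exact hasDerivAt_const _ _)
  have h3 := hx.sub h2
  convert! h3 using 1
  · ext1 s
    simp only [Pi.sub_apply, map_sub, h₀.apply_neg_self, sub_sub_cancel]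
  · rw [h₀.zero_apply]
    simp

/-- For x in the domain of the generator of U, the curve U'(-s)U(s)x has derivative zero. It
suffices that the generator of U' extends that of U, whose domain is dense. -/
theorem IsUGroup.unique (hU : IsUGroup U) (hU' : IsUGroup U')
    (hd : Dense {x : H | ∃ η, HasDerivAt (fun s => U s x) η 0})
    (h : ∀ x η, HasDerivAt (fun s => U s x) η 0 → HasDerivAt (fun s => U' s x) η 0) (t : ℝ) :
    U t = U' t := by
  have key : ∀ x ∈ {x : H | ∃ η, HasDerivAt (fun s => U s x) η 0}, U t x = U' t x := by
    rintro x ⟨η, hη⟩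
    have hder : ∀ t, HasDerivAt (fun s => U' (-s) (U s x)) 0 t := by
      intro t
      have h1 := hU.hasDerivAt_of_zero hη t
      have h2 := hU'.hasDerivAt_of_zero (h _ _ (hU.hasDerivAt_zero_apply hη t)) (-t)
      have h3 := h2.scomp t (hasDerivAt_neg t)
      have h4 := hU'.comp_neg.hasDerivAt_apply h1 h3
      simpa using h4
    have hc := is_const_of_deriv_eq_zero (fun t => (hder t).differentiableAt)
      (fun t => (hder t).deriv) t 0
    simp only [neg_zero, hU.zero_apply, hU'.zero_apply] at hc
    rw [← hU'.apply_neg_self t (U t x), hc]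
  have := Continuous.ext_on hd (U t).continuous (U' t).continuous key
  exact ContinuousLinearMap.ext (congrFun this)

end Groups


/-! ### The free group -/

section Free

variable {X X' Z W : Finset ℕ}

theorem norm_sq_eq_integral (u : L2 d X) : ‖u‖ ^ 2 = ∫ x, ‖u x‖ ^ 2 := by
  have h1 : ((‖u‖ ^ 2 : ℝ) : ℂ) = ((∫ x, ‖u x‖ ^ 2 : ℝ) : ℂ) := by
    push_cast
    rw [← Complex.coe_algebraMap, ← inner_self_eq_norm_sq_to_K (𝕜 := ℂ), L2.inner_def,
      Complex.coe_algebraMap, ← integral_complex_ofReal]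
    refine integral_congr_ae (Eventually.of_forall fun x => ?_)
    simp only [inner_self_eq_norm_sq_to_K]
    push_cast
    rfl
  exact_mod_cast h1

/-- Dominated convergence in L², applied below to Fourier transforms of difference quotients. -/
theorem tendsto_zero_of_dominated {ι : Type*} {l : Filter ι} [l.IsCountablyGenerated]
    (F : ι → L2 d X) (f : ι → Conf d X → ℂ) (hF : ∀ i, F i =ᵐ[volume] f i) (g : L2 d X)
    (hb : ∀ᶠ i in l, ∀ᵐ x, ‖f i x‖ ≤ ‖g x‖)
    (hl : ∀ᵐ x, Tendsto (fun i => f i x) l (𝓝 0)) : Tendsto F l (𝓝 0) := by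
  have h1 : Tendsto (fun i => ∫ x, ‖f i x‖ ^ 2) l (𝓝 (∫ _ : Conf d X, (0 : ℝ))) := by
    refine tendsto_integral_filter_of_dominated_convergence (fun x => ‖g x‖ ^ 2) ?_ ?_ ?_ ?_
    · exact Eventually.of_forall fun i =>
        (((Lp.aestronglyMeasurable (F i)).congr (hF i)).norm.pow 2)
    · filter_upwards [hb] with i hi
      filter_upwards [hi] with x hx
      rw [Real.norm_of_nonneg (by positivity)]
      gcongr
    · exact (memLp_two_iff_integrable_sq_norm (Lp.aestronglyMeasurable g)).1 (Lp.memLp g)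
    · filter_upwards [hl] with x hx
      simpa using hx.norm.pow 2
  rw [integral_zero] at h1
  have h2 : ∀ i, ∫ x, ‖f i x‖ ^ 2 = ‖F i‖ ^ 2 := by
    intro i
    rw [norm_sq_eq_integral]
    refine integral_congr_ae ?_
    filter_upwards [hF i] with x hx
    rw [hx]
  simp_rw [h2] at h1
  rw [tendsto_zero_iff_norm_tendsto_zero]
  have h3 := (Real.continuous_sqrt.tendsto 0).comp h1
  rw [Real.sqrt_zero] at h3
  refine h3.congr fun i => ?_
  simp only [Function.comp_apply]
  exact Real.sqrt_sq (norm_nonneg _)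

/-- The kinetic energy as a function of the Fourier variable. -/
def kin (ξ : Conf d X) : ℝ := 2 * Real.pi ^ 2 * ‖ξ‖ ^ 2

theorem continuous_kin : Continuous (kin : Conf d X → ℝ) := by
  unfold kin
  fun_prop

/-- The Fourier multiplier of the free group. -/
def phase (t : ℝ) (ξ : Conf d X) : ℂ := Complex.exp (Complex.I * ((-t * kin ξ : ℝ) : ℂ))

theorem norm_phase (t : ℝ) (ξ : Conf d X) : ‖phase t ξ‖ = 1 := by
  rw [phase, mul_comm, Complex.norm_exp_ofReal_mul_I]

theorem isBdd_phase (t : ℝ) : IsBdd (phase t : Conf d X → ℂ) := by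
  refine ⟨Continuous.measurable ?_, 1, fun ξ => (norm_phase t ξ).le⟩
  unfold phase
  have := continuous_kin (d := d) (X := X)
  fun_prop

theorem phase_zero (ξ : Conf d X) : phase 0 ξ = 1 := by simp [phase]

theorem phase_add (t τ : ℝ) (ξ : Conf d X) : phase (t + τ) ξ = phase t ξ * phase τ ξ := by
  rw [phase, phase, phase, ← Complex.exp_add]
  congr 1
  push_cast
  ring

theorem continuous_phase (ξ : Conf d X) : Continuous fun t => phase t ξ := by
  unfold phase
  fun_prop

theorem hasDerivAt_phase (ξ : Conf d X) :
    HasDerivAt (fun t => phase t ξ) (-Complex.I * kin ξ) 0 := by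
  have h1 : HasDerivAt (fun t : ℝ => ((-t * kin ξ : ℝ) : ℂ)) ((-1 * kin ξ : ℝ) : ℂ) 0 :=
    ((hasDerivAt_id (0 : ℝ)).neg.mul_const (kin ξ)).ofReal_comp
  have h2 := (h1.const_mul Complex.I).cexp
  convert! h2 using 1
  simp

theorem norm_slope_phase_le (h : ℝ) (ξ : Conf d X) :
    ‖h⁻¹ • (phase h ξ - 1)‖ ≤ ‖(kin ξ : ℂ)‖ := by
  rcases eq_or_ne h 0 with rfl | hh
  · simp
  · have := Real.norm_exp_I_mul_ofReal_sub_one_le (x := -h * kin ξ)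
    rw [norm_smul, norm_inv, phase]
    rw [norm_mul, norm_neg] at this
    rw [inv_mul_le_iff₀ (by positivity)]
    simpa using this

/-- The Fourier transform as a bounded operator. -/
def fourierOp (X : Finset ℕ) : Op d X :=
  (Lp.fourierTransformₗᵢ (Conf d X) ℂ).toContinuousLinearEquiv.toContinuousLinearMap

/-- The inverse Fourier transform as a bounded operator. -/
def fourierInvOp (X : Finset ℕ) : Op d X :=
  (Lp.fourierTransformₗᵢ (Conf d X) ℂ).symm.toContinuousLinearEquiv.toContinuousLinearMap

theorem fourierOp_apply (u : L2 d X) : fourierOp X u = (𝓕 u : L2 d X) := rfl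

theorem fourierOp_fourierInvOp (u : L2 d X) : fourierOp X (fourierInvOp X u) = u :=
  (Lp.fourierTransformₗᵢ (Conf d X) ℂ).apply_symm_apply u

theorem norm_fourierOp (u : L2 d X) : ‖fourierOp X u‖ = ‖u‖ :=
  (Lp.fourierTransformₗᵢ (Conf d X) ℂ).norm_map u

/-- The free group `e^{-itH₀}`. -/
def freeEvol (X : Finset ℕ) (t : ℝ) : Op d X := fourierInvOp X * multOp (phase t) * fourierOp X

theorem fourierOp_freeEvol (t : ℝ) (u : L2 d X) :
    fourierOp X (freeEvol X t u) = multOp (phase t) (fourierOp X u) := by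
  rw [freeEvol, op_mul_apply, op_mul_apply, fourierOp_fourierInvOp]

theorem fourierOp_injective : Function.Injective (fourierOp (d := d) X) :=
  (Lp.fourierTransformₗᵢ (Conf d X) ℂ).injective

theorem coeFn_fourierOp_freeEvol (t : ℝ) (u : L2 d X) :
    fourierOp X (freeEvol X t u) =ᵐ[volume] fun ξ => phase t ξ * fourierOp X u ξ := by
  rw [fourierOp_freeEvol]
  exact coeFn_multOp (isBdd_phase t) _

theorem freeEvol_zero : freeEvol (d := d) X 0 = 1 := by
  ext1 u
  refine fourierOp_injective ?_
  rw [fourierOp_freeEvol]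
  rw [op_one_apply]
  have : (fun ξ : Conf d X => phase 0 ξ) = fun _ => 1 := funext phase_zero
  rw [show (phase 0 : Conf d X → ℂ) = fun _ => 1 from this, multOp_one, op_one_apply]

theorem freeEvol_add (t τ : ℝ) : freeEvol (d := d) X (t + τ) = freeEvol X t * freeEvol X τ := by
  ext1 u
  refine fourierOp_injective ?_
  rw [op_mul_apply, fourierOp_freeEvol, fourierOp_freeEvol, fourierOp_freeEvol,
    ← op_mul_apply (multOp (phase t)), multOp_mul (isBdd_phase t) (isBdd_phase τ)]
  congr 2
  exact funext (phase_add t τ)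

theorem norm_freeEvol_apply (t : ℝ) (u : L2 d X) : ‖freeEvol X t u‖ = ‖u‖ := by
  have hle : ∀ t (u : L2 d X), ‖freeEvol X t u‖ ≤ ‖u‖ := by
    intro t u
    rw [← norm_fourierOp, fourierOp_freeEvol, ← norm_fourierOp u]
    have := norm_multOp_apply_le (isBdd_phase t) (C := 1) (fun ξ => (norm_phase t ξ).le)
      (fourierOp X u)
    rwa [one_mul] at this
  refine le_antisymm (hle t u) ?_
  have := hle (-t) (freeEvol X t u)
  rwa [← op_mul_apply, ← freeEvol_add, neg_add_cancel, freeEvol_zero, op_one_apply] at this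

theorem isUGroup_freeEvol (X : Finset ℕ) : IsUGroup (freeEvol (d := d) X) where
  unitary t := by
    have hiso : star (freeEvol (d := d) X t) * freeEvol X t = 1 :=
      (ContinuousLinearMap.norm_map_iff_adjoint_comp_self _).1 (norm_freeEvol_apply t)
    have hright : freeEvol (d := d) X t * freeEvol X (-t) = 1 := by
      rw [← freeEvol_add, add_neg_cancel, freeEvol_zero]
    refine Unitary.mem_iff.2 ⟨hiso, ?_⟩
    have h1 : freeEvol (d := d) X (-t) = star (freeEvol X t) := by
      calc freeEvol (d := d) X (-t)
          = star (freeEvol X t) * freeEvol X t * freeEvol X (-t) := by rw [hiso, one_mul]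
        _ = star (freeEvol X t) := by rw [mul_assoc, hright, mul_one]
    rw [← h1, hright]
  zero := freeEvol_zero
  add := freeEvol_add
  continuous ψ := by
    rw [continuous_iff_continuousAt]
    intro t₀
    have h : Tendsto (fun t => fourierOp X (freeEvol X t ψ - freeEvol X t₀ ψ)) (𝓝 t₀) (𝓝 0) := by
      refine tendsto_zero_of_dominated _
        (fun t ξ => (phase t ξ - phase t₀ ξ) * fourierOp X ψ ξ) (fun t => ?_)
        ((2 : ℂ) • fourierOp X ψ) (Eventually.of_forall fun t => ?_)
        (Eventually.of_forall fun ξ => ?_)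
      · rw [map_sub]
        filter_upwards [Lp.coeFn_sub (fourierOp X (freeEvol X t ψ))
          (fourierOp X (freeEvol X t₀ ψ)), coeFn_fourierOp_freeEvol t ψ,
          coeFn_fourierOp_freeEvol t₀ ψ] with ξ h1 h2 h3
        rw [h1, Pi.sub_apply, h2, h3, sub_mul]
      · filter_upwards [Lp.coeFn_smul (2 : ℂ) (fourierOp X ψ)] with ξ h1
        rw [h1, Pi.smul_apply, smul_eq_mul, norm_mul, norm_mul]
        gcongr
        refine (norm_sub_le _ _).trans ?_
        rw [norm_phase, norm_phase]
        norm_num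
      · have h1 : Tendsto (fun t => (phase t ξ - phase t₀ ξ) * fourierOp X ψ ξ) (𝓝 t₀)
            (𝓝 ((phase t₀ ξ - phase t₀ ξ) * fourierOp X ψ ξ)) :=
          (((continuous_phase ξ).sub continuous_const).mul continuous_const).tendsto t₀
        simpa using h1
    rw [tendsto_zero_iff_norm_tendsto_zero] at h
    simp_rw [norm_fourierOp] at h
    exact tendsto_iff_norm_sub_tendsto_zero.2 h

theorem isKinetic_iff_fourierOp {ψ χ : L2 d X} : IsKinetic ψ χ ↔
    fourierOp X χ =ᵐ[volume] fun ξ => (kin ξ : ℂ) * fourierOp X ψ ξ := Iff.rfl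

theorem real_smul_eq (r : ℝ) (u : L2 d X) : r • u = (r : ℂ) • u := by
  refine Lp.ext ?_
  filter_upwards [Lp.coeFn_smul r u, Lp.coeFn_smul (r : ℂ) u] with x h1 h2
  rw [h1, h2, Pi.smul_apply, Pi.smul_apply, Complex.coe_smul]

theorem coeFn_fourierOp_slope (h : ℝ) (ψ : L2 d X) :
    fourierOp X (h⁻¹ • (freeEvol X (0 + h) ψ - freeEvol X 0 ψ)) =ᵐ[volume]
      fun ξ => h⁻¹ • (phase h ξ - 1) * fourierOp X ψ ξ := by
  rw [zero_add, freeEvol_zero, op_one_apply, real_smul_eq, map_smul, map_sub]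
  filter_upwards [Lp.coeFn_smul ((h⁻¹ : ℝ) : ℂ) (fourierOp X (freeEvol X h ψ) - fourierOp X ψ),
    Lp.coeFn_sub (fourierOp X (freeEvol X h ψ)) (fourierOp X ψ),
    coeFn_fourierOp_freeEvol h ψ] with ξ h1 h2 h3
  rw [h1, Pi.smul_apply, h2, Pi.sub_apply, h3, Complex.coe_smul, smul_mul_assoc, sub_mul, one_mul]

/-- On the Fourier side the difference quotient minus its limit is dominated by twice the transform
of the kinetic energy of ψ, because |e^{ix} - 1| ≤ |x|. -/
theorem IsKinetic.hasDerivAt {ψ κ : L2 d X} (h : IsKinetic ψ κ) :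
    HasDerivAt (fun t => freeEvol X t ψ) (-Complex.I • κ) 0 := by
  rw [isKinetic_iff_fourierOp] at h
  rw [hasDerivAt_iff_tendsto_slope_zero]
  have hm : Tendsto (fun s : ℝ => fourierOp X (s⁻¹ • (freeEvol X (0 + s) ψ - freeEvol X 0 ψ) -
      -Complex.I • κ)) (𝓝[≠] 0) (𝓝 0) := by
    refine tendsto_zero_of_dominated _
      (fun s ξ => (s⁻¹ • (phase s ξ - 1) + Complex.I * kin ξ) * fourierOp X ψ ξ) (fun s => ?_)
      ((2 : ℂ) • fourierOp X κ) (Eventually.of_forall fun s => ?_)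
      (Eventually.of_forall fun ξ => ?_)
    · rw [map_sub, map_smul (fourierOp X) (-Complex.I) κ]
      filter_upwards [Lp.coeFn_sub (fourierOp X (s⁻¹ • (freeEvol X (0 + s) ψ - freeEvol X 0 ψ)))
        (-Complex.I • fourierOp X κ), coeFn_fourierOp_slope s ψ,
        Lp.coeFn_smul (-Complex.I) (fourierOp X κ), h] with ξ h1 h2 h3 h4
      rw [h1, Pi.sub_apply, h2, h3, Pi.smul_apply, h4, smul_eq_mul]
      ring
    · filter_upwards [Lp.coeFn_smul (2 : ℂ) (fourierOp X κ), h] with ξ h1 h2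
      rw [h1, Pi.smul_apply, smul_eq_mul, h2, norm_mul, norm_mul, norm_mul, ← mul_assoc]
      gcongr
      refine (norm_add_le _ _).trans ?_
      have := norm_slope_phase_le s ξ
      rw [norm_mul, Complex.norm_I, one_mul]
      have h2 : ‖(2 : ℂ)‖ = 2 := by norm_num
      rw [h2]
      linarith
    · have h1 := hasDerivAt_iff_tendsto_slope_zero.1 (hasDerivAt_phase ξ)
      have h2 := (h1.add_const (Complex.I * kin ξ)).mul_const (fourierOp X ψ ξ)
      simpa [phase_zero] using h2
  rw [tendsto_zero_iff_norm_tendsto_zero] at hm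
  simp_rw [norm_fourierOp] at hm
  exact tendsto_iff_norm_sub_tendsto_zero.2 hm

/-- L² convergence of the difference quotients along s_n → 0 gives almost everywhere convergence
along a subsequence, while the pointwise limit of the multipliers is known. Thus the domain of the
free generator is exactly H². -/
theorem isKinetic_of_hasDerivAt {ψ η : L2 d X}
    (h : HasDerivAt (fun t => freeEvol X t ψ) η 0) : IsKinetic ψ (Complex.I • η) := by
  rw [isKinetic_iff_fourierOp]
  rw [hasDerivAt_iff_tendsto_slope_zero] at h
  let s : ℕ → ℝ := fun n => ((n : ℝ) + 1)⁻¹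
  have hs : Tendsto s atTop (𝓝[≠] 0) := by
    refine tendsto_nhdsWithin_iff.2 ⟨?_, Eventually.of_forall fun n => ?_⟩
    · simpa [s, one_div] using tendsto_one_div_add_atTop_nhds_zero_nat (𝕜 := ℝ)
    · have : (0 : ℝ) < (n : ℝ) + 1 := by positivity
      exact (inv_pos.2 this).ne'
  have h1 := ((fourierOp X).continuous.tendsto η).comp (h.comp hs)
  obtain ⟨ns, hns, hae⟩ := (tendstoInMeasure_of_tendsto_Lp h1).exists_seq_tendsto_ae
  have h2 : ∀ᵐ ξ, ∀ n : ℕ, fourierOp X ((s n)⁻¹ • (freeEvol X (0 + s n) ψ - freeEvol X 0 ψ)) ξ =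
      (s n)⁻¹ • (phase (s n) ξ - 1) * fourierOp X ψ ξ :=
    ae_all_iff.2 fun n => coeFn_fourierOp_slope (s n) ψ
  rw [map_smul]
  filter_upwards [hae, h2, Lp.coeFn_smul Complex.I (fourierOp X η)] with ξ h3 h4 h5
  rw [h5, Pi.smul_apply]
  have h6 : Tendsto (fun n => (s (ns n))⁻¹ • (phase (s (ns n)) ξ - 1) * fourierOp X ψ ξ) atTop
      (𝓝 (-Complex.I * kin ξ * fourierOp X ψ ξ)) := by
    have h7 := hasDerivAt_iff_tendsto_slope_zero.1 (hasDerivAt_phase ξ)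
    have h8 := ((h7.mul_const (fourierOp X ψ ξ)).comp hs).comp hns.tendsto_atTop
    simpa [phase_zero, Function.comp_def] using h8
  have h9 := tendsto_nhds_unique h3 (h6.congr fun n => (h4 (ns n)).symm)
  rw [h9, smul_eq_mul, ← mul_assoc, ← mul_assoc, mul_neg, Complex.I_mul_I, neg_neg, one_mul]

theorem exists_isKinetic_schwartz (f : SchwartzMap (Conf d X) ℂ) :
    ∃ κ : L2 d X, IsKinetic (f.toLp 2 volume : L2 d X) κ := by
  have hg : (fun ξ : Conf d X => (kin ξ : ℂ)).HasTemperateGrowth := by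
    have h1 : (fun ξ : Conf d X => ‖ξ‖ ^ 2).HasTemperateGrowth := Function.hasTemperateGrowth_norm_sq _
    have h2 := (Function.HasTemperateGrowth.const (E := Conf d X) (2 * Real.pi ^ 2)).mul h1
    exact Function.HasTemperateGrowth.comp Function.Complex.hasTemperateGrowth_ofReal h2
  let g : SchwartzMap (Conf d X) ℂ := SchwartzMap.smulLeftCLM ℂ (fun ξ => (kin ξ : ℂ)) (𝓕 f)
  refine ⟨fourierInvOp X (g.toLp 2 volume), ?_⟩
  rw [isKinetic_iff_fourierOp, fourierOp_fourierInvOp, fourierOp_apply, SchwartzMap.toLp_fourier_eq]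
  filter_upwards [g.coeFn_toLp 2 volume, (𝓕 f : SchwartzMap (Conf d X) ℂ).coeFn_toLp 2 volume]
    with ξ h1 h2
  rw [h1, h2]
  exact SchwartzMap.smulLeftCLM_apply_apply hg _ _

theorem IsTest.exists_schwartz {a : L2 d X} (h : IsTest a) :
    ∃ f : SchwartzMap (Conf d X) ℂ, a = f.toLp 2 volume := by
  obtain ⟨g, hg, hgs, ha⟩ := h
  refine ⟨hgs.toSchwartzMap hg, Lp.ext ?_⟩
  filter_upwards [ha, (hgs.toSchwartzMap hg).coeFn_toLp 2 volume] with x h1 h2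
  rw [h1, h2]
  rfl

theorem dense_freeEvol_domain (X : Finset ℕ) :
    Dense {x : L2 d X | ∃ η, HasDerivAt (fun s => freeEvol X s x) η 0} := by
  refine (dense_schwartz (d := d) X).mono ?_
  rintro _ ⟨f, rfl⟩
  obtain ⟨κ, hκ⟩ := exists_isKinetic_schwartz f
  exact ⟨_, hκ.hasDerivAt⟩

theorem kin_eq_restr (h : Split X Z W) (ξ : Conf d W) :
    kin ξ = kin (restr h.left ξ) + kin (restr h.right ξ) := by
  rw [kin, kin, kin, norm_sq_eq_restr h]
  ring

/-- The kinetic energy |ξ|² is additive over the two groups of particles, so the multiplier factors.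
-/
theorem freeEvol_tp (h : Split X Z W) (t : ℝ) (u : L2 d X) (w : L2 d Z) :
    freeEvol W t (tp h u w) = tp h (freeEvol X t u) (freeEvol Z t w) := by
  refine fourierOp_injective ?_
  have hf : ∀ u w, fourierOp (d := d) W (tp h u w) = tp h (fourierOp X u) (fourierOp Z w) :=
    fourier_tp h
  rw [fourierOp_freeEvol, hf, hf, fourierOp_freeEvol, fourierOp_freeEvol]
  refine Lp.ext ?_
  filter_upwards [coeFn_multOp (isBdd_phase t) (tp h (fourierOp X u) (fourierOp Z w)),
    coeFn_tp h (fourierOp X u) (fourierOp Z w),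
    coeFn_tp h (multOp (phase t) (fourierOp X u)) (multOp (phase t) (fourierOp Z w)),
    (quasiMeasurePreserving_restr h.left).ae (coeFn_multOp (isBdd_phase t) (fourierOp X u)),
    (quasiMeasurePreserving_restr h.right).ae (coeFn_multOp (isBdd_phase t) (fourierOp Z w))]
    with ξ h1 h2 h3 h4 h5
  rw [h1, h2, h3, h4, h5]
  have : phase t ξ = phase t (restr h.left ξ) * phase t (restr h.right ξ) := by
    rw [phase, phase, phase, ← Complex.exp_add, kin_eq_restr h]
    congr 1
    push_cast
    ring
  rw [this]
  ring

theorem freeEvol_split (h : Split X Z W) (t : ℝ) :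
    freeEvol (d := d) W t = ampl W (freeEvol X t) * ampl W (freeEvol Z t) :=
  clm_ext_tp h fun u w => by rw [freeEvol_tp, ampl_mul_ampl_tp]

theorem freeEvol_relabelVec (e : X ≃ X') (t : ℝ) (u : L2 d X) :
    freeEvol X' t (relabelVec e u) = relabelVec e (freeEvol X t u) := by
  refine fourierOp_injective ?_
  have hf : ∀ u, fourierOp (d := d) X' (relabelVec e u) = relabelVec e (fourierOp X u) :=
    fourier_relabelVec e
  rw [fourierOp_freeEvol, hf, hf, fourierOp_freeEvol]
  refine Lp.ext ?_
  filter_upwards [coeFn_multOp (isBdd_phase t) (relabelVec e (fourierOp X u)),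
    coeFn_relabelVec e (fourierOp X u), coeFn_relabelVec e (multOp (phase t) (fourierOp X u)),
    (relabelConf (d := d) e).symm.measurePreserving.quasiMeasurePreserving.ae
      (coeFn_multOp (isBdd_phase t) (fourierOp X u))] with ξ h1 h2 h3 h4
  rw [h1, h2, h3, h4]
  have : phase t ξ = phase t ((relabelConf (d := d) e).symm ξ) := by
    rw [phase, phase, kin, kin, LinearIsometryEquiv.norm_map]
  rw [this]

theorem relabelOp_freeEvol (e : X ≃ X') (t : ℝ) :
    relabelOp e (freeEvol (d := d) X t) = freeEvol X' t := by
  ext1 u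
  rw [relabelOp_apply, ← freeEvol_relabelVec, relabelVec_apply_symm]

end Free

/-! ### The interacting group -/

section Interacting

variable {X X' : Finset ℕ} {Φ : Pos d → Pos d → ℝ}

/-- The interaction energy of the particles in `X`, as an operator on the particles in `W`. -/
def potOp (Φ : Pos d → Pos d → ℝ) (ε : ℝ) (X W : Finset ℕ) : Op d W :=
  (ε : ℂ) • ∑ p ∈ pairs X, pairOp Φ W p.1 p.2

theorem adjoint_potOp (hΦ : IsPot Φ) (ε : ℝ) (X W : Finset ℕ) :
    ContinuousLinearMap.adjoint (potOp Φ ε X W) = potOp Φ ε X W := by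
  rw [potOp, map_smulₛₗ, map_sum]
  simp_rw [adjoint_pairOp hΦ]
  simp

theorem potOp_apply (Φ : Pos d → Pos d → ℝ) (ε : ℝ) (ψ : L2 d X) :
    potOp Φ ε X X ψ = (ε : ℂ) • ∑ p ∈ pairs X, pairOp Φ X p.1 p.2 ψ := by
  rw [potOp, smul_apply, sum_apply]

theorem IsUnitaryGroup.isUGroup {ε : ℝ} {U : ℝ → Op d X} (h : IsUnitaryGroup Φ ε X U) :
    IsUGroup U := ⟨h.unitary, h.zero, h.add, h.continuous⟩

theorem isUnitaryGroup_of_isPerturbation (ε : ℝ) {U : ℝ → Op d X}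
    (hU : IsUGroup U) (h : IsPerturbation (freeEvol X) (potOp Φ ε X X) U) :
    IsUnitaryGroup Φ ε X U := by
  refine ⟨hU.unitary, hU.zero, hU.add, hU.continuous, ?_⟩
  rintro ψ χ ⟨κ, hκ, rfl⟩
  rw [smul_add, ← potOp_apply]
  exact h.hasDerivAt (isUGroup_freeEvol X) hU hκ.hasDerivAt

/-- `IsUnitaryGroup` prescribes the generator only on the domain of the Hamiltonian. The group
constructed by perturbation has precisely this domain, so uniqueness identifies U with it, and the
chosen group `evol` obeys the interaction picture equation. -/
theorem IsUnitaryGroup.isPerturbation (hΦ : IsPot Φ) (ε : ℝ) {U : ℝ → Op d X}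
    (hU : IsUnitaryGroup Φ ε X U) : IsPerturbation (freeEvol X) (potOp Φ ε X X) U := by
  obtain ⟨U', hU', hp⟩ := exists_perturbation (isUGroup_freeEvol (d := d) X)
    (adjoint_potOp hΦ ε X X)
  have : U = U' := by
    ext1 t
    symm
    refine hU'.unique hU.isUGroup ?_ ?_ t
    · refine (dense_freeEvol_domain (d := d) X).mono ?_
      rintro x ⟨η, hη⟩
      exact ⟨_, hp.hasDerivAt (isUGroup_freeEvol X) hU' hη⟩
    · intro x η hη
      have h1 := isKinetic_of_hasDerivAt (hp.hasDerivAt_free (isUGroup_freeEvol X) hU' hη)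
      have h2 := hU.generator x _ ⟨_, h1, rfl⟩
      rw [← potOp_apply] at h2
      convert! h2 using 1
      simp only [smul_add, smul_smul]
      simp
  rw [this]
  exact hp

theorem exists_isUnitaryGroup (hΦ : IsPot Φ) (ε : ℝ) (X : Finset ℕ) :
    ∃ U, IsUnitaryGroup Φ ε X U := by
  obtain ⟨U, hU, hp⟩ := exists_perturbation (isUGroup_freeEvol (d := d) X)
    (adjoint_potOp hΦ ε X X)
  exact ⟨U, isUnitaryGroup_of_isPerturbation ε hU hp⟩

theorem isUnitaryGroup_evol (hΦ : IsPot Φ) (ε : ℝ) (X : Finset ℕ) :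
    IsUnitaryGroup Φ ε X (evol Φ ε X) := by
  have h := exists_isUnitaryGroup hΦ ε X
  have h2 : evol Φ ε X = h.choose := funext fun t => by rw [evol, dif_pos h]
  rw [h2]
  exact h.choose_spec

theorem isUGroup_evol (hΦ : IsPot Φ) (ε : ℝ) (X : Finset ℕ) : IsUGroup (evol Φ ε X) :=
  (isUnitaryGroup_evol hΦ ε X).isUGroup

theorem isPerturbation_evol (hΦ : IsPot Φ) (ε : ℝ) (X : Finset ℕ) :
    IsPerturbation (freeEvol X) (potOp Φ ε X X) (evol Φ ε X) :=
  (isUnitaryGroup_evol hΦ ε X).isPerturbation hΦ ε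

theorem pair_sum_eq {M : Type*} [AddCommGroup M] [Module ℂ M] (X : Finset ℕ) {f : ℕ → ℕ → M}
    (hf : ∀ i j, f i j = f j i) :
    (2 : ℂ) • ∑ p ∈ pairs X, f p.1 p.2 = ∑ i ∈ X, ∑ j ∈ X with i ≠ j, f i j := by
  have h1 : ∑ p ∈ pairs X, f p.1 p.2 = ∑ i ∈ X, ∑ j ∈ X, if i < j then f i j else 0 := by
    rw [pairs, Finset.sum_filter, Finset.sum_product]
  have h2 : ∑ p ∈ pairs X, f p.1 p.2 = ∑ i ∈ X, ∑ j ∈ X, if j < i then f i j else 0 := by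
    rw [h1, Finset.sum_comm]
    refine Finset.sum_congr rfl fun i _ => Finset.sum_congr rfl fun j _ => ?_
    rw [hf]
  rw [two_smul]
  nth_rewrite 1 [h1]
  rw [h2, ← Finset.sum_add_distrib]
  refine Finset.sum_congr rfl fun i _ => ?_
  rw [← Finset.sum_add_distrib, Finset.sum_filter]
  refine Finset.sum_congr rfl fun j _ => ?_
  rcases lt_trichotomy i j with h | h | h
  · simp [h, h.ne, h.not_gt]
  · simp [h]
  · simp [h, h.ne', h.not_gt]

/-- A permutation need not respect the order i < j, so the sum is symmetrized over ordered pairs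
before relabelling. -/
theorem pair_sum_map {M : Type*} [AddCommGroup M] [Module ℂ M] {σ : Equiv.Perm ℕ}
    (hX : Maps σ X X') {f : ℕ → ℕ → M} (hf : ∀ i j, f i j = f j i) :
    ∑ p ∈ pairs X, f (σ p.1) (σ p.2) = ∑ p ∈ pairs X', f p.1 p.2 := by
  have h2 : (2 : ℂ) ≠ 0 := two_ne_zero
  refine (smul_right_inj h2).1 ?_
  rw [pair_sum_eq X (f := fun i j => f (σ i) (σ j)) fun i j => hf _ _, pair_sum_eq X' hf,
    hX.eq_map, Finset.sum_map]
  refine Finset.sum_congr rfl fun i _ => ?_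
  rw [Finset.sum_filter, Finset.sum_filter, Finset.sum_map]
  refine Finset.sum_congr rfl fun j _ => ?_
  simp

theorem relabelOp_potOp (hΦ : IsPot Φ) (ε : ℝ) {σ : Equiv.Perm ℕ} {W W' : Finset ℕ}
    (hX : Maps σ X X') (hW : Maps σ W W') :
    relabelOp hW.equiv (potOp Φ ε X W) = potOp Φ ε X' W' := by
  rw [potOp, potOp, relabelOp_smul, ← pair_sum_map hX (pairOp_comm hΦ W')]
  congr 1
  have h0 : relabelOp hW.equiv (0 : Op d W) = 0 := by
    ext1 u
    rw [relabelOp_apply]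
    simp
  have : ∀ s : Finset (ℕ × ℕ), relabelOp hW.equiv (∑ p ∈ s, pairOp Φ W p.1 p.2) =
      ∑ p ∈ s, pairOp Φ W' (σ p.1) (σ p.2) := by
    intro s
    induction s using Finset.induction_on with
    | empty => simpa using h0
    | insert p s hp ih =>
      rw [Finset.sum_insert hp, Finset.sum_insert hp, relabelOp_add, ih, relabelOp_pairOp hΦ]
  exact this _

/-- The relabelled group is a perturbation of the free group of X' by the potential of X'; such a
perturbation is unique. -/
theorem relabelOp_evol (hΦ : IsPot Φ) (ε : ℝ) {σ : Equiv.Perm ℕ} (hX : Maps σ X X') (t : ℝ) :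
    relabelOp hX.equiv (evol Φ ε X t) = evol Φ ε X' t := by
  have h₀ := isUGroup_freeEvol (d := d) X'
  refine IsPerturbation.unique (U := fun t => relabelOp hX.equiv (evol Φ ε X t)) h₀
    (adjoint_potOp hΦ ε X' X') ?_ (isUGroup_evol hΦ ε X').zero ?_ (isPerturbation_evol hΦ ε X') t
  · rw [(isUGroup_evol hΦ ε X).zero, relabelOp_one]
  · intro x t
    have h1 := isPerturbation_evol hΦ ε X (relabelVec hX.equiv.symm x) t
    have h2 := ((relabelVec (d := d) hX.equiv).restrictScalars ℝ).hasFDerivAt.comp_hasDerivAt t h1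
    convert! h2 using 1
    · ext1 s
      simp only [Function.comp_apply, ContinuousLinearMap.coe_restrictScalars', relabelOp_apply,
        freeEvol_relabelVec]
    · simp only [ContinuousLinearMap.coe_restrictScalars', map_smul, relabelOp_apply]
      rw [← freeEvol_relabelVec, ← relabelOp_potOp hΦ ε hX hX, relabelOp_apply_relabelVec]

end Interacting


/-! ### Groups of contractions -/

section ContractionGroups

variable {E : Type*} [NormedAddCommGroup E] [NormedSpace ℂ E]

/-- Strongly continuous groups of contractions on a complex normed space. -/
structure IsCGroup (C : ℝ → E →L[ℂ] E) : Prop where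
  norm_apply_le : ∀ t x, ‖C t x‖ ≤ ‖x‖
  zero : ∀ x, C 0 x = x
  add : ∀ t τ x, C (t + τ) x = C t (C τ x)
  continuous : ∀ x, Continuous fun t => C t x

/-- `C` is the perturbation of the group `C₀` by the bounded operator `K`. -/
def IsPert (C₀ : ℝ → E →L[ℂ] E) (K : E →L[ℂ] E) (C : ℝ → E →L[ℂ] E) : Prop :=
  ∀ x t, HasDerivAt (fun s => C₀ (-s) (C s x)) (C₀ (-t) (K (C t x))) t

namespace IsCGroup

variable {C C₀ : ℝ → E →L[ℂ] E} {K : E →L[ℂ] E} (hC : IsCGroup C)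
include hC

theorem apply_neg_self (t : ℝ) (x : E) : C t (C (-t) x) = x := by
  rw [← hC.add, add_neg_cancel, hC.zero]

theorem continuous₂ : Continuous fun p : ℝ × E => C p.1 p.2 := by
  rw [continuous_iff_continuousAt]
  rintro ⟨t, x⟩
  have h1 : Tendsto (fun p : ℝ × E => C p.1 x) (𝓝 (t, x)) (𝓝 (C t x)) :=
    ((hC.continuous x).tendsto t).comp continuous_fst.continuousAt
  have h2 : Tendsto (fun p : ℝ × E => C p.1 (p.2 - x)) (𝓝 (t, x)) (𝓝 0) := by
    refine squeeze_zero_norm (fun p => hC.norm_apply_le p.1 (p.2 - x)) ?_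
    have : Tendsto (fun p : ℝ × E => ‖p.2 - x‖) (𝓝 (t, x)) (𝓝 ‖x - x‖) :=
      ((continuous_snd.sub continuous_const).norm).tendsto (t, x)
    rwa [sub_self, norm_zero] at this
  have h3 := h1.add h2
  rw [add_zero] at h3
  refine h3.congr fun p => ?_
  rw [map_sub, add_sub_cancel]

/-- Product rule for `C(s) x(s)`. -/
theorem hasDerivAt_apply {x : ℝ → E} {x' η : E} {t : ℝ} (hx : HasDerivAt x x' t)
    (hη : HasDerivAt (fun s => C s (x t)) η t) :
    HasDerivAt (fun s => C s (x s)) (η + C t x') t := by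
  rw [hasDerivAt_iff_tendsto_slope_zero] at hx hη ⊢
  have h1 : Tendsto (fun h : ℝ => C (t + h) (h⁻¹ • (x (t + h) - x t))) (𝓝[≠] 0) (𝓝 (C t x')) := by
    have h2 : Tendsto (fun h : ℝ => t + h) (𝓝[≠] 0) (𝓝 t) := by
      have : Tendsto (fun h : ℝ => t + h) (𝓝 0) (𝓝 (t + 0)) :=
        (continuous_const.add continuous_id).tendsto 0
      rw [add_zero] at this
      exact this.mono_left nhdsWithin_le_nhds
    exact (hC.continuous₂.tendsto (t, x')).comp (h2.prodMk_nhds hx)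
  refine (hη.add h1).congr fun h => ?_
  have h3 : C (t + h) (h⁻¹ • (x (t + h) - x t)) =
      h⁻¹ • (C (t + h) (x (t + h)) - C (t + h) (x t)) := by
    rw [← map_sub, ← Complex.coe_smul, ← Complex.coe_smul, map_smul]
  rw [h3, ← smul_add]
  congr 1
  abel

theorem hasDerivAt_of_zero {x η : E} (h : HasDerivAt (fun s => C s x) η 0) (t : ℝ) :
    HasDerivAt (fun s => C s x) (C t η) t := by
  rw [hasDerivAt_iff_tendsto_slope_zero] at h ⊢
  refine (((C t).continuous.tendsto η).comp h).congr fun s => ?_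
  simp only [Function.comp_apply]
  rw [← Complex.coe_smul, map_smul, map_sub, zero_add, hC.add t s, hC.zero, Complex.coe_smul]

theorem _root_.QBBGKY.IsPert.hasDerivAt (h : IsPert C₀ K C) (h₀ : IsCGroup C₀) {x η : E}
    (hx : HasDerivAt (fun s => C₀ s x) η 0) : HasDerivAt (fun s => C s x) (η + K x) 0 := by
  have h1 := h x 0
  rw [neg_zero, h₀.zero, hC.zero] at h1
  have h2 := h₀.hasDerivAt_apply h1 (η := η) (by
    simpa only [neg_zero, h₀.zero, hC.zero] using hx)
  simpa only [h₀.apply_neg_self, h₀.zero] using h2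

omit hC in
/-- If `C₀(-s) x(s)` and `x(s)` are differentiable at `t`, then so is `C₀(h) x(t)` at `h = 0`. -/
theorem _root_.QBBGKY.IsCGroup.hasDerivAt_zero_of_hasDerivAt (h₀ : IsCGroup C₀) {x : ℝ → E}
    {x' y : E} {t : ℝ} (hx : HasDerivAt x x' t)
    (hy : HasDerivAt (fun s => C₀ (-s) (x s)) (C₀ (-t) y) t) :
    HasDerivAt (fun s => C₀ s (x t)) (x' - y) 0 := by
  have h2 := h₀.hasDerivAt_apply (x := fun s => C₀ (-s) (x s) - C₀ (-t) (x t)) (η := 0)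
    (hy.sub_const _) (by simpa using hasDerivAt_const t (0 : E))
  rw [zero_add, h₀.apply_neg_self] at h2
  have h3 := hx.sub h2
  have h4 : HasDerivAt (fun s => C₀ (s - t) (x t)) (x' - y) t := by
    refine h3.congr_of_eventuallyEq (Eventually.of_forall fun s => ?_)
    simp only [Pi.sub_apply, map_sub, h₀.apply_neg_self, sub_sub_cancel]
    rw [sub_eq_add_neg, h₀.add]
  have h5 : HasDerivAt (fun s => C₀ (s - t) (x t)) (x' - y) (0 + t) := by rwa [zero_add]
  have h6 := h5.comp_add_const 0 t
  simpa using h6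

end IsCGroup

end ContractionGroups

/-! ### Conjugation of trace class operators -/

section Conjugation

variable {H : Type} [NormedAddCommGroup H] [InnerProductSpace ℂ H] [CompleteSpace H]

/-- The group `T ↦ U(t) T U(-t)` on the trace class operators. -/
def conj (U : ℝ → H →L[ℂ] H) (t : ℝ) : TC H →L[ℂ] TC H := TC.sandwich (U t) (U (-t))

/-- The commutator `-i (V T - T V)`. -/
def comm (V : H →L[ℂ] H) : TC H →L[ℂ] TC H := -Complex.I • (TC.lmul V - TC.rmul V)

theorem comm_apply (V : H →L[ℂ] H) (T : TC H) :
    comm V T = -Complex.I • (TC.lmul V T - TC.rmul V T) := rfl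

theorem op_comm (V : H →L[ℂ] H) (T : TC H) :
    TC.op H (comm V T) = -Complex.I • (V * TC.op H T - TC.op H T * V) := by
  rw [comm_apply, map_smul, map_sub, TC.op_lmul, TC.op_rmul]

theorem norm_comm_le (V : H →L[ℂ] H) (T : TC H) : ‖comm V T‖ ≤ 2 * ‖V‖ * ‖T‖ := by
  rw [comm_apply, norm_smul, norm_neg, Complex.norm_I, one_mul]
  have h1 : ‖(1 : H →L[ℂ] H)‖ ≤ 1 := ContinuousLinearMap.norm_id_le
  have h2 : ‖TC.lmul V T‖ ≤ ‖V‖ * ‖(1 : H →L[ℂ] H)‖ * ‖T‖ := TC.norm_sandwich_le _ _ _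
  have h3 : ‖TC.rmul V T‖ ≤ ‖(1 : H →L[ℂ] H)‖ * ‖V‖ * ‖T‖ := TC.norm_sandwich_le _ _ _
  have h4 : ‖V‖ * ‖(1 : H →L[ℂ] H)‖ ≤ ‖V‖ := mul_le_of_le_one_right (norm_nonneg _) h1
  have h5 : ‖(1 : H →L[ℂ] H)‖ * ‖V‖ ≤ ‖V‖ := mul_le_of_le_one_left (norm_nonneg _) h1
  calc _ ≤ ‖TC.lmul V T‖ + ‖TC.rmul V T‖ := norm_sub_le _ _
    _ ≤ ‖V‖ * ‖T‖ + ‖V‖ * ‖T‖ := add_le_add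
        (h2.trans (mul_le_mul_of_nonneg_right h4 (norm_nonneg _)))
        (h3.trans (mul_le_mul_of_nonneg_right h5 (norm_nonneg _)))
    _ = _ := by ring

theorem isBoundedBilinearMap_kb : IsBoundedBilinearMap ℝ fun p : H × H => TC.kb p.1 p.2 where
  add_left := TC.kb_add_left
  smul_left c x y := by
    rw [← Complex.coe_smul, TC.kb_smul_left, Complex.coe_smul]
  add_right := TC.kb_add_right
  smul_right c x y := by
    rw [← Complex.coe_smul, TC.kb_smul_right, Complex.conj_ofReal, Complex.coe_smul]
  bound := ⟨1, one_pos, fun x y => by rw [one_mul]; exact TC.norm_kb_le x y⟩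

variable {U₀ U : ℝ → H →L[ℂ] H} {V : H →L[ℂ] H}

theorem conj_kb (hU : IsUGroup U) (t : ℝ) (x y : H) :
    conj U t (TC.kb x y) = TC.kb (U t x) (U t y) := by
  rw [conj, TC.sandwich_kb, hU.adjoint_eq, neg_neg]

theorem norm_conj_apply_le (hU : IsUGroup U) (t : ℝ) (T : TC H) : ‖conj U t T‖ ≤ ‖T‖ := by
  refine (TC.norm_sandwich_le _ _ _).trans ?_
  have h1 := hU.norm_le t
  have h2 := hU.norm_le (-t)
  calc _ ≤ 1 * 1 * ‖T‖ := by gcongr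
    _ = ‖T‖ := by ring

theorem conj_eq_tsum (hU : IsUGroup U) {ι : Type*} {T : TC H} {x y : ι → H}
    (hs : HasSum (fun i => TC.kb (x i) (y i)) T) (t : ℝ) :
    conj U t T = ∑' i, TC.kb (U t (x i)) (U t (y i)) := by
  have := (conj U t).hasSum hs
  simp only [conj_kb hU] at this
  exact this.tsum_eq.symm

theorem continuous_kb {f g : ℝ → H} (hf : Continuous f) (hg : Continuous g) :
    Continuous fun t => TC.kb (f t) (g t) := by
  have h1 : Continuous fun p : H × H => TC.kb p.1 p.2 := by
    have := (isBoundedBilinearMap_kb (H := H)).continuous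
    exact this
  have h2 : Continuous fun t => (f t, g t) := hf.prodMk hg
  have h3 := Continuous.comp h1 h2
  exact h3

theorem continuous_conj (hU : IsUGroup U) (T : TC H) : Continuous fun t => conj U t T := by
  obtain ⟨x, y, hs, hsum, -⟩ := T.exists_hasSum
  simp_rw [conj_eq_tsum hU hs]
  have h1 : ∀ i, Continuous fun t => TC.kb (U t (x i)) (U t (y i)) := fun i =>
    continuous_kb (hU.continuous (x i)) (hU.continuous (y i))
  have h2 : ∀ i t, ‖TC.kb (U t (x i)) (U t (y i))‖ ≤ ‖x i‖ * ‖y i‖ := fun i t => by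
    refine (TC.norm_kb_le _ _).trans_eq ?_
    rw [hU.norm_apply, hU.norm_apply]
  exact continuous_tsum h1 hsum h2

theorem isCGroup_conj (hU : IsUGroup U) : IsCGroup (conj U) where
  norm_apply_le := norm_conj_apply_le hU
  zero T := TC.op_injective (by
    rw [conj, TC.op_sandwich, neg_zero, hU.zero]; rfl)
  add t τ T := TC.op_injective (by
    rw [conj, conj, conj, TC.op_sandwich, TC.op_sandwich, TC.op_sandwich, neg_add_rev, hU.add,
      hU.add]; rfl)
  continuous := continuous_conj hU

theorem comm_kb (hV : ContinuousLinearMap.adjoint V = V) (x y : H) :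
    comm V (TC.kb x y) = TC.kb x (-Complex.I • V y) + TC.kb (-Complex.I • V x) y := by
  have h1 : ContinuousLinearMap.adjoint (1 : H →L[ℂ] H) = 1 := adjoint_one_eq
  rw [comm_apply, TC.lmul, TC.rmul, TC.sandwich_kb, TC.sandwich_kb, h1, hV, TC.kb_smul_left,
    TC.kb_smul_right]
  simp only [op_one_apply, map_neg, Complex.conj_I, neg_neg, smul_sub, neg_smul]
  abel

/-- For a rank one operator this is the product rule for its two vectors. An optimal expansion of T
is differentiated term by term; the derivatives are bounded by 2‖V‖ ‖x_i‖ ‖y_i‖ uniformly in time.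
No domain condition on T is needed. -/
theorem isPert_conj (h₀ : IsUGroup U₀) (hU : IsUGroup U)
    (hV : ContinuousLinearMap.adjoint V = V) (h : IsPerturbation U₀ V U) :
    IsPert (conj U₀) (comm V) (conj U) := by
  intro T t
  obtain ⟨x, y, hs, hsum, -⟩ := T.exists_hasSum
  have h1 : (fun t => conj U₀ (-t) (conj U t T)) = fun t =>
      ∑' i, TC.kb (U₀ (-t) (U t (x i))) (U₀ (-t) (U t (y i))) := by
    ext1 t
    have := (conj U₀ (-t)).hasSum ((conj U t).hasSum hs)
    simp only [conj_kb hU, conj_kb h₀] at this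
    exact this.tsum_eq.symm
  have h2 : conj U₀ (-t) (comm V (conj U t T)) =
      ∑' i, conj U₀ (-t) (comm V (conj U t (TC.kb (x i) (y i)))) := by
    have := (conj U₀ (-t)).hasSum ((comm V).hasSum ((conj U t).hasSum hs))
    exact this.tsum_eq.symm
  rw [h1, h2]
  refine hasDerivAt_tsum (u := fun i => 2 * ‖V‖ * (‖x i‖ * ‖y i‖))
    (g := fun i t => TC.kb (U₀ (-t) (U t (x i))) (U₀ (-t) (U t (y i))))
    (g' := fun i t => conj U₀ (-t) (comm V (conj U t (TC.kb (x i) (y i))))) (y₀ := 0)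
    (hsum.mul_left _) (fun i s => ?_) (fun i s => ?_) ?_ t
  · have h3 := (isBoundedBilinearMap_kb.hasFDerivAt (U₀ (-s) (U s (x i)),
      U₀ (-s) (U s (y i)))).comp_hasDerivAt s ((h (x i) s).prodMk (h (y i) s))
    convert! h3 using 1
    change _ = TC.kb (U₀ (-s) (U s (x i))) _ + TC.kb _ (U₀ (-s) (U s (y i)))
    rw [conj_kb hU, comm_kb hV, map_add, conj_kb h₀, conj_kb h₀,
      map_smul, map_smul]
    rfl
  · refine (norm_conj_apply_le h₀ _ _).trans ((norm_comm_le _ _).trans ?_)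
    gcongr
    exact (norm_conj_apply_le hU _ _).trans (TC.norm_kb_le _ _)
  · refine Summable.of_norm_bounded hsum fun i => (TC.norm_kb_le _ _).trans_eq ?_
    rw [h₀.norm_apply, h₀.norm_apply, hU.norm_apply, hU.norm_apply]

theorem tr_conj (hU : IsUGroup U) (t : ℝ) (T : TC H) : TC.tr H (conj U t T) = TC.tr H T := by
  rw [conj, TC.tr_sandwich]
  congr 1
  refine TC.op_injective ?_
  rw [TC.op_lmul]
  change (U (-t) * U t) * _ = _
  rw [hU.neg_mul, one_mul]

end Conjugation

/-! ### Groups of the particles in a subset -/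

section Subsets

variable {X X' Y Z U W W' : Finset ℕ} {Φ : Pos d → Pos d → ℝ} {ε : ℝ}

theorem tp_induction (h : Split X Z W) {p : L2 d W → Prop} (hclosed : IsClosed {ψ | p ψ})
    (h0 : p 0) (hadd : ∀ ψ χ, p ψ → p χ → p (ψ + χ)) (htp : ∀ u w, p (tp h u w)) (ψ : L2 d W) :
    p ψ := by
  -- Scalars are absorbed into the first factor of a product vector, so p need not be stable under
  -- scalar multiplication.
  have h0' : ∀ χ ∈ Submodule.span ℂ (Set.range fun p : L2 d X × L2 d Z => tp h p.1 p.2),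
      ∀ c : ℂ, p (c • χ) := by
    intro χ hχ
    induction hχ using Submodule.span_induction with
    | mem x hx =>
      obtain ⟨⟨u, w⟩, rfl⟩ := hx
      intro c
      simp only
      rw [← tp_smul_left]
      exact htp _ w
    | zero => intro c; rw [smul_zero]; exact h0
    | add x y _ _ hx hy => intro c; rw [smul_add]; exact hadd _ _ (hx c) (hy c)
    | smul b x _ hx => intro c; rw [smul_smul]; exact hx _
  have h1 : ∀ χ ∈ Submodule.span ℂ (Set.range fun p : L2 d X × L2 d Z => tp h p.1 p.2), p χ :=
    fun χ hχ => by simpa using h0' χ hχ 1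
  have h2 : ψ ∈ (Submodule.span ℂ
      (Set.range fun p : L2 d X × L2 d Z => tp h p.1 p.2)).topologicalClosure := by
    rw [dense_span_tp]
    exact Submodule.mem_top
  exact closure_minimal h1 hclosed h2

theorem isClosed_continuous {E : Type*} [NormedAddCommGroup E] {A : ℝ → E → E}
    (hA : ∀ t x y, ‖A t x - A t y‖ ≤ ‖x - y‖) : IsClosed {x | Continuous fun t => A t x} := by
  rw [← isSeqClosed_iff_isClosed]
  intro x y hx hy
  have : TendstoUniformly (fun n t => A t (x n)) (fun t => A t y) atTop := by
    rw [Metric.tendstoUniformly_iff]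
    intro r hr
    have h1 := (Metric.tendsto_nhds.1 hy) r hr
    filter_upwards [h1] with n hn t
    rw [dist_eq_norm, norm_sub_rev]
    rw [dist_eq_norm] at hn
    exact (hA t _ _).trans_lt hn
  exact this.continuous (Frequently.of_forall hx)

theorem IsUGroup.ampl {u : ℝ → Op d X} (hu : IsUGroup u) (h : X ⊆ W) :
    IsUGroup fun t => ampl W (u t) where
  unitary t := ampl_mem_unitary h (hu.unitary t)
  zero := by rw [hu.zero, ampl_one h]
  add t τ := by rw [hu.add, ampl_mul h]
  continuous ψ := by
    have hs := Split.of_subset h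
    have hn : ∀ t (x : L2 d W), ‖QBBGKY.ampl W (u t) x‖ = ‖x‖ := fun t x =>
      ContinuousLinearMap.norm_map_of_mem_unitary (ampl_mem_unitary h (hu.unitary t)) x
    refine tp_induction hs (p := fun ψ => Continuous fun t => QBBGKY.ampl W (u t) ψ) ?_ ?_ ?_ ?_ ψ
    · refine isClosed_continuous (A := fun t x => QBBGKY.ampl W (u t) x) fun t x y => ?_
      rw [← map_sub, hn]
    · simpa using continuous_const
    · intro ψ χ hψ hχ
      simp_rw [map_add]
      exact hψ.add hχ
    · intro v w
      simp_rw [ampl_tp hs]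
      exact (continuous_tp hs).comp ((hu.continuous v).prodMk continuous_const)

/-- For u(t) ⊗ 1 the equation is directly available only on product vectors. There it identifies
u(t) ⊗ 1 with the perturbed group on W, which satisfies the equation on all vectors. -/
theorem IsPerturbation.ampl {u₀ u : ℝ → Op d X} {V : Op d X} (h₀ : IsUGroup u₀) (hu : IsUGroup u)
    (hV : ContinuousLinearMap.adjoint V = V) (hp : IsPerturbation u₀ V u) (h : X ⊆ W) :
    IsPerturbation (fun t => ampl W (u₀ t)) (ampl W V) fun t => ampl W (u t) := by
  have hV' : ContinuousLinearMap.adjoint (QBBGKY.ampl W V) = QBBGKY.ampl W V := by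
    rw [← ampl_adjoint h, hV]
  have h₀' := h₀.ampl h
  obtain ⟨u', hu', hp'⟩ := exists_perturbation h₀' hV'
  have hs := Split.of_subset h
  have key : u' = fun t => QBBGKY.ampl W (u t) := by
    ext1 t
    refine clm_ext_tp hs fun x w => ?_
    have := solution_unique (inner_interaction h₀' hV')
      (x := fun s => QBBGKY.ampl W (u₀ (-s)) (u' s (tp hs x w)))
      (y := fun s => QBBGKY.ampl W (u₀ (-s)) (QBBGKY.ampl W (u s) (tp hs x w)))
      (fun t => by
        convert! hp' (tp hs x w) t using 1
        simp only [smul_apply, ContinuousLinearMap.comp_apply, h₀'.apply_neg_self])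
      (fun t => by
        simp only [smul_apply, ContinuousLinearMap.comp_apply, h₀'.apply_neg_self]
        simp only [ampl_tp hs]
        have h1 := ((tpL (d := d) hs).flip w).restrictScalars ℝ |>.hasFDerivAt.comp_hasDerivAt t
          (hp x t)
        convert! h1 using 1
        simp only [ContinuousLinearMap.coe_restrictScalars', ContinuousLinearMap.flip_apply,
          tpL_apply, tp_smul_left]) (by
        simp only [neg_zero, h₀'.zero_apply, hu'.zero_apply, (hu.ampl h).zero_apply]) t
    rw [← h₀'.apply_neg_self t (u' t (tp hs x w)), this, h₀'.apply_neg_self]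
  rw [key] at hp'
  exact hp'

/-- The free group of the particles in `X`, acting on operators of the particles in `W`. -/
def freeG (X W : Finset ℕ) (t : ℝ) : TCV d W →L[ℂ] TCV d W :=
  conj (fun t => ampl W (freeEvol X t)) t

/-- The group `𝒢*` of the particles in `X`, acting on operators of the particles in `W`. -/
def evolG (Φ : Pos d → Pos d → ℝ) (ε : ℝ) (X W : Finset ℕ) (t : ℝ) : TCV d W →L[ℂ] TCV d W :=
  conj (fun t => ampl W (evol Φ ε X t)) t

theorem isCGroup_freeG (h : X ⊆ W) : IsCGroup (freeG (d := d) X W) :=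
  isCGroup_conj ((isUGroup_freeEvol X).ampl h)

theorem isCGroup_evolG (hΦ : IsPot Φ) (h : X ⊆ W) : IsCGroup (evolG Φ ε X W) :=
  isCGroup_conj ((isUGroup_evol hΦ ε X).ampl h)

theorem ampl_potOp (hΦ : IsPot Φ) (ε : ℝ) (hU : U ⊆ X) (h : X ⊆ W) :
    ampl W (potOp Φ ε U X) = potOp Φ ε U W := by
  rw [potOp, ampl_smul h, ampl_sum h, potOp]
  congr 1
  refine Finset.sum_congr rfl fun p hp => ?_
  simp only [pairs, Finset.mem_filter, Finset.mem_product] at hp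
  exact ampl_pairOp hΦ h (hU hp.1.1) (hU hp.1.2)

theorem isPert_evolG (hΦ : IsPot Φ) (ε : ℝ) (h : X ⊆ W) :
    IsPert (freeG X W) (comm (potOp Φ ε X W)) (evolG Φ ε X W) := by
  have h1 := (isPerturbation_evol hΦ ε X).ampl (isUGroup_freeEvol X) (isUGroup_evol hΦ ε X)
    (adjoint_potOp hΦ ε X X) h
  rw [ampl_potOp hΦ ε le_rfl h] at h1
  exact isPert_conj ((isUGroup_freeEvol X).ampl h) ((isUGroup_evol hΦ ε X).ampl h)
    (adjoint_potOp hΦ ε X W) h1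

theorem Split.inter (h : Split U Z W) (hX : X ⊆ W) : Split (U ∩ X) (Z ∩ X) X := by
  refine ⟨Finset.inter_subset_right, ?_⟩
  rw [h.eq]
  ext a
  simp only [Finset.mem_inter, Finset.mem_sdiff]
  constructor
  · rintro ⟨⟨-, h2⟩, h3⟩
    exact ⟨h3, fun h4 => h2 h4.1⟩
  · rintro ⟨h3, h4⟩
    exact ⟨⟨hX h3, fun h5 => h4 ⟨h5, h3⟩⟩, h3⟩

/-- Without interaction the motion of X splits into the motions of its particles in U and in Z.
Together with `pt_freeG` this makes the free interaction picture compatible with products of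
correlations and with partial traces. -/
theorem freeG_tens (h : Split U Z W) (hX : X ⊆ W) (t : ℝ) (S : TCV d U) (T : TCV d Z) :
    freeG X W t (tens h S T) = tens h (freeG (U ∩ X) U t S) (freeG (Z ∩ X) Z t T) := by
  have key : ∀ t, ampl W (freeEvol (d := d) X t) =
      ampl W (ampl U (freeEvol (U ∩ X) t)) * ampl W (ampl Z (freeEvol (Z ∩ X) t)) := by
    intro t
    rw [ampl_ampl Finset.inter_subset_left h.left, ampl_ampl Finset.inter_subset_left h.right,
      freeEvol_split (h.inter hX), ampl_mul hX, ampl_ampl Finset.inter_subset_right hX,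
      ampl_ampl Finset.inter_subset_right hX]
  rw [freeG, freeG, freeG, conj, conj, conj, tens_sandwich, key, key]

theorem pt_freeG (hY : Y ⊆ W) (hX : X ⊆ W) (t : ℝ) (T : TCV d W) :
    pt hY (freeG X W t T) = freeG (Y ∩ X) Y t (pt hY T) := by
  have hs := Split.of_subset hY
  have : pt hY ∘L freeG X W t = freeG (Y ∩ X) Y t ∘L pt (d := d) hY := by
    refine clm_ext_tens hs fun S T => ?_
    simp only [ContinuousLinearMap.comp_apply]
    rw [freeG_tens hs hX, pt_tens hs, pt_tens hs, map_smul, freeG, freeG,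
      tr_conj ((isUGroup_freeEvol _).ampl Finset.inter_subset_left)]
  exact congrArg (fun f => f T) this

/-- The moving particles are all traced out, and by cyclicity the unitary and its inverse cancel. -/
theorem pt_evolG (hΦ : IsPot Φ) (hY : Y ⊆ W) (hX : X ⊆ W) (hd : Disjoint X Y) (t : ℝ)
    (T : TCV d W) : pt hY (evolG Φ ε X W t T) = pt hY T := by
  have h1 : evolG Φ ε X W t T = TC.lmul (ampl W (evol Φ ε X t))
      (TC.rmul (ampl W (evol Φ ε X (-t))) T) := TC.op_injective (by
    rw [evolG, conj, TC.op_sandwich, TC.op_lmul, TC.op_rmul]; rfl)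
  rw [h1, pt_lmul_eq_rmul hY hX hd]
  refine congrArg (pt hY) (TC.op_injective ?_)
  rw [TC.op_rmul, TC.op_rmul, mul_assoc, ← ampl_mul hX, (isUGroup_evol hΦ ε X).neg_mul,
    ampl_one hX, mul_one]

theorem op_evolG (t : ℝ) (T : TCV d W) : TC.op _ (evolG Φ ε X W t T) =
    ampl W (evol Φ ε X t) * TC.op _ T * ampl W (evol Φ ε X (-t)) := by
  rw [evolG, conj, TC.op_sandwich]
  rfl

variable {σ : Equiv.Perm ℕ}

theorem rlT_evolG (hΦ : IsPot Φ) (hX : Maps σ X X') (hW : Maps σ W W') (h : X ⊆ W) (t : ℝ)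
    (T : TCV d W) :
    rlT hW.equiv (evolG Φ ε X W t T) = evolG Φ ε X' W' t (rlT hW.equiv T) := by
  rw [evolG, evolG, conj, conj, rlT_sandwich, relabelOp_ampl hX hW h, relabelOp_ampl hX hW h,
    relabelOp_evol hΦ, relabelOp_evol hΦ]

theorem rlT_freeG (hX : Maps σ X X') (hW : Maps σ W W') (h : X ⊆ W) (t : ℝ)
    (T : TCV d W) :
    rlT hW.equiv (freeG X W t T) = freeG X' W' t (rlT hW.equiv T) := by
  rw [freeG, freeG, conj, conj, rlT_sandwich, relabelOp_ampl hX hW h, relabelOp_ampl hX hW h,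
    relabelOp_freeEvol, relabelOp_freeEvol]

/-! ### Commutators with pair potentials -/

/-- `𝒩*_int(i, j)` on trace class operators. -/
def nint (Φ : Pos d → Pos d → ℝ) (W : Finset ℕ) (i j : ℕ) : TCV d W →L[ℂ] TCV d W :=
  comm (pairOp Φ W i j)

theorem op_nint (i j : ℕ) (T : TCV d W) : TC.op _ (nint Φ W i j T) = Nint Φ i j (TC.op _ T) :=
  op_comm _ _

theorem nint_comm (hΦ : IsPot Φ) (W : Finset ℕ) (i j : ℕ) : nint Φ W i j = nint Φ W j i := by
  rw [nint, pairOp_comm hΦ, nint]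

theorem comm_potOp (X : Finset ℕ) (T : TCV d W) :
    comm (potOp Φ ε X W) T = (ε : ℂ) • ∑ p ∈ pairs X, nint Φ W p.1 p.2 T := by
  refine TC.op_injective ?_
  rw [op_comm, map_smul, map_sum, potOp]
  simp_rw [nint, op_comm]
  rw [smul_mul_assoc, mul_smul_comm, ← smul_sub, Finset.sum_mul, Finset.mul_sum,
    ← Finset.sum_sub_distrib, ← Finset.smul_sum, smul_comm]

theorem norm_nint_le {C : ℝ} (hΦ : IsPot Φ) (hC : ∀ q q', |Φ q q'| ≤ C) (i j : ℕ) (T : TCV d W) :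
    ‖nint Φ W i j T‖ ≤ 2 * C * ‖T‖ := by
  have h0 : 0 ≤ C := (abs_nonneg _).trans (hC 0 0)
  refine (norm_comm_le _ _).trans ?_
  gcongr
  rw [pairOp_eq]
  refine ContinuousLinearMap.opNorm_le_bound _ h0 fun u => ?_
  exact norm_multOp_apply_le (hΦ.isBdd i j) (fun q => by simpa using hC _ _) u

theorem nint_tens (hΦ : IsPot Φ) (h : Split X Z W) {i j : ℕ} (hi : i ∈ X) (hj : j ∈ X)
    (S : TCV d X) (T : TCV d Z) :
    nint Φ W i j (tens h S T) = tens h (nint Φ X i j S) T := by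
  have h1 := lmul_tens h (pairOp Φ X i j) (1 : Op d Z) S T
  have h2 : TC.rmul (ampl W (pairOp Φ X i j)) (tens h S T) =
      tens h (TC.rmul (pairOp Φ X i j) S) T := by
    refine TC.op_injective ?_
    rw [TC.op_rmul, op_tens, op_tens, TC.op_rmul, ampl_mul h.left, mul_assoc,
      (ampl_commute h.right h.left h.disjoint.symm _ _).eq, mul_assoc]
  have h3 : TC.lmul (1 : Op d Z) T = T := TC.op_injective (by rw [TC.op_lmul, one_mul])
  rw [ampl_one h.right, mul_one, h3] at h1
  rw [nint, nint, comm_apply, comm_apply, ← ampl_pairOp hΦ h.left hi hj, h1, h2, map_smul, map_sub]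
  rfl

theorem nint_tens_right (hΦ : IsPot Φ) (h : Split X Z W) {i j : ℕ} (hi : i ∈ Z) (hj : j ∈ Z)
    (S : TCV d X) (T : TCV d Z) :
    nint Φ W i j (tens h S T) = tens h S (nint Φ Z i j T) := by
  rw [← tens_comm h, nint_tens hΦ h.symm hi hj, tens_comm]

theorem pt_nint (hΦ : IsPot Φ) (h : X ⊆ W) {i j : ℕ} (hi : i ∈ X) (hj : j ∈ X) (T : TCV d W) :
    pt h (nint Φ W i j T) = nint Φ X i j (pt h T) := by
  have hs := Split.of_subset h
  have : pt h ∘L nint Φ W i j = nint Φ X i j ∘L pt (d := d) h := by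
    refine clm_ext_tens hs fun S T => ?_
    simp only [ContinuousLinearMap.comp_apply]
    rw [nint_tens hΦ hs hi hj, pt_tens hs, pt_tens hs, map_smul]
  exact congrArg (fun f => f T) this

/-- The partial trace of a commutator with an operator of the traced particles vanishes. -/
theorem pt_nint_eq_zero (hΦ : IsPot Φ) (h : X ⊆ W) {i j : ℕ} (hi : i ∈ W \ X) (hj : j ∈ W \ X)
    (T : TCV d W) : pt h (nint Φ W i j T) = 0 := by
  rw [nint, comm_apply, map_smul, map_sub, ← ampl_pairOp hΦ Finset.sdiff_subset hi hj,
    pt_lmul_eq_rmul h Finset.sdiff_subset Finset.sdiff_disjoint, sub_self, smul_zero]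

theorem rlT_nint (hΦ : IsPot Φ) (hW : Maps σ W W') (i j : ℕ) (T : TCV d W) :
    rlT hW.equiv (nint Φ W i j T) = nint Φ W' (σ i) (σ j) (rlT hW.equiv T) := by
  have h1 : relabelOp hW.equiv (1 : Op d W) = 1 := relabelOp_one _
  rw [nint, nint, comm_apply, comm_apply, map_smul, map_sub, TC.lmul, TC.rmul, rlT_sandwich,
    rlT_sandwich, relabelOp_pairOp hΦ, h1]

end Subsets


/-! ### Trace class families -/

section Families

variable {X Y Z U V W : Finset ℕ} {Φ : Pos d → Pos d → ℝ} {ε t : ℝ} {F : OpFam d}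

theorem ampl_of_not_subset (h : ¬X ⊆ W) (A : Op d X) : ampl W A = 0 := by
  rw [ampl, dif_neg]
  rintro ⟨hX, -⟩
  exact h hX

theorem commute_ampl (W : Finset ℕ) (h : Disjoint X Z) (A : Op d X) (B : Op d Z) :
    Commute (ampl W A) (ampl W B) := by
  by_cases hX : X ⊆ W
  · by_cases hZ : Z ⊆ W
    · exact ampl_commute hX hZ h A B
    · rw [ampl_of_not_subset hZ]; exact Commute.zero_right _
  · rw [ampl_of_not_subset hX]; exact Commute.zero_left _

/-- With no particles the configuration space is a point of mass 1 and the identity is a rank one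
operator. This starts the inductions over sets of particles, as `expFam` equals 1 on the empty set.
-/
theorem isTraceClass_one_empty : IsTraceClass (1 : Op d ∅) ∧ traceNorm (1 : Op d ∅) ≤ 1 := by
  have hvol : (volume : Measure (Conf d ∅)) = Measure.dirac 0 := by
    have h1 := PiLp.volume_preserving_toLp (ι := ((∅ : Finset ℕ) × Fin d))
    rw [← h1.map_eq, Measure.volume_pi_eq_dirac 0, Measure.map_dirac' h1.measurable]
    rfl
  have : IsProbabilityMeasure (volume : Measure (Conf d ∅)) := by
    rw [hvol]; infer_instance
  let e : L2 d ∅ := (memLp_const (1 : ℂ)).toLp (fun _ : Conf d ∅ => (1 : ℂ))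
  have he : ‖e‖ ≤ 1 := by
    have := (Lp.norm_toLp (p := 2) (μ := (volume : Measure (Conf d ∅)))
      (fun _ : Conf d ∅ => (1 : ℂ)) (memLp_const 1)).le
    refine this.trans ?_
    rw [eLpNorm_const _ (by norm_num) (IsProbabilityMeasure.ne_zero _)]
    simp
  have h0 : ∀ u v : L2 d ∅, u 0 = v 0 → u = v := by
    intro u v h
    refine Lp.ext ?_
    refine Eventually.of_forall fun q => ?_
    rwa [Subsingleton.elim q 0]
  have hae : ∀ {p : Conf d ∅ → Prop}, (∀ᵐ q, p q) → p 0 := by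
    intro p hp
    obtain ⟨q, hq⟩ := hp.exists
    rwa [Subsingleton.elim 0 q]
  have he0 : e 0 = 1 := hae (p := fun q => e q = 1) (MemLp.coeFn_toLp _)
  have h1 : (1 : Op d ∅) = ketbra e e := by
    ext1 u
    refine h0 _ _ ?_
    rw [ketbra, InnerProductSpace.rankOne_apply]
    have h2 : ((⟪e, u⟫_ℂ • e : L2 d ∅) : Conf d ∅ → ℂ) 0 = ⟪e, u⟫_ℂ * e 0 :=
      hae (p := fun q => ((⟪e, u⟫_ℂ • e : L2 d ∅) : Conf d ∅ → ℂ) q = ⟪e, u⟫_ℂ * e q)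
        (Lp.coeFn_smul _ _)
    rw [h2, he0, mul_one, L2.inner_def, op_one_apply]
    have h3 : ∀ q : Conf d ∅, ⟪e q, u q⟫_ℂ = u 0 := by
      intro q
      rw [Subsingleton.elim q 0, he0]
      simp
    simp_rw [h3]
    simp
  have h2 := traceNorm_ketbra_le e e
  have h3 : ‖e‖ₑ * ‖e‖ₑ ≤ 1 := by
    have : ‖e‖ₑ ≤ 1 := by
      rw [← ofReal_norm]
      exact ENNReal.ofReal_le_one.2 he
    exact mul_le_one' this this
  rw [h1]
  exact ⟨(h2.trans h3).trans_lt ENNReal.one_lt_top, h2.trans h3⟩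

/-- The tensor product of an operator of the particles in `U` and one of the other particles
of `W`. -/
def tn (U W : Finset ℕ) : TCV d U →L[ℂ] TCV d (W \ U) →L[ℂ] TCV d W :=
  if h : U ⊆ W then tens (Split.of_subset h) else 0

theorem tn_of_subset (h : U ⊆ W) : tn (d := d) U W = tens (Split.of_subset h) := dif_pos h

theorem op_tn (S : TCV d U) (T : TCV d (W \ U)) :
    TC.op _ (tn U W S T) = ampl W (TC.op _ S) * ampl W (TC.op _ T) := by
  by_cases h : U ⊆ W
  · rw [tn_of_subset h, op_tens]
  · rw [tn, dif_neg h, ampl_of_not_subset h, zero_mul]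
    rfl

theorem norm_tn_le (S : TCV d U) (T : TCV d (W \ U)) : ‖tn U W S T‖ ≤ ‖S‖ * ‖T‖ := by
  by_cases h : U ⊆ W
  · rw [tn_of_subset h]
    exact norm_tens_le _ _ _
  · rw [tn, dif_neg h]
    simp only [zero_apply, norm_zero]
    positivity

theorem freeG_tn (hX : X ⊆ W) (S : TCV d U) (T : TCV d (W \ U)) :
    freeG X W t (tn U W S T) = tn U W (freeG (U ∩ X) U t S) (freeG ((W \ U) ∩ X) (W \ U) t T) := by
  by_cases h : U ⊆ W
  · rw [tn_of_subset h, freeG_tens (Split.of_subset h) hX]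
  · rw [tn, dif_neg h]
    simp only [zero_apply, map_zero]

theorem ampl_lprod (h : V ⊆ W) {β : Type*} (s : Finset β) (f : β → Op d V) :
    ampl W (lprod s f) = lprod s fun b => ampl W (f b) := by
  rw [lprod, lprod]
  induction s.toList with
  | nil => simpa using ampl_one h
  | cons a l ih => simp only [List.map_cons, List.prod_cons, ampl_mul h, ih]

theorem ampl_expSum (h : V ⊆ W) (w : ℕ → ℂ) (f : Finset ℕ → Op d V) :
    ampl W (expSum w f V) = expSum w (fun b => ampl W (f b)) V := by
  rw [expSum, expSum, ampl_sum h]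
  refine Finset.sum_congr rfl fun P _ => ?_
  rw [ampl_smul h, ampl_lprod h]

/-- The sum over the partitions of `V` of the products of the `F(B)` over their blocks. -/
def expFam (F : OpFam d) : OpFam d := fun V => ∑ Q : Finpartition V, clusterProd Q F

theorem ampl_clusterProd (h : V ⊆ W) (Q : Finpartition V) :
    ampl W (clusterProd Q F) = lprod Q.parts fun B => ampl W (F B) := by
  have : clusterProd Q F = lprod Q.parts fun B => ampl V (F B) := rfl
  rw [this, ampl_lprod h]
  exact lprod_congr fun B hB => ampl_ampl (Q.le hB) h _

theorem ampl_expFam (h : V ⊆ W) :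
    ampl W (expFam F V) = expSum (1 : ℕ → ℂ) (fun B => ampl W (F B)) V := by
  rw [expFam, ampl_sum h, expSum]
  refine Finset.sum_congr rfl fun Q _ => ?_
  rw [ampl_clusterProd h, Pi.one_apply, one_smul]

theorem expFam_empty : expFam F ∅ = 1 := by
  have := ampl_expFam (F := F) (Finset.empty_subset ∅)
  rwa [ampl_self, expSum_empty, Pi.one_apply, one_smul] at this

theorem ampl_expFam_eq_sum (h : V ⊆ W) {a : ℕ} (ha : a ∈ V) :
    ampl W (expFam F V) = ∑ U ∈ V.powerset,
      if a ∈ U then ampl W (F U) * ampl W (expFam F (V \ U)) else 0 := by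
  rw [ampl_expFam h, expSum_eq_sum_mem (1 : ℕ → ℂ) (fun U _ U' _ hd => commute_ampl W hd _ _) ha]
  refine Finset.sum_congr rfl fun U _ => ?_
  rw [ampl_expFam (Finset.sdiff_subset.trans h)]
  rfl

theorem sdiff_ssubset {a : ℕ} (hU : U ⊆ V) (ha : a ∈ U) : V \ U ⊂ V :=
  Finset.sdiff_ssubset hU ⟨a, ha⟩

/-- Families of operators that are trace class on non-empty sets of particles. -/
def IsTCFam (F : OpFam d) : Prop := ∀ V : Finset ℕ, V.Nonempty → IsTraceClass (F V)

/-- The members of a family, as trace class operators. -/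
def famT (F : OpFam d) (V : Finset ℕ) : TCV d V := TC.mk (F V)

theorem IsTCFam.op_famT (hF : IsTCFam F) (hV : V.Nonempty) : TC.op _ (famT F V) = F V :=
  TC.op_mk (hF V hV)

theorem eq_zero_or_op_sum {s : Finset (Finset ℕ)} (T : Finset ℕ → TCV d V) (p : Finset ℕ → Prop)
    [DecidablePred p] : TC.op _ (∑ U ∈ s, if p U then T U else 0) =
      ∑ U ∈ s, if p U then TC.op _ (T U) else 0 := by
  rw [map_sum]
  refine Finset.sum_congr rfl fun U _ => ?_
  split_ifs
  · rfl
  · exact map_zero _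

theorem IsTCFam.isTraceClass_expFam (hF : IsTCFam F) (V : Finset ℕ) :
    IsTraceClass (expFam F V) := by
  induction V using Finset.strongInduction with
  | H V ih =>
    rcases V.eq_empty_or_nonempty with rfl | ⟨a, ha⟩
    · rw [expFam_empty]
      exact isTraceClass_one_empty.1
    · have : expFam F V = TC.op _ (∑ U ∈ V.powerset, if a ∈ U then
          tn U V (famT F U) (TC.mk (expFam F (V \ U))) else 0) := by
        rw [eq_zero_or_op_sum, ← ampl_self (expFam F V), ampl_expFam_eq_sum le_rfl ha]
        refine Finset.sum_congr rfl fun U hU => ?_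
        split_ifs with haU
        · rw [op_tn, hF.op_famT ⟨a, haU⟩,
            TC.op_mk (ih _ (sdiff_ssubset (Finset.mem_powerset.1 hU) haU))]
        · rfl
      rw [this]
      exact TC.isTraceClass_op _

/-- The operators of `expFam`, as trace class operators. -/
def expT (F : OpFam d) (V : Finset ℕ) : TCV d V := TC.mk (expFam F V)

theorem IsTCFam.op_expT (hF : IsTCFam F) (V : Finset ℕ) : TC.op _ (expT F V) = expFam F V :=
  TC.op_mk (hF.isTraceClass_expFam V)

theorem IsTCFam.expT_eq_sum (hF : IsTCFam F) {a : ℕ} (ha : a ∈ V) :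
    expT F V = ∑ U ∈ V.powerset, if a ∈ U then tn U V (famT F U) (expT F (V \ U)) else 0 := by
  refine TC.op_injective ?_
  rw [eq_zero_or_op_sum, hF.op_expT, ← ampl_self (expFam F V), ampl_expFam_eq_sum le_rfl ha]
  refine Finset.sum_congr rfl fun U hU => ?_
  split_ifs with haU
  · rw [op_tn, hF.op_famT ⟨a, haU⟩, hF.op_expT]
  · rfl

theorem norm_expT_empty : ‖expT F ∅‖ ≤ 1 := by
  refine TC.norm_mk_le zero_le_one ?_
  rw [expFam_empty, ENNReal.ofReal_one]
  exact isTraceClass_one_empty.2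

/-! ### The evolution of a trace class family -/

/-- The evolution of `expFam F` when the particles in `X` move. -/
def evolFam (Φ : Pos d → Pos d → ℝ) (ε t : ℝ) (X : Finset ℕ) (F : OpFam d) : OpFam d := fun V =>
  ampl V (evol Φ ε (V ∩ X) t) * expFam F V * ampl V (evol Φ ε (V ∩ X) (-t))

theorem ampl_evolFam (h : V ⊆ W) : ampl W (evolFam Φ ε t X F V) =
    ampl W (evol Φ ε (V ∩ X) t) * ampl W (expFam F V) * ampl W (evol Φ ε (V ∩ X) (-t)) := by
  rw [evolFam, ampl_mul h, ampl_mul h, ampl_ampl Finset.inter_subset_left h,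
    ampl_ampl Finset.inter_subset_left h]

theorem evolFam_empty (hΦ : IsPot Φ) : evolFam Φ ε t X F ∅ = 1 := by
  rw [evolFam, expFam_empty, mul_one, ← ampl_mul Finset.inter_subset_left,
    (isUGroup_evol hΦ ε _).mul_neg, ampl_one Finset.inter_subset_left]

/-- One factor of the product of the evolved blocks. -/
def evolBlock (Φ : Pos d → Pos d → ℝ) (ε t : ℝ) (X W : Finset ℕ) (F : OpFam d)
    (Z : Finset (Finset ℕ)) : Op d W :=
  ampl W (evol Φ ε (declust Z ∩ X) t) * lprod Z (fun B => ampl W (F B)) *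
    ampl W (evol Φ ε (declust Z ∩ X) (-t))

theorem le_declust {Z : Finset (Finset ℕ)} {B : Finset ℕ} (hB : B ∈ Z) : B ⊆ declust Z :=
  Finset.le_sup (f := id) hB

theorem commute_evol_evol {Z Z' : Finset (Finset ℕ)} (h : Disjoint (declust Z) (declust Z'))
    (τ τ' : ℝ) : Commute (ampl W (evol Φ ε (declust Z ∩ X) τ))
      (ampl W (evol Φ ε (declust Z' ∩ X) τ')) :=
  commute_ampl W (h.mono Finset.inter_subset_left Finset.inter_subset_left) _ _

theorem commute_evol_lprod {Z Z' : Finset (Finset ℕ)} (h : Disjoint (declust Z) (declust Z'))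
    (τ : ℝ) : Commute (ampl W (evol Φ ε (declust Z ∩ X) τ)) (lprod Z' fun B => ampl W (F B)) :=
  commute_lprod fun _ hB => commute_ampl W (h.mono Finset.inter_subset_left (le_declust hB)) _ _

theorem commute_lprod_lprod {Z Z' : Finset (Finset ℕ)} (h : Disjoint (declust Z) (declust Z')) :
    Commute (lprod Z fun B => ampl W (F B)) (lprod Z' fun B => ampl W (F B)) :=
  commute_lprod fun _ hB => (commute_lprod fun _ hB' =>
    commute_ampl W (h.mono (le_declust hB') (le_declust hB)).symm _ _).symm

theorem commute_evolBlock {Z Z' : Finset (Finset ℕ)} (h : Disjoint (declust Z) (declust Z')) :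
    Commute (evolBlock Φ ε t X W F Z) (evolBlock Φ ε t X W F Z') :=
  (((commute_evol_evol h _ _).mul_right (commute_evol_lprod h _)).mul_right
      (commute_evol_evol h _ _)).mul_left
    ((((commute_evol_lprod h.symm _).symm.mul_right (commute_lprod_lprod h)).mul_right
      (commute_evol_lprod h.symm _).symm)) |>.mul_left
    (((commute_evol_evol h _ _).mul_right (commute_evol_lprod h _)).mul_right
      (commute_evol_evol h _ _))

theorem disjoint_declust {Q : Finpartition V} (R : Finpartition Q.parts)
    {Z Z' : Finset (Finset ℕ)} (hZ : Z ∈ R.parts) (hZ' : Z' ∈ R.parts) (h : Z ≠ Z') :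
    Disjoint (declust Z) (declust Z') :=
  disjoint_sup_of_parts Q (R.le hZ) (R.le hZ') (R.disjoint hZ hZ' h)

/-- Different blocks of R involve disjoint sets of particles, so all their factors commute and can
be regrouped block by block. -/
theorem evolProd_mul_clusterProd_mul (Q : Finpartition V) (R : Finpartition Q.parts) :
    evolProd Φ ε X V R t * clusterProd Q F * evolProd Φ ε X V R (-t) =
      lprod R.parts (evolBlock Φ ε t X V F) := by
  have hc : clusterProd Q F = lprod R.parts fun Z => lprod Z fun B => ampl V (F B) := by
    have h1 : clusterProd Q F = lprod Q.parts fun B => ampl V (F B) := rfl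
    rw [h1, ← lprod_biUnion R.disjoint, R.biUnion_parts]
    rw [R.biUnion_parts]
    intro B hB B' hB' hne
    exact commute_ampl V (Q.disjoint hB hB' hne) _ _
  have h1 : ∀ τ, evolProd Φ ε X V R τ =
      lprod R.parts fun Z => ampl V (evol Φ ε (declust Z ∩ X) τ) := fun τ => rfl
  rw [hc, h1, h1, ← lprod_mul, ← lprod_mul]
  · rfl
  · intro Z hZ Z' hZ' hne
    have h := disjoint_declust R hZ hZ' hne
    exact ((commute_evol_evol h _ _).mul_right (commute_evol_lprod h _)).mul_left
      ((commute_evol_lprod h.symm _).symm.mul_right (commute_lprod_lprod h))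
  · exact fun Z hZ Z' hZ' hne => commute_evol_evol (disjoint_declust R hZ hZ' hne) _ _
  · intro Z hZ Z' hZ' hne
    have h := disjoint_declust R hZ hZ' hne
    exact (commute_evol_evol h _ _).mul_left (commute_evol_lprod h.symm _).symm
  · exact fun Z hZ Z' hZ' hne => commute_evol_evol (disjoint_declust R hZ hZ' hne) _ _
  · exact fun Z hZ Z' hZ' hne => commute_lprod_lprod (disjoint_declust R hZ hZ' hne)
  · exact fun Z hZ Z' hZ' hne => commute_evol_lprod (disjoint_declust R hZ hZ' hne) _

theorem sum_evolBlock (h : V ⊆ W) :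
    ∑ Q : Finpartition V, evolBlock Φ ε t X W F Q.parts = ampl W (evolFam Φ ε t X F V) := by
  have h1 : ∀ Q : Finpartition V, declust Q.parts = V := fun Q => Q.sup_parts
  have h2 : ∀ Q : Finpartition V, evolBlock Φ ε t X W F Q.parts =
      ampl W (evol Φ ε (V ∩ X) t) * lprod Q.parts (fun B => ampl W (F B)) *
        ampl W (evol Φ ε (V ∩ X) (-t)) := fun Q => by rw [evolBlock, h1]
  rw [Finset.sum_congr rfl fun Q _ => h2 Q, ← Finset.sum_mul, ← Finset.mul_sum, ampl_evolFam h, ampl_expFam h, expSum]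
  simp

/-- By `sum_expSum_parts` the double sum over Q and R becomes one sum over the partitions of V into
the sets T = θ(Z), with the sum over the partitions of each T inside. That inner sum is the linear
evolution of the density of T, so the nonlinear group is the logarithm of the evolved exponential.
-/
theorem ampl_nonlinearGroup (h : V ⊆ W) : ampl W (nonlinearGroup Φ ε t X F V) =
    expSum cumulantWeight (fun T => ampl W (evolFam Φ ε t X F T)) V := by
  have h1 : nonlinearGroup Φ ε t X F V =
      expSum cumulantWeight (fun T => ampl V (evolFam Φ ε t X F T)) V := by
    rw [nonlinearGroup]
    have h2 := sum_expSum_parts cumulantWeight (evolBlock Φ ε t X V F)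
      (fun Z Z' hd => commute_evolBlock hd) V
    have h3 : expSum cumulantWeight (fun T => ∑ Q : Finpartition T,
        evolBlock Φ ε t X V F Q.parts) V =
        expSum cumulantWeight (fun T => ampl V (evolFam Φ ε t X F T)) V :=
      expSum_congr _ fun T hT => sum_evolBlock hT
    rw [← h3, ← h2]
    refine Finset.sum_congr rfl fun Q _ => ?_
    rw [cumulant, expSum]
    refine Finset.sum_congr rfl fun R _ => ?_
    rw [evolProd_mul_clusterProd_mul]
  rw [h1, ampl_expSum h]
  exact expSum_congr _ fun T hT => ampl_ampl hT h _

theorem nonlinearGroup_inter (X V : Finset ℕ) :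
    nonlinearGroup Φ ε t (V ∩ X) F V = nonlinearGroup Φ ε t X F V := by
  rw [← ampl_self (nonlinearGroup Φ ε t (V ∩ X) F V), ← ampl_self (nonlinearGroup Φ ε t X F V),
    ampl_nonlinearGroup le_rfl, ampl_nonlinearGroup le_rfl]
  refine expSum_congr _ fun T hT => ?_
  rw [evolFam, evolFam, ← Finset.inter_assoc, Finset.inter_eq_left.2 hT]

theorem ampl_evolFam_eq_sum (hΦ : IsPot Φ) (h : V ⊆ W) {a : ℕ} (ha : a ∈ V) :
    ampl W (evolFam Φ ε t X F V) = ∑ U ∈ V.powerset, if a ∈ U then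
      ampl W (nonlinearGroup Φ ε t X F U) * ampl W (evolFam Φ ε t X F (V \ U)) else 0 := by
  rw [eq_sum_expSum_cumulantWeight_mul (D := fun T => ampl W (evolFam Φ ε t X F T))
    (by rw [evolFam_empty hΦ, ampl_one (Finset.empty_subset W)])
    (fun U _ U' _ hd => commute_ampl W hd _ _) ha]
  refine Finset.sum_congr rfl fun U hU => ?_
  rw [ampl_nonlinearGroup ((Finset.mem_powerset.1 hU).trans h)]

/-- The evolution of `expT F` when the particles in `X` move. -/
def evolT (Φ : Pos d → Pos d → ℝ) (ε : ℝ) (F : OpFam d) (X V : Finset ℕ) (t : ℝ) : TCV d V :=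
  evolG Φ ε (V ∩ X) V t (expT F V)

/-- The correlations that belong to `evolT`, as trace class operators. -/
def corrT (Φ : Pos d → Pos d → ℝ) (ε : ℝ) (F : OpFam d) (X V : Finset ℕ) (t : ℝ) : TCV d V :=
  TC.mk (nonlinearGroup Φ ε t X F V)

theorem IsTCFam.op_evolT (hF : IsTCFam F) (X V : Finset ℕ) (t : ℝ) :
    TC.op _ (evolT Φ ε F X V t) = evolFam Φ ε t X F V := by
  rw [evolT, op_evolG, hF.op_expT]
  rfl

theorem sum_ite_mem_eq_add {ι : Type*} [DecidableEq ι] {V : Finset ι} {M : Type*} [AddCommMonoid M]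
    {a : ι} (ha : a ∈ V) (f : Finset ι → M) : (∑ U ∈ V.powerset, if a ∈ U then f U else 0) =
      f V + ∑ U ∈ V.ssubsets, if a ∈ U then f U else 0 := by
  rw [Finset.ssubsets, ← Finset.add_sum_erase _ _ (Finset.mem_powerset_self V), if_pos ha]

theorem ampl_eq_one_of_sdiff (hΦ : IsPot Φ) :
    ampl V (evolFam Φ ε t X F (V \ V)) = 1 := by
  have : ∀ T : Finset ℕ, T = ∅ → ampl V (evolFam Φ ε t X F T) = 1 := by
    rintro T rfl
    rw [evolFam_empty hΦ, ampl_one (Finset.empty_subset V)]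
  exact this _ (Finset.sdiff_self V)

theorem IsTCFam.nonlinearGroup (hΦ : IsPot Φ) (hF : IsTCFam F) (ε t : ℝ) (X : Finset ℕ) :
    IsTCFam (nonlinearGroup Φ ε t X F) := by
  intro V hV
  induction V using Finset.strongInduction with
  | H V ih =>
    obtain ⟨a, ha⟩ := hV
    have h1 := ampl_evolFam_eq_sum (ε := ε) (t := t) (X := X) (F := F) hΦ (le_refl V) ha
    rw [sum_ite_mem_eq_add ha, ampl_eq_one_of_sdiff hΦ, mul_one, ampl_self, ampl_self] at h1
    -- The summand U = V of the recursion is the correlation itself; the others are tensor products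
    -- of trace class operators by induction.
    have : QBBGKY.nonlinearGroup Φ ε t X F V = TC.op _ (evolT Φ ε F X V t -
        ∑ U ∈ V.ssubsets, if a ∈ U then tn U V (corrT Φ ε F X U t) (evolT Φ ε F X (V \ U) t)
          else 0) := by
      rw [map_sub, eq_zero_or_op_sum, hF.op_evolT, h1, eq_comm, sub_eq_iff_eq_add]
      congr 1
      refine Finset.sum_congr rfl fun U hU => ?_
      split_ifs with haU
      · rw [op_tn, hF.op_evolT, corrT, TC.op_mk (ih U (Finset.mem_ssubsets.1 hU) ⟨a, haU⟩)]
      · rfl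
    rw [this]
    exact TC.isTraceClass_op _

theorem IsTCFam.op_corrT (hΦ : IsPot Φ) (hF : IsTCFam F) (X : Finset ℕ) (hV : V.Nonempty)
    (t : ℝ) : TC.op _ (corrT Φ ε F X V t) = QBBGKY.nonlinearGroup Φ ε t X F V :=
  TC.op_mk (hF.nonlinearGroup hΦ ε t X V hV)

theorem IsTCFam.evolT_eq_sum (hΦ : IsPot Φ) (hF : IsTCFam F) (X : Finset ℕ) {a : ℕ} (ha : a ∈ V)
    (t : ℝ) : evolT Φ ε F X V t = ∑ U ∈ V.powerset, if a ∈ U then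
      tn U V (corrT Φ ε F X U t) (evolT Φ ε F X (V \ U) t) else 0 := by
  refine TC.op_injective ?_
  rw [eq_zero_or_op_sum, hF.op_evolT, ← ampl_self (evolFam Φ ε t X F V),
    ampl_evolFam_eq_sum hΦ le_rfl ha]
  refine Finset.sum_congr rfl fun U hU => ?_
  split_ifs with haU
  · rw [op_tn, hF.op_corrT hΦ X ⟨a, haU⟩, hF.op_evolT]
  · rfl

/-- The recursion through which bounds, derivatives and symmetry pass from the evolved densities to
the correlations, by induction on V. -/
theorem IsTCFam.corrT_eq_sub (hΦ : IsPot Φ) (hF : IsTCFam F) (X : Finset ℕ) {a : ℕ} (ha : a ∈ V)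
    (t : ℝ) : corrT Φ ε F X V t = evolT Φ ε F X V t - ∑ U ∈ V.ssubsets, if a ∈ U then
      tn U V (corrT Φ ε F X U t) (evolT Φ ε F X (V \ U) t) else 0 := by
  rw [hF.evolT_eq_sum hΦ X ha, sum_ite_mem_eq_add ha, add_sub_cancel_right]
  refine TC.op_injective ?_
  rw [op_tn, hF.op_evolT, ampl_eq_one_of_sdiff hΦ, mul_one, ampl_self]

theorem corrT_inter (X V : Finset ℕ) (t : ℝ) :
    corrT Φ ε F (V ∩ X) V t = corrT Φ ε F X V t := by
  rw [corrT, corrT, nonlinearGroup_inter]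

theorem corrT_congr {X' : Finset ℕ} (h : V ∩ X = V ∩ X') (t : ℝ) :
    corrT Φ ε F X V t = corrT Φ ε F X' V t := by
  rw [← corrT_inter, h, corrT_inter]

end Families


/-! ### Separating pairs of particles -/

section Ring

variable {ι A : Type*} [DecidableEq ι] [Ring A]

theorem sum_powerset_sdiff_comm {M : Type*} [AddCommMonoid M] (V : Finset ι)
    (h : Finset ι → Finset ι → M) :
    ∑ T ∈ V.powerset, ∑ S ∈ (V \ T).powerset, h T S =
      ∑ S ∈ V.powerset, ∑ T ∈ (V \ S).powerset, h T S := by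
  refine Finset.sum_comm' fun T S => ?_
  simp only [Finset.mem_powerset, Finset.subset_sdiff]
  constructor
  · rintro ⟨h1, h2, h3⟩
    exact ⟨⟨h1, h3.symm⟩, h2⟩
  · rintro ⟨⟨h1, h3⟩, h2⟩
    exact ⟨h1, h2, h3.symm⟩

/-- On the left the block U of a is split into two parts that separate i from j. The part without a
is released and summed together with the complement: by the recursion based at j or at i this
restores the D of everything outside the part with a. What remains is the sum over blocks of a that
contain exactly one of i and j. -/
theorem sum_separated_eq {V : Finset ι} {l D : Finset ι → A}
    (hR : ∀ W ⊆ V, ∀ b ∈ W, D W = ∑ U ∈ W.powerset, if b ∈ U then l U * D (W \ U) else 0)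
    (hl : ∀ S T, Disjoint S T → Commute (l S) (l T)) {a i j : ι} (hi : i ∈ V) (hj : j ∈ V) :
    (∑ U ∈ V.powerset, if a ∈ U ∧ i ∈ U ∧ j ∈ U then
      (∑ T ∈ U.powerset, if i ∈ T ∧ j ∉ T then l T * l (U \ T) else 0) * D (V \ U) else 0) =
    ∑ U ∈ V.powerset, if a ∈ U ∧ ((i ∈ U ∧ j ∉ U) ∨ (j ∈ U ∧ i ∉ U)) then l U * D (V \ U)
      else 0 := by
  have h1 : (∑ U ∈ V.powerset, if a ∈ U ∧ i ∈ U ∧ j ∈ U then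
      (∑ T ∈ U.powerset, if i ∈ T ∧ j ∉ T then l T * l (U \ T) else 0) * D (V \ U) else 0) =
      ∑ U ∈ V.powerset, ∑ T ∈ U.powerset,
        ((if a ∈ T ∧ i ∈ T ∧ j ∈ U \ T then l T * (l (U \ T) * D ((V \ T) \ (U \ T))) else 0) +
        (if a ∈ U \ T ∧ i ∈ T ∧ j ∈ U \ T then
          l (U \ T) * (l T * D ((V \ (U \ T)) \ T)) else 0)) := by
    refine Finset.sum_congr rfl fun U hU => ?_
    rw [← Finset.sum_filter_add_sum_filter_not U.powerset (fun T => T ⊆ U)]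
    have hU' := Finset.mem_powerset.1 hU
    rw [Finset.filter_true_of_mem (fun T hT => Finset.mem_powerset.1 hT),
      Finset.filter_false_of_mem (fun T hT => not_not.2 (Finset.mem_powerset.1 hT)),
      Finset.sum_empty, add_zero]
    by_cases hij : a ∈ U ∧ i ∈ U ∧ j ∈ U
    · rw [if_pos hij, Finset.sum_mul]
      refine Finset.sum_congr rfl fun T hT => ?_
      have hT' := Finset.mem_powerset.1 hT
      have e1 : (V \ T) \ (U \ T) = V \ U := by
        ext x
        simp only [Finset.mem_sdiff]
        have := @hT' x
        tauto
      have e2 : (V \ (U \ T)) \ T = V \ U := by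
        ext x
        simp only [Finset.mem_sdiff]
        have := @hT' x
        tauto
      rw [e1, e2, ← mul_assoc, ← mul_assoc, (hl _ _ Finset.sdiff_disjoint).eq]
      by_cases h2 : i ∈ T <;> by_cases h3 : j ∈ T <;> by_cases h4 : a ∈ T <;>
        simp [h2, h3, h4, hij.1, hij.2.2]
    · rw [if_neg hij, eq_comm]
      refine Finset.sum_eq_zero fun T hT => ?_
      have hT' := Finset.mem_powerset.1 hT
      rw [if_neg, if_neg, add_zero]
      · rintro ⟨h2, h3, h4⟩
        exact hij ⟨(Finset.mem_sdiff.1 h2).1, hT' h3, (Finset.mem_sdiff.1 h4).1⟩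
      · rintro ⟨h2, h3, h4⟩
        exact hij ⟨hT' h2, hT' h3, (Finset.mem_sdiff.1 h4).1⟩
  rw [h1, sum_powerset_powerset V fun T S =>
    (if a ∈ T ∧ i ∈ T ∧ j ∈ S then l T * (l S * D ((V \ T) \ S)) else 0) +
        (if a ∈ S ∧ i ∈ T ∧ j ∈ S then l S * (l T * D ((V \ S) \ T)) else 0)]
  simp_rw [Finset.sum_add_distrib]
  rw [sum_powerset_sdiff_comm V fun T S =>
    if a ∈ S ∧ i ∈ T ∧ j ∈ S then l S * (l T * D ((V \ S) \ T)) else 0,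
    ← Finset.sum_add_distrib]
  have key : ∀ T ∈ V.powerset, ∀ x ∈ V, x ∉ T →
      (∑ S ∈ (V \ T).powerset, if x ∈ S then l T * (l S * D ((V \ T) \ S)) else 0) =
        l T * D (V \ T) := by
    intro T hT x hx hxT
    rw [hR (V \ T) Finset.sdiff_subset x (Finset.mem_sdiff.2 ⟨hx, hxT⟩), Finset.mul_sum]
    refine Finset.sum_congr rfl fun S _ => ?_
    split_ifs <;> simp
  have key' : ∀ T ∈ V.powerset, ∀ x ∈ V, ∀ p : Prop, [Decidable p] →
      (∑ S ∈ (V \ T).powerset, if p ∧ x ∈ S then l T * (l S * D ((V \ T) \ S)) else 0) =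
        if p ∧ x ∉ T then l T * D (V \ T) else 0 := by
    intro T hT x hx p _
    by_cases hp : p
    · simp only [hp, true_and]
      by_cases hxT : x ∈ T
      · simp only [hxT, not_true_eq_false, if_false]
        refine Finset.sum_eq_zero fun S hS => ?_
        rw [if_neg]
        intro hxS
        exact (Finset.mem_sdiff.1 (Finset.mem_powerset.1 hS hxS)).2 hxT
      · rw [if_pos hxT, key T hT x hx hxT]
    · simp [hp]
  refine Finset.sum_congr rfl fun T hT => ?_
  have h2 := key' T hT j hj (a ∈ T ∧ i ∈ T)
  have h3 := key' T hT i hi (a ∈ T ∧ j ∈ T)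
  have e2 : ∀ S : Finset ι, (a ∈ T ∧ i ∈ T ∧ j ∈ S) = ((a ∈ T ∧ i ∈ T) ∧ j ∈ S) := fun S => by
    rw [and_assoc]
  have e3 : ∀ S : Finset ι, (a ∈ T ∧ i ∈ S ∧ j ∈ T) = ((a ∈ T ∧ j ∈ T) ∧ i ∈ S) := fun S => by
    rw [and_assoc, and_comm (a := i ∈ S)]
  simp_rw [e2, e3]
  rw [h2, h3]
  by_cases h2 : i ∈ T <;> by_cases h3 : j ∈ T <;> by_cases h4 : a ∈ T <;> simp [h2, h3, h4]

/-- In the recursion for D the block of a contains both, neither or exactly one of i and j. The last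
case is rewritten by `sum_separated_eq`, which joins that block with the one of the other particle.
Then i and j always lie in the same factor, and a pair potential acts on that factor alone. -/
theorem eq_sum_link {V : Finset ι} {l D : Finset ι → A}
    (hR : ∀ W ⊆ V, ∀ b ∈ W, D W = ∑ U ∈ W.powerset, if b ∈ U then l U * D (W \ U) else 0)
    (hl : ∀ S T, Disjoint S T → Commute (l S) (l T)) {a i j : ι} (ha : a ∈ V) (hi : i ∈ V)
    (hj : j ∈ V) : D V = ∑ U ∈ V.powerset, if a ∈ U then
      (if i ∈ U ∧ j ∈ U then
        (l U + ∑ T ∈ U.powerset, if i ∈ T ∧ j ∉ T then l T * l (U \ T) else 0) * D (V \ U) else 0) +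
      (if i ∉ U ∧ j ∉ U then l U * D (V \ U) else 0) else 0 := by
  have h1 : D V = ∑ U ∈ V.powerset, ((if a ∈ U ∧ ((i ∈ U ∧ j ∉ U) ∨ (j ∈ U ∧ i ∉ U)) then
      l U * D (V \ U) else 0) + if a ∈ U then
      (if i ∈ U ∧ j ∈ U then l U * D (V \ U) else 0) +
      (if i ∉ U ∧ j ∉ U then l U * D (V \ U) else 0) else 0) := by
    rw [hR V le_rfl a ha]
    refine Finset.sum_congr rfl fun U _ => ?_
    by_cases h2 : i ∈ U <;> by_cases h3 : j ∈ U <;> by_cases h4 : a ∈ U <;> simp [h2, h3, h4]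
  rw [h1, Finset.sum_add_distrib, ← sum_separated_eq hR hl hi hj, ← Finset.sum_add_distrib]
  refine Finset.sum_congr rfl fun U _ => ?_
  by_cases h2 : i ∈ U <;> by_cases h3 : j ∈ U <;> by_cases h4 : a ∈ U <;>
    simp [h2, h3, h4, add_mul, add_comm]

end Ring

/-! ### The evolution of the correlations in the interaction picture -/

section Derivative

variable {X Y Z U V W : Finset ℕ} {Φ : Pos d → Pos d → ℝ} {ε t : ℝ} {F : OpFam d}

theorem tn_smul_left (c : ℂ) (S : TCV d U) (T : TCV d (W \ U)) :
    tn U W (c • S) T = c • tn U W S T := by rw [map_smul]; rfl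

theorem tn_sum_left {κ : Type*} (s : Finset κ) (S : κ → TCV d U) (T : TCV d (W \ U)) :
    tn U W (∑ k ∈ s, S k) T = ∑ k ∈ s, tn U W (S k) T := by
  rw [map_sum, sum_apply]

/-- `f(V) + ∑_{V = X₁ ⊔ X₂, i ∈ X₁, j ∈ X₂} f(X₁) f(X₂)`. -/
def link (f : ∀ V, TCV d V) (i j : ℕ) (V : Finset ℕ) : TCV d V :=
  f V + ∑ U ∈ V.powerset, if i ∈ U ∧ j ∉ U then tn U V (f U) (f (V \ U)) else 0

theorem nint_tn_left (hΦ : IsPot Φ) (h : U ⊆ W) {i j : ℕ} (hi : i ∈ U) (hj : j ∈ U)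
    (S : TCV d U) (T : TCV d (W \ U)) : nint Φ W i j (tn U W S T) = tn U W (nint Φ U i j S) T := by
  rw [tn_of_subset h, nint_tens hΦ _ hi hj]

theorem nint_tn_right (hΦ : IsPot Φ) (h : U ⊆ W) {i j : ℕ} (hi : i ∈ W) (hj : j ∈ W)
    (hi' : i ∉ U) (hj' : j ∉ U) (S : TCV d U) (T : TCV d (W \ U)) :
    nint Φ W i j (tn U W S T) = tn U W S (nint Φ (W \ U) i j T) := by
  rw [tn_of_subset h, nint_tens_right hΦ _ (Finset.mem_sdiff.2 ⟨hi, hi'⟩)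
    (Finset.mem_sdiff.2 ⟨hj, hj'⟩)]

theorem IsTCFam.evolT_eq_sum_link (hΦ : IsPot Φ) (hF : IsTCFam F) (X : Finset ℕ) {a i j : ℕ}
    (ha : a ∈ V) (hi : i ∈ V) (hj : j ∈ V) (t : ℝ) :
    evolT Φ ε F X V t = ∑ U ∈ V.powerset, if a ∈ U then
      (if i ∈ U ∧ j ∈ U then
        tn U V (link (fun T => corrT Φ ε F X T t) i j U) (evolT Φ ε F X (V \ U) t) else 0) +
      (if i ∉ U ∧ j ∉ U then tn U V (corrT Φ ε F X U t) (evolT Φ ε F X (V \ U) t) else 0)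
        else 0 := by
  have hR : ∀ W ⊆ V, ∀ b ∈ W, ampl V (TC.op _ (evolT Φ ε F X W t)) = ∑ U ∈ W.powerset,
      if b ∈ U then ampl V (TC.op _ (corrT Φ ε F X U t)) *
        ampl V (TC.op _ (evolT Φ ε F X (W \ U) t)) else 0 := by
    intro W hW b hb
    rw [hF.evolT_eq_sum hΦ X hb, eq_zero_or_op_sum, ampl_sum hW]
    refine Finset.sum_congr rfl fun U hU => ?_
    split_ifs
    · rw [op_tn, ampl_mul hW, ampl_ampl (Finset.mem_powerset.1 hU) hW,
        ampl_ampl Finset.sdiff_subset hW]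
    · exact ampl_zero hW
  have h1 := eq_sum_link (l := fun T => ampl V (TC.op _ (corrT Φ ε F X T t)))
    (D := fun T => ampl V (TC.op _ (evolT Φ ε F X T t))) hR
    (fun S T hd => commute_ampl V hd _ _) ha hi hj
  refine TC.op_injective ?_
  rw [eq_zero_or_op_sum, ← ampl_self (TC.op _ (evolT Φ ε F X V t)), h1]
  refine Finset.sum_congr rfl fun U hU => ?_
  have hU' := Finset.mem_powerset.1 hU
  split_ifs with h2 h3 h4 h4
  · exact absurd h3.1 h4.1
  · rw [add_zero, add_zero, op_tn, link, map_add, ampl_add hU', map_sum, ampl_sum hU']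
    congr 2
    refine Finset.sum_congr rfl fun T hT => ?_
    split_ifs
    · rw [op_tn, ampl_mul hU', ampl_ampl (Finset.mem_powerset.1 hT) hU',
        ampl_ampl Finset.sdiff_subset hU']
    · rw [map_zero, ampl_zero hU']
  · rw [zero_add, zero_add, op_tn]
  · simp only [add_zero, map_zero]
  · rfl

/-- The interaction term of the equation for `evolT`. -/
def evolD (Φ : Pos d → Pos d → ℝ) (ε : ℝ) (F : OpFam d) (X V : Finset ℕ) (t : ℝ) : TCV d V :=
  (ε : ℂ) • ∑ p ∈ pairs (V ∩ X), nint Φ V p.1 p.2 (evolT Φ ε F X V t)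

/-- The interaction term of the equation for `corrT`. -/
def corrD (Φ : Pos d → Pos d → ℝ) (ε : ℝ) (F : OpFam d) (X V : Finset ℕ) (t : ℝ) : TCV d V :=
  (ε : ℂ) • ∑ p ∈ pairs (V ∩ X),
    nint Φ V p.1 p.2 (link (fun T => corrT Φ ε F X T t) p.1 p.2 V)

theorem mem_pairs {p : ℕ × ℕ} : p ∈ pairs X ↔ p.1 ∈ X ∧ p.2 ∈ X ∧ p.1 < p.2 := by
  simp [pairs, and_assoc]

theorem sum_pairs_of_subset {M : Type*} [AddCommMonoid M] (hU : U ⊆ V) (f : ℕ × ℕ → M) :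
    (∑ p ∈ pairs (V ∩ X), if p.1 ∈ U ∧ p.2 ∈ U then f p else 0) = ∑ p ∈ pairs (U ∩ X), f p := by
  rw [← Finset.sum_filter]
  refine Finset.sum_congr ?_ fun _ _ => rfl
  ext p
  simp only [Finset.mem_filter, mem_pairs, Finset.mem_inter]
  constructor
  · tauto
  · rintro ⟨⟨h1, h2⟩, ⟨h3, h4⟩, h5⟩
    exact ⟨⟨⟨hU h1, h2⟩, ⟨hU h3, h4⟩, h5⟩, h1, h3⟩

theorem sum_pairs_sdiff {M : Type*} [AddCommMonoid M] (f : ℕ × ℕ → M) :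
    (∑ p ∈ pairs (V ∩ X), if p.1 ∉ U ∧ p.2 ∉ U then f p else 0) =
      ∑ p ∈ pairs ((V \ U) ∩ X), f p := by
  rw [← Finset.sum_filter]
  refine Finset.sum_congr ?_ fun _ _ => rfl
  ext p
  simp only [Finset.mem_filter, mem_pairs, Finset.mem_inter, Finset.mem_sdiff]
  tauto

/-- The recursion of the densities, differentiated by the Leibniz rule. With `evolT_eq_sum_link` for
each pair, its commutator acts either on the block of a, where it yields `corrD`, or on the
complement, where it yields `evolD`. -/
theorem IsTCFam.evolD_eq_sum (hΦ : IsPot Φ) (hF : IsTCFam F) (X : Finset ℕ) {a : ℕ} (ha : a ∈ V)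
    (t : ℝ) : evolD Φ ε F X V t = ∑ U ∈ V.powerset, if a ∈ U then
      tn U V (corrD Φ ε F X U t) (evolT Φ ε F X (V \ U) t) +
        tn U V (corrT Φ ε F X U t) (evolD Φ ε F X (V \ U) t) else 0 := by
  have h1 : ∀ p ∈ pairs (V ∩ X), nint Φ V p.1 p.2 (evolT Φ ε F X V t) = ∑ U ∈ V.powerset,
      if a ∈ U then
        (if p.1 ∈ U ∧ p.2 ∈ U then tn U V (nint Φ U p.1 p.2
          (link (fun T => corrT Φ ε F X T t) p.1 p.2 U)) (evolT Φ ε F X (V \ U) t) else 0) +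
        (if p.1 ∉ U ∧ p.2 ∉ U then tn U V (corrT Φ ε F X U t)
          (nint Φ (V \ U) p.1 p.2 (evolT Φ ε F X (V \ U) t)) else 0) else 0 := by
    intro p hp
    rw [mem_pairs, Finset.mem_inter, Finset.mem_inter] at hp
    rw [hF.evolT_eq_sum_link hΦ X ha hp.1.1 hp.2.1.1, map_sum]
    refine Finset.sum_congr rfl fun U hU => ?_
    have hU' := Finset.mem_powerset.1 hU
    split_ifs with h2 h3 h4 h4
    · exact absurd h3.1 h4.1
    · rw [add_zero, add_zero, nint_tn_left hΦ hU' h3.1 h3.2]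
    · rw [zero_add, zero_add, nint_tn_right hΦ hU' hp.1.1 hp.2.1.1 h4.1 h4.2]
    · rw [add_zero, map_zero]
    · exact map_zero _
  rw [evolD, Finset.sum_congr rfl h1, Finset.sum_comm, Finset.smul_sum]
  refine Finset.sum_congr rfl fun U hU => ?_
  by_cases h2 : a ∈ U
  · simp only [h2, if_true]
    rw [Finset.sum_add_distrib, smul_add, sum_pairs_of_subset (Finset.mem_powerset.1 hU),
      sum_pairs_sdiff, corrD, evolD, tn_smul_left, map_smul, tn_sum_left, map_sum]
  · simp only [h2, if_false, Finset.sum_const_zero, smul_zero]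

theorem hasDerivAt_tn {u : ℝ → TCV d U} {v : ℝ → TCV d (W \ U)} {u' : TCV d U}
    {v' : TCV d (W \ U)} (hu : HasDerivAt u u' t) (hv : HasDerivAt v v' t) :
    HasDerivAt (fun τ => tn U W (u τ) (v τ)) (tn U W u' (v t) + tn U W (u t) v') t := by
  let B : TCV d U →L[ℝ] TCV d (W \ U) →L[ℝ] TCV d W :=
    ContinuousLinearMap.bilinearRestrictScalars ℝ (tn (d := d) U W)
  have h1 := B.hasDerivAt_of_bilinear (u := u) (v := v) (u' := u') (v' := v') (x := t)
    (fun _ => hu) (fun _ => hv)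
  rw [add_comm]
  exact h1

theorem hasDerivAt_freeG_evolT (hΦ : IsPot Φ) (ε : ℝ) (F : OpFam d) (X V : Finset ℕ) (t : ℝ) :
    HasDerivAt (fun τ => freeG (V ∩ X) V (-τ) (evolT Φ ε F X V τ))
      (freeG (V ∩ X) V (-t) (evolD Φ ε F X V t)) t := by
  have := isPert_evolG hΦ ε (Finset.inter_subset_left (s₁ := V) (s₂ := X)) (expT F V) t
  rw [comm_potOp] at this
  exact this

theorem evolD_sdiff_self : evolD Φ ε F X (V \ V) t = 0 := by
  have : pairs ((V \ V) ∩ X) = ∅ := by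
    rw [Finset.sdiff_self, Finset.empty_inter]
    rfl
  rw [evolD, this, Finset.sum_empty, smul_zero]

theorem IsTCFam.tn_evolT_sdiff_self (hΦ : IsPot Φ) (hF : IsTCFam F) (T : TCV d V) :
    tn V V T (evolT Φ ε F X (V \ V) t) = T := by
  refine TC.op_injective ?_
  rw [op_tn, hF.op_evolT, ampl_eq_one_of_sdiff hΦ, mul_one, ampl_self]

/-- The free group distributes over the products in the recursion of `corrT`, so induction and the
product rule differentiate it; `evolD_eq_sum`, solved for its summand U = V, identifies the result.
Any trace class F is admitted. -/
theorem IsTCFam.hasDerivAt_freeG_corrT (hΦ : IsPot Φ) (hF : IsTCFam F) (X : Finset ℕ)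
    (hV : V.Nonempty) (t : ℝ) :
    HasDerivAt (fun τ => freeG (V ∩ X) V (-τ) (corrT Φ ε F X V τ))
      (freeG (V ∩ X) V (-t) (corrD Φ ε F X V t)) t := by
  induction V using Finset.strongInduction with
  | H V ih =>
    obtain ⟨a, ha⟩ := hV
    have e1 : ∀ U ∈ V.ssubsets, ∀ τ S T, freeG (V ∩ X) V τ (tn U V S T) =
        tn U V (freeG (U ∩ X) U τ S) (freeG (d := d) ((V \ U) ∩ X) (V \ U) τ T) := by
      intro U hU τ S T
      have hU' := (Finset.mem_ssubsets.1 hU).1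
      rw [freeG_tn Finset.inter_subset_left, ← Finset.inter_assoc, ← Finset.inter_assoc,
        Finset.inter_eq_left.2 hU', Finset.inter_eq_left.2 Finset.sdiff_subset]
    have h1 : ∀ U ∈ V.ssubsets, HasDerivAt (fun τ => freeG (V ∩ X) V (-τ)
        (if a ∈ U then tn U V (corrT Φ ε F X U τ) (evolT Φ ε F X (V \ U) τ) else 0))
        (freeG (V ∩ X) V (-t) (if a ∈ U then
          tn U V (corrD Φ ε F X U t) (evolT Φ ε F X (V \ U) t) +
          tn U V (corrT Φ ε F X U t) (evolD Φ ε F X (V \ U) t) else 0)) t := by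
      intro U hU
      split_ifs with haU
      · rw [map_add, e1 U hU, e1 U hU]
        simp_rw [e1 U hU]
        exact hasDerivAt_tn (ih U (Finset.mem_ssubsets.1 hU) ⟨a, haU⟩)
          (hasDerivAt_freeG_evolT hΦ ε F X (V \ U) t)
      · simp only [map_zero]
        exact hasDerivAt_const _ _
    have h2 := (hasDerivAt_freeG_evolT hΦ ε F X V t).sub (HasDerivAt.fun_sum h1)
    have e2 : corrD Φ ε F X V t = evolD Φ ε F X V t - ∑ U ∈ V.ssubsets, if a ∈ U then
          tn U V (corrD Φ ε F X U t) (evolT Φ ε F X (V \ U) t) +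
          tn U V (corrT Φ ε F X U t) (evolD Φ ε F X (V \ U) t) else 0 := by
      rw [hF.evolD_eq_sum hΦ X ha, sum_ite_mem_eq_add ha, add_sub_cancel_right, evolD_sdiff_self,
        map_zero, add_zero, hF.tn_evolT_sdiff_self hΦ]
    rw [e2, map_sub, map_sum]
    refine h2.congr_of_eventuallyEq (Eventually.of_forall fun τ => ?_)
    simp only [Pi.sub_apply]
    rw [hF.corrT_eq_sub hΦ X ha, map_sub, map_sum]

end Derivative


/-! ### Bounded curves -/

section C1Bd

variable {E E' : Type*} [NormedAddCommGroup E] [NormedSpace ℂ E] [NormedAddCommGroup E']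
  [NormedSpace ℂ E'] {θ M N : ℝ} {u v : ℝ → E}

/-- `‖u‖ + θ ‖u'‖ ≤ M`; for `θ = 0` the curve `u` need not be differentiable. -/
def C1Bd (θ : ℝ) (u : ℝ → E) (M : ℝ) : Prop :=
  ∃ u' : ℝ → E, (0 < θ → ∀ t, HasDerivAt u (u' t) t) ∧ ∀ t, ‖u t‖ + θ * ‖u' t‖ ≤ M

namespace C1Bd

theorem mono (h : C1Bd θ u M) (hMN : M ≤ N) : C1Bd θ u N := by
  obtain ⟨u', h1, h2⟩ := h
  exact ⟨u', h1, fun t => (h2 t).trans hMN⟩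

theorem norm_le (h : C1Bd θ u M) (hθ : 0 ≤ θ) (t : ℝ) : ‖u t‖ ≤ M := by
  obtain ⟨u', h1, h2⟩ := h
  have := mul_nonneg hθ (norm_nonneg (u' t))
  linarith [h2 t]

theorem nonneg (h : C1Bd θ u M) (hθ : 0 ≤ θ) : 0 ≤ M := (norm_nonneg _).trans (h.norm_le hθ 0)

theorem const (x : E) : C1Bd θ (fun _ => x) ‖x‖ :=
  ⟨fun _ => 0, fun _ t => hasDerivAt_const t x, fun t => by simp⟩

theorem zero : C1Bd θ (fun _ => (0 : E)) 0 := by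
  simpa using const (θ := θ) (0 : E)

theorem add (hθ : 0 ≤ θ) (h : C1Bd θ u M) (h' : C1Bd θ v N) :
    C1Bd θ (fun t => u t + v t) (M + N) := by
  obtain ⟨u', h1, h2⟩ := h
  obtain ⟨v', h3, h4⟩ := h'
  refine ⟨fun t => u' t + v' t, fun h0 t => (h1 h0 t).fun_add (h3 h0 t), fun t => ?_⟩
  have := mul_le_mul_of_nonneg_left (norm_add_le (u' t) (v' t)) hθ
  have := norm_add_le (u t) (v t)
  linarith [h2 t, h4 t]

theorem clm (hθ : 0 ≤ θ) (h : C1Bd θ u M) (A : E →L[ℂ] E') {K : ℝ} (hA : ∀ x, ‖A x‖ ≤ K * ‖x‖)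
    (hK : 0 ≤ K) : C1Bd θ (fun t => A (u t)) (K * M) := by
  obtain ⟨u', h1, h2⟩ := h
  refine ⟨fun t => A (u' t), fun h0 t =>
    (A.restrictScalars ℝ).hasFDerivAt.comp_hasDerivAt t (h1 h0 t), fun t => ?_⟩
  have e1 := mul_le_mul_of_nonneg_left (hA (u' t)) hθ
  have e2 := mul_le_mul_of_nonneg_left (h2 t) hK
  have := hA (u t)
  nlinarith

theorem smul (hθ : 0 ≤ θ) (h : C1Bd θ u M) (c : ℂ) : C1Bd θ (fun t => c • u t) (‖c‖ * M) :=
  h.clm hθ (c • ContinuousLinearMap.id ℂ E) (fun x => by simp [norm_smul]) (norm_nonneg _)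

theorem sub (hθ : 0 ≤ θ) (h : C1Bd θ u M) (h' : C1Bd θ v N) :
    C1Bd θ (fun t => u t - v t) (M + N) := by
  have := h.add hθ (h'.smul hθ (-1))
  simpa [sub_eq_add_neg] using this

theorem sum (hθ : 0 ≤ θ) {κ : Type*} (s : Finset κ) {w : κ → ℝ → E} {M : κ → ℝ}
    (h : ∀ k ∈ s, C1Bd θ (w k) (M k)) : C1Bd θ (fun t => ∑ k ∈ s, w k t) (∑ k ∈ s, M k) := by
  classical
  induction s using Finset.induction_on with
  | empty => simpa using zero (E := E)
  | insert k s hk ih =>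
    simp only [Finset.sum_insert hk]
    exact (h k (Finset.mem_insert_self _ _)).add hθ
      (ih fun j hj => h j (Finset.mem_insert_of_mem hj))

theorem ite {p : Prop} [Decidable p] (h : p → C1Bd θ u M) :
    C1Bd θ (fun t => if p then u t else 0) (if p then M else 0) := by
  split_ifs with hp
  · exact h hp
  · exact zero

/-- The norm ‖u‖ + θ‖u'‖ is submultiplicative: the product of the two norms exceeds that of the
tensor product by at least θ²‖u'‖‖v'‖. -/
theorem tn (hθ : 0 ≤ θ) {U W : Finset ℕ} {u : ℝ → TCV d U} {v : ℝ → TCV d (W \ U)}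
    (h : C1Bd θ u M) (h' : C1Bd θ v N) : C1Bd θ (fun t => tn U W (u t) (v t)) (M * N) := by
  have hM := h.nonneg hθ
  obtain ⟨u', h1, h2⟩ := h
  obtain ⟨v', h3, h4⟩ := h'
  refine ⟨fun t => QBBGKY.tn U W (u' t) (v t) + QBBGKY.tn U W (u t) (v' t),
    fun h0 t => hasDerivAt_tn (h1 h0 t) (h3 h0 t), fun t => ?_⟩
  have e1 := norm_tn_le (u t) (v t)
  have e2 := (norm_add_le _ _).trans (add_le_add (norm_tn_le (u' t) (v t))
    (norm_tn_le (u t) (v' t)))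
  have e3 := mul_le_mul_of_nonneg_left e2 hθ
  have e4 : 0 ≤ θ * θ * (‖u' t‖ * ‖v' t‖) := by positivity
  have e5 : (‖u t‖ + θ * ‖u' t‖) * (‖v t‖ + θ * ‖v' t‖) ≤ M * N :=
    mul_le_mul (h2 t) (h4 t) (by positivity) hM
  nlinarith

end C1Bd

end C1Bd

/-! ### The majorant -/

section Majorant

variable {ι : Type*} [DecidableEq ι]

/-- The sum of `c^{|Q|}` over the partitions of a set. -/
def expBd (c : ℝ) (V : Finset ι) : ℝ := ∑ Q : Finpartition V, c ^ Q.parts.card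

/-- The sum of `(|R| - 1)! c^{|Q|}` over the partitions `Q` of a set and the partitions `R`
of `Q`. -/
def corrBd (c : ℝ) (V : Finset ι) : ℝ :=
  ∑ Q : Finpartition V, ∑ R : Finpartition Q.parts, (R.parts.card - 1).factorial *
    c ^ Q.parts.card

theorem lprod_eq_prod {β A : Type*} [CommRing A] (s : Finset β) (f : β → A) :
    lprod s f = ∏ b ∈ s, f b := by
  rw [lprod, Finset.prod_map_toList]

theorem expBd_empty (c : ℝ) : expBd c (∅ : Finset ι) = 1 := by
  rw [expBd, sum_finpartition_empty fun Q : Finset (Finset ι) => c ^ Q.card, Finset.card_empty,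
    pow_zero]

theorem expBd_eq_sum (c : ℝ) {V : Finset ι} {a : ι} (ha : a ∈ V) :
    expBd c V = ∑ U ∈ V.powerset, if a ∈ U then c * expBd c (V \ U) else 0 := by
  have h1 : ∀ V : Finset ι, expBd c V = expSum (1 : ℕ → ℝ) (fun _ => c) V := by
    intro V
    rw [expBd, expSum]
    refine Finset.sum_congr rfl fun Q _ => ?_
    rw [lprod_eq_prod, Finset.prod_const, Pi.one_apply, one_smul]
  rw [h1, expSum_eq_sum_mem (1 : ℕ → ℝ) (fun _ _ _ _ _ => Commute.all _ _) ha]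
  refine Finset.sum_congr rfl fun U _ => ?_
  rw [h1]
  rfl

/-- The recursion of the correlations with the minus sign replaced by plus. It is the logarithm
identity for D = -`expBd` on non-empty sets: the signs (-1)^(n-1) of the weights and (-1)^n of the
factors combine to -1, so the logarithm is -`corrBd`. -/
theorem corrBd_eq_sum (c : ℝ) {V : Finset ι} {a : ι} (ha : a ∈ V) :
    corrBd c V = expBd c V +
      ∑ U ∈ V.ssubsets, if a ∈ U then corrBd c U * expBd c (V \ U) else 0 := by
  classical
  let D : Finset ι → ℂ := fun T => if T = ∅ then 1 else -(expBd c T : ℂ)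
  have h1 : ∀ U : Finset ι, U.Nonempty → expSum cumulantWeight D U = -(corrBd c U : ℂ) := by
    intro U hU
    have e1 := sum_expSum_parts (A := ℂ) (fun n => ((n - 1).factorial : ℂ))
      (fun Z : Finset (Finset ι) => (c : ℂ) ^ Z.card) (fun _ _ _ => Commute.all _ _) U
    have e2 : ((corrBd c U : ℝ) : ℂ) = ∑ Q : Finpartition U,
        expSum (fun n => ((n - 1).factorial : ℂ)) (fun Z : Finset (Finset ι) => (c : ℂ) ^ Z.card)
          Q.parts := by
      rw [corrBd]
      push_cast
      refine Finset.sum_congr rfl fun Q _ => ?_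
      rw [expSum]
      refine Finset.sum_congr rfl fun R _ => ?_
      rw [lprod_eq_prod, Finset.prod_pow_eq_pow_sum, R.sum_card_parts, smul_eq_mul]
    rw [e2, e1, expSum, expSum, ← Finset.sum_neg_distrib]
    refine Finset.sum_congr rfl fun P _ => ?_
    rw [lprod_eq_prod, lprod_eq_prod]
    have e3 : ∏ b ∈ P.parts, D b = (-1) ^ P.parts.card * ∏ b ∈ P.parts, (expBd c b : ℂ) := by
      rw [← Finset.prod_const, ← Finset.prod_mul_distrib]
      refine Finset.prod_congr rfl fun b hb => ?_
      have : b ≠ ∅ := (P.nonempty_of_mem_parts hb).ne_empty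
      simp [D, this]
    have e4 : ∀ Q : Finset ι, (∑ R : Finpartition Q, (c : ℂ) ^ R.parts.card) = (expBd c Q : ℂ) := by
      intro Q
      rw [expBd]
      push_cast
      rfl
    simp_rw [e4]
    rw [e3, cumulantWeight, smul_eq_mul, smul_eq_mul]
    have e5 : P.parts.card ≠ 0 := by
      rw [Finset.card_ne_zero]
      exact P.parts_nonempty hU.ne_empty
    obtain ⟨n, hn⟩ := Nat.exists_eq_succ_of_ne_zero e5
    rw [hn]
    simp only [Nat.succ_eq_add_one, Nat.add_sub_cancel]
    have e6 : ((-1 : ℂ) ^ n) * (-1) ^ n = 1 := by rw [← mul_pow]; simp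
    rw [pow_succ]
    linear_combination (-(n.factorial : ℂ) * ∏ b ∈ P.parts, (expBd c b : ℂ)) * e6
  have h2 := eq_sum_expSum_cumulantWeight_mul (A := ℂ) (D := D) (by simp [D])
    (fun _ _ _ _ _ => Commute.all _ _) ha
  have hV : V.Nonempty := ⟨a, ha⟩
  rw [sum_ite_mem_eq_add ha, h1 V hV] at h2
  have h3 : (∑ U ∈ V.ssubsets, if a ∈ U then expSum cumulantWeight D U * D (V \ U) else 0) =
      ((∑ U ∈ V.ssubsets, if a ∈ U then corrBd c U * expBd c (V \ U) else 0 : ℝ) : ℂ) := by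
    rw [Complex.ofReal_sum]
    refine Finset.sum_congr rfl fun U hU => ?_
    split_ifs with haU
    · have hne : V \ U ≠ ∅ := by
        rw [Ne, Finset.sdiff_eq_empty_iff_subset]
        exact (Finset.mem_ssubsets.1 hU).2
      rw [h1 U ⟨a, haU⟩]
      simp [D, hne]
    · simp
  rw [h3] at h2
  simp only [D, hV.ne_empty, if_false, Finset.sdiff_self, if_true, mul_one] at h2
  have h4 : ((corrBd c V : ℝ) : ℂ) = ((expBd c V + ∑ U ∈ V.ssubsets,
      if a ∈ U then corrBd c U * expBd c (V \ U) else 0 : ℝ) : ℂ) := by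
    rw [Complex.ofReal_add]
    linear_combination h2
  exact Complex.ofReal_injective h4

end Majorant

/-! ### Bounds of the correlations -/

section Bounds

variable {X V : Finset ℕ} {Φ : Pos d → Pos d → ℝ} {ε θ c C : ℝ} {F : OpFam d}

/-- The free evolution of the members of `F` is bounded by `c`. -/
def IsC1Fam (θ : ℝ) (F : OpFam d) (c : ℝ) : Prop :=
  ∀ X V : Finset ℕ, V.Nonempty → C1Bd θ (fun t => freeG (V ∩ X) V t (famT F V)) c

theorem freeG_expT_empty (X : Finset ℕ) (t : ℝ) :
    freeG (∅ ∩ X) ∅ t (expT F ∅) = expT F ∅ := by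
  refine TC.op_injective ?_
  have h : TC.op _ (expT F ∅) = 1 := by
    rw [expT, expFam_empty, TC.op_mk isTraceClass_one_empty.1]
  rw [freeG, conj, TC.op_sandwich, h]
  have := ((isUGroup_freeEvol (d := d) (∅ ∩ X)).ampl (Finset.inter_subset_left)).mul_neg t
  exact this

theorem c1Bd_freeG_expT (hθ : 0 ≤ θ) (hF : IsTCFam F) (h : IsC1Fam θ F c) (X V : Finset ℕ) :
    C1Bd θ (fun t => freeG (V ∩ X) V t (expT F V)) (expBd c V) := by
  induction V using Finset.strongInduction with
  | H V ih =>
    rcases V.eq_empty_or_nonempty with rfl | ⟨a, ha⟩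
    · simp_rw [freeG_expT_empty]
      rw [expBd_empty]
      exact (C1Bd.const _).mono norm_expT_empty
    · rw [expBd_eq_sum c ha, hF.expT_eq_sum ha]
      simp_rw [map_sum]
      refine C1Bd.sum hθ _ fun U hU => ?_
      have hU' := Finset.mem_powerset.1 hU
      have e1 : ∀ t, freeG (V ∩ X) V t (if a ∈ U then tn U V (famT F U) (expT F (V \ U)) else 0) =
          if a ∈ U then tn U V (freeG (U ∩ X) U t (famT F U))
            (freeG ((V \ U) ∩ X) (V \ U) t (expT F (V \ U))) else 0 := by
        intro t
        split_ifs
        · rw [freeG_tn Finset.inter_subset_left, ← Finset.inter_assoc, ← Finset.inter_assoc,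
            Finset.inter_eq_left.2 hU', Finset.inter_eq_left.2 Finset.sdiff_subset]
        · exact map_zero _
      simp_rw [e1]
      exact C1Bd.ite fun haU => (h X U ⟨a, haU⟩).tn hθ (ih _ (sdiff_ssubset hU' haU))

theorem card_pairs_le (X : Finset ℕ) : (pairs X).card ≤ X.card ^ 2 := by
  rw [pairs, sq, ← Finset.card_product]
  exact Finset.card_filter_le _ _

theorem norm_comm_potOp_le (hΦ : IsPot Φ) (hC : ∀ q q', |Φ q q'| ≤ C) (ε : ℝ) (hX : X ⊆ V)
    (T : TCV d V) : ‖comm (potOp Φ ε X V) T‖ ≤ 2 * |ε| * C * V.card ^ 2 * ‖T‖ := by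
  have h0 : 0 ≤ C := (abs_nonneg _).trans (hC 0 0)
  rw [comm_potOp, norm_smul, Complex.norm_real, Real.norm_eq_abs]
  have h1 : ‖∑ p ∈ pairs X, nint Φ V p.1 p.2 T‖ ≤ (pairs X).card • (2 * C * ‖T‖) :=
    (norm_sum_le _ _).trans (Finset.sum_le_card_nsmul _ _ _ fun p _ => norm_nint_le hΦ hC _ _ _)
  have h2 : ((pairs X).card : ℝ) ≤ (V.card : ℝ) ^ 2 := by
    have := (card_pairs_le X).trans (Nat.pow_le_pow_left (Finset.card_le_card hX) 2)
    exact_mod_cast this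
  rw [nsmul_eq_mul] at h1
  have h3 := h1.trans (mul_le_mul_of_nonneg_right h2 (by positivity))
  calc _ ≤ |ε| * ((V.card : ℝ) ^ 2 * (2 * C * ‖T‖)) := by gcongr
    _ = _ := by ring

/-- The potential of n particles costs a factor of order n², which is absorbed into an exponential.
The base 6/5 is harmless because 2 · (6/5) · (1/3) is still less than 1. -/
theorem one_add_sq_le_pow (n : ℕ) : 1 + (1 / 50 : ℝ) * n ^ 2 ≤ (6 / 5) ^ n := by
  induction n with
  | zero => norm_num
  | succ n ih =>
    rw [pow_succ (6 / 5 : ℝ)]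
    have : (0 : ℝ) ≤ n := n.cast_nonneg
    push_cast
    -- The induction step amounts to n² - 10n + 45 ≥ 0.
    nlinarith [sq_nonneg ((n : ℝ) - 5)]

/-- The derivative at time t is the evolution of the derivative at time 0, and the latter is the
free derivative plus the commutator with the potential. The commutator has norm at most 2|ε|C|V|²
times that of the density; θ is small enough to make this at most |V|²/50. -/
theorem c1Bd_evolT (hθ : 0 ≤ θ) (hΦ : IsPot Φ) (hC : ∀ q q', |Φ q q'| ≤ C) (hF : IsTCFam F)
    (h : IsC1Fam θ F c) (hs : θ * (2 * |ε| * C) ≤ 1 / 50) (X V : Finset ℕ) :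
    C1Bd θ (fun t => evolT Φ ε F X V t) ((6 / 5) ^ V.card * expBd c V) := by
  have hb := c1Bd_freeG_expT hθ hF h X V
  have hδ := hb.nonneg hθ
  obtain ⟨w', h1, h2⟩ := hb
  have hVX : V ∩ X ⊆ V := Finset.inter_subset_left
  have hg := isCGroup_evolG (ε := ε) hΦ hVX
  have h0 := isCGroup_freeG (d := d) hVX
  refine ⟨fun t => evolG Φ ε (V ∩ X) V t (w' 0 + comm (potOp Φ ε (V ∩ X) V) (expT F V)),
    fun hθ' t => ?_, fun t => ?_⟩
  · have := (isPert_evolG hΦ ε hVX).hasDerivAt hg h0 (h1 hθ' 0)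
    exact hg.hasDerivAt_of_zero this t
  · have e1 := hg.norm_apply_le t (expT F V)
    have e2 := hg.norm_apply_le t (w' 0 + comm (potOp Φ ε (V ∩ X) V) (expT F V))
    have e3 := e2.trans (norm_add_le _ _)
    have e4 := norm_comm_potOp_le hΦ hC ε hVX (expT F V)
    have e5 := mul_le_mul_of_nonneg_left (e3.trans (add_le_add_right e4 _)) hθ
    have e6 : ‖freeG (V ∩ X) V 0 (expT F V)‖ + θ * ‖w' 0‖ ≤ expBd c V := h2 0
    rw [h0.zero] at e6
    have e7 : ‖expT F V‖ ≤ expBd c V := by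
      have := mul_nonneg hθ (norm_nonneg (w' 0))
      linarith
    have e8 := mul_le_mul_of_nonneg_right (one_add_sq_le_pow V.card) hδ
    have e9 : θ * (2 * |ε| * C) * (V.card : ℝ) ^ 2 * ‖expT F V‖ ≤
        1 / 50 * (V.card : ℝ) ^ 2 * expBd c V := by gcongr
    change ‖evolG Φ ε (V ∩ X) V t (expT F V)‖ + θ * ‖evolG Φ ε (V ∩ X) V t
      (w' 0 + comm (potOp Φ ε (V ∩ X) V) (expT F V))‖ ≤ _
    nlinarith

theorem c1Bd_corrT (hθ : 0 ≤ θ) (hΦ : IsPot Φ) (hC : ∀ q q', |Φ q q'| ≤ C) (hF : IsTCFam F)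
    (h : IsC1Fam θ F c) (hs : θ * (2 * |ε| * C) ≤ 1 / 50) (X : Finset ℕ) (hV : V.Nonempty) :
    C1Bd θ (fun t => corrT Φ ε F X V t) ((6 / 5) ^ V.card * corrBd c V) := by
  induction V using Finset.strongInduction with
  | H V ih =>
    obtain ⟨a, ha⟩ := hV
    have h1 : ∀ t, corrT Φ ε F X V t = _ := fun t => hF.corrT_eq_sub hΦ X ha t
    simp_rw [h1]
    rw [corrBd_eq_sum c ha, mul_add, Finset.mul_sum]
    refine (c1Bd_evolT hθ hΦ hC hF h hs X V).sub hθ (C1Bd.sum hθ _ fun U hU => ?_)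
    have hU' := (Finset.mem_ssubsets.1 hU)
    have e1 : (6 / 5 : ℝ) ^ V.card * (if a ∈ U then corrBd c U * expBd c (V \ U) else 0) =
        if a ∈ U then ((6 / 5) ^ U.card * corrBd c U) * ((6 / 5) ^ (V \ U).card * expBd c (V \ U))
          else 0 := by
      rw [mul_ite, mul_zero]
      congr 1
      rw [← Finset.card_sdiff_add_card_eq_card hU'.1, pow_add]
      ring
    rw [e1]
    exact C1Bd.ite fun haU => (ih U hU' ⟨a, haU⟩).tn hθ (c1Bd_evolT hθ hΦ hC hF h hs X (V \ U))

/-- The base 2/5 is (6/5) · (1/3): the concession for derivatives times the decay from the count of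
partitions. -/
theorem c1Bd_corrT_factorial (hθ : 0 ≤ θ) (hΦ : IsPot Φ) (hC : ∀ q q', |Φ q q'| ≤ C)
    (hF : IsTCFam F) (h : IsC1Fam θ F c) (hs : θ * (2 * |ε| * C) ≤ 1 / 50) (hc : 0 ≤ c)
    (hc' : 2 * c * (Real.exp 3 - 1) ≤ 1) (X : Finset ℕ) (hV : V.Nonempty) :
    C1Bd θ (fun t => corrT Φ ε F X V t) (V.card.factorial * (2 / 5) ^ V.card) := by
  refine (c1Bd_corrT hθ hΦ hC hF h hs X hV).mono ?_
  have h1 : corrBd c V ≤ V.card.factorial * 3⁻¹ ^ V.card := sum_sum_factorial_le hc hc' V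
  calc _ ≤ (6 / 5 : ℝ) ^ V.card * (V.card.factorial * 3⁻¹ ^ V.card) := by gcongr
    _ = V.card.factorial * ((6 / 5) ^ V.card * 3⁻¹ ^ V.card) := by ring
    _ = _ := by rw [← mul_pow]; norm_num

end Bounds


/-! ### Sums over subsets and over pairs -/

section Sums

variable {ι M : Type*} [DecidableEq ι] [AddCommMonoid M]

theorem sum_powerset_union {N₁ N₂ : Finset ι} (hd : Disjoint N₁ N₂) (g : Finset ι → M) :
    ∑ A ∈ (N₁ ∪ N₂).powerset, g A = ∑ A₁ ∈ N₁.powerset, ∑ A₂ ∈ N₂.powerset, g (A₁ ∪ A₂) := by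
  rw [← Finset.sum_product']
  symm
  refine Finset.sum_nbij' (fun p => p.1 ∪ p.2) (fun A => (A ∩ N₁, A ∩ N₂)) ?_ ?_ ?_ ?_ ?_
  · rintro ⟨A, B⟩ h
    simp only [Finset.mem_product, Finset.mem_powerset] at h ⊢
    exact Finset.union_subset_union h.1 h.2
  · intro A h
    simp only [Finset.mem_product, Finset.mem_powerset]
    exact ⟨Finset.inter_subset_right, Finset.inter_subset_right⟩
  · rintro ⟨A, B⟩ h
    simp only [Finset.mem_product, Finset.mem_powerset] at h
    have h1 : Disjoint B N₁ := (hd.mono_right h.2).symm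
    have h2 : Disjoint A N₂ := hd.mono_left h.1
    simp only [Finset.union_inter_distrib_right, Finset.inter_eq_left.2 h.1,
      Finset.inter_eq_left.2 h.2, Finset.disjoint_iff_inter_eq_empty.1 h1,
      Finset.disjoint_iff_inter_eq_empty.1 h2, Finset.union_empty, Finset.empty_union]
  · intro A h
    simp only [Finset.mem_powerset] at h
    rw [← Finset.inter_union_distrib_left, Finset.inter_eq_left.2 h]
  · intro _ _
    rfl

theorem sum_powerset_sum_mem {N : Finset ι} (f : Finset ι → ι → M) :
    ∑ A ∈ N.powerset, ∑ j ∈ A, f A j =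
      ∑ j ∈ N, ∑ A ∈ (N.erase j).powerset, f (insert j A) j := by
  have h1 : ∀ A ∈ N.powerset, ∑ j ∈ A, f A j = ∑ j ∈ N, if j ∈ A then f A j else 0 := by
    intro A hA
    rw [← Finset.sum_filter, Finset.filter_mem_eq_inter,
      Finset.inter_eq_right.2 (Finset.mem_powerset.1 hA)]
  rw [Finset.sum_congr rfl h1, Finset.sum_comm]
  refine Finset.sum_congr rfl fun j hj => ?_
  conv_lhs => rw [← Finset.insert_erase hj]
  rw [Finset.sum_powerset_insert (Finset.notMem_erase j N)]
  have h2 : ∀ A ∈ (N.erase j).powerset, j ∉ A := fun A hA h =>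
    Finset.notMem_erase j N (Finset.mem_powerset.1 hA h)
  rw [Finset.sum_eq_zero fun A hA => if_neg (h2 A hA), zero_add]
  exact Finset.sum_congr rfl fun A _ => if_pos (Finset.mem_insert_self _ _)

theorem sum_pairs_eq (S : Finset ℕ) (f : ℕ → ℕ → M) :
    ∑ p ∈ pairs S, f p.1 p.2 = ∑ i ∈ S, ∑ j ∈ S, if i < j then f i j else 0 := by
  rw [pairs, Finset.sum_filter, Finset.sum_product]

theorem sum_pairs_union {Y A : Finset ℕ} (hd : Disjoint Y A) {f : ℕ → ℕ → M}
    (hf : ∀ i ∈ Y, ∀ j ∈ A, f j i = f i j) :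
    ∑ p ∈ pairs (Y ∪ A), f p.1 p.2 = ∑ p ∈ pairs Y, f p.1 p.2 + ∑ j ∈ A, ∑ i ∈ Y, f i j +
      ∑ p ∈ pairs A, f p.1 p.2 := by
  have h1 : ∑ j ∈ A, ∑ i ∈ Y, f i j = (∑ i ∈ Y, ∑ j ∈ A, if i < j then f i j else 0) +
      ∑ i ∈ A, ∑ j ∈ Y, if i < j then f i j else 0 := by
    rw [Finset.sum_comm (s := Y) (t := A), ← Finset.sum_add_distrib]
    refine Finset.sum_congr rfl fun j hj => ?_
    rw [← Finset.sum_add_distrib]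
    refine Finset.sum_congr rfl fun i hi => ?_
    have hne : i ≠ j := fun h => Finset.disjoint_left.1 hd hi (h ▸ hj)
    rcases lt_or_gt_of_ne hne with h | h
    · rw [if_pos h, if_neg h.not_gt, add_zero]
    · rw [if_pos h, if_neg h.not_gt, zero_add, hf i hi j hj]
  rw [h1, sum_pairs_eq, sum_pairs_eq, sum_pairs_eq, Finset.sum_union hd]
  simp_rw [Finset.sum_union hd, Finset.sum_add_distrib]
  abel

theorem sum_powerset_map {ι' : Type*} [DecidableEq ι'] (e : ι ≃ ι') (V : Finset ι)
    (f : Finset ι' → M) : ∑ U ∈ (V.map e.toEmbedding).powerset, f U =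
      ∑ U ∈ V.powerset, f (U.map e.toEmbedding) := by
  symm
  refine Finset.sum_nbij' (fun U => U.map e.toEmbedding) (fun U => U.map e.symm.toEmbedding)
    ?_ ?_ ?_ ?_ ?_
  · intro U hU
    simpa using hU
  · intro U hU
    rw [Finset.mem_powerset] at hU ⊢
    intro a ha
    rw [Finset.mem_map_equiv, Equiv.symm_symm] at ha
    simpa using hU ha
  · intro U _
    ext a
    simp [Finset.mem_map_equiv]
  · intro U _
    ext a
    simp [Finset.mem_map_equiv]
  · intro _ _
    rfl

theorem sum_ssubsets_map {ι' : Type*} [DecidableEq ι'] (e : ι ≃ ι') (V : Finset ι)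
    (f : Finset ι' → M) : ∑ U ∈ (V.map e.toEmbedding).ssubsets, f U =
      ∑ U ∈ V.ssubsets, f (U.map e.toEmbedding) := by
  rw [Finset.ssubsets, Finset.ssubsets, ← Finset.filter_ne', ← Finset.filter_ne',
    Finset.sum_filter, Finset.sum_filter, sum_powerset_map]
  refine Finset.sum_congr rfl fun U _ => ?_
  simp only [ne_eq, Finset.map_inj]

end Sums

/-! ### Marginals of the correlations -/

section Marginals

variable {X Y Z U V W : Finset ℕ} {Φ : Pos d → Pos d → ℝ} {ε t θ c C : ℝ} {F : OpFam d}

/-- The partial trace. -/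
def ptd (Y V : Finset ℕ) : TCV d V →L[ℂ] TCV d Y := if h : Y ⊆ V then pt h else 0

theorem ptd_of_subset (h : Y ⊆ V) : ptd (d := d) Y V = pt h := dif_pos h

theorem norm_ptd_le (T : TCV d V) : ‖ptd Y V T‖ ≤ ‖T‖ := by
  rw [ptd]
  split_ifs with h
  · exact norm_pt_le h T
  · simp

theorem ptd_tn (hY : Y ⊆ V) (hU : U ⊆ V) (S : TCV d U) (T : TCV d (V \ U)) :
    ptd Y V (tn U V S T) =
      tn (Y ∩ U) Y (ptd (Y ∩ U) U S) (ptd (Y \ (Y ∩ U)) (V \ U) T) := by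
  have h1 : Y ∩ U ⊆ U := Finset.inter_subset_right
  have h2 : Y \ (Y ∩ U) ⊆ V \ U := fun a ha => by
    simp only [Finset.mem_sdiff, Finset.mem_inter, not_and] at ha ⊢
    exact ⟨hY ha.1, ha.2 ha.1⟩
  rw [ptd_of_subset hY, ptd_of_subset h1, ptd_of_subset h2, tn_of_subset hU,
    tn_of_subset Finset.inter_subset_left]
  exact pt_tens_tens _ (Split.of_subset Finset.inter_subset_left) h1 h2 hY S T

/-- The alternating sum over `A` of the marginals on `Y` of the correlations of the particles
in `V`, when the particles in `Y ∪ A` move. -/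
def marg (Φ : Pos d → Pos d → ℝ) (ε : ℝ) (F : OpFam d) (Y V : Finset ℕ) (t : ℝ) : TCV d Y :=
  ∑ A ∈ (V \ Y).powerset, (-1 : ℂ) ^ ((V \ Y) \ A).card • ptd Y V (corrT Φ ε F (Y ∪ A) V t)

theorem c1Bd_marg (hθ : 0 ≤ θ) (hΦ : IsPot Φ) (hC : ∀ q q', |Φ q q'| ≤ C)
    (hF : IsTCFam F) (h : IsC1Fam θ F c) (hs : θ * (2 * |ε| * C) ≤ 1 / 50) (hc : 0 ≤ c)
    (hc' : 2 * c * (Real.exp 3 - 1) ≤ 1) (Y : Finset ℕ) (hV : V.Nonempty) :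
    C1Bd θ (fun t => marg Φ ε F Y V t)
      (2 ^ (V \ Y).card * (V.card.factorial * (2 / 5) ^ V.card)) := by
  have h1 : (2 : ℝ) ^ (V \ Y).card * (V.card.factorial * (2 / 5) ^ V.card) =
      ∑ A ∈ (V \ Y).powerset, (V.card.factorial * (2 / 5) ^ V.card : ℝ) := by
    rw [Finset.sum_const, Finset.card_powerset, nsmul_eq_mul]
    push_cast
    ring
  rw [h1]
  refine C1Bd.sum hθ _ fun A _ => ?_
  have h2 := (((c1Bd_corrT_factorial hθ hΦ hC hF h hs hc hc' (Y ∪ A) hV).clm hθ (ptd Y V)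
    (K := 1) (fun x => by rw [one_mul]; exact norm_ptd_le x) zero_le_one)).smul hθ
      ((-1 : ℂ) ^ ((V \ Y) \ A).card)
  rw [norm_pow, norm_neg, norm_one, one_pow, one_mul, one_mul] at h2
  exact h2

/-- `link` for the marginals of correlations. -/
def mlink (Φ : Pos d → Pos d → ℝ) (ε : ℝ) (F : OpFam d) (i j : ℕ) (Y V : Finset ℕ) (t : ℝ) :
    TCV d Y :=
  marg Φ ε F Y V t + ∑ U ∈ V.powerset, if i ∈ U ∧ j ∉ U then
    tn (Y ∩ U) Y (marg Φ ε F (Y ∩ U) U t) (marg Φ ε F (Y \ (Y ∩ U)) (V \ U) t) else 0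

/-- The set A splits into its parts inside and outside U. Each correlation depends only on the
moving particles among its own, and the sign is multiplicative, so the alternating sum factors. -/
theorem sum_ptd_tn (hY : Y ⊆ V) (hU : U ⊆ V) (t : ℝ) :
    ∑ A ∈ (V \ Y).powerset, (-1 : ℂ) ^ ((V \ Y) \ A).card •
      ptd Y V (tn U V (corrT Φ ε F (Y ∪ A) U t) (corrT Φ ε F (Y ∪ A) (V \ U) t)) =
    tn (Y ∩ U) Y (marg Φ ε F (Y ∩ U) U t) (marg Φ ε F (Y \ (Y ∩ U)) (V \ U) t) := by
  have hN : V \ Y = (U \ (Y ∩ U)) ∪ ((V \ U) \ (Y \ (Y ∩ U))) := by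
    ext a
    have := @hU a
    simp only [Finset.mem_sdiff, Finset.mem_union, Finset.mem_inter]
    tauto
  have hd : Disjoint (U \ (Y ∩ U)) ((V \ U) \ (Y \ (Y ∩ U))) :=
    Finset.disjoint_sdiff.mono Finset.sdiff_subset Finset.sdiff_subset
  have h0 : ∀ g : Finset ℕ → TCV d Y, ∑ A ∈ (V \ Y).powerset, g A =
      ∑ A₁ ∈ (U \ (Y ∩ U)).powerset, ∑ A₂ ∈ ((V \ U) \ (Y \ (Y ∩ U))).powerset, g (A₁ ∪ A₂) := by
    intro g
    rw [hN, sum_powerset_union hd]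
  rw [h0, marg, marg, tn_sum_left]
  refine Finset.sum_congr rfl fun A₁ h1 => ?_
  rw [map_sum]
  refine Finset.sum_congr rfl fun A₂ h2 => ?_
  rw [Finset.mem_powerset] at h1 h2
  have e1 : corrT Φ ε F (Y ∪ (A₁ ∪ A₂)) U t = corrT Φ ε F ((Y ∩ U) ∪ A₁) U t := by
    refine corrT_congr ?_ t
    ext a
    have := @h1 a
    have := @h2 a
    simp only [Finset.mem_sdiff, Finset.mem_union, Finset.mem_inter] at *
    tauto
  have e2 : corrT Φ ε F (Y ∪ (A₁ ∪ A₂)) (V \ U) t =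
      corrT Φ ε F ((Y \ (Y ∩ U)) ∪ A₂) (V \ U) t := by
    refine corrT_congr ?_ t
    ext a
    have := @h1 a
    have := @h2 a
    simp only [Finset.mem_sdiff, Finset.mem_union, Finset.mem_inter] at *
    tauto
  have e3 : ((V \ Y) \ (A₁ ∪ A₂)).card =
      ((U \ (Y ∩ U)) \ A₁).card + (((V \ U) \ (Y \ (Y ∩ U))) \ A₂).card := by
    rw [← Finset.card_union_of_disjoint (hd.mono Finset.sdiff_subset Finset.sdiff_subset)]
    congr 1
    ext a
    have := @h1 a
    have := @h2 a
    have := @hU a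
    simp only [Finset.mem_sdiff, Finset.mem_union, Finset.mem_inter] at *
    tauto
  rw [ptd_tn hY hU, e1, e2, e3, tn_smul_left, map_smul, smul_smul, pow_add]

theorem sum_ptd_link (hY : Y ⊆ V) (i j : ℕ) (t : ℝ) :
    ∑ A ∈ (V \ Y).powerset, (-1 : ℂ) ^ ((V \ Y) \ A).card •
      ptd Y V (link (fun T => corrT Φ ε F (Y ∪ A) T t) i j V) = mlink Φ ε F i j Y V t := by
  simp_rw [link, map_add, smul_add]
  rw [Finset.sum_add_distrib, mlink, marg]
  congr 1
  simp_rw [map_sum, Finset.smul_sum]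
  rw [Finset.sum_comm]
  refine Finset.sum_congr rfl fun U hU => ?_
  by_cases hij : i ∈ U ∧ j ∉ U
  · simp only [if_pos hij]
    exact sum_ptd_tn hY (Finset.mem_powerset.1 hU) t
  · simp only [if_neg hij, map_zero, smul_zero, Finset.sum_const_zero]

theorem link_comm {f : ∀ V, TCV d V} {i j : ℕ} (hi : i ∈ V) (hj : j ∈ V) :
    link f i j V = link f j i V := by
  refine TC.op_injective ?_
  rw [link, link, map_add, map_add, eq_zero_or_op_sum, eq_zero_or_op_sum]
  congr 1
  simp_rw [op_tn]
  let G : Finset ℕ → Op d V := fun U => ampl V (TC.op _ (f U))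
  change (∑ U ∈ V.powerset, if i ∈ U ∧ j ∉ U then G U * G (V \ U) else 0) =
    ∑ U ∈ V.powerset, if j ∈ U ∧ i ∉ U then G U * G (V \ U) else 0
  refine Finset.sum_nbij' (fun U => V \ U) (fun U => V \ U) ?_ ?_ ?_ ?_ ?_
  · exact fun U _ => Finset.mem_powerset.2 Finset.sdiff_subset
  · exact fun U _ => Finset.mem_powerset.2 Finset.sdiff_subset
  · exact fun U hU => Finset.sdiff_sdiff_eq_self (Finset.mem_powerset.1 hU)
  · exact fun U hU => Finset.sdiff_sdiff_eq_self (Finset.mem_powerset.1 hU)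
  · intro U hU
    rw [Finset.sdiff_sdiff_eq_self (Finset.mem_powerset.1 hU)]
    have h1 : (j ∈ V \ U ∧ i ∉ V \ U) ↔ (i ∈ U ∧ j ∉ U) := by
      simp only [Finset.mem_sdiff]
      tauto
    simp only [h1]
    split_ifs
    · exact (commute_ampl V Finset.disjoint_sdiff _ _).eq
    · rfl

/-- The derivative of `marg` in the interaction picture. -/
def margD (Φ : Pos d → Pos d → ℝ) (ε : ℝ) (F : OpFam d) (Y V : Finset ℕ) (t : ℝ) : TCV d Y :=
  (ε : ℂ) • (∑ p ∈ pairs Y, nint Φ Y p.1 p.2 (mlink Φ ε F p.1 p.2 Y V t) +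
    ∑ j ∈ V \ Y, ∑ i ∈ Y, ptd Y (insert j Y)
      (nint Φ (insert j Y) i j (mlink Φ ε F i j (insert j Y) V t)))

/-- The moving pairs are of three kinds. Those inside Y pass through the partial trace, those inside
A vanish under it, and for i in Y, j in A all particles except Y ∪ {j} can be traced first. After
exchanging the sums over A and j, the sum over A \ {j} is the alternating sum that belongs to Y ∪
{j}, with the same signs. -/
theorem sum_ptd_corrD (hΦ : IsPot Φ) (hY : Y ⊆ V) (t : ℝ) :
    ∑ A ∈ (V \ Y).powerset, (-1 : ℂ) ^ ((V \ Y) \ A).card •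
      ptd Y V (corrD Φ ε F (Y ∪ A) V t) = margD Φ ε F Y V t := by
  have h1 : ∀ A ∈ (V \ Y).powerset, ptd Y V (corrD Φ ε F (Y ∪ A) V t) = (ε : ℂ) •
      (∑ p ∈ pairs Y, nint Φ Y p.1 p.2
        (ptd Y V (link (fun T => corrT Φ ε F (Y ∪ A) T t) p.1 p.2 V)) +
      ∑ j ∈ A, ∑ i ∈ Y, ptd Y (insert j Y) (nint Φ (insert j Y) i j
        (ptd (insert j Y) V (link (fun T => corrT Φ ε F (Y ∪ A) T t) i j V)))) := by
    intro A hA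
    rw [Finset.mem_powerset] at hA
    have hAV : A ⊆ V := hA.trans Finset.sdiff_subset
    have hd : Disjoint Y A := Finset.disjoint_sdiff.mono_right hA
    rw [corrD, Finset.inter_eq_right.2 (Finset.union_subset hY hAV), map_smul,
      sum_pairs_union hd (f := fun i j => nint Φ V i j
        (link (fun T => corrT Φ ε F (Y ∪ A) T t) i j V)) (fun i hi j hj => by
          rw [nint_comm hΦ, link_comm (hAV hj) (hY hi)]), map_add, map_add]
    congr 1
    have e3 : ptd Y V (∑ p ∈ pairs A, nint Φ V p.1 p.2
        (link (fun T => corrT Φ ε F (Y ∪ A) T t) p.1 p.2 V)) = 0 := by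
      rw [map_sum]
      refine Finset.sum_eq_zero fun p hp => ?_
      rw [mem_pairs] at hp
      rw [ptd_of_subset hY, pt_nint_eq_zero hΦ hY (hA hp.1) (hA hp.2.1)]
    rw [e3, add_zero, map_sum, map_sum]
    congr 1
    · refine Finset.sum_congr rfl fun p hp => ?_
      rw [mem_pairs] at hp
      rw [ptd_of_subset hY, pt_nint hΦ hY hp.1 hp.2.1]
    · refine Finset.sum_congr rfl fun j hj => ?_
      rw [map_sum]
      refine Finset.sum_congr rfl fun i hi => ?_
      have hjY : insert j Y ⊆ V := Finset.insert_subset (hAV hj) hY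
      rw [ptd_of_subset hY, ptd_of_subset hjY, ptd_of_subset (Finset.subset_insert j Y),
        ← pt_nint hΦ hjY (Finset.mem_insert_of_mem hi) (Finset.mem_insert_self j Y), pt_pt]
  rw [Finset.sum_congr rfl fun A hA => by rw [h1 A hA], margD]
  simp_rw [smul_comm _ (ε : ℂ), ← Finset.smul_sum]
  congr 1
  simp_rw [smul_add]
  rw [Finset.sum_add_distrib]
  congr 1
  · simp_rw [Finset.smul_sum]
    rw [Finset.sum_comm]
    refine Finset.sum_congr rfl fun p hp => ?_
    rw [← sum_ptd_link hY, map_sum]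
    simp_rw [map_smul]
  · simp_rw [Finset.smul_sum]
    rw [sum_powerset_sum_mem (f := fun A j => ∑ i ∈ Y, (-1 : ℂ) ^ ((V \ Y) \ A).card •
      ptd Y (insert j Y) (nint Φ (insert j Y) i j
        (ptd (insert j Y) V (link (fun T => corrT Φ ε F (Y ∪ A) T t) i j V))))]
    refine Finset.sum_congr rfl fun j hj => ?_
    rw [Finset.sum_comm]
    refine Finset.sum_congr rfl fun i hi => ?_
    rw [Finset.mem_sdiff] at hj
    have hjY : insert j Y ⊆ V := Finset.insert_subset hj.1 hY
    rw [← sum_ptd_link hjY, map_sum, map_sum]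
    have e1 : (V \ Y).erase j = V \ insert j Y := by
      ext a
      simp only [Finset.mem_erase, Finset.mem_sdiff, Finset.mem_insert]
      tauto
    rw [e1]
    refine Finset.sum_congr rfl fun A hA => ?_
    have e2 : (V \ Y) \ insert j A = (V \ insert j Y) \ A := by
      ext a
      simp only [Finset.mem_sdiff, Finset.mem_insert]
      tauto
    have e3 : Y ∪ insert j A = insert j Y ∪ A := by
      rw [Finset.union_insert, Finset.insert_union]
    rw [e2, e3, map_smul, map_smul]

theorem IsTCFam.hasDerivAt_freeG_marg (hΦ : IsPot Φ) (hF : IsTCFam F) (hY : Y ⊆ V)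
    (hV : V.Nonempty) (t : ℝ) :
    HasDerivAt (fun τ => freeG Y Y (-τ) (marg Φ ε F Y V τ))
      (freeG Y Y (-t) (margD Φ ε F Y V t)) t := by
  rw [← sum_ptd_corrD hΦ hY, map_sum]
  simp_rw [marg, map_sum]
  refine HasDerivAt.fun_sum fun A hA => ?_
  simp_rw [map_smul]
  refine HasDerivAt.fun_const_smul _ ?_
  -- After the trace only the free motion of Y remains, whatever A is, so one interaction picture
  -- serves all summands.
  have e1 : ∀ τ T, freeG Y Y τ (ptd Y V T) =
      ptd Y V (freeG (d := d) (V ∩ (Y ∪ A)) V τ T) := by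
    intro τ T
    have e2 : Y ∩ (V ∩ (Y ∪ A)) = Y := Finset.inter_eq_left.2
      (Finset.subset_inter hY Finset.subset_union_left)
    rw [ptd_of_subset hY, pt_freeG hY Finset.inter_subset_left, e2]
  simp_rw [e1]
  exact ((ptd Y V).restrictScalars ℝ).hasFDerivAt.comp_hasDerivAt t
    (hF.hasDerivAt_freeG_corrT hΦ (Y ∪ A) hV t)

/-! ### Relabelling -/

/-- Families that do not depend on the labels of the particles. -/
def IsSymmFam (F : OpFam d) : Prop :=
  ∀ (X X' : Finset ℕ) (e : X ≃ X'), X.Nonempty → rlT e (famT F X) = famT F X'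

variable {X' Y' U' V' : Finset ℕ} {σ : Equiv.Perm ℕ}

theorem rlT_tn (hU : Maps σ U U') (hV : Maps σ V V') (S : TCV d U) (T : TCV d (V \ U)) :
    rlT hV.equiv (tn U V S T) = tn U' V' (rlT hU.equiv S) (rlT (hV.sdiff hU).equiv T) := by
  by_cases h : U ⊆ V
  · rw [tn_of_subset h, tn_of_subset (hV.subset hU h), rlT_tens hU (hV.sdiff hU) hV]
  · have h' : ¬U' ⊆ V' := fun h' => h (hV.symm.subset hU.symm h')
    rw [tn, tn, dif_neg h, dif_neg h']
    simp

theorem rlT_ptd (hY : Maps σ Y Y') (hV : Maps σ V V') (T : TCV d V) :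
    rlT hY.equiv (ptd Y V T) = ptd Y' V' (rlT hV.equiv T) := by
  by_cases h : Y ⊆ V
  · rw [ptd_of_subset h, ptd_of_subset (hV.subset hY h), pt_rlT hY hV h]
  · have h' : ¬Y' ⊆ V' := fun h' => h (hV.symm.subset hY.symm h')
    rw [ptd, ptd, dif_neg h, dif_neg h']
    simp

theorem IsTCFam.rlT_expT (hF : IsTCFam F) (hs : IsSymmFam F) (hV : Maps σ V V') :
    rlT hV.equiv (expT F V) = expT F V' := by
  induction V using Finset.strongInduction generalizing V' with
  | H V ih =>
    obtain rfl := hV.eq_map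
    rcases V.eq_empty_or_nonempty with rfl | ⟨a, ha⟩
    · refine TC.op_injective ?_
      rw [op_rlT, hF.op_expT, expFam_empty, relabelOp_one, hF.op_expT]
      exact expFam_empty.symm
    · rw [hF.expT_eq_sum ha, hF.expT_eq_sum ((hV a).1 ha), sum_powerset_map, map_sum]
      refine Finset.sum_congr rfl fun U hU => ?_
      have hU' := maps_map σ U
      by_cases haU : a ∈ U
      · rw [if_pos haU, if_pos ((hU' a).1 haU), rlT_tn hU' hV, hs _ _ _ ⟨a, haU⟩,
          ih _ (sdiff_ssubset (Finset.mem_powerset.1 hU) haU)]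
      · rw [if_neg haU, if_neg (fun h => haU ((hU' a).2 h)), map_zero]

theorem IsTCFam.rlT_evolT (hΦ : IsPot Φ) (hF : IsTCFam F) (hs : IsSymmFam F) (hX : Maps σ X X')
    (hV : Maps σ V V') (t : ℝ) :
    rlT hV.equiv (evolT Φ ε F X V t) = evolT Φ ε F X' V' t := by
  rw [evolT, evolT, rlT_evolG hΦ (hV.inter hX) hV Finset.inter_subset_left, hF.rlT_expT hs]

theorem IsTCFam.rlT_corrT (hΦ : IsPot Φ) (hF : IsTCFam F) (hs : IsSymmFam F) (hX : Maps σ X X')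
    (hV : Maps σ V V') (hne : V.Nonempty) (t : ℝ) :
    rlT hV.equiv (corrT Φ ε F X V t) = corrT Φ ε F X' V' t := by
  induction V using Finset.strongInduction generalizing V' with
  | H V ih =>
    obtain rfl := hV.eq_map
    obtain ⟨a, ha⟩ := hne
    rw [hF.corrT_eq_sub hΦ X ha, hF.corrT_eq_sub hΦ X' ((hV a).1 ha), map_sub,
      hF.rlT_evolT hΦ hs hX hV, sum_ssubsets_map, map_sum]
    congr 1
    refine Finset.sum_congr rfl fun U hU => ?_
    have hU' := maps_map σ U
    by_cases haU : a ∈ U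
    · rw [if_pos haU, if_pos ((hU' a).1 haU), rlT_tn hU' hV,
        ih U (Finset.mem_ssubsets.1 hU) hU' ⟨a, haU⟩, hF.rlT_evolT hΦ hs hX]
    · rw [if_neg haU, if_neg (fun h => haU ((hU' a).2 h)), map_zero]

theorem IsTCFam.rlT_marg (hΦ : IsPot Φ) (hF : IsTCFam F) (hs : IsSymmFam F) (hY : Maps σ Y Y')
    (hV : Maps σ V V') (hne : V.Nonempty) (t : ℝ) :
    rlT hY.equiv (marg Φ ε F Y V t) = marg Φ ε F Y' V' t := by
  obtain rfl := hV.eq_map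
  obtain rfl := hY.eq_map
  have e1 : V.map σ.toEmbedding \ Y.map σ.toEmbedding = (V \ Y).map σ.toEmbedding :=
    (Finset.map_sdiff ..).symm
  rw [marg, marg, map_sum, e1, sum_powerset_map]
  refine Finset.sum_congr rfl fun A _ => ?_
  rw [map_smul, rlT_ptd hY hV, hF.rlT_corrT hΦ hs (hY.union (maps_map σ A)) hV hne,
    ← Finset.map_sdiff, Finset.card_map]

end Marginals


/-! ### Compositions of the nonlinear groups -/

section Composition

variable {X Y Z U V W : Finset ℕ} {Φ : Pos d → Pos d → ℝ} {ε t : ℝ} {F F' : OpFam d}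

/-- The exponential undoes the logarithm: both sides satisfy the same recursion over the block of an
element. Consequently, composing nonlinear groups means evolving the densities in succession. -/
theorem expFam_nonlinearGroup (hΦ : IsPot Φ) (X V : Finset ℕ) :
    expFam (nonlinearGroup Φ ε t X F) V = evolFam Φ ε t X F V := by
  induction V using Finset.strongInduction with
  | H V ih =>
    rcases V.eq_empty_or_nonempty with rfl | ⟨a, ha⟩
    · rw [expFam_empty, evolFam_empty hΦ]
    · rw [← ampl_self (expFam (nonlinearGroup Φ ε t X F) V), ← ampl_self (evolFam Φ ε t X F V),
        ampl_expFam_eq_sum le_rfl ha, ampl_evolFam_eq_sum hΦ le_rfl ha]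
      refine Finset.sum_congr rfl fun U hU => ?_
      split_ifs with haU
      · rw [ih _ (sdiff_ssubset (Finset.mem_powerset.1 hU) haU)]
      · rfl

theorem expT_nonlinearGroup (hΦ : IsPot Φ) (hF : IsTCFam F) (X V : Finset ℕ) :
    expT (nonlinearGroup Φ ε t X F) V = evolT Φ ε F X V t :=
  TC.op_injective (by
    rw [(hF.nonlinearGroup hΦ ε t X).op_expT, hF.op_evolT, expFam_nonlinearGroup hΦ])

theorem pt_evolG_of_subset (h : Y ⊆ W) (hX : X ⊆ Y) (t : ℝ) (T : TCV d W) :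
    pt h (evolG Φ ε X W t T) = evolG Φ ε X Y t (pt h T) := by
  rw [evolG, evolG, conj, conj, ← ampl_ampl hX h, ← ampl_ampl hX h, pt_sandwich_ampl]

/-- The composition of the nonlinear groups of the sets in a list. -/
def compList (Φ : Pos d → Pos d → ℝ) (ε t : ℝ) (l : List (Finset ℕ)) (F : OpFam d) : OpFam d :=
  l.foldr (fun X F' => nonlinearGroup Φ ε t X F') F

theorem IsTCFam.compList (hΦ : IsPot Φ) (hF : IsTCFam F) (ε t : ℝ) (l : List (Finset ℕ)) :
    IsTCFam (compList Φ ε t l F) := by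
  induction l with
  | nil => exact hF
  | cons X l ih => exact ih.nonlinearGroup hΦ ε t X

theorem IsTCFam.ptd_expT_cons (hΦ : IsPot Φ) (hF : IsTCFam F) (X : Finset ℕ)
    (l : List (Finset ℕ)) (hY : Y ⊆ V) (hd : Disjoint X Y) :
    ptd Y V (expT (QBBGKY.compList Φ ε t (X :: l) F) V) =
      ptd Y V (expT (QBBGKY.compList Φ ε t l F) V) := by
  have h1 : expT (QBBGKY.compList Φ ε t (X :: l) F) V =
      evolT Φ ε (QBBGKY.compList Φ ε t l F) X V t :=
    expT_nonlinearGroup hΦ (hF.compList hΦ ε t l) X V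
  rw [h1, evolT, ptd_of_subset hY, pt_evolG hΦ hY Finset.inter_subset_left
    (hd.mono_left Finset.inter_subset_right)]

theorem IsTCFam.ptd_expT_compList_of_disjoint (hΦ : IsPot Φ) (hF : IsTCFam F)
    {l : List (Finset ℕ)} (hY : Y ⊆ V) (hl : ∀ X ∈ l, Disjoint X Y) :
    ptd Y V (expT (QBBGKY.compList Φ ε t l F) V) = ptd Y V (expT F V) := by
  induction l with
  | nil => rfl
  | cons X l ih =>
    rw [hF.ptd_expT_cons hΦ X l hY (hl X List.mem_cons_self),
      ih fun Z hZ => hl Z (List.mem_cons_of_mem _ hZ)]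

/-- The head of the list acts last. Groups that act after X are disjoint from Y and invisible by
cyclicity. When X acts last, everything outside V ∩ X is traced first; the evolution of X passes
through this trace, and the earlier groups, being disjoint from X, disappear. -/
theorem IsTCFam.ptd_expT_compList (hΦ : IsPot Φ) (hF : IsTCFam F)
    {l : List (Finset ℕ)} (hl : l.Pairwise Disjoint) (hX : X ∈ l) (hY : Y ⊆ V ∩ X) :
    ptd Y V (expT (QBBGKY.compList Φ ε t l F) V) = ptd Y V (evolT Φ ε F X V t) := by
  have hYV : Y ⊆ V := hY.trans Finset.inter_subset_left
  have hYX : Y ⊆ X := hY.trans Finset.inter_subset_right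
  induction l with
  | nil => simp at hX
  | cons Z l ih =>
    rw [List.pairwise_cons] at hl
    by_cases hXl : X ∈ l
    · rw [hF.ptd_expT_cons hΦ Z l hYV ((hl.1 X hXl).mono_right hYX), ih hl.2 hXl]
    · have hXZ : X = Z := by
        rcases List.mem_cons.1 hX with h | h
        · exact h
        · exact absurd h hXl
      subst hXZ
      have h1 : expT (QBBGKY.compList Φ ε t (X :: l) F) V =
          evolT Φ ε (QBBGKY.compList Φ ε t l F) X V t :=
        expT_nonlinearGroup hΦ (hF.compList hΦ ε t l) X V
      have hXV : V ∩ X ⊆ V := Finset.inter_subset_left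
      have h2 : ∀ T, ptd Y V (evolG Φ ε (V ∩ X) V t T) =
          pt hY (evolG Φ ε (V ∩ X) (V ∩ X) t (ptd (V ∩ X) V T)) := by
        intro T
        rw [ptd_of_subset hYV, ptd_of_subset hXV, ← pt_evolG_of_subset hXV le_rfl, pt_pt]
      rw [h1, evolT, evolT, h2, h2, hF.ptd_expT_compList_of_disjoint hΦ hXV fun Z hZ =>
        (hl.1 Z hZ).symm.mono_right Finset.inter_subset_right]

theorem IsTCFam.tn_expT_sdiff_self (hF : IsTCFam F) (T : TCV d V) :
    tn V V T (expT F (V \ V)) = T := by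
  have h : ∀ U : Finset ℕ, U = ∅ → ampl V (expFam F U) = 1 := by
    rintro U rfl
    rw [expFam_empty, ampl_one (Finset.empty_subset V)]
  refine TC.op_injective ?_
  rw [op_tn, hF.op_expT, h _ (Finset.sdiff_self V), mul_one, ampl_self]

theorem IsTCFam.famT_eq_sub (hF : IsTCFam F) {a : ℕ} (ha : a ∈ V) :
    famT F V = expT F V - ∑ U ∈ V.ssubsets,
      if a ∈ U then tn U V (famT F U) (expT F (V \ U)) else 0 := by
  rw [hF.expT_eq_sum ha, sum_ite_mem_eq_add ha, add_sub_cancel_right, hF.tn_expT_sdiff_self]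

/-- Families with the same marginals on `Y` of the products have the same marginals on `Y`. -/
theorem IsTCFam.ptd_famT_congr (hF : IsTCFam F) (hF' : IsTCFam F')
    (h : ∀ Z V, Z = V ∩ Y → ptd Z V (expT F V) = ptd Z V (expT F' V)) (hZ : Z = V ∩ Y)
    (hV : V.Nonempty) : ptd Z V (famT F V) = ptd Z V (famT F' V) := by
  induction V using Finset.strongInduction generalizing Z with
  | H V ih =>
    obtain ⟨a, ha⟩ := hV
    have hZV : Z ⊆ V := hZ ▸ Finset.inter_subset_left
    rw [hF.famT_eq_sub ha, hF'.famT_eq_sub ha, map_sub, map_sub, h Z V hZ, map_sum, map_sum]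
    refine congrArg (fun S : TCV d Z => ptd Z V (expT F' V) - S)
      (Finset.sum_congr rfl fun U hU => ?_)
    split_ifs with haU
    · have hU' := Finset.mem_ssubsets.1 hU
      rw [ptd_tn hZV hU'.1, ptd_tn hZV hU'.1]
      have e1 : Z ∩ U = U ∩ Y := by
        ext b
        have := @hU'.1 b
        simp only [hZ, Finset.mem_inter]
        tauto
      have e2 : Z \ (Z ∩ U) = (V \ U) ∩ Y := by
        ext b
        simp only [hZ, Finset.mem_inter, Finset.mem_sdiff]
        tauto
      rw [ih U hU' e1 ⟨a, haU⟩, h _ _ e2]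
    · rfl

theorem sum_powerset_image {M β β' : Type*} [AddCommMonoid M] [DecidableEq β'] {f : β → β'}
    (hf : Function.Injective f) (N : Finset β) (g : Finset β' → M) :
    ∑ B ∈ (N.image f).powerset, g B = ∑ A ∈ N.powerset, g (A.image f) := by
  rw [Finset.powerset_image, Finset.sum_image]
  exact fun A _ B _ h => Finset.image_injective hf h

theorem clusters_eq (s n : ℕ) : clusters s n = insert (Finset.range s)
    ((Finset.range (s + n) \ Finset.range s).image fun i => {i}) := by
  have : Finset.range (s + n) \ Finset.range s = Finset.Ico s (s + n) := by
    ext a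
    simp only [Finset.mem_sdiff, Finset.mem_range, Finset.mem_Ico]
    omega
  rw [this]
  rfl

theorem notMem_image_singleton {Y A : Finset ℕ} (h : Disjoint A Y) :
    Y ∉ A.image fun i => ({i} : Finset ℕ) := by
  intro hY
  obtain ⟨i, hi, rfl⟩ := Finset.mem_image.1 hY
  exact Finset.disjoint_left.1 h hi (Finset.mem_singleton_self i)

theorem declust_insert_image (Y A : Finset ℕ) :
    declust (insert Y (A.image fun i => {i})) = Y ∪ A := by
  ext b
  simp [declust]

theorem disjoint_of_mem_clusters {s n : ℕ} {B B' : Finset ℕ} (hB : B ∈ clusters s n)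
    (hB' : B' ∈ clusters s n) (hne : B ≠ B') : Disjoint B B' := by
  simp only [clusters, Finset.mem_insert, Finset.mem_image, Finset.mem_Ico] at hB hB'
  rcases hB with rfl | ⟨i, hi, rfl⟩ <;> rcases hB' with rfl | ⟨j, hj, rfl⟩
  · exact absurd rfl hne
  · rw [Finset.disjoint_singleton_right, Finset.mem_range]
    omega
  · rw [Finset.disjoint_singleton_left, Finset.mem_range]
    omega
  · rw [Finset.disjoint_singleton]
    exact fun h => hne (by rw [h])

theorem disjoint_declust_clusters {s n : ℕ} (P : Finpartition (clusters s n))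
    {Z Z' : Finset (Finset ℕ)} (hZ : Z ∈ P.parts) (hZ' : Z' ∈ P.parts) (hne : Z ≠ Z') :
    Disjoint (declust Z) (declust Z') := by
  rw [declust, declust, Finset.disjoint_sup_left]
  intro B hB
  rw [Finset.disjoint_sup_right]
  intro B' hB'
  refine disjoint_of_mem_clusters (P.le hZ hB) (P.le hZ' hB') ?_
  rintro rfl
  exact Finset.disjoint_left.1 (P.disjoint hZ hZ' hne) hB hB'

theorem pairwise_disjoint_declust {s n : ℕ} (P : Finpartition (clusters s n)) :
    (P.parts.toList.map declust).Pairwise Disjoint := by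
  rw [List.pairwise_map]
  have h := P.parts.nodup_toList
  rw [List.nodup_iff_pairwise_ne] at h
  refine h.imp_of_mem fun hZ hZ' hne => ?_
  exact disjoint_declust_clusters P (Finset.mem_toList.1 hZ) (Finset.mem_toList.1 hZ') hne

/-- For every V, the densities of the composition and those of the single group of the block of Y
have the same marginals on V ∩ Y. `ptd_famT_congr` transfers this to the correlations. -/
theorem IsTCFam.ptd_compGroup (hΦ : IsPot Φ) (hF : IsTCFam F) {s n : ℕ} (hs : 1 ≤ s)
    (P : Finpartition (clusters s n)) :
    ptd (Finset.range s) (Finset.range (s + n))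
        (famT (compGroup Φ ε t P F) (Finset.range (s + n))) =
      ptd (Finset.range s) (Finset.range (s + n))
        (corrT Φ ε F (declust (P.part (Finset.range s))) (Finset.range (s + n)) t) := by
  have hmem : Finset.range s ∈ clusters s n := Finset.mem_insert_self _ _
  have hsub : Finset.range s ⊆ declust (P.part (Finset.range s)) :=
    le_declust (P.mem_part hmem)
  have hX : declust (P.part (Finset.range s)) ∈ P.parts.toList.map declust :=
    List.mem_map_of_mem (Finset.mem_toList.2 (P.part_mem.2 hmem))
  refine (hF.compList hΦ ε t (P.parts.toList.map declust)).ptd_famT_congr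
    (hF.nonlinearGroup hΦ ε t (declust (P.part (Finset.range s)))) (Y := Finset.range s)
    ?_ ?_ ⟨0, Finset.mem_range.2 (by omega)⟩
  · rintro Z V rfl
    rw [hF.ptd_expT_compList hΦ (pairwise_disjoint_declust P) hX
      (Finset.inter_subset_inter_left hsub), expT_nonlinearGroup hΦ hF]
  · exact (Finset.inter_eq_right.2 (Finset.range_subset_range.2 (by omega))).symm

/-- Each composition may be replaced by the evolution of the block of Y, and the weights of the
other blocks are summed by `sum_cumulantWeight_part`, leaving the sign of the number of clusters
outside that block. -/
theorem IsTCFam.ptrace_nonlinearCumulant (hΦ : IsPot Φ) {f : OpSeq d} (hF : IsTCFam (at_ f))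
    {s : ℕ} (hs : 1 ≤ s) (n : ℕ) :
    ptrace (Finset.range s) (nonlinearCumulant Φ ε t s n f) =
      TC.op _ (marg Φ ε (at_ f) (Finset.range s) (Finset.range (s + n)) t) := by
  have hne : (Finset.range (s + n)).Nonempty := ⟨0, Finset.mem_range.2 (by omega)⟩
  have hsub : Finset.range s ⊆ Finset.range (s + n) := Finset.range_subset_range.2 (by omega)
  have h1 : nonlinearCumulant Φ ε t s n f = TC.op _ (∑ P : Finpartition (clusters s n),
      cumulantWeight P.parts.card • famT (compGroup Φ ε t P (at_ f)) (Finset.range (s + n))) := by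
    rw [nonlinearCumulant, map_sum]
    refine Finset.sum_congr rfl fun P _ => ?_
    rw [map_smul]
    refine congrArg (fun A : Op d (Finset.range (s + n)) => cumulantWeight P.parts.card • A) ?_
    exact ((hF.compList hΦ ε t (P.parts.toList.map declust)).op_famT hne).symm
  have hd : Disjoint (Finset.range (s + n) \ Finset.range s) (Finset.range s) :=
    Finset.sdiff_disjoint
  rw [h1, ← op_pt hsub, ← ptd_of_subset hsub, map_sum]
  refine congrArg (TC.op _) ?_
  simp_rw [map_smul, hF.ptd_compGroup hΦ hs]
  have hmem : Finset.range s ∈ clusters s n := Finset.mem_insert_self _ _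
  refine (sum_cumulantWeight_part hmem (fun Z => ptd (Finset.range s)
    (Finset.range (s + n)) (corrT Φ ε (at_ f) (declust Z) (Finset.range (s + n)) t))).trans ?_
  rw [clusters_eq, Finset.sum_powerset_insert (notMem_image_singleton hd), marg]
  have h2 : ∀ A ⊆ Finset.range (s + n) \ Finset.range s,
      Finset.range s ∉ A.image fun i => ({i} : Finset ℕ) := fun A hA =>
    notMem_image_singleton (hd.mono_left hA)
  have hinj : Function.Injective fun i : ℕ => ({i} : Finset ℕ) := Finset.singleton_injective
  -- Sets of clusters without Y drop out; those with Y correspond to the sets A of single particles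
  -- that move along with Y.
  rw [sum_powerset_image hinj, sum_powerset_image hinj, Finset.sum_eq_zero, zero_add]
  · refine Finset.sum_congr rfl fun A hA => ?_
    rw [if_pos (Finset.mem_insert_self _ _), declust_insert_image]
    congr 2
    rw [Finset.insert_sdiff_insert, Finset.sdiff_insert_of_notMem
      (notMem_image_singleton hd), ← Finset.image_sdiff _ _ hinj,
      Finset.card_image_of_injective _ hinj]
  · intro A hA
    rw [if_neg (h2 A (Finset.mem_powerset.1 hA))]

theorem IsTCFam.seriesTerm_eq (hΦ : IsPot Φ) {f : OpSeq d} (hF : IsTCFam (at_ f))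
    {s : ℕ} (hs : 1 ≤ s) (n : ℕ) :
    seriesTerm Φ ε t f s n = TC.op _ ((n.factorial : ℂ)⁻¹ •
      marg Φ ε (at_ f) (Finset.range s) (Finset.range (s + n)) t) := by
  rw [seriesTerm, hF.ptrace_nonlinearCumulant hΦ hs, map_smul]

end Composition


/-! ### Summation over the number of traced particles -/

section Series

theorem hasSum_bilinear_antidiagonal {E E' E'' : Type*} [NormedAddCommGroup E] [NormedSpace ℂ E]
    [NormedAddCommGroup E'] [NormedSpace ℂ E'] [NormedAddCommGroup E''] [NormedSpace ℂ E'']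
    [CompleteSpace E] [CompleteSpace E'] [CompleteSpace E''] (B : E →L[ℂ] E' →L[ℂ] E'')
    {f : ℕ → E} {g : ℕ → E'} (hf : Summable fun n => ‖f n‖) (hg : Summable fun n => ‖g n‖) :
    HasSum (fun n => ∑ p ∈ Finset.HasAntidiagonal.antidiagonal n, B (f p.1) (g p.2))
      (B (∑' n, f n) (∑' n, g n)) := by
  have h1 : Summable fun p : ℕ × ℕ => B (f p.1) (g p.2) := by
    refine Summable.of_norm_bounded ((hf.mul_of_nonneg hg (fun _ => norm_nonneg _)
      fun _ => norm_nonneg _).mul_left ‖B‖) fun p => ?_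
    rw [← mul_assoc]
    exact B.le_opNorm₂ _ _
  have h2 : HasSum (fun p : ℕ × ℕ => B (f p.1) (g p.2)) (B (∑' n, f n) (∑' n, g n)) := by
    have h3 : HasSum (fun k => B (f k) (∑' n, g n)) (∑' p : ℕ × ℕ, B (f p.1) (g p.2)) :=
      h1.hasSum.prod_fiberwise fun k => (B (f k)).hasSum hg.of_norm.hasSum
    have h4 : HasSum (fun k => B (f k) (∑' n, g n)) (B (∑' n, f n) (∑' n, g n)) :=
      (B.flip (∑' n, g n)).hasSum hf.of_norm.hasSum
    rw [← h3.unique h4]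
    exact h1.hasSum
  have h3 := (Finset.HasAntidiagonal.sigmaAntidiagonalEquivProd (A := ℕ)).hasSum_iff.2 h2
  refine h3.sigma fun n => ?_
  have h4 := (Finset.HasAntidiagonal.antidiagonal n).hasSum fun p : ℕ × ℕ => B (f p.1) (g p.2)
  exact h4

/-- The sequence `0, f 0, f 1, …`. -/
def shift {E : Type*} [Zero E] (f : ℕ → E) : ℕ → E
  | 0 => 0
  | n + 1 => f n

theorem hasSum_shift {E : Type*} [NormedAddCommGroup E] {f : ℕ → E} {a : E} (h : HasSum f a) :
    HasSum (shift f) a := by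
  rw [← hasSum_nat_add_iff' 1]
  simpa [shift] using h

theorem summable_shift {E : Type*} [NormedAddCommGroup E] {f : ℕ → E} (h : Summable f) :
    Summable (shift f) := (hasSum_shift h.hasSum).summable

/-- The bound of the `n`-th term of the series of an operator of `s` particles. -/
def termBd (s n : ℕ) : ℝ := (n.factorial : ℝ)⁻¹ * (2 ^ n * ((s + n).factorial * (2 / 5) ^ (s + n)))

theorem termBd_nonneg (s n : ℕ) : 0 ≤ termBd s n := by rw [termBd]; positivity

/-- The bound equals s!(2/5)^s binom(n+s,s) (4/5)^n, where 4/5 is 2 · (2/5). -/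
theorem summable_termBd (s : ℕ) : Summable (termBd s) := by
  have h1 : termBd s = fun n => (s.factorial * (2 / 5) ^ s : ℝ) *
      (((n + s).choose s : ℝ) * (4 / 5) ^ n) := by
    ext1 n
    have h2 : ((n + s).choose s : ℝ) * n.factorial * s.factorial = (s + n).factorial := by
      rw [add_comm s n]
      exact_mod_cast Nat.add_choose_mul_factorial_mul_factorial n s
    have h3 : (n.factorial : ℝ) ≠ 0 := by positivity
    have h4 : (4 / 5 : ℝ) ^ n = 2 ^ n * (2 / 5) ^ n := by rw [← mul_pow]; norm_num
    rw [termBd, ← h2, h4, pow_add]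
    field_simp
  rw [h1]
  have h2 : ‖(4 / 5 : ℝ)‖ < 1 := by norm_num
  exact (summable_choose_mul_geometric_of_norm_lt_one s h2).mul_left _

end Series

/-! ### The series of the marginals for an arbitrary finite set of particles. -/

section Marginals

variable {X Y Z U V W Y' V' : Finset ℕ} {Φ : Pos d → Pos d → ℝ} {ε t θ c C : ℝ} {F : OpFam d}
  {σ : Equiv.Perm ℕ}

/-- The assumptions on the potential and on the initial data. -/
structure IsAdmissible (Φ : Pos d → Pos d → ℝ) (ε θ C c : ℝ) (F : OpFam d) : Prop where
  pot : IsPot Φ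
  bdd : ∀ q q', |Φ q q'| ≤ C
  tc : IsTCFam F
  symm : IsSymmFam F
  theta_nonneg : 0 ≤ θ
  c1 : IsC1Fam θ F c
  theta_le : θ * (2 * |ε| * C) ≤ 1 / 50
  c_nonneg : 0 ≤ c
  c_le : 2 * c * (Real.exp 3 - 1) ≤ 1

theorem exists_maps_fix (hV : Y ⊆ V) (hV' : Y ⊆ V') (hc : (V \ Y).card = (V' \ Y).card) :
    ∃ (σ : Equiv.Perm ℕ) (_ : Maps σ V V') (hY : Maps σ Y Y), hY.equiv = Equiv.refl Y := by
  let e₀ : (V \ Y : Finset ℕ) ≃ (V' \ Y : Finset ℕ) := Finset.equivOfCardEq hc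
  let e : V ≃ V' := (Split.of_subset hV).equiv.symm.trans
    ((Equiv.sumCongr (Equiv.refl _) e₀).trans (Split.of_subset hV').equiv)
  obtain ⟨σ, h, he⟩ := exists_maps e
  have h1 : ∀ a ∈ Y, σ a = a := by
    intro a ha
    have e1 : (⟨a, hV ha⟩ : V) = (Split.of_subset hV).equiv (Sum.inl ⟨a, ha⟩) := rfl
    have e2 : e ⟨a, hV ha⟩ = (Split.of_subset hV').equiv (Sum.inl ⟨a, ha⟩) := by
      rw [e1]
      simp [e]
    rw [← h.equiv_apply ⟨a, hV ha⟩, he, e2]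
    rfl
  have hY : Maps σ Y Y := fun a => by
    constructor
    · intro ha
      rwa [h1 a ha]
    · intro ha
      have := σ.injective (h1 _ ha)
      rwa [this] at ha
  refine ⟨σ, h, hY, ?_⟩
  ext x
  rw [hY.equiv_apply, h1 x x.2]
  rfl

/-- A label that is larger than the labels in `Y`. -/
def fresh (Y : Finset ℕ) : ℕ := Y.sup Nat.succ

theorem lt_fresh {a : ℕ} (ha : a ∈ Y) : a < fresh Y := Finset.le_sup (f := Nat.succ) ha

theorem fresh_notMem (Y : Finset ℕ) : fresh Y ∉ Y := fun h => (lt_fresh h).false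

theorem fresh_range (s : ℕ) : fresh (Finset.range s) = s := by
  refine le_antisymm (Finset.sup_le fun a ha => Finset.mem_range.1 ha) ?_
  cases s with
  | zero => exact Nat.zero_le _
  | succ s => exact lt_fresh (Finset.mem_range.2 (Nat.lt_succ_self s))

/-- `Y` together with `n` further labels. -/
def extend (Y : Finset ℕ) (n : ℕ) : Finset ℕ := Y ∪ Finset.Ico (fresh Y) (fresh Y + n)

theorem subset_extend (Y : Finset ℕ) (n : ℕ) : Y ⊆ extend Y n := Finset.subset_union_left

theorem extend_sdiff (Y : Finset ℕ) (n : ℕ) :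
    extend Y n \ Y = Finset.Ico (fresh Y) (fresh Y + n) := by
  rw [extend, Finset.union_sdiff_left, Finset.sdiff_eq_self_of_disjoint]
  rw [Finset.disjoint_left]
  intro a ha hY
  exact absurd (Finset.mem_Ico.1 ha).1 (not_le.2 (lt_fresh hY))

theorem card_extend_sdiff (Y : Finset ℕ) (n : ℕ) : (extend Y n \ Y).card = n := by
  rw [extend_sdiff, Nat.card_Ico, Nat.add_sub_cancel_left]

theorem card_extend (Y : Finset ℕ) (n : ℕ) : (extend Y n).card = Y.card + n := by
  rw [← Finset.card_sdiff_add_card_eq_card (subset_extend Y n), card_extend_sdiff, add_comm]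

theorem extend_range (s n : ℕ) : extend (Finset.range s) n = Finset.range (s + n) := by
  rw [extend, fresh_range]
  ext a
  simp only [Finset.mem_union, Finset.mem_range, Finset.mem_Ico]
  omega

/-- The `n`-th term of the series of the marginal correlation operator of the particles in `Y`. -/
def term (Φ : Pos d → Pos d → ℝ) (ε : ℝ) (F : OpFam d) (Y : Finset ℕ) (n : ℕ) (t : ℝ) : TCV d Y :=
  (n.factorial : ℂ)⁻¹ • marg Φ ε F Y (extend Y n) t

namespace IsAdmissible

variable (h : IsAdmissible Φ ε θ C c F)
include h

/-- By symmetry the marginal depends on V only through the number of traced particles: a permutation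
fixing Y pointwise carries V to the standard extension of Y. -/
theorem marg_eq (hY : Y.Nonempty) (hV : Y ⊆ V) (t : ℝ) :
    marg Φ ε F Y V t = ((V \ Y).card.factorial : ℂ) • term Φ ε F Y (V \ Y).card t := by
  obtain ⟨σ, hσ, hYY, he⟩ := exists_maps_fix hV (subset_extend Y (V \ Y).card)
    (card_extend_sdiff Y _).symm
  have h1 := h.tc.rlT_marg (ε := ε) h.pot h.symm hYY hσ (hY.mono hV) t
  rw [he, rlT_refl] at h1
  rw [term, smul_smul, mul_inv_cancel₀ (Nat.cast_ne_zero.2 (Nat.factorial_ne_zero _)), one_smul, h1]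

theorem rlT_term (hY : Y.Nonempty) (hYY : Maps σ Y Y') (n : ℕ) (t : ℝ) :
    rlT hYY.equiv (term Φ ε F Y n t) = term Φ ε F Y' n t := by
  have hm := maps_map σ (extend Y n)
  have hYne : Y'.Nonempty := by
    obtain ⟨a, ha⟩ := hY
    exact ⟨σ a, (hYY a).1 ha⟩
  have hc : ((extend Y n).map σ.toEmbedding \ Y').card = n := by
    rw [hYY.eq_map, ← Finset.map_sdiff, Finset.card_map, card_extend_sdiff]
  have h1 := h.marg_eq hYne (hm.subset hYY (subset_extend Y n)) t
  rw [hc] at h1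
  rw [term, map_smul, h.tc.rlT_marg h.pot h.symm hYY hm (hY.mono (subset_extend Y n)), h1,
    smul_smul, inv_mul_cancel₀ (Nat.cast_ne_zero.2 (Nat.factorial_ne_zero _)), one_smul]

theorem rlT_term' (hY : Y.Nonempty) (e : Y ≃ Y') (n : ℕ) (t : ℝ) :
    rlT e (term Φ ε F Y n t) = term Φ ε F Y' n t := by
  obtain ⟨σ, hσ, rfl⟩ := exists_maps e
  exact h.rlT_term hY hσ n t

theorem c1Bd_term (hY : Y.Nonempty) (n : ℕ) :
    C1Bd θ (fun t => term Φ ε F Y n t) (termBd Y.card n) := by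
  have h1 := (c1Bd_marg h.theta_nonneg h.pot h.bdd h.tc h.c1 h.theta_le h.c_nonneg h.c_le Y
    (hY.mono (subset_extend Y n))).smul h.theta_nonneg ((n.factorial : ℂ)⁻¹)
  rw [card_extend_sdiff, card_extend, norm_inv, Complex.norm_natCast] at h1
  exact h1

theorem norm_term_le (hY : Y.Nonempty) (n : ℕ) (t : ℝ) :
    ‖term Φ ε F Y n t‖ ≤ termBd Y.card n := (h.c1Bd_term hY n).norm_le h.theta_nonneg t

theorem summable_norm_term (hY : Y.Nonempty) (t : ℝ) : Summable fun n => ‖term Φ ε F Y n t‖ :=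
  Summable.of_nonneg_of_le (fun _ => norm_nonneg _) (fun n => h.norm_term_le hY n t)
    (summable_termBd _)

end IsAdmissible

/-- The terms of the series of `G(Y) + ∑_{Y = X₁ ⊔ X₂, i ∈ X₁, j ∈ X₂} G(X₁) G(X₂)`. -/
def termLink (Φ : Pos d → Pos d → ℝ) (ε : ℝ) (F : OpFam d) (i j : ℕ) (Y : Finset ℕ) (n : ℕ)
    (t : ℝ) : TCV d Y :=
  term Φ ε F Y n t + ∑ U ∈ Y.powerset, if i ∈ U ∧ j ∉ U then
    ∑ p ∈ Finset.HasAntidiagonal.antidiagonal n,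
      tn U Y (term Φ ε F U p.1 t) (term Φ ε F (Y \ U) p.2 t) else 0

/-- The bound of `termLink`. -/
def linkBd (Y : Finset ℕ) (n : ℕ) : ℝ :=
  termBd Y.card n + ∑ U ∈ Y.powerset,
    ∑ p ∈ Finset.HasAntidiagonal.antidiagonal n, termBd U.card p.1 * termBd (Y \ U).card p.2

theorem summable_linkBd (Y : Finset ℕ) : Summable (linkBd Y) := by
  refine (summable_termBd _).add (summable_sum fun U _ => ?_)
  refine summable_sum_mul_antidiagonal_of_summable_mul (f := termBd U.card)
    (g := termBd (Y \ U).card) ?_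
  exact (summable_termBd _).mul_of_nonneg (summable_termBd _) (termBd_nonneg _) (termBd_nonneg _)

/-- The marginal correlation operator of the particles in `Y`. -/
def corr (Φ : Pos d → Pos d → ℝ) (ε : ℝ) (F : OpFam d) (Y : Finset ℕ) (t : ℝ) : TCV d Y :=
  ∑' n, term Φ ε F Y n t

/-- The derivative of `term` in the interaction picture. -/
def termD (Φ : Pos d → Pos d → ℝ) (ε : ℝ) (F : OpFam d) (Y : Finset ℕ) (n : ℕ) (t : ℝ) : TCV d Y :=
  (ε : ℂ) • (∑ p ∈ pairs Y, nint Φ Y p.1 p.2 (termLink Φ ε F p.1 p.2 Y n t) +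
    shift (fun n => ∑ i ∈ Y, ptd Y (insert (fresh Y) Y) (nint Φ (insert (fresh Y) Y) i (fresh Y)
      (termLink Φ ε F i (fresh Y) (insert (fresh Y) Y) n t))) n)

/-- The derivative of `corr` in the interaction picture. -/
def corrDeriv (Φ : Pos d → Pos d → ℝ) (ε : ℝ) (F : OpFam d) (Y : Finset ℕ) (t : ℝ) : TCV d Y :=
  (ε : ℂ) • (∑ p ∈ pairs Y, nint Φ Y p.1 p.2 (link (fun U => corr Φ ε F U t) p.1 p.2 Y) +
    ∑ i ∈ Y, ptd Y (insert (fresh Y) Y) (nint Φ (insert (fresh Y) Y) i (fresh Y)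
      (link (fun U => corr Φ ε F U t) i (fresh Y) (insert (fresh Y) Y))))

theorem hasSum_tn_antidiagonal {f : ℕ → TCV d U} {g : ℕ → TCV d (Y \ U)}
    (hf : Summable fun n => ‖f n‖) (hg : Summable fun n => ‖g n‖) :
    HasSum (fun n => ∑ p ∈ Finset.HasAntidiagonal.antidiagonal n, tn U Y (f p.1) (g p.2))
      (tn U Y (∑' n, f n) (∑' n, g n)) := by
  have h1 := hasSum_bilinear_antidiagonal (E := TCV d U) (E' := TCV d (Y \ U)) (E'' := TCV d Y)
    (tn U Y) (f := f) (g := g) hf hg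
  exact h1

namespace IsAdmissible

variable (h : IsAdmissible Φ ε θ C c F)
include h

theorem tn_marg_eq (hV : Y ⊆ V) {N : Finset ℕ} (hUY : U ⊆ Y) (hN : N ⊆ V \ Y) (hU : U.Nonempty)
    (hYU : (Y \ U).Nonempty) {U' : Finset ℕ} (hU' : U' = U ∪ N) (t : ℝ) :
    tn (Y ∩ U') Y (marg Φ ε F (Y ∩ U') U' t) (marg Φ ε F (Y \ (Y ∩ U')) (V \ U') t) =
      (N.card.factorial * ((V \ Y).card - N.card).factorial : ℂ) •
        tn U Y (term Φ ε F U N.card t) (term Φ ε F (Y \ U) ((V \ Y).card - N.card) t) := by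
  have e1 : Y ∩ U' = U := by
    ext a
    have := @hUY a
    have := @hN a
    simp only [hU', Finset.mem_inter, Finset.mem_union, Finset.mem_sdiff] at *
    tauto
  have e2 : U' \ U = N := by
    ext a
    have := @hUY a
    have := @hN a
    simp only [hU', Finset.mem_union, Finset.mem_sdiff] at *
    tauto
  have e3 : (V \ U') \ (Y \ U) = (V \ Y) \ N := by
    ext a
    have := @hUY a
    have := @hN a
    simp only [hU', Finset.mem_union, Finset.mem_sdiff] at *
    tauto
  have e4 : Y \ U ⊆ V \ U' := by
    intro a
    have := @hV a
    have := @hN a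
    simp only [hU', Finset.mem_union, Finset.mem_sdiff] at *
    tauto
  have e5 : U ⊆ U' := hU' ▸ Finset.subset_union_left
  have key : ∀ U₁ : Finset ℕ, U₁ = U →
      tn U₁ Y (marg Φ ε F U₁ U' t) (marg Φ ε F (Y \ U₁) (V \ U') t) =
      tn U Y (marg Φ ε F U U' t) (marg Φ ε F (Y \ U) (V \ U') t) := by
    rintro U₁ rfl
    rfl
  rw [key _ e1, h.marg_eq hU e5, h.marg_eq hYU e4, e2, e3, tn_smul_left, map_smul, smul_smul,
    Finset.card_sdiff_of_subset hN]

/-- A subset of V consists of a part U of Y and a set N of traced particles, and the summand depends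
on N only through k = |N|. With m traced particles in all, binom(m,k) k! (m-k)! = m!, which turns
the sum over N into m! times a Cauchy product. -/
theorem mlink_eq {i j : ℕ} (hV : Y ⊆ V) (hi : i ∈ Y) (hj : j ∈ Y) (t : ℝ) :
    mlink Φ ε F i j Y V t =
      ((V \ Y).card.factorial : ℂ) • termLink Φ ε F i j Y (V \ Y).card t := by
  rw [mlink, termLink, smul_add, ← h.marg_eq ⟨i, hi⟩ hV]
  congr 1
  have e0 : V = Y ∪ (V \ Y) := (Finset.union_sdiff_of_subset hV).symm
  have e1 : ∀ g : Finset ℕ → TCV d Y, ∑ U ∈ V.powerset, g U =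
      ∑ U ∈ Y.powerset, ∑ N ∈ (V \ Y).powerset, g (U ∪ N) := by
    intro g
    conv_lhs => rw [e0]
    rw [sum_powerset_union Finset.disjoint_sdiff]
  rw [e1, Finset.smul_sum]
  refine Finset.sum_congr rfl fun U hU => ?_
  rw [Finset.mem_powerset] at hU
  have e2 : ∀ N ∈ (V \ Y).powerset, (i ∈ U ∪ N ∧ j ∉ U ∪ N) ↔ (i ∈ U ∧ j ∉ U) := by
    intro N hN
    rw [Finset.mem_powerset] at hN
    have h1 := @hN i
    have h2 := @hN j
    simp only [Finset.mem_union, Finset.mem_sdiff] at *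
    tauto
  by_cases hij : i ∈ U ∧ j ∉ U
  · have e3 : ∀ N ∈ (V \ Y).powerset, (if i ∈ U ∪ N ∧ j ∉ U ∪ N then
        tn (Y ∩ (U ∪ N)) Y (marg Φ ε F (Y ∩ (U ∪ N)) (U ∪ N) t)
          (marg Φ ε F (Y \ (Y ∩ (U ∪ N))) (V \ (U ∪ N)) t) else 0) =
        (fun k : ℕ => (k.factorial * ((V \ Y).card - k).factorial : ℂ) •
          tn U Y (term Φ ε F U k t) (term Φ ε F (Y \ U) ((V \ Y).card - k) t)) N.card := by
      intro N hN
      rw [if_pos ((e2 N hN).2 hij), h.tn_marg_eq hV hU (Finset.mem_powerset.1 hN) ⟨i, hij.1⟩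
        ⟨j, Finset.mem_sdiff.2 ⟨hj, hij.2⟩⟩ rfl]
    rw [if_pos hij, Finset.sum_congr rfl e3, Finset.sum_powerset_apply_card
      (fun k : ℕ => (k.factorial * ((V \ Y).card - k).factorial : ℂ) •
          tn U Y (term Φ ε F U k t) (term Φ ε F (Y \ U) ((V \ Y).card - k) t)),
      Finset.Nat.sum_antidiagonal_eq_sum_range_succ_mk, Finset.smul_sum]
    refine Finset.sum_congr rfl fun k hk => ?_
    have hk' : k ≤ (V \ Y).card := Nat.lt_succ_iff.1 (Finset.mem_range.1 hk)
    rw [← Nat.cast_smul_eq_nsmul ℂ, smul_smul]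
    congr 1
    rw [← mul_assoc]
    exact_mod_cast Nat.choose_mul_factorial_mul_factorial hk'
  · rw [if_neg hij, smul_zero]
    exact Finset.sum_eq_zero fun N hN => if_neg fun h' => hij ((e2 N hN).1 h')

theorem rlT_termLink (hYY : Maps σ Y Y') {i j : ℕ} (hj : j ∈ Y) (hY : Y.Nonempty) (n : ℕ)
    (t : ℝ) : rlT hYY.equiv (termLink Φ ε F i j Y n t) =
      termLink Φ ε F (σ i) (σ j) Y' n t := by
  obtain rfl := hYY.eq_map
  rw [termLink, termLink, map_add, h.rlT_term hY, sum_powerset_map, map_sum]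
  congr 1
  refine Finset.sum_congr rfl fun U hU => ?_
  have hU := maps_map σ U
  by_cases hij : i ∈ U ∧ j ∉ U
  · rw [if_pos hij, if_pos ⟨(hU i).1 hij.1, fun h' => hij.2 ((hU j).2 h')⟩, map_sum]
    refine Finset.sum_congr rfl fun p _ => ?_
    rw [rlT_tn hU hYY, h.rlT_term ⟨i, hij.1⟩, h.rlT_term ⟨j, Finset.mem_sdiff.2 ⟨hj, hij.2⟩⟩]
  · rw [if_neg hij, if_neg (fun h' => hij ⟨(hU i).2 h'.1, fun h'' => h'.2 ((hU j).1 h'')⟩),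
      map_zero]

/-- The transposition of j and j' fixes Y, so all traced particles contribute equally to the
interaction with Y. -/
theorem ptd_nint_termLink {i j j' : ℕ} (hi : i ∈ Y) (hj : j ∉ Y) (hj' : j' ∉ Y) (n : ℕ)
    (t : ℝ) : ptd Y (insert j Y) (nint Φ (insert j Y) i j
        (termLink Φ ε F i j (insert j Y) n t)) =
      ptd Y (insert j' Y) (nint Φ (insert j' Y) i j'
        (termLink Φ ε F i j' (insert j' Y) n t)) := by
  let σ : Equiv.Perm ℕ := Equiv.swap j j'
  have h1 : ∀ a ∈ Y, σ a = a := fun a ha =>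
    Equiv.swap_apply_of_ne_of_ne (fun h => hj (h ▸ ha)) (fun h => hj' (h ▸ ha))
  have h2 : Maps σ Y Y := fun a => by
    constructor
    · intro ha
      rwa [h1 a ha]
    · intro ha
      have := σ.injective (h1 _ ha)
      rwa [this] at ha
  have h3 : Maps σ (insert j Y) (insert j' Y) := fun a => by
    rw [Finset.mem_insert, Finset.mem_insert, h2 a]
    have : a = j ↔ σ a = j' := by
      rw [← Equiv.swap_apply_left j j']
      exact σ.injective.eq_iff.symm
    rw [this]
  have h4 : h2.equiv = Equiv.refl Y := by
    ext x
    rw [h2.equiv_apply, h1 x x.2]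
    rfl
  rw [← rlT_refl (ptd Y (insert j Y) _), ← h4, rlT_ptd h2 h3, rlT_nint h.pot,
    h.rlT_termLink h3 (Finset.mem_insert_self j Y) ⟨j, Finset.mem_insert_self j Y⟩, h1 i hi]
  have h5 : σ j = j' := Equiv.swap_apply_left j j'
  rw [h5]

/-- Among n+1 traced particles each may interact with Y, which gives n+1 equal terms with the n! of
the remaining ones; (n+1) n!/(n+1)! = 1. Hence the trace over one additional particle carries the
index n, and `shift` records the displacement. -/
theorem margD_extend (Y : Finset ℕ) (n : ℕ) (t : ℝ) :
    (n.factorial : ℂ)⁻¹ • margD Φ ε F Y (extend Y n) t = termD Φ ε F Y n t := by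
  have hn : (n.factorial : ℂ) ≠ 0 := Nat.cast_ne_zero.2 (Nat.factorial_ne_zero _)
  rw [margD, termD, smul_comm, smul_add]
  congr 2
  · rw [Finset.smul_sum]
    refine Finset.sum_congr rfl fun p hp => ?_
    rw [mem_pairs] at hp
    rw [h.mlink_eq (subset_extend Y n) hp.1 hp.2.1, card_extend_sdiff, map_smul, smul_smul,
      inv_mul_cancel₀ hn, one_smul]
  · cases n with
    | zero =>
      rw [extend_sdiff, add_zero, Finset.Ico_self, Finset.sum_empty, smul_zero]
      rfl
    | succ n =>
      have e1 : ∀ j ∈ extend Y (n + 1) \ Y, (∑ i ∈ Y, ptd Y (insert j Y)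
          (nint Φ (insert j Y) i j (mlink Φ ε F i j (insert j Y) (extend Y (n + 1)) t))) =
          (n.factorial : ℂ) • ∑ i ∈ Y, ptd Y (insert (fresh Y) Y)
            (nint Φ (insert (fresh Y) Y) i (fresh Y)
              (termLink Φ ε F i (fresh Y) (insert (fresh Y) Y) n t)) := by
        intro j hj
        rw [Finset.mem_sdiff] at hj
        rw [Finset.smul_sum]
        refine Finset.sum_congr rfl fun i hi => ?_
        have hjs : insert j Y ⊆ extend Y (n + 1) :=
          Finset.insert_subset hj.1 (subset_extend Y _)
        have hc : (extend Y (n + 1) \ insert j Y).card = n := by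
          rw [Finset.card_sdiff_of_subset hjs, card_extend, Finset.card_insert_of_notMem hj.2]
          omega
        rw [h.mlink_eq hjs (Finset.mem_insert_of_mem hi) (Finset.mem_insert_self j Y), hc,
          map_smul, map_smul, h.ptd_nint_termLink hi hj.2 (fresh_notMem Y)]
      rw [Finset.sum_congr rfl e1, Finset.sum_const, card_extend_sdiff,
        ← Nat.cast_smul_eq_nsmul ℂ, smul_smul, smul_smul]
      have e2 : ((n + 1).factorial : ℂ)⁻¹ * (((n + 1 : ℕ) : ℂ) * (n.factorial : ℂ)) = 1 := by
        rw [← Nat.cast_mul, ← Nat.factorial_succ]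
        exact inv_mul_cancel₀ hn
      rw [mul_assoc, e2, one_smul]
      rfl

theorem hasDerivAt_freeG_term (hY : Y.Nonempty) (n : ℕ) (t : ℝ) :
    HasDerivAt (fun τ => freeG Y Y (-τ) (term Φ ε F Y n τ))
      (freeG Y Y (-t) (termD Φ ε F Y n t)) t := by
  rw [← h.margD_extend, map_smul]
  simp_rw [term, map_smul]
  exact (h.tc.hasDerivAt_freeG_marg h.pot (subset_extend Y n)
    (hY.mono (subset_extend Y n)) t).fun_const_smul _

theorem hasSum_term (hY : Y.Nonempty) (t : ℝ) :
    HasSum (fun n => term Φ ε F Y n t) (corr Φ ε F Y t) :=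
  (h.summable_norm_term hY t).of_norm.hasSum

theorem hasSum_termLink {i j : ℕ} (hj : j ∈ Y) (hY : Y.Nonempty) (t : ℝ) :
    HasSum (fun n => termLink Φ ε F i j Y n t) (link (fun U => corr Φ ε F U t) i j Y) := by
  suffices h2 : ∀ U ∈ Y.powerset, HasSum (fun n => if i ∈ U ∧ j ∉ U then
      ∑ p ∈ Finset.HasAntidiagonal.antidiagonal n,
        tn U Y (term Φ ε F U p.1 t) (term Φ ε F (Y \ U) p.2 t) else 0)
      (if i ∈ U ∧ j ∉ U then tn U Y (corr Φ ε F U t) (corr Φ ε F (Y \ U) t) else 0) by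
    have h3 := (h.hasSum_term hY t).add (hasSum_sum h2)
    exact h3
  intro U _
  split_ifs with hij
  · have h4 := hasSum_tn_antidiagonal (f := fun n => term Φ ε F U n t)
      (g := fun n => term Φ ε F (Y \ U) n t) (h.summable_norm_term ⟨i, hij.1⟩ t)
      (h.summable_norm_term ⟨j, Finset.mem_sdiff.2 ⟨hj, hij.2⟩⟩ t)
    exact h4
  · exact hasSum_zero

theorem norm_termLink_le {i j : ℕ} (hj : j ∈ Y) (hY : Y.Nonempty) (n : ℕ) (t : ℝ) :
    ‖termLink Φ ε F i j Y n t‖ ≤ linkBd Y n := by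
  refine (norm_add_le _ _).trans (add_le_add (h.norm_term_le hY n t) ?_)
  refine (norm_sum_le _ _).trans (Finset.sum_le_sum fun U _ => ?_)
  have h0 : 0 ≤ ∑ p ∈ Finset.HasAntidiagonal.antidiagonal n,
      termBd U.card p.1 * termBd (Y \ U).card p.2 :=
    Finset.sum_nonneg fun p _ => mul_nonneg (termBd_nonneg _ _) (termBd_nonneg _ _)
  split_ifs with hij
  · refine (norm_sum_le _ _).trans (Finset.sum_le_sum fun p _ => ?_)
    refine (norm_tn_le _ _).trans ?_
    exact mul_le_mul (h.norm_term_le ⟨i, hij.1⟩ _ t)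
      (h.norm_term_le ⟨j, Finset.mem_sdiff.2 ⟨hj, hij.2⟩⟩ _ t) (norm_nonneg _)
      (termBd_nonneg _ _)
  · rwa [norm_zero]

theorem hasSum_termD (hY : Y.Nonempty) (t : ℝ) :
    HasSum (fun n => termD Φ ε F Y n t) (corrDeriv Φ ε F Y t) := by
  refine HasSum.const_smul _ (HasSum.add (hasSum_sum fun p hp => ?_)
    (hasSum_shift (hasSum_sum fun i hi => ?_)))
  · rw [mem_pairs] at hp
    exact (nint Φ Y p.1 p.2).hasSum (h.hasSum_termLink hp.2.1 hY t)
  · exact (ptd Y (insert (fresh Y) Y)).hasSum ((nint Φ _ i (fresh Y)).hasSum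
      (h.hasSum_termLink (Finset.mem_insert_self _ _) (Finset.insert_nonempty _ _) t))

theorem norm_termD_le (hY : Y.Nonempty) (n : ℕ) (t : ℝ) :
    ‖termD Φ ε F Y n t‖ ≤ |ε| * ((pairs Y).card • (2 * C * linkBd Y n) +
      shift (fun n => Y.card • (2 * C * linkBd (insert (fresh Y) Y) n)) n) := by
  have hC : 0 ≤ C := (abs_nonneg _).trans (h.bdd 0 0)
  rw [termD, norm_smul, Complex.norm_real, Real.norm_eq_abs]
  refine mul_le_mul_of_nonneg_left ((norm_add_le _ _).trans (add_le_add ?_ ?_)) (abs_nonneg _)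
  · refine (norm_sum_le _ _).trans (Finset.sum_le_card_nsmul _ _ _ fun p hp => ?_)
    rw [mem_pairs] at hp
    refine (norm_nint_le h.pot h.bdd _ _ _).trans ?_
    exact mul_le_mul_of_nonneg_left (h.norm_termLink_le hp.2.1 hY n t) (by positivity)
  · cases n with
    | zero => simp [shift]
    | succ n =>
      refine (norm_sum_le _ _).trans (Finset.sum_le_card_nsmul _ _ _ fun i hi => ?_)
      refine (norm_ptd_le _).trans ((norm_nint_le h.pot h.bdd _ _ _).trans ?_)
      exact mul_le_mul_of_nonneg_left (h.norm_termLink_le (Finset.mem_insert_self _ _)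
        (Finset.insert_nonempty _ _) n t) (by positivity)

/-- Termwise differentiation: the free group is contractive and the bounds of `term` and `termD` are
uniform in time and summable. -/
theorem hasDerivAt_freeG_corr (hY : Y.Nonempty) (t : ℝ) :
    HasDerivAt (fun τ => freeG Y Y (-τ) (corr Φ ε F Y τ))
      (freeG Y Y (-t) (corrDeriv Φ ε F Y t)) t := by
  have hg := isCGroup_freeG (d := d) (le_refl Y)
  have e1 : (fun τ => freeG Y Y (-τ) (corr Φ ε F Y τ)) =
      fun τ => ∑' n, freeG Y Y (-τ) (term Φ ε F Y n τ) := by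
    ext1 τ
    exact ((freeG Y Y (-τ)).hasSum (h.hasSum_term hY τ)).tsum_eq.symm
  have e2 : freeG Y Y (-t) (corrDeriv Φ ε F Y t) =
      ∑' n, freeG Y Y (-t) (termD Φ ε F Y n t) :=
    ((freeG Y Y (-t)).hasSum (h.hasSum_termD hY t)).tsum_eq.symm
  rw [e1, e2]
  refine hasDerivAt_tsum (u := fun n => |ε| * ((pairs Y).card • (2 * C * linkBd Y n) +
      shift (fun n => Y.card • (2 * C * linkBd (insert (fresh Y) Y) n)) n))
    (g := fun n τ => freeG Y Y (-τ) (term Φ ε F Y n τ))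
    (g' := fun n τ => freeG Y Y (-τ) (termD Φ ε F Y n τ)) (y₀ := 0) ?_
    (fun n τ => h.hasDerivAt_freeG_term hY n τ)
    (fun n τ => (hg.norm_apply_le _ _).trans (h.norm_termD_le hY n τ)) ?_ t
  · refine Summable.mul_left _ (Summable.add ?_ (summable_shift ?_))
    · exact ((summable_linkBd Y).mul_left _).const_smul _
    · exact ((summable_linkBd _).mul_left _).const_smul _
  · exact Summable.of_norm_bounded (summable_termBd Y.card) fun n =>
      (hg.norm_apply_le _ _).trans (h.norm_term_le hY n 0)

theorem rlT_corr (hY : Y.Nonempty) (e : Y ≃ Y') (t : ℝ) :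
    rlT e (corr Φ ε F Y t) = corr Φ ε F Y' t := by
  have h1 := (rlT e).hasSum (h.hasSum_term hY t)
  simp only [h.rlT_term' hY] at h1
  exact h1.tsum_eq.symm

/-- For `θ > 0` the marginal correlation operators are differentiable. -/
theorem exists_hasDerivAt_corr (hθ : 0 < θ) (hY : Y.Nonempty) (t : ℝ) :
    ∃ D, HasDerivAt (fun τ => corr Φ ε F Y τ) D t := by
  choose u' h1 h2 using fun n => h.c1Bd_term hY n
  refine ⟨_, hasDerivAt_tsum (u := fun n => θ⁻¹ * termBd Y.card n)
    (g := fun n τ => term Φ ε F Y n τ) (g' := u') (y₀ := 0)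
    ((summable_termBd _).mul_left _) (fun n τ => h1 n hθ τ) (fun n τ => ?_)
    (h.summable_norm_term hY 0).of_norm t⟩
  rw [← div_eq_inv_mul, le_div_iff₀ hθ]
  have := h2 n τ
  have := norm_nonneg (term Φ ε F Y n τ)
  linarith [h2 n τ]

end IsAdmissible

end Marginals


/-! ### The marginal correlation operators and the hierarchy -/

section Hierarchy

variable {X Y U V W : Finset ℕ} {Φ : Pos d → Pos d → ℝ} {ε t θ c C : ℝ}

theorem expSum_eq_zero {ι A 𝕜 : Type*} [DecidableEq ι] [CommRing 𝕜] [Ring A] [Algebra 𝕜 A]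
    {V : Finset ι} (hV : V.Nonempty) {w : ℕ → 𝕜} (hw : ∀ n, n ≠ 0 → w n = 0) (F : Finset ι → A) :
    expSum w F V = 0 :=
  Finset.sum_eq_zero fun P _ => by
    rw [hw _ (Finset.card_ne_zero.2 (P.parts_nonempty hV.ne_empty)), zero_smul]

/-- A partition into two blocks separating i from j is determined by the block U of i. It is treated
as a cluster expansion whose weight w selects two blocks and whose factor F vanishes on blocks
containing both i and j. -/
theorem pairSum_eq (G : OpSeq d) {i j : ℕ} (hi : i ∈ W) (hj : j ∈ W) :
    pairSum G W i j = ∑ U ∈ W.powerset, if i ∈ U ∧ j ∉ U then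
      ampl W (at_ G U) * ampl W (at_ G (W \ U)) else 0 := by
  let w : ℕ → ℂ := fun n => if n = 2 then 1 else 0
  let F : Finset ℕ → Op d W := fun U => if i ∈ U ∧ j ∈ U then 0 else ampl W (at_ G U)
  have hF : ∀ S T : Finset ℕ, Disjoint S T → Commute (F S) (F T) := by
    intro S T hd
    simp only [F]
    split_ifs
    · exact Commute.zero_left _
    · exact Commute.zero_left _
    · exact Commute.zero_right _
    · exact commute_ampl W hd _ _
  have h1 : pairSum G W i j = expSum w F W := by
    rw [pairSum, Finset.sum_filter, expSum]
    refine Finset.sum_congr rfl fun P _ => ?_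
    by_cases hc : P.parts.card = 2
    · by_cases hp : P.part i = P.part j
      · have e1 : F (P.part i) = 0 :=
          if_pos ⟨P.mem_part_self.2 hi, hp ▸ P.mem_part_self.2 hj⟩
        rw [if_neg (fun h => h.2 hp), ← lprod_erase (P.part_mem.2 hi)
          (commute_lprod_parts (fun S _ T _ hd => hF S T hd) P), e1, zero_mul, smul_zero]
      · rw [if_pos ⟨hc, hp⟩]
        have e1 : w P.parts.card = 1 := if_pos hc
        rw [e1, one_smul]
        refine lprod_congr fun B hB => (if_neg fun hB' => hp ?_).symm
        rw [P.part_eq_of_mem hB hB'.1, P.part_eq_of_mem hB hB'.2]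
    · have e1 : w P.parts.card = 0 := if_neg hc
      rw [if_neg (fun h => hc h.1), e1, zero_smul]
  rw [h1, expSum_eq_sum_mem w (fun S _ T _ hd => hF S T hd) hi]
  refine Finset.sum_congr rfl fun U hU => ?_
  by_cases hiU : i ∈ U
  · rw [if_pos hiU]
    by_cases hjU : j ∈ U
    · have e1 : F U = 0 := if_pos ⟨hiU, hjU⟩
      rw [e1, zero_mul, if_neg (fun h => h.2 hjU)]
    · have hjW : j ∈ W \ U := Finset.mem_sdiff.2 ⟨hj, hjU⟩
      have e1 : F U = ampl W (at_ G U) := if_neg fun h => hjU h.2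
      have e2 : F (W \ U) = ampl W (at_ G (W \ U)) :=
        if_neg fun h => (Finset.mem_sdiff.1 h.1).2 hiU
      have e3 : ∀ T : Finset ℕ, T = ∅ → expSum (fun n => w (n + 1 + 1)) F T = 1 := by
        rintro T rfl
        rw [expSum_empty]
        exact one_smul ℂ _
      rw [if_pos ⟨hiU, hjU⟩, e1, expSum_eq_sum_mem _ (fun S _ T _ hd => hF S T hd) hjW,
        Finset.sum_eq_single_of_mem (W \ U) (Finset.mem_powerset_self _), if_pos hjW, e2,
        e3 _ (Finset.sdiff_self _), mul_one]
      intro T hT hne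
      split_ifs
      · rw [expSum_eq_zero (Finset.sdiff_nonempty.2 fun h =>
          hne (Finset.Subset.antisymm (Finset.mem_powerset.1 hT) h)), mul_zero]
        intro n hn
        exact if_neg fun h => hn (by omega)
      · rfl
  · rw [if_neg hiU, if_neg (fun h => hiU h.1)]

variable {f : OpSeq d}

theorem isSymm_of_le (hf : ∀ n, 1 ≤ n → IsSymm (f n)) (n : ℕ) : IsSymm (f n) := by
  cases n with
  | zero =>
    intro σ
    have : σ = Equiv.refl _ := Equiv.ext fun x => absurd x.2 (by simp)
    rw [this, relabelOp_refl]
  | succ n => exact hf _ (Nat.succ_le_succ (Nat.zero_le n))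

theorem isTCFam_at_ (hf : ∀ n, 1 ≤ n → IsTraceClass (f n)) : IsTCFam (at_ f) := fun _ hV =>
  isTraceClass_relabelOp _ (hf _ (Finset.card_pos.2 hV))

theorem isSymmFam_at_ (hf : ∀ n, 1 ≤ n → MemL1 (f n)) : IsSymmFam (at_ f) := by
  intro X X' e hX
  have hF := isTCFam_at_ fun n hn => (hf n hn).1
  have hX' : X'.Nonempty := by
    obtain ⟨a, ha⟩ := hX
    exact ⟨_, (e ⟨a, ha⟩).2⟩
  refine TC.op_injective ?_
  rw [op_rlT, hF.op_famT hX, hF.op_famT hX', relabelOp_at_ (isSymm_of_le fun n hn => (hf n hn).2)]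

theorem norm_famT_at_le (hc : 0 ≤ c) (hf : ∀ n, 1 ≤ n → MemL1 (f n))
    (hn : ∀ n, 1 ≤ n → traceNorm (f n) ≤ ENNReal.ofReal c) (hV : V.Nonempty) :
    ‖famT (at_ f) V‖ ≤ c := by
  have hV' : 1 ≤ V.card := Finset.card_pos.2 hV
  have h1 : famT (at_ f) V = rlT (enum V) (TC.mk (f V.card)) := by
    refine TC.op_injective ?_
    rw [(isTCFam_at_ fun n hn => (hf n hn).1).op_famT hV, op_rlT, TC.op_mk (hf _ hV').1]
    rfl
  rw [h1]
  exact (norm_rlT_le _ _).trans (TC.norm_mk_le hc (hn _ hV'))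

/-! ### Initial values. -/

section Initial

variable {F : OpFam d}

theorem evolT_zero (hΦ : IsPot Φ) (X V : Finset ℕ) : evolT Φ ε F X V 0 = expT F V := by
  rw [evolT, (isCGroup_evolG hΦ Finset.inter_subset_left).zero]

theorem IsTCFam.corrT_zero (hΦ : IsPot Φ) (hF : IsTCFam F) (X : Finset ℕ) (hV : V.Nonempty) :
    corrT Φ ε F X V 0 = famT F V := by
  induction V using Finset.strongInduction with
  | H V ih =>
    obtain ⟨a, ha⟩ := hV
    rw [hF.corrT_eq_sub hΦ X ha, hF.famT_eq_sub ha, evolT_zero hΦ]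
    refine congrArg (fun S : TCV d V => expT F V - S) (Finset.sum_congr rfl fun U hU => ?_)
    split_ifs with haU
    · rw [ih U (Finset.mem_ssubsets.1 hU) ⟨a, haU⟩, evolT_zero hΦ]
    · rfl

theorem sum_neg_one_pow_card_sdiff {ι : Type*} [DecidableEq ι] {N : Finset ι} (hN : N.Nonempty) :
    ∑ A ∈ N.powerset, (-1 : ℂ) ^ (N \ A).card = 0 := by
  have h1 : ∀ A ∈ N.powerset, (-1 : ℂ) ^ (N \ A).card = (-1) ^ N.card * (-1) ^ A.card := by
    intro A hA
    have h2 := Finset.card_sdiff_add_card_eq_card (Finset.mem_powerset.1 hA)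
    rw [← h2, pow_add, mul_assoc, ← mul_pow]
    norm_num
  rw [Finset.sum_congr rfl h1, ← Finset.mul_sum]
  have h2 := Finset.sum_powerset_neg_one_pow_card_of_nonempty hN
  have h3 : ∑ A ∈ N.powerset, (-1 : ℂ) ^ A.card = 0 := by exact_mod_cast h2
  rw [h3, mul_zero]

/-- At time zero the correlations do not depend on the set of moving particles, so for n > 0 only
the alternating sum of the signs over the subsets of a non-empty set remains. -/
theorem IsTCFam.term_zero (hΦ : IsPot Φ) (hF : IsTCFam F) (hY : Y.Nonempty) (n : ℕ) :
    term Φ ε F Y n 0 = if n = 0 then famT F Y else 0 := by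
  have h1 : marg Φ ε F Y (extend Y n) 0 =
      (∑ A ∈ (extend Y n \ Y).powerset, (-1 : ℂ) ^ ((extend Y n \ Y) \ A).card) •
        ptd Y (extend Y n) (famT F (extend Y n)) := by
    rw [marg, Finset.sum_smul]
    exact Finset.sum_congr rfl fun A _ => by
      rw [hF.corrT_zero hΦ _ (hY.mono (subset_extend Y n))]
  rw [term, h1]
  split_ifs with hn
  · subst hn
    have key : ∀ V, V = Y → (Nat.factorial 0 : ℂ)⁻¹ •
        (∑ A ∈ (V \ Y).powerset, (-1 : ℂ) ^ ((V \ Y) \ A).card) • ptd Y V (famT F V) =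
        famT F Y := by
      rintro V rfl
      rw [Finset.sdiff_self, Finset.powerset_empty, Finset.sum_singleton, ptd_of_subset le_rfl,
        pt_self]
      simp
    refine key _ ?_
    rw [extend, add_zero, Finset.Ico_self, Finset.union_empty]
  · rw [sum_neg_one_pow_card_sdiff, zero_smul, smul_zero]
    rw [← Finset.card_pos, card_extend_sdiff]
    omega

theorem IsTCFam.corr_zero (hΦ : IsPot Φ) (hF : IsTCFam F) (hY : Y.Nonempty) :
    corr Φ ε F Y 0 = famT F Y := by
  rw [corr, tsum_eq_single 0]
  · rw [hF.term_zero hΦ hY, if_pos rfl]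
  · intro n hn
    rw [hF.term_zero hΦ hY, if_neg hn]

end Initial

theorem seriesTerm_eq_op_term (hΦ : IsPot Φ) (hF : IsTCFam (at_ f)) {s : ℕ} (hs : 1 ≤ s) (n : ℕ) :
    seriesTerm Φ ε t f s n = TC.op _ (term Φ ε (at_ f) (Finset.range s) n t) := by
  rw [hF.seriesTerm_eq hΦ hs, term, extend_range]

namespace IsAdmissible

variable (h : IsAdmissible Φ ε θ C c (at_ f))
include h

theorem marginal_eq {s : ℕ} (hs : 1 ≤ s) (t : ℝ) :
    marginal Φ ε f t s = TC.op _ (corr Φ ε (at_ f) (Finset.range s) t) := by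
  have h1 := (TC.op (L2 d (Finset.range s))).hasSum
    (h.hasSum_term (Finset.nonempty_range_iff.2 (by omega : s ≠ 0)) t)
  rw [marginal, ← h1.tsum_eq]
  exact tsum_congr fun n => seriesTerm_eq_op_term h.pot h.tc hs n

theorem tendsto_sum_seriesTerm {s : ℕ} (hs : 1 ≤ s) (t : ℝ) :
    Tendsto (fun N => traceNorm (∑ n ∈ Finset.range N, seriesTerm Φ ε t f s n -
      marginal Φ ε f t s)) atTop (𝓝 0) := by
  have h1 := (h.hasSum_term (Finset.nonempty_range_iff.2 (by omega : s ≠ 0)) t).tendsto_sum_nat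
  have h2 := ENNReal.tendsto_ofReal (tendsto_iff_norm_sub_tendsto_zero.1 h1)
  rw [ENNReal.ofReal_zero] at h2
  refine h2.congr fun N => ?_
  rw [← TC.traceNorm_op, map_sub, map_sum, h.marginal_eq hs]
  exact congrArg (fun A => traceNorm (A - _)) (Finset.sum_congr rfl fun n _ =>
    (seriesTerm_eq_op_term h.pot h.tc hs n).symm)

theorem memL1_marginal {s : ℕ} (hs : 1 ≤ s) (t : ℝ) : MemL1 (marginal Φ ε f t s) := by
  rw [h.marginal_eq hs]
  refine ⟨TC.isTraceClass_op _, fun σ => ?_⟩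
  rw [← op_rlT, h.rlT_corr (Finset.nonempty_range_iff.2 (by omega : s ≠ 0))]

theorem at_marginal (hX : X.Nonempty) (t : ℝ) :
    at_ (marginal Φ ε f t) X = TC.op _ (corr Φ ε (at_ f) X t) := by
  have hc : 1 ≤ X.card := Finset.card_pos.2 hX
  rw [at_, h.marginal_eq hc, ← op_rlT, h.rlT_corr (Finset.nonempty_range_iff.2 (by omega))]

theorem op_link {i j : ℕ} (hi : i ∈ W) (hj : j ∈ W) (t : ℝ) :
    TC.op _ (link (fun U => corr Φ ε (at_ f) U t) i j W) =
      TC.op _ (corr Φ ε (at_ f) W t) + pairSum (marginal Φ ε f t) W i j := by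
  rw [link, map_add, pairSum_eq _ hi hj, eq_zero_or_op_sum]
  congr 1
  refine Finset.sum_congr rfl fun U _ => ?_
  split_ifs with hij
  · rw [op_tn, h.at_marginal ⟨i, hij.1⟩, h.at_marginal ⟨j, Finset.mem_sdiff.2 ⟨hj, hij.2⟩⟩]
  · rfl

/-- The undivided summand of `link` in the sum over pairs of Y gives the commutator with the
potential, which belongs to the linear term 𝒩*_s G_s; all the rest is the interaction term of the
hierarchy. The additional label `fresh (Finset.range s)` is s. -/
theorem op_corrDeriv {s : ℕ} (t : ℝ) :
    TC.op _ (corrDeriv Φ ε (at_ f) (Finset.range s) t) =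
      TC.op _ (comm (potOp Φ ε (Finset.range s) (Finset.range s))
        (corr Φ ε (at_ f) (Finset.range s) t)) + interaction Φ ε (marginal Φ ε f t) s := by
  have h1 : ∀ p ∈ pairs (Finset.range s), TC.op _ (nint Φ (Finset.range s) p.1 p.2
      (link (fun U => corr Φ ε (at_ f) U t) p.1 p.2 (Finset.range s))) =
      TC.op _ (nint Φ (Finset.range s) p.1 p.2 (corr Φ ε (at_ f) (Finset.range s) t)) +
        Nint Φ p.1 p.2 (pairSum (marginal Φ ε f t) (Finset.range s) p.1 p.2) := by
    intro p hp
    rw [mem_pairs] at hp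
    rw [op_nint, h.op_link hp.1 hp.2.1, op_nint, Nint, Nint, Nint, ← smul_add, mul_add, add_mul,
      add_sub_add_comm]
  have h2 : ∀ (V : Finset ℕ) (j : ℕ), V = Finset.range (s + 1) → j = s →
      TC.op _ (∑ i ∈ Finset.range s, ptd (Finset.range s) V (nint Φ V i j
        (link (fun U => corr Φ ε (at_ f) U t) i j V))) =
      ptrace (Finset.range s) (∑ i ∈ Finset.range s, Nint Φ i s (marginal Φ ε f t (s + 1) +
        pairSum (marginal Φ ε f t) (Finset.range (s + 1)) i s)) := by
    rintro V j rfl rfl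
    have hj : Finset.range j ⊆ Finset.range (j + 1) := Finset.range_subset_range.2 (Nat.le_succ j)
    rw [← map_sum, ptd_of_subset hj, op_pt, map_sum]
    congr 1
    refine Finset.sum_congr rfl fun i hi => ?_
    rw [op_nint, h.op_link (hj hi) (Finset.self_mem_range_succ j),
      h.marginal_eq (Nat.le_add_left 1 j)]
  rw [corrDeriv, map_smul, map_add, map_sum, Finset.sum_congr rfl h1, Finset.sum_add_distrib,
    h2 _ _ (by rw [fresh_range, Finset.range_add_one]) (fresh_range s), comm_potOp, map_smul,
    map_sum, interaction, smul_add, smul_add, add_assoc]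

end IsAdmissible

end Hierarchy


/-! ### The domains of the generators -/

section Domains

variable {X Y Z U V W : Finset ℕ} {Φ : Pos d → Pos d → ℝ} {ε t θ c C : ℝ}

theorem ampl_freeEvol (h : X ⊆ W) (t : ℝ) : ampl W (freeEvol (d := d) X t) =
    fourierInvOp W * multOp (fun ξ => phase t (restr h ξ)) * fourierOp W := by
  have hs := Split.of_subset h
  have hf : ∀ u w, fourierOp (d := d) W (tp hs u w) = tp hs (fourierOp X u) (fourierOp _ w) :=
    fourier_tp hs
  refine ampl_unique hs fun u w => fourierOp_injective ?_
  rw [op_mul_apply, op_mul_apply, fourierOp_fourierInvOp, hf, hf, fourierOp_freeEvol,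
    ← ampl_multOp h (isBdd_phase t), ampl_tp hs]

theorem coeFn_fourierOp_ampl_freeEvol (h : X ⊆ W) (t : ℝ) (u : L2 d W) :
    fourierOp W (ampl W (freeEvol X t) u) =ᵐ[volume]
      fun ξ => phase t (restr h ξ) * fourierOp W u ξ := by
  rw [ampl_freeEvol h, op_mul_apply, op_mul_apply, fourierOp_fourierInvOp]
  exact coeFn_multOp ((isBdd_phase t).comp (measurable_restr h)) _

/-- The domain of the kinetic energy is contained in the domain of the kinetic energy of
some of the particles. -/
theorem IsKinetic.hasDerivAt_ampl {ψ κ : L2 d W} (hκ : IsKinetic ψ κ) (h : X ⊆ W) :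
    ∃ η, HasDerivAt (fun t => ampl W (freeEvol X t) ψ) η 0 := by
  rw [isKinetic_iff_fourierOp] at hκ
  -- Kinetic energies are non-negative and additive, so that of some of the particles is dominated
  -- by the total.
  have hk : ∀ ξ : Conf d W, 0 ≤ kin (restr h ξ) ∧ kin (restr h ξ) ≤ kin ξ := by
    intro ξ
    have h0 : ∀ (X : Finset ℕ) (ζ : Conf d X), 0 ≤ kin ζ := fun X ζ => by rw [kin]; positivity
    refine ⟨h0 _ _, ?_⟩
    rw [kin_eq_restr (Split.of_subset h) ξ]
    exact le_add_of_nonneg_right (h0 _ _)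
  have hb : ∀ᵐ ξ, ‖(kin (restr h ξ) : ℂ)‖ * ‖fourierOp W ψ ξ‖ ≤ ‖fourierOp W κ ξ‖ := by
    filter_upwards [hκ] with ξ h1
    rw [h1, norm_mul, Complex.norm_real, Complex.norm_real, Real.norm_of_nonneg (hk ξ).1,
      Real.norm_of_nonneg ((hk ξ).1.trans (hk ξ).2)]
    exact mul_le_mul_of_nonneg_right (hk ξ).2 (norm_nonneg _)
  have hm : MemLp (fun ξ => (kin (restr h ξ) : ℂ) * fourierOp W ψ ξ) 2 volume := by
    refine (Lp.memLp (fourierOp W κ)).of_le ?_ ?_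
    · have h1 : Measurable fun ξ : Conf d W => (kin (restr h ξ) : ℂ) :=
        Complex.measurable_ofReal.comp (continuous_kin.measurable.comp (measurable_restr h))
      exact h1.aestronglyMeasurable.mul (Lp.aestronglyMeasurable _)
    · filter_upwards [hb] with ξ h1
      rwa [norm_mul]
  let χ : L2 d W := hm.toLp _
  refine ⟨-Complex.I • fourierInvOp W χ, ?_⟩
  rw [hasDerivAt_iff_tendsto_slope_zero]
  have h0 : ampl W (freeEvol (d := d) X 0) = 1 := by rw [freeEvol_zero, ampl_one h]
  have hl : Tendsto (fun s : ℝ => fourierOp W (s⁻¹ • (ampl W (freeEvol X (0 + s)) ψ -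
      ampl W (freeEvol X 0) ψ) - -Complex.I • fourierInvOp W χ)) (𝓝[≠] 0) (𝓝 0) := by
    refine tendsto_zero_of_dominated _
      (fun s ξ => (s⁻¹ • (phase s (restr h ξ) - 1) + Complex.I * kin (restr h ξ)) *
        fourierOp W ψ ξ) (fun s => ?_)
      ((2 : ℂ) • fourierOp W κ) (Eventually.of_forall fun s => ?_)
      (Eventually.of_forall fun ξ => ?_)
    · rw [map_sub, map_smul (fourierOp W) (-Complex.I) _, fourierOp_fourierInvOp, h0, zero_add,
        op_one_apply, real_smul_eq, map_smul, map_sub]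
      filter_upwards [Lp.coeFn_sub (((s⁻¹ : ℝ) : ℂ) • (fourierOp W (ampl W (freeEvol X s) ψ) -
          fourierOp W ψ)) (-Complex.I • χ),
        Lp.coeFn_smul ((s⁻¹ : ℝ) : ℂ) (fourierOp W (ampl W (freeEvol X s) ψ) - fourierOp W ψ),
        Lp.coeFn_sub (fourierOp W (ampl W (freeEvol X s) ψ)) (fourierOp W ψ),
        coeFn_fourierOp_ampl_freeEvol h s ψ,
        Lp.coeFn_smul (-Complex.I) χ, hm.coeFn_toLp] with ξ h1 h2 h3 h4 h5 h6
      rw [h1, Pi.sub_apply, h2, Pi.smul_apply, h3, Pi.sub_apply, h4, h5, Pi.smul_apply]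
      have h7 : χ ξ = (kin (restr h ξ) : ℂ) * fourierOp W ψ ξ := h6
      rw [h7, Complex.coe_smul, smul_eq_mul, add_mul, smul_mul_assoc, sub_mul, one_mul]
      ring
    · filter_upwards [Lp.coeFn_smul (2 : ℂ) (fourierOp W κ), hb] with ξ h1 h2
      rw [h1, Pi.smul_apply, norm_smul, norm_mul]
      have h3 := norm_slope_phase_le s (restr h ξ)
      have h4 : ‖s⁻¹ • (phase s (restr h ξ) - 1) + Complex.I * kin (restr h ξ)‖ ≤
          2 * ‖(kin (restr h ξ) : ℂ)‖ := by
        refine (norm_add_le _ _).trans ?_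
        rw [norm_mul, Complex.norm_I, one_mul]
        linarith
      have h5 : ‖(2 : ℂ)‖ = 2 := by norm_num
      rw [h5]
      refine (mul_le_mul_of_nonneg_right h4 (norm_nonneg _)).trans ?_
      rw [mul_assoc]
      exact mul_le_mul_of_nonneg_left h2 zero_le_two
    · have h1 := hasDerivAt_iff_tendsto_slope_zero.1 (hasDerivAt_phase (restr h ξ))
      have h2 := (h1.add_const (Complex.I * kin (restr h ξ))).mul_const (fourierOp W ψ ξ)
      simpa [phase_zero] using h2
  rw [tendsto_zero_iff_norm_tendsto_zero] at hl
  simp_rw [norm_fourierOp] at hl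
  exact tendsto_iff_norm_sub_tendsto_zero.2 hl

theorem IsTest.hasDerivAt_ampl_freeEvol {a : L2 d W} (ha : IsTest a) (h : X ⊆ W) :
    ∃ η, HasDerivAt (fun t => ampl W (freeEvol X t) a) η 0 := by
  obtain ⟨f, rfl⟩ := ha.exists_schwartz
  obtain ⟨κ, hκ⟩ := exists_isKinetic_schwartz f
  exact hκ.hasDerivAt_ampl h

/-- Test functions lie in H², hence in the domain of the free motion of any subset X of the
particles; every X is needed because the correlations involve the motion of only some of the
particles. -/
theorem exists_hasDerivAt_freeG_kb {a b : L2 d W} (ha : IsTest a) (hb : IsTest b) (h : X ⊆ W) :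
    ∃ η, HasDerivAt (fun t => freeG X W t (TC.kb a b)) η 0 := by
  obtain ⟨η, hη⟩ := ha.hasDerivAt_ampl_freeEvol h
  obtain ⟨ζ, hζ⟩ := hb.hasDerivAt_ampl_freeEvol h
  have h1 := (isBoundedBilinearMap_kb.hasFDerivAt (ampl W (freeEvol X 0) a,
    ampl W (freeEvol X 0) b)).comp_hasDerivAt (0 : ℝ) (hη.prodMk hζ)
  refine ⟨_, h1.congr_of_eventuallyEq (Eventually.of_forall fun t => ?_)⟩
  exact conj_kb ((isUGroup_freeEvol X).ampl h) t a b

theorem IsDegenerate.exists_eq_op {A : Op d W} (hA : IsDegenerate A) :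
    ∃ T : TCV d W, A = TC.op _ T ∧
      ∀ X ⊆ W, ∃ η, HasDerivAt (fun t => freeG X W t T) η 0 := by
  obtain ⟨m, a, b, hab, hA⟩ := hA
  refine ⟨∑ k, TC.kb (a k) (b k), ?_, fun X h => ?_⟩
  · ext1 ψ
    rw [hA, map_sum, sum_apply]
    refine Finset.sum_congr rfl fun k _ => ?_
    rw [TC.op_kb]
    rfl
  · choose η hη using fun k => exists_hasDerivAt_freeG_kb (hab k).1 (hab k).2 h
    refine ⟨∑ k, η k, ?_⟩
    simp_rw [map_sum]
    exact HasDerivAt.fun_sum fun k _ => hη k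

theorem isGenerator_of_hasDerivAt {T D : TCV d X} (h : HasDerivAt (fun t => evolG Φ ε X X t T) D 0) :
    IsGenerator Φ ε (TC.op _ T) (TC.op _ D) := by
  have h1 := hasTraceDerivAt_of_hasDerivAt h
  have h2 : (fun t => TC.op _ (evolG Φ ε X X t T)) = fun t => vonNeumann Φ ε t (TC.op _ T) := by
    ext1 t
    rw [op_evolG, ampl_self, ampl_self]
    rfl
  rw [h2] at h1
  exact h1

theorem isGenerator_of_hasDerivAt_freeG (hΦ : IsPot Φ) {T D : TCV d X}
    (h : HasDerivAt (fun t => freeG X X t T) D 0) :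
    IsGenerator Φ ε (TC.op _ T) (TC.op _ (D + comm (potOp Φ ε X X) T)) :=
  isGenerator_of_hasDerivAt ((isPert_evolG hΦ ε le_rfl).hasDerivAt
    (isCGroup_evolG hΦ le_rfl) (isCGroup_freeG le_rfl) h)

end Domains

/-! ### The trace of a product -/

section TraceForm

variable {H : Type} [NormedAddCommGroup H] [InnerProductSpace ℂ H] [CompleteSpace H]

/-- The bilinear form `Tr S T`. -/
def trForm : TC H →L[ℂ] TC H →L[ℂ] ℂ :=
  LinearMap.mkContinuous₂
    (LinearMap.mk₂ ℂ (fun S T => TC.tr H (TC.lmul (TC.op H S) T))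
      (fun S S' T => by
        rw [← map_add]
        exact congrArg _ (TC.op_injective (by simp only [TC.op_lmul, map_add, add_mul])))
      (fun c S T => by
        rw [← map_smul]
        exact congrArg _ (TC.op_injective (by simp only [TC.op_lmul, map_smul, smul_mul_assoc])))
      (fun S T T' => by rw [map_add, map_add])
      (fun c S T => by rw [map_smul, map_smul]))
    1 fun S T => by
      refine (TC.norm_tr_le _).trans ((TC.norm_sandwich_le _ _ _).trans ?_)
      have h1 : ‖(1 : H →L[ℂ] H)‖ ≤ 1 := ContinuousLinearMap.norm_id_le
      have h2 := TC.norm_op_le S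
      calc _ ≤ ‖S‖ * 1 * ‖T‖ := by gcongr
        _ = _ := by ring

theorem trForm_apply (S T : TC H) : trForm S T = TC.tr H (TC.lmul (TC.op H S) T) := rfl

theorem trForm_eq_trace (S T : TC H) : trForm S T = trace (TC.op H S * TC.op H T) := by
  rw [trForm_apply, TC.tr_apply, TC.op_lmul]

theorem trForm_conj {U : ℝ → H →L[ℂ] H} (hU : IsUGroup U) (t : ℝ) (S T : TC H) :
    trForm (conj U t S) (conj U t T) = trForm S T := by
  rw [trForm_apply, trForm_apply, ← tr_conj hU t (TC.lmul (TC.op H S) T)]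
  refine congrArg _ (TC.op_injective ?_)
  have h1 : ∀ A : H →L[ℂ] H, U (-t) * (U t * A) = A := fun A => by
    rw [← mul_assoc, hU.neg_mul, one_mul]
  have h2 : ∀ S : TC H, TC.op H (conj U t S) = U t * (TC.op H S * U (-t)) := fun S => by
    rw [conj, TC.op_sandwich]
    rfl
  rw [TC.op_lmul, h2, h2, h2, TC.op_lmul, mul_assoc, mul_assoc, h1, mul_assoc]

theorem trForm_comm (V : H →L[ℂ] H) (S T : TC H) :
    trForm S (comm V T) = -trForm (comm V S) T := by
  have h1 : trForm S (TC.lmul V T) = trForm (TC.rmul V S) T := by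
    rw [trForm_apply, trForm_apply]
    exact congrArg _ (TC.op_injective (by
      rw [TC.op_lmul, TC.op_lmul, TC.op_lmul, TC.op_rmul, mul_assoc]))
  have h2 : trForm S (TC.rmul V T) = trForm (TC.lmul V S) T := by
    have h3 : TC.lmul (TC.op H S) (TC.rmul V T) = TC.rmul V (TC.lmul (TC.op H S) T) :=
      TC.op_injective (by rw [TC.op_lmul, TC.op_rmul, TC.op_rmul, TC.op_lmul, mul_assoc])
    rw [trForm_apply, trForm_apply, h3, ← TC.tr_lmul_eq_tr_rmul]
    exact congrArg _ (TC.op_injective (by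
      rw [TC.op_lmul, TC.op_lmul, TC.op_lmul, TC.op_lmul, mul_assoc]))
  rw [comm_apply, comm_apply, map_smul, map_sub, h1, h2, map_smul, map_sub,
    smul_apply, sub_apply, ← smul_neg, neg_sub]

theorem hasDerivAt_trForm {u v : ℝ → TC H} {u' v' : TC H} {t : ℝ} (hu : HasDerivAt u u' t)
    (hv : HasDerivAt v v' t) :
    HasDerivAt (fun τ => trForm (u τ) (v τ)) (trForm (u t) v' + trForm u' (v t)) t :=
  (ContinuousLinearMap.bilinearRestrictScalars ℝ (trForm (H := H))).hasDerivAt_of_bilinear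
    (u := u) (v := v) (u' := u') (v' := v') (x := t) (fun _ => hu) (fun _ => hv)

end TraceForm

/-! ### Solutions of the hierarchy -/

section Solutions

variable {X Y V : Finset ℕ} {Φ : Pos d → Pos d → ℝ} {ε t θ c C : ℝ} {f : OpSeq d}

namespace IsAdmissible

variable (h : IsAdmissible Φ ε θ C c (at_ f))
include h

theorem marginal_zero (hf : ∀ n, 1 ≤ n → IsSymm (f n)) {s : ℕ} (hs : 1 ≤ s) :
    marginal Φ ε f 0 s = f s := by
  have hne : (Finset.range s).Nonempty := Finset.nonempty_range_iff.2 (by omega)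
  rw [h.marginal_eq hs, h.tc.corr_zero h.pot hne, h.tc.op_famT hne, at_range (isSymm_of_le hf)]

/-- Tr φ G(τ) is unchanged when both factors are moved freely by -τ. The moved test operator is
differentiable because φ is smooth, the moved marginal because this is its interaction picture. The
free generator and the commutator with the potential, both carried over to φ, combine to -𝒩*φ. -/
theorem isWeakSolution (hf : ∀ n, 1 ≤ n → IsSymm (f n)) :
    IsWeakSolution Φ ε f (marginal Φ ε f) := by
  intro s hs
  refine ⟨h.marginal_zero hf hs, fun t => ⟨h.memL1_marginal hs t, fun φ hφ => ?_⟩⟩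
  have hne : (Finset.range s).Nonempty := Finset.nonempty_range_iff.2 (by omega)
  obtain ⟨S, rfl, hS⟩ := hφ.exists_eq_op
  obtain ⟨η, hη⟩ := hS _ le_rfl
  refine ⟨_, isGenerator_of_hasDerivAt_freeG h.pot hη, ?_⟩
  have hg := isCGroup_freeG (d := d) (le_refl (Finset.range s))
  have hU := (isUGroup_freeEvol (d := d) (Finset.range s)).ampl (le_refl (Finset.range s))
  have e1 : ∀ (τ : ℝ) (A B : TCV d (Finset.range s)),
      trForm (freeG (Finset.range s) (Finset.range s) τ A)
        (freeG (Finset.range s) (Finset.range s) τ B) = trForm A B :=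
    fun τ A B => trForm_conj hU τ A B
  have h1 : HasDerivAt (fun τ => freeG (Finset.range s) (Finset.range s) (-τ) S)
      (-freeG (Finset.range s) (Finset.range s) (-t) η) t := by
    have := (hg.hasDerivAt_of_zero hη (-t)).scomp t (hasDerivAt_neg t)
    rw [neg_one_smul] at this
    exact this
  have h2 := hasDerivAt_trForm h1 (h.hasDerivAt_freeG_corr hne t)
  simp only [e1, map_neg, neg_apply] at h2
  have h3 : (fun τ => trace (TC.op _ S * marginal Φ ε f τ s)) =
      fun τ => trForm S (corr Φ ε (at_ f) (Finset.range s) τ) := by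
    ext1 τ
    rw [h.marginal_eq hs, trForm_eq_trace]
  rw [h3]
  have h4 : interaction Φ ε (marginal Φ ε f t) s =
      TC.op _ (corrDeriv Φ ε (at_ f) (Finset.range s) t -
        comm (potOp Φ ε (Finset.range s) (Finset.range s))
          (corr Φ ε (at_ f) (Finset.range s) t)) := by
    rw [map_sub, h.op_corrDeriv, add_sub_cancel_left]
  rw [h4, h.marginal_eq hs, ← trForm_eq_trace, ← trForm_eq_trace]
  convert h2 using 1
  rw [map_add, add_apply, map_sub, trForm_comm]
  ring

/-- Both the marginal and its interaction picture are differentiable. Hence the free motion of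
G_s(t) is differentiable at zero, with derivative equal to the derivative of the marginal minus
`corrDeriv`; so G_s(t) lies in the domain, and the equation is this identity rearranged. -/
theorem isStrongSolution (hθ : 0 < θ) (hf : ∀ n, 1 ≤ n → IsSymm (f n)) :
    IsStrongSolution Φ ε f (marginal Φ ε f) := by
  intro s hs
  refine ⟨h.marginal_zero hf hs, fun t => ⟨h.memL1_marginal hs t, ?_⟩⟩
  have hne : (Finset.range s).Nonempty := Finset.nonempty_range_iff.2 (by omega)
  obtain ⟨D, hD⟩ := h.exists_hasDerivAt_corr hθ hne t
  have h1 := (isCGroup_freeG (d := d) (le_refl (Finset.range s))).hasDerivAt_zero_of_hasDerivAt hD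
    (h.hasDerivAt_freeG_corr hne t)
  have h2 := isGenerator_of_hasDerivAt_freeG (ε := ε) h.pot h1
  have h3 : (fun τ => marginal Φ ε f τ s) =
      fun τ => TC.op _ (corr Φ ε (at_ f) (Finset.range s) τ) := by
    ext1 τ
    exact h.marginal_eq hs τ
  rw [← h.marginal_eq hs] at h2
  refine ⟨_, h2, ?_⟩
  rw [h3, map_add, map_sub, h.op_corrDeriv]
  convert hasTraceDerivAt_of_hasDerivAt hD using 1
  abel

end IsAdmissible

theorem isC1Fam_zero {F : OpFam d} (hF : ∀ V : Finset ℕ, V.Nonempty → ‖famT F V‖ ≤ c) :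
    IsC1Fam 0 F c := fun X V hV =>
  ⟨fun _ => 0, fun h => absurd h (lt_irrefl 0), fun t => by
    rw [zero_mul, add_zero]
    exact ((isCGroup_freeG Finset.inter_subset_left).norm_apply_le _ _).trans (hF V hV)⟩

theorem isC1Fam_of_hasDerivAt {F : OpFam d} {K : ℝ} (hθ : 0 ≤ θ)
    (hF : ∀ V : Finset ℕ, V.Nonempty → ‖famT F V‖ ≤ c)
    (hD : ∀ V : Finset ℕ, V.Nonempty → ∀ X ⊆ V, ∃ η, ‖η‖ ≤ K ∧
      HasDerivAt (fun t => freeG X V t (famT F V)) η 0) :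
    IsC1Fam θ F (c + θ * K) := by
  intro X V hV
  obtain ⟨η, h1, h2⟩ := hD V hV (V ∩ X) Finset.inter_subset_left
  have hg := isCGroup_freeG (d := d) (Finset.inter_subset_left : V ∩ X ⊆ V)
  exact ⟨fun t => freeG (V ∩ X) V t η, fun _ t => hg.hasDerivAt_of_zero h2 t, fun t =>
    add_le_add ((hg.norm_apply_le _ _).trans (hF V hV))
      (mul_le_mul_of_nonneg_left ((hg.norm_apply_le _ _).trans h1) hθ)⟩

/-- Up to relabelling only finitely many cases occur: n < N and X a subset of the first n particles.
The sum of the norms of the corresponding derivatives bounds all of them, and the members with n ≥ N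
vanish. -/
theorem MemL10.exists_bound (h : MemL10 f) (hf : ∀ n, 1 ≤ n → MemL1 (f n)) :
    ∃ K : ℝ, 0 ≤ K ∧ ∀ V : Finset ℕ, V.Nonempty → ∀ X ⊆ V, ∃ η, ‖η‖ ≤ K ∧
      HasDerivAt (fun t => freeG X V t (famT (at_ f) V)) η 0 := by
  obtain ⟨⟨N, hN⟩, hd⟩ := h
  have hF := isTCFam_at_ fun n hn => (hf n hn).1
  have hS := isSymmFam_at_ hf
  have h1 : ∀ n X, ∃ η : TCV d (Finset.range n), 1 ≤ n → X ⊆ Finset.range n →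
      HasDerivAt (fun t => freeG X (Finset.range n) t (famT (at_ f) (Finset.range n))) η 0 := by
    intro n X
    by_cases hn : 1 ≤ n
    · obtain ⟨T, hT, hT'⟩ := (hd n hn).exists_eq_op
      have e : famT (at_ f) (Finset.range n) = T := TC.op_injective (by
        rw [hF.op_famT (Finset.nonempty_range_iff.2 (by omega)),
          at_range (isSymm_of_le fun n hn => (hf n hn).2), hT])
      by_cases hX : X ⊆ Finset.range n
      · obtain ⟨η, hη⟩ := hT' X hX
        exact ⟨η, fun _ _ => e ▸ hη⟩
      · exact ⟨0, fun _ h => absurd h hX⟩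
    · exact ⟨0, fun h => absurd h hn⟩
  choose η hη using h1
  have hsum : ∀ n, 0 ≤ ∑ X ∈ (Finset.range n).powerset, ‖η n X‖ := fun n =>
    Finset.sum_nonneg fun _ _ => norm_nonneg _
  refine ⟨∑ n ∈ Finset.range N, ∑ X ∈ (Finset.range n).powerset, ‖η n X‖,
    Finset.sum_nonneg fun n _ => hsum n, fun V hV X hX => ?_⟩
  have hc : 1 ≤ V.card := Finset.card_pos.2 hV
  by_cases hVN : N ≤ V.card
  · have e : famT (at_ f) V = 0 := TC.op_injective (by
      rw [hF.op_famT hV, at_, hN _ hVN, map_zero, relabelOp, ContinuousLinearMap.zero_comp,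
        ContinuousLinearMap.comp_zero])
    refine ⟨0, by rw [norm_zero]; exact Finset.sum_nonneg fun n _ => hsum n, ?_⟩
    simp only [e, map_zero]
    exact hasDerivAt_const _ _
  · obtain ⟨σ, hσ, -⟩ := exists_maps (enum V)
    have hX' : Maps σ (X.map σ.symm.toEmbedding) X := (maps_map σ.symm X).symm
    have hXs : X.map σ.symm.toEmbedding ⊆ Finset.range V.card :=
      hσ.symm.subset (maps_map σ.symm X) hX
    have h2 := hη V.card _ hc hXs
    have e : (fun t => freeG X V t (famT (at_ f) V)) = fun t => rlT hσ.equiv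
        (freeG (X.map σ.symm.toEmbedding) (Finset.range V.card) t
          (famT (at_ f) (Finset.range V.card))) := by
      ext1 t
      rw [rlT_freeG hX' hσ hXs, hS _ _ hσ.equiv (Finset.nonempty_range_iff.2 (by omega))]
    refine ⟨rlT hσ.equiv (η V.card (X.map σ.symm.toEmbedding)), ?_, ?_⟩
    · refine (norm_rlT_le _ _).trans ?_
      refine (Finset.single_le_sum (f := fun X => ‖η V.card X‖) (fun _ _ => norm_nonneg _)
        (Finset.mem_powerset.2 hXs)).trans ?_
      exact Finset.single_le_sum (f := fun n => ∑ X ∈ (Finset.range n).powerset, ‖η n X‖)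
        (fun n _ => hsum n) (Finset.mem_range.2 (not_le.1 hVN))
    · rw [e]
      exact ((rlT hσ.equiv).restrictScalars ℝ).hasFDerivAt.comp_hasDerivAt (0 : ℝ) h2

theorem exists_isAdmissible (hΦ : IsPot Φ) (hC : ∀ q q', |Φ q q'| ≤ C) (ε : ℝ)
    (hf : ∀ n, 1 ≤ n → MemL1 (f n)) (hc : c < (2 * Real.exp 1 ^ 3)⁻¹)
    (hn : ∀ n, 1 ≤ n → traceNorm (f n) ≤ ENNReal.ofReal c) :
    (∃ c', IsAdmissible Φ ε 0 C c' (at_ f)) ∧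
      (MemL10 f → ∃ θ c', 0 < θ ∧ IsAdmissible Φ ε θ C c' (at_ f)) := by
  have hC0 : 0 ≤ C := (abs_nonneg _).trans (hC 0 0)
  have he : Real.exp 1 ^ 3 = Real.exp 3 := by
    rw [← Real.exp_nat_mul]
    norm_num
  have he1 : 1 < Real.exp 3 := Real.one_lt_exp_iff.2 (by norm_num)
  rw [he] at hc
  -- The largest constant allowed by the majorant. It exceeds 1/(2e³) strictly, and the gap leaves
  -- room for the derivatives.
  let b : ℝ := (2 * (Real.exp 3 - 1))⁻¹
  have hb : 2 * b * (Real.exp 3 - 1) = 1 := by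
    have : Real.exp 3 - 1 ≠ 0 := (sub_pos.2 he1).ne'
    simp only [b]
    field_simp
  have hcb : (2 * Real.exp 3)⁻¹ < b :=
    inv_strictAnti₀ (by linarith) (by linarith)
  -- The constant c of the hypothesis may be negative (all norms are then zero), but the majorant
  -- needs a non-negative one.
  have hc0 : 0 ≤ max c 0 := le_max_right _ _
  have hcm : max c 0 < b := max_lt (hc.trans hcb) (lt_of_le_of_lt (by positivity) hcb)
  have hF : ∀ V : Finset ℕ, V.Nonempty → ‖famT (at_ f) V‖ ≤ max c 0 := fun V hV =>
    norm_famT_at_le hc0 hf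
      (fun n h1 => (hn n h1).trans (ENNReal.ofReal_le_ofReal (le_max_left _ _))) hV
  have htc := isTCFam_at_ fun n hn => (hf n hn).1
  refine ⟨⟨max c 0, hΦ, hC, htc, isSymmFam_at_ hf, le_rfl, isC1Fam_zero hF, ?_, hc0, ?_⟩,
    fun h => ?_⟩
  · norm_num
  · refine le_trans ?_ hb.le
    gcongr
  · obtain ⟨K, hK, hD⟩ := h.exists_bound hf
    have h1 : 0 < (b - max c 0) / (K + 1) := div_pos (sub_pos.2 hcm) (by linarith)
    have hA : 0 ≤ 2 * |ε| * C := by positivity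
    have h2 : 0 < 1 / (50 * (2 * |ε| * C + 1)) := by positivity
    -- The first bound on θ gives max c 0 + θK ≤ b, the second makes the commutator term at most
    -- 1/50; adding 1 in the denominators covers K = 0 and C = 0.
    refine ⟨min ((b - max c 0) / (K + 1)) (1 / (50 * (2 * |ε| * C + 1))), _, lt_min h1 h2, hΦ, hC,
      htc, isSymmFam_at_ hf, (lt_min h1 h2).le,
      isC1Fam_of_hasDerivAt (lt_min h1 h2).le hF hD, ?_, ?_, ?_⟩
    · refine (mul_le_mul_of_nonneg_right (min_le_right _ _) hA).trans ?_
      rw [div_mul_eq_mul_div, div_le_div_iff₀ (by positivity) (by norm_num)]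
      linarith
    · exact add_nonneg hc0 (mul_nonneg (lt_min h1 h2).le hK)
    · have h3 : min ((b - max c 0) / (K + 1)) (1 / (50 * (2 * |ε| * C + 1))) * K ≤
          b - max c 0 := by
        refine (mul_le_mul_of_nonneg_right (min_le_left _ _) hK).trans ?_
        rw [div_mul_eq_mul_div, div_le_iff₀ (by linarith)]
        nlinarith [sub_pos.2 hcm]
      refine le_trans ?_ hb.le
      have := (sub_pos.2 he1).le
      gcongr
      linarith

end Solutions

end QBBGKY

end

theorem theorem1 (d : ℕ) (Φ : Pos d → Pos d → ℝ)
    (hΦ_meas : Measurable (Function.uncurry Φ))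
    (hΦ_symm : ∀ q q', Φ q q' = Φ q' q)
    (hΦ_bdd : ∃ C, ∀ q q', |Φ q q'| ≤ C)
    (ε : ℝ) (hε : 0 < ε)
    (G0 : OpSeq d)
    (hG0 : ∀ n, 1 ≤ n → MemL1 (G0 n))
    (hnorm : ∃ c : ℝ, c < (2 * Real.exp 1 ^ 3)⁻¹ ∧
      ∀ n, 1 ≤ n → traceNorm (G0 n) ≤ ENNReal.ofReal c) :
    (∀ t s, 1 ≤ s →
      Filter.Tendsto
        (fun N => traceNorm (∑ n ∈ Finset.range N, seriesTerm Φ ε t G0 s n - marginal Φ ε G0 t s))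
        Filter.atTop (nhds 0)) ∧
    IsWeakSolution Φ ε G0 (marginal Φ ε G0) ∧
    (MemL10 G0 → IsStrongSolution Φ ε G0 (marginal Φ ε G0)) := by
  obtain ⟨C, hC⟩ := hΦ_bdd
  obtain ⟨c, hc, hn⟩ := hnorm
  -- Convergence and the weak equation use θ = 0, which asks for no differentiability; θ > 0 is
  -- available for data in 𝔏¹₀ and gives the strong equation.
  obtain ⟨⟨c₀, h⟩, h'⟩ := exists_isAdmissible ⟨hΦ_meas, hΦ_symm, C, hC⟩ hC ε hG0 hc hn
  have hs := fun n hn => (hG0 n hn).2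
  refine ⟨fun t s hs => h.tendsto_sum_seriesTerm hs t, h.isWeakSolution hs, fun hd => ?_⟩
  obtain ⟨θ, c', hθ, h''⟩ := h' hd
  exact h''.isStrongSolution hθ hs
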